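/- **Setting.** Let $G$ be one of the exceptional complex reflection groups $G_4,G_5,G_6,G_8,G_9,G_{10},G_{14},G_{16},G_{17},G_{18},G_{20},G_{21}$ (rank $n=2$), $G_{23},G_{24},G_{25},G_{26},G_{27}$ (rank $n=3$) of Shephard and Todd, acting on $\mathbb C^n$ with linear coordinates $p=(p_1,\dots,p_n)$. Let $h$ be the standard Hermitian metric, except for $G_{27}$, where $h=\mathrm{diag}(1,1,3)$. For a covector $\alpha$ put $\|\alpha\|^2=h^{im}\alpha_i\bar\alpha_m$ (where $h^{im}$ is the inverse of $h$), and let $\pi_\alpha{}^i{}_k=h^{im}\bar\alpha_m\alpha_k/\|\alpha\|^2$ be the $h$-unitary projection onto the complement of $\ker\alpha$. The group $G$ is generated by the reflections $1-(1-e^{2\pi i/m})\pi_\alpha$, for the pairs $\alpha_{(m)}$ listed below. A *mirror* is a hyperplane that is the fixed space of an element of $G$; $\kappa_H$ is the order of the pointwise stabilizer of the mirror $H$, i.e. the order of the corresponding (pseudo-)reflection; $\alpha_H$ is any covector with kernel $H$. **Saito flat coordinates.** With $\Phi=p_1^4+2i\sqrt3p_1^2p_2^2+p_2^4$, $f=p_1^5p_2-p_1p_2^5$,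 $\chi=p_1^8+14p_1^4p_2^4+p_2^8$, $t=p_1^{12}-33p_1^8p_2^4-33p_1^4p_2^8+p_2^{12}$, $A=p_1^{12}+\frac{22}5\sqrt5p_1^{10}p_2^2-33p_1^8p_2^4-\frac{44}5\sqrt5p_1^6p_2^6-33p_1^4p_2^8+\frac{22}5\sqrt5p_1^2p_2^{10}+p_2^{12}$, $B=p_1^{20}-\frac{38}3\sqrt5p_1^{18}p_2^2-19p_1^{16}p_2^4-152\sqrt5p_1^{14}p_2^6-494p_1^{12}p_2^8+\frac{988}3\sqrt5p_1^{10}p_2^{10}-494p_1^8p_2^{12}-152\sqrt5p_1^6p_2^{14}-19p_1^4p_2^{16}-\frac{38}3\sqrt5p_1^2p_2^{18}+p_2^{20}$, $T=b(p_1,p_2)-b(p_2,p_1)$, $b(x,y)=x^{29}y-\frac{116}{45}\sqrt5x^{27}y^3+\frac{1769}{25}x^{25}y^5+\frac{464}5\sqrt5x^{23}y^7+\frac{2001}5x^{21}y^9-\frac{2668}{15}\sqrt5x^{19}y^{11}+\frac{12673}5x^{17}y^{13}$, $\lambda=\sqrt{10-2\sqrt5}$, $\gamma=\frac{\sqrt3+\sqrt{15}+\sqrt5+3}2$,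 and $M_e$ the number of mirrors with $\kappa_H=e$, the generators, coordinates $u=(u^1,\dots,u^n)$ and constants are: | group | generators $\alpha_{(m)}$ | $u^1$ | $u^2$ | mirrors | $N$ | |---|---|---|---|---|---| | $G_4$ | $[-1-i,\sqrt3-1]_{(3)},[1-i,\sqrt3+1]_{(3)}$ | $\Phi$ | $f$ | $M_3=4$ | 6 | | $G_5$ | $[-1-i,\sqrt3-1]_{(3)},[1,\frac{1-\sqrt3}2(1+i)]_{(3)}$ | $f$ | $\Phi^3-6i\sqrt3f^2$ | $M_3=8$ | 12 | | $G_6$ | $[1,0]_{(2)},[-1-i,\sqrt3-1]_{(3)}$ | $\Phi$ | $f^2+\frac{5i\sqrt3}{288}\Phi^3$ | $M_2=6,M_3=4$ | 12 | | $G_8$ | $[1,0]_{(4)},[1,1]_{(4)}$ | $\chi$ | $t$ | $M_4=6$ | 12 | | $G_9$ | $[1,\sqrt2-1]_{(2)},[1,0]_{(4)}$ | $\chi$ | $t^2-\frac{11}{16}\chi^3$ | $M_2=12,M_4=6$ | 24 | | $G_{10}$ | $[1,\frac{1-\sqrt3}2(1+i)]_{(3)},[1,0]_{(4)}$ | $t$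 | $\chi^3-\frac7{12}t^2$ | $M_3=8,M_4=6$ | 24 | | $G_{14}$ | $[1,1-\sqrt2]_{(2)},[1,\frac{1-\sqrt3}2(1+i)]_{(3)}$ | $f$ | $t^2+66f^4$ | $M_2=12,M_3=8$ | 24 | | $G_{16}$ | $[1,\frac{\sqrt5-1-\lambda}2]_{(5)},[1,\frac{1-\sqrt5+\lambda}2]_{(5)}$ | $B$ | $T$ | $M_5=12$ | 30 | | $G_{17}$ | $[1,0]_{(2)},[1,\frac{\sqrt5-1-\lambda}2]_{(5)}$ | $B$ | $T^2+\frac{29\sqrt5}{12000}B^3$ | $M_2=30,M_5=12$ | 60 | | $G_{18}$ | $[1,\frac{1-\sqrt3}2(1-i)]_{(3)},[1,\frac{\sqrt5-1-\lambda}2]_{(5)}$ | $T$ | $B^3+38\sqrt5T^2$ | $M_3=20,M_5=12$ | 60 | | $G_{20}$ | $[1,\frac{1-\sqrt3}2(1-i)]_{(3)},[1,\gamma]_{(3)}$ | $A$ | $T$ | $M_3=20$ | 30 | | $G_{21}$ | $[1,0]_{(2)},[1,\gamma]_{(3)}$ | $A$ | $T^2-\frac{29\sqrt5}{14400}A^5$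 | $M_2=30,M_3=20$ | 60 | In rank three: * $G_{23}$: generators $[1,0,0],[0,1,0],[-2,\sqrt5-1,\sqrt5+1]$ (order 2); $M_2=15$, $N=10$; $u^1=U_1$, $u^2=U_2-2U_1^3$, $u^3=U_3+\frac{33}7U_1^2U_2-\frac{2091}{175}U_1^5$, where, with $s_a=p_1^a+p_2^a+p_3^a$, $m_{a,b}=\sum_{i\ne j}p_i^ap_j^b$, $\Delta=(p_1^2-p_2^2)(p_1^2-p_3^2)(p_2^2-p_3^2)$: $U_1=s_2$, $U_2=2s_6-15m_{4,2}+180p_1^2p_2^2p_3^2+21\sqrt5\Delta$, $U_3=5\big(2s_{10}-45m_{8,2}+42m_{6,4}+1008p_1^2p_2^2p_3^2s_4-1260p_1^2p_2^2p_3^2(p_1^2p_2^2+p_1^2p_3^2+p_2^2p_3^2)\big)-33\sqrt5\Delta\big(3s_4-11(p_1^2p_2^2+p_1^2p_3^2+p_2^2p_3^2)\big)$. * $G_{24}$: with $\tau=2\cos\frac{2\pi}7$, $\zeta=e^{2\pi i/7}$, generators $[1,\tau,-1-\tau],[\zeta,\zeta^4\tau,\zeta^2(-1-\tau)],[\tau,-1-\tau,1]$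 (order 2); $M_2=21$, $N=14$; $u^1=U_1=p_1^3p_2+p_1p_3^3+p_2^3p_3$, $u^2=U_2=p_1^5p_3+p_1p_2^5+p_2p_3^5-5p_1^2p_2^2p_3^2$, $u^3=U_3+34U_1^2U_2$, $U_3=s_{14}+18(p_1^7p_2^7+p_1^7p_3^7+p_2^7p_3^7)-126(p_1^6p_2^3p_3^5+p_1^5p_2^6p_3^3+p_1^3p_2^5p_3^6)+375(p_1^8p_2^4p_3^2+p_1^4p_2^2p_3^8+p_1^2p_2^8p_3^4)-250(p_1^9p_2p_3^4+p_1^4p_2^9p_3+p_1p_2^4p_3^9)-34(p_1^{11}p_2^2p_3+p_1^2p_2p_3^{11}+p_1p_2^{11}p_3^2)$. * $G_{25}$: generators $[1,0,0],[1,1,1],[0,1,0]$ (order 3); $M_3=12$, $N=12$; $u^1=V_1=s_6-10(p_1^3p_2^3+p_1^3p_3^3+p_2^3p_3^3)$, $u^2=(p_1^3-p_2^3)(p_1^3-p_3^3)(p_2^3-p_3^3)$, $u^3=V_2-\frac58V_1^2$, $V_2=s_3(s_3^3+216p_1^3p_2^3p_3^3)$. * $G_{26}$: generators $[1,-1,0]$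 (order 2), $[1,0,0],[1,1,1]$ (order 3); $M_2=9,M_3=12$, $N=18$; $u^1=V_1$, $u^2=V_2-\frac16V_1^2$, $u^3=s_3^6-540p_1^3p_2^3p_3^3s_3^3-5832p_1^6p_2^6p_3^6-\frac12V_1V_2+\frac19V_1^3$. * $G_{27}$: with $w=\frac{(\sqrt5-1)(3+i\sqrt{15})}4$, generators $[1,-e^{2\pi i/5},0],[1,1,w],[1,1,\bar w]$ (order 2); $M_2=45$, $N=30$; $u^1=W_1=10p_1^3p_2^3+9p_3(p_1^5+p_2^5)-45p_1^2p_2^2p_3^2-135p_1p_2p_3^4+27p_3^6$, $u^2=W_2-\frac19W_1^2$, $u^3=W_3-\frac{17}{18}W_2^2W_1+\frac{29}{27}W_2W_1^3-\frac{43}{486}W_1^5$, where $W_2=\frac1{20250}\det\mathrm{Hess}(W_1)$ and $W_3=\frac1{24300}\det\begin{pmatrix}\mathrm{Hess}(W_1)&\nabla W_2\\ \nabla W_2^{T}&0\end{pmatrix}$. Let $d_l=\deg u^l$, $J^l_j=\partial u^l/\partial p^j$. The *dual product* and *dual connection* belonging to $u$ are those with structure constants $\frac1{d_l-1}\frac{\partial^2u^l}{\partial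 p^a\partial p^b}(J^{-1})^a_j(J^{-1})^b_k$ and Christoffel symbols $-\frac{d_l}{d_l-1}\frac{\partial^2u^l}{\partial p^a\partial p^b}(J^{-1})^a_j(J^{-1})^b_k$ in the coordinates $u$. A *standard bi-flat structure* on an open subset $\Omega$ of the complement of the mirrors consists of holomorphic flat torsionless connections $\nabla^{(1)},\nabla^{(2)}$, commutative associative products $\circ,*$ with units $e$ and $E=\sum_kp^k\partial_{p^k}$, such that $[e,E]=d_ne$, $\mathrm{Lie}_E(\circ)=d_n\,\circ$ ($d_n$ the highest degree), $X*Y=E^{-1}\circ X\circ Y$, $\nabla^{(1)}e=0$, $\nabla^{(2)}E=0$, $\nabla^{(1)}\circ$ and $\nabla^{(2)}*$ are totally symmetric, $(d_{\nabla^{(1)}}-d_{\nabla^{(2)}})(X\circ)=0$ for all vector fields $X$, the $u^l$ are flat coordinates of $\nabla^{(1)}$, and $\nabla^{(2)}=\nabla^{(0)}-*$, with $\nabla^{(0)}$ the standard flat connection of $\mathbb C^n$. **Theorem.** In each of the 17 cases, the $u^l$ are homogeneous $G$-invariant polynomials; the set $\mathcal H$ of mirrors is finite, has $M=\sum_eM_e$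 elements, and exactly $M_e$ of them have $\kappa_H=e$; each $H\in\mathcal H$ is the mirror of a reflection in $G$ of order $\kappa_H$; and $$\det\frac{\partial u^l}{\partial p^j}=a\prod_{H\in\mathcal H}\alpha_H^{\kappa_H-1}\quad\text{for a constant }a\ne0 .$$ At each point $p$ outside the mirrors $J$ is invertible, and the dual product and dual connection belonging to $u$ are given, in the coordinates $p$, by $$c^{*i}_{jk}(p)=-\Gamma^{*i}_{jk}(p)=h^{im}\,\frac1N\sum_{H\in\mathcal H}\frac{\kappa_H}{\|\alpha_H\|^2}\,\frac{(\alpha_H)_j(\alpha_H)_k(\bar\alpha_H)_m}{\alpha_H(p)},$$ that is, $c^*=-\Gamma^*=\frac1N\sum_H\kappa_H\frac{d\alpha_H}{\alpha_H}\otimes\pi_{\alpha_H}$, where $N$ is the normalizing factor for which the right-hand side $c^{*i}_{jk}$ satisfies $c^{*i}_{jk}p^k=\delta^i_j$. The same formula gives the product $*$ and the Christoffel symbols of $\nabla^{(2)}$ of every standard bi-flat structure on an open subset of the complement of the mirrors. -/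

import Mathlib

noncomputable section

namespace ReflectionDuality

open MvPolynomial

/-! ## Reflections, mirrors and the Dunkl-Kohno tensor -/

/-- The squared norm `‖α‖² = h^{im} α_i conj(α_m)` of a covector, for the Hermitian metric `h`. -/
def normSq {n : ℕ} (h : Matrix (Fin n) (Fin n) ℂ) (α : Fin n → ℂ) : ℂ :=
  ∑ i, ∑ m, h⁻¹ i m * α i * star (α m)

/-- The matrix `π^i_k = h^{im} conj(α_m) α_k / ‖α‖²` of the unitary projection, with respect to the
Hermitian metric `h`, onto the unitary complement of the hyperplane `ker α`. -/
def proj {n : ℕ} (h : Matrix (Fin n) (Fin n) ℂ) (α : Fin n → ℂ) : Matrix (Fin n) (Fin n) ℂ :=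
  Matrix.of fun i k => (∑ m, h⁻¹ i m * star (α m)) * α k / normSq h α

/-- The unitary reflection with mirror `ker α` and non-trivial eigenvalue `exp (2πi/m)`. -/
def reflection {n : ℕ} (h : Matrix (Fin n) (Fin n) ℂ) (α : Fin n → ℂ) (m : ℕ) :
    Matrix (Fin n) (Fin n) ℂ :=
  1 - (1 - Complex.exp (2 * Real.pi * Complex.I / m)) • proj h α

/-- The explicit data attached to one of the groups. -/
structure GroupData where
  /-- the rank `n` -/
  n : ℕ
  /-- the Hermitian metric `h` on `ℂⁿ` -/
  h : Matrix (Fin n) (Fin n) ℂ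
  /-- generating reflections, given by a covector that defines the mirror and by the order -/
  gens : List ((Fin n → ℂ) × ℕ)
  /-- the degrees `d_l` of the basic invariants -/
  deg : Fin n → ℕ
  /-- the (generalized) Saito flat coordinates `u^l`, as polynomials in the linear coordinates -/
  u : Fin n → MvPolynomial (Fin n) ℂ
  /-- the normalizing factor `N` -/
  N : ℕ
  /-- the pairs (order of reflection, number of mirrors with this order) -/
  table : List (ℕ × ℕ)

namespace GroupData

variable (D : GroupData)

/-- The reflection group: the subgroup of `GL_n(ℂ)` generated by the given reflections. -/
def group : Subgroup (Matrix.GeneralLinearGroup (Fin D.n) ℂ) :=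
  Subgroup.closure {x | ∃ a ∈ D.gens, (x : Matrix (Fin D.n) (Fin D.n) ℂ) = reflection D.h a.1 a.2}

/-- The space of fixed vectors of a linear transformation. -/
def fixedSpace {n : ℕ} (x : Matrix.GeneralLinearGroup (Fin n) ℂ) : Submodule ℂ (Fin n → ℂ) :=
  LinearMap.ker (Matrix.toLin' (x : Matrix (Fin n) (Fin n) ℂ) - LinearMap.id)

/-- The mirrors: the hyperplanes that are the fixed space of some element of the group. -/
def mirrors : Set (Submodule ℂ (Fin D.n → ℂ)) :=
  {H | Module.finrank ℂ H + 1 = D.n ∧ ∃ x ∈ D.group, fixedSpace x = H}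

/-- The order `κ_H` of the pointwise stabilizer of a mirror, a cyclic group which consists of the
identity and of the reflections with mirror `H`. -/
def kappa (H : Submodule ℂ (Fin D.n → ℂ)) : ℕ :=
  Nat.card {x : Matrix.GeneralLinearGroup (Fin D.n) ℂ //
    x ∈ D.group ∧ ∀ v ∈ H, (x : Matrix (Fin D.n) (Fin D.n) ℂ).mulVec v = v}

/-- The complement of the union of the mirrors. -/
def regularSet : Set (Fin D.n → ℂ) := {p | ∀ H ∈ D.mirrors, p ∉ H}

/-- A choice of defining covectors: `α H` has kernel `H`, for each mirror `H`. -/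
def IsMirrorForms (α : Submodule ℂ (Fin D.n → ℂ) → Fin D.n → ℂ) : Prop :=
  ∀ H ∈ D.mirrors, ∀ v : Fin D.n → ℂ, v ∈ H ↔ α H ⬝ᵥ v = 0

/-- The coefficients of `(1/N) ∑_H κ_H (dα_H / α_H) ⊗ π_H`, that is
`h^{im} (1/N) ∑_H (κ_H / ‖α_H‖²) (α_H)_j (α_H)_k conj((α_H)_m) / α_H(p)`. -/
def dunklKohno (α : Submodule ℂ (Fin D.n → ℂ) → Fin D.n → ℂ) (p : Fin D.n → ℂ)
    (i j k : Fin D.n) : ℂ :=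
  (1 / (D.N : ℂ)) *
    ∑ᶠ H ∈ D.mirrors, (D.kappa H : ℂ) * (α H j / (α H ⬝ᵥ p)) * proj D.h (α H) i k

/-- The Jacobian matrix `J^l_j = ∂u^l/∂p^j`. -/
def jac : Matrix (Fin D.n) (Fin D.n) (MvPolynomial (Fin D.n) ℂ) :=
  Matrix.of fun l j => pderiv j (D.u l)

/-- The Jacobian matrix at a point. -/
def jacAt (p : Fin D.n → ℂ) : Matrix (Fin D.n) (Fin D.n) ℂ := D.jac.map (eval p)

/-- The second derivatives `∂²u^l/∂p^j∂p^k` at a point. -/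
def hessAt (p : Fin D.n → ℂ) (l j k : Fin D.n) : ℂ := eval p (pderiv j (pderiv k (D.u l)))

/-- The dual product in the coordinates `p`, obtained from its structure constants
`(1/(d_l - 1)) ∂²u^l/∂p^a∂p^b (J⁻¹)^a_j (J⁻¹)^b_k` in the flat coordinates `u`. -/
def dualProduct (p : Fin D.n → ℂ) (i j k : Fin D.n) : ℂ :=
  ∑ l, 1 / ((D.deg l : ℂ) - 1) * D.hessAt p l j k * (D.jacAt p)⁻¹ i l

/-- The Christoffel symbols in the coordinates `p` of the dual connection, whose Christoffel
symbols in the flat coordinates `u` are `-(d_l/(d_l - 1)) ∂²u^l/∂p^a∂p^b (J⁻¹)^a_j (J⁻¹)^b_k`. -/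
def dualConnection (p : Fin D.n → ℂ) (i j k : Fin D.n) : ℂ :=
  ∑ l, (D.jacAt p)⁻¹ i l *
    (D.hessAt p l j k - (D.deg l : ℂ) / ((D.deg l : ℂ) - 1) * D.hessAt p l j k)

end GroupData

/-! ## Bi-flat F-structures on open subsets of `ℂⁿ` -/

/-- Holomorphic vector fields, by their components. -/
abbrev VField (n : ℕ) := (Fin n → ℂ) → Fin n → ℂ

/-- Fields `A^i_{jk}` with one upper and two lower indices, as `A p i j k`. -/
abbrev Field12 (n : ℕ) := (Fin n → ℂ) → Fin n → Fin n → Fin n → ℂ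

/-- The partial derivative `∂_j f` at `p`. -/
def pd {n : ℕ} (j : Fin n) (f : (Fin n → ℂ) → ℂ) (p : Fin n → ℂ) : ℂ :=
  fderiv ℂ f p (Pi.single j 1)

/-- `(∇_j X)^i = ∂_j X^i + Γ^i_{jk} X^k`. -/
def covV {n : ℕ} (Γ : Field12 n) (X : VField n) (p : Fin n → ℂ) (j i : Fin n) : ℂ :=
  pd j (fun q => X q i) p + ∑ k, Γ p i j k * X p k

/-- `(∇_j c)^i_{kl}`. -/
def covC {n : ℕ} (Γ c : Field12 n) (p : Fin n → ℂ) (j i k l : Fin n) : ℂ :=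
  pd j (fun q => c q i k l) p + ∑ s, Γ p i j s * c p s k l
    - ∑ s, Γ p s j k * c p i s l - ∑ s, Γ p s j l * c p i k s

/-- The curvature `R^i_{ljk}`. -/
def curv {n : ℕ} (Γ : Field12 n) (p : Fin n → ℂ) (i l j k : Fin n) : ℂ :=
  pd j (fun q => Γ q i k l) p - pd k (fun q => Γ q i j l) p
    + ∑ s, Γ p i j s * Γ p s k l - ∑ s, Γ p i k s * Γ p s j l

/-- The exterior covariant derivative `(d_∇ L)^k_{ij}` of the endomorphism field `L = X∘`,
`L^k_j = c^k_{mj} X^m`. -/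
def extCov {n : ℕ} (Γ c : Field12 n) (X : VField n) (p : Fin n → ℂ) (k i j : Fin n) : ℂ :=
  pd i (fun q => ∑ m, c q k m j * X q m) p + ∑ l, Γ p k i l * ∑ m, c p l m j * X p m
    - (pd j (fun q => ∑ m, c q k m i * X q m) p + ∑ l, Γ p k j l * ∑ m, c p l m i * X p m)

/-- `Γ` are holomorphic Christoffel symbols on `Ω` of a torsionless flat connection. -/
structure IsFlatConnection {n : ℕ} (Ω : Set (Fin n → ℂ)) (Γ : Field12 n) : Prop where
  holo : ∀ i j k, DifferentiableOn ℂ (fun p => Γ p i j k) Ω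
  torsionless : ∀ p ∈ Ω, ∀ i j k, Γ p i j k = Γ p i k j
  flat : ∀ p ∈ Ω, ∀ i l j k, curv Γ p i l j k = 0

/-- `c` are holomorphic structure constants on `Ω` of a commutative associative product on
vector fields with unit `e`. -/
structure IsProduct {n : ℕ} (Ω : Set (Fin n → ℂ)) (c : Field12 n) (e : VField n) : Prop where
  holo : ∀ i j k, DifferentiableOn ℂ (fun p => c p i j k) Ω
  holo_unit : ∀ i, DifferentiableOn ℂ (fun p => e p i) Ω
  comm : ∀ p ∈ Ω, ∀ i j k, c p i j k = c p i k j
  assoc : ∀ p ∈ Ω, ∀ i j k l, ∑ s, c p i s l * c p s j k = ∑ s, c p i j s * c p s k l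
  unit : ∀ p ∈ Ω, ∀ i k, ∑ j, c p i j k * e p j = if i = k then 1 else 0

/-- A bi-flat `F`-structure `(∇¹, ∇², ∘, *, e, E)` on the open set `Ω`, in coordinates, with
Christoffel symbols `Γ₁`, `Γ₂` and structure constants `c`, `cs`. The constant `w` is the
normalization of the Euler field: `[e, E] = w e` and `Lie_E c = w c`. Replacing `E`, `cs` by
`E / w`, `w cs` leads to the normalization with `w = 1`. -/
structure IsBiFlat {n : ℕ} (Ω : Set (Fin n → ℂ)) (w : ℂ) (Γ₁ Γ₂ c cs : Field12 n)
    (e E : VField n) : Prop where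
  connection₁ : IsFlatConnection Ω Γ₁
  connection₂ : IsFlatConnection Ω Γ₂
  product₁ : IsProduct Ω c e
  product₂ : IsProduct Ω cs E
  bracket : ∀ p ∈ Ω, ∀ i,
    ∑ s, (e p s * pd s (fun q => E q i) p - E p s * pd s (fun q => e q i) p) = w * e p i
  lie : ∀ p ∈ Ω, ∀ i j k,
    ∑ s, (E p s * pd s (fun q => c q i j k) p - c p s j k * pd s (fun q => E q i) p
      + c p i s k * pd j (fun q => E q s) p + c p i j s * pd k (fun q => E q s) p)
      = w * c p i j k
  /-- `X * Y = E⁻¹ ∘ X ∘ Y`, where `E⁻¹ ∘ E = e` -/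
  dual : ∃ Einv : VField n, ∀ p ∈ Ω,
    (∀ i, ∑ j, ∑ k, c p i j k * Einv p j * E p k = e p i) ∧
    (∀ i j k, cs p i j k = ∑ s, ∑ m, c p i s m * Einv p s * c p m j k)
  flat_unit₁ : ∀ p ∈ Ω, ∀ i j, covV Γ₁ e p j i = 0
  flat_unit₂ : ∀ p ∈ Ω, ∀ i j, covV Γ₂ E p j i = 0
  compat₁ : ∀ p ∈ Ω, ∀ i j k l, covC Γ₁ c p j i k l = covC Γ₁ c p k i j l
  compat₂ : ∀ p ∈ Ω, ∀ i j k l, covC Γ₂ cs p j i k l = covC Γ₂ cs p k i j l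
  /-- `(d_{∇¹} - d_{∇²})(X∘) = 0` for every vector field `X` -/
  almost_hydro : ∀ X : VField n, (∀ i, DifferentiableOn ℂ (fun p => X p i) Ω) →
    ∀ p ∈ Ω, ∀ k i j, extCov Γ₁ c X p k i j = extCov Γ₂ c X p k i j

/-- The bi-flat structures with the flat coordinates `u` on an open subset `Ω` of the complement of
the mirrors: `E = ∑ p^k ∂/∂p^k` is the Euler field of `ℂⁿ` (so that `[e, E] = d_n e`, where `d_n`
is the highest degree), the `u^l` are flat coordinates of the natural connection, and
`∇² = ∇⁰ - *`, where `∇⁰` is the standard flat connection of `ℂⁿ`. -/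
structure GroupData.IsStandard (D : GroupData) (Ω : Set (Fin D.n → ℂ))
    (Γ₁ Γ₂ c cs : Field12 D.n) (e : VField D.n) : Prop where
  isOpen : IsOpen Ω
  subset : Ω ⊆ D.regularSet
  biflat : IsBiFlat Ω ((Finset.univ.sup D.deg : ℕ) : ℂ) Γ₁ Γ₂ c cs e (fun p => p)
  flatCoordinates : ∀ p ∈ Ω, ∀ l j k, D.hessAt p l j k = ∑ s, Γ₁ p s j k * D.jacAt p l s
  dual_eq : ∀ p ∈ Ω, ∀ i j k, Γ₂ p i j k = - cs p i j k

/-! ## The groups and their Saito flat coordinates -/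

/-- The exceptional well-generated irreducible complex reflection groups of rank 2 and 3, in the
numbering of Shephard and Todd. -/
inductive STGroup
  | G4 | G5 | G6 | G8 | G9 | G10 | G14 | G16 | G17 | G18 | G20 | G21
  | G23 | G24 | G25 | G26 | G27

/-- `√2`, `√3`, `√5`, `√15` as complex numbers. -/
def r2 : ℂ := (Real.sqrt 2 : ℝ)
def r3 : ℂ := (Real.sqrt 3 : ℝ)
def r5 : ℂ := (Real.sqrt 5 : ℝ)
def r15 : ℂ := (Real.sqrt 15 : ℝ)

/-- `√(10 - 2√5)`. -/
def lam : ℂ := (Real.sqrt (10 - 2 * Real.sqrt 5) : ℝ)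

/-- `exp (2πi/n)`. -/
def zeta (n : ℕ) : ℂ := Complex.exp (2 * Real.pi * Complex.I / n)

/-- Tetrahedral and octahedral polynomials. -/
def phi4 : MvPolynomial (Fin 2) ℂ :=
  X 0 ^ 4 + C (2 * Complex.I * r3) * X 0 ^ 2 * X 1 ^ 2 + X 1 ^ 4

def f6 : MvPolynomial (Fin 2) ℂ := X 0 ^ 5 * X 1 - X 0 * X 1 ^ 5

def h8 : MvPolynomial (Fin 2) ℂ := X 0 ^ 8 + 14 * X 0 ^ 4 * X 1 ^ 4 + X 1 ^ 8

def t12 : MvPolynomial (Fin 2) ℂ :=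
  X 0 ^ 12 - 33 * X 0 ^ 8 * X 1 ^ 4 - 33 * X 0 ^ 4 * X 1 ^ 8 + X 1 ^ 12

/-- Icosahedral polynomials. -/
def F12 : MvPolynomial (Fin 2) ℂ :=
  X 0 ^ 12 + C (22 / 5 * r5) * X 0 ^ 10 * X 1 ^ 2 - 33 * X 0 ^ 8 * X 1 ^ 4
    - C (44 / 5 * r5) * X 0 ^ 6 * X 1 ^ 6 - 33 * X 0 ^ 4 * X 1 ^ 8
    + C (22 / 5 * r5) * X 0 ^ 2 * X 1 ^ 10 + X 1 ^ 12

def F20 : MvPolynomial (Fin 2) ℂ :=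
  X 0 ^ 20 - C (38 / 3 * r5) * X 0 ^ 18 * X 1 ^ 2 - 19 * X 0 ^ 16 * X 1 ^ 4
    - C (152 * r5) * X 0 ^ 14 * X 1 ^ 6 - 494 * X 0 ^ 12 * X 1 ^ 8
    + C (988 / 3 * r5) * X 0 ^ 10 * X 1 ^ 10 - 494 * X 0 ^ 8 * X 1 ^ 12
    - C (152 * r5) * X 0 ^ 6 * X 1 ^ 14 - 19 * X 0 ^ 4 * X 1 ^ 16
    - C (38 / 3 * r5) * X 0 ^ 2 * X 1 ^ 18 + X 1 ^ 20

def F30 : MvPolynomial (Fin 2) ℂ :=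
  X 0 ^ 29 * X 1 - C (116 / 45 * r5) * X 0 ^ 27 * X 1 ^ 3 + C (1769 / 25) * X 0 ^ 25 * X 1 ^ 5
    + C (464 / 5 * r5) * X 0 ^ 23 * X 1 ^ 7 + C (2001 / 5) * X 0 ^ 21 * X 1 ^ 9
    - C (2668 / 15 * r5) * X 0 ^ 19 * X 1 ^ 11 + C (12673 / 5) * X 0 ^ 17 * X 1 ^ 13
    - C (12673 / 5) * X 0 ^ 13 * X 1 ^ 17 + C (2668 / 15 * r5) * X 0 ^ 11 * X 1 ^ 19
    - C (2001 / 5) * X 0 ^ 9 * X 1 ^ 21 - C (464 / 5 * r5) * X 0 ^ 7 * X 1 ^ 23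
    - C (1769 / 25) * X 0 ^ 5 * X 1 ^ 25 + C (116 / 45 * r5) * X 0 ^ 3 * X 1 ^ 27
    - X 0 * X 1 ^ 29

/-- Basic invariants of `G23`. -/
def sym3 (a b : ℕ) : MvPolynomial (Fin 3) ℂ :=
  X 0 ^ a * X 1 ^ b + X 0 ^ a * X 2 ^ b + X 1 ^ a * X 0 ^ b + X 1 ^ a * X 2 ^ b
    + X 2 ^ a * X 0 ^ b + X 2 ^ a * X 1 ^ b

def pow3 (a : ℕ) : MvPolynomial (Fin 3) ℂ := X 0 ^ a + X 1 ^ a + X 2 ^ a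

def delta23 : MvPolynomial (Fin 3) ℂ :=
  (X 0 ^ 2 - X 1 ^ 2) * (X 0 ^ 2 - X 2 ^ 2) * (X 1 ^ 2 - X 2 ^ 2)

def U23₂ : MvPolynomial (Fin 3) ℂ :=
  2 * pow3 6 - 15 * sym3 4 2 + 180 * X 0 ^ 2 * X 1 ^ 2 * X 2 ^ 2 + C (21 * r5) * delta23

def U23₃ : MvPolynomial (Fin 3) ℂ :=
  5 * (2 * pow3 10 - 45 * sym3 8 2 + 42 * sym3 6 4
      + 1008 * (X 0 ^ 6 * X 1 ^ 2 * X 2 ^ 2 + X 1 ^ 6 * X 0 ^ 2 * X 2 ^ 2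
        + X 2 ^ 6 * X 0 ^ 2 * X 1 ^ 2)
      - 1260 * (X 0 ^ 4 * X 1 ^ 4 * X 2 ^ 2 + X 0 ^ 4 * X 2 ^ 4 * X 1 ^ 2
        + X 1 ^ 4 * X 2 ^ 4 * X 0 ^ 2))
    - C (33 * r5) * delta23 * (3 * pow3 4
      - 11 * (X 0 ^ 2 * X 1 ^ 2 + X 0 ^ 2 * X 2 ^ 2 + X 1 ^ 2 * X 2 ^ 2))

/-- Basic invariants of `G24`. -/
def U24₁ : MvPolynomial (Fin 3) ℂ := X 0 ^ 3 * X 1 + X 0 * X 2 ^ 3 + X 1 ^ 3 * X 2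

def U24₂ : MvPolynomial (Fin 3) ℂ :=
  X 0 ^ 5 * X 2 + X 0 * X 1 ^ 5 + X 1 * X 2 ^ 5 - 5 * X 0 ^ 2 * X 1 ^ 2 * X 2 ^ 2

def U24₃ : MvPolynomial (Fin 3) ℂ :=
  X 0 ^ 14 + X 1 ^ 14 + X 2 ^ 14
    + 18 * (X 0 ^ 7 * X 1 ^ 7 + X 0 ^ 7 * X 2 ^ 7 + X 1 ^ 7 * X 2 ^ 7)
    - 126 * (X 0 ^ 6 * X 1 ^ 3 * X 2 ^ 5 + X 0 ^ 5 * X 1 ^ 6 * X 2 ^ 3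
      + X 0 ^ 3 * X 1 ^ 5 * X 2 ^ 6)
    + 375 * (X 0 ^ 8 * X 1 ^ 4 * X 2 ^ 2 + X 0 ^ 4 * X 1 ^ 2 * X 2 ^ 8
      + X 0 ^ 2 * X 1 ^ 8 * X 2 ^ 4)
    - 250 * (X 0 ^ 9 * X 1 * X 2 ^ 4 + X 0 ^ 4 * X 1 ^ 9 * X 2 + X 0 * X 1 ^ 4 * X 2 ^ 9)
    - 34 * (X 0 ^ 11 * X 1 ^ 2 * X 2 + X 0 ^ 2 * X 1 * X 2 ^ 11 + X 0 * X 1 ^ 11 * X 2 ^ 2)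

/-- The number `2 cos (2π/7)`. -/
def cos7 : ℂ := (2 * Real.cos (2 * Real.pi / 7) : ℝ)

/-- Basic invariants of `G25` and `G26`. -/
def U25₁ : MvPolynomial (Fin 3) ℂ :=
  pow3 6 - 10 * X 0 ^ 3 * X 1 ^ 3 - 10 * X 0 ^ 3 * X 2 ^ 3 - 10 * X 1 ^ 3 * X 2 ^ 3

def U25₂ : MvPolynomial (Fin 3) ℂ :=
  (X 0 ^ 3 - X 1 ^ 3) * (X 0 ^ 3 - X 2 ^ 3) * (X 1 ^ 3 - X 2 ^ 3)

def U25₃ : MvPolynomial (Fin 3) ℂ :=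
  pow3 3 * (pow3 3 ^ 3 + 216 * X 0 ^ 3 * X 1 ^ 3 * X 2 ^ 3)

def U26₃ : MvPolynomial (Fin 3) ℂ :=
  pow3 3 ^ 6 - 540 * X 0 ^ 3 * X 1 ^ 3 * X 2 ^ 3 * pow3 3 ^ 3
    - 5832 * X 0 ^ 6 * X 1 ^ 6 * X 2 ^ 6

/-- The Hessian matrix of a polynomial. -/
def hessian (f : MvPolynomial (Fin 3) ℂ) : Matrix (Fin 3) (Fin 3) (MvPolynomial (Fin 3) ℂ) :=
  Matrix.of fun i j => pderiv i (pderiv j f)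

/-- The determinant of the Hessian matrix of `f`, bordered by the gradient of `k`. -/
def bord (f k : MvPolynomial (Fin 3) ℂ) : MvPolynomial (Fin 3) ℂ :=
  (Matrix.fromBlocks (hessian f) (Matrix.of fun i (_ : Unit) => pderiv i k)
    (Matrix.of fun (_ : Unit) j => pderiv j k) 0).det

/-- Basic invariants of `G27` (Wiman). -/
def U27₁ : MvPolynomial (Fin 3) ℂ :=
  10 * X 0 ^ 3 * X 1 ^ 3 + 9 * X 2 * (X 0 ^ 5 + X 1 ^ 5) - 45 * X 0 ^ 2 * X 1 ^ 2 * X 2 ^ 2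
    - 135 * X 0 * X 1 * X 2 ^ 4 + 27 * X 2 ^ 6

def U27₂ : MvPolynomial (Fin 3) ℂ := C (1 / 20250) * (hessian U27₁).det

def U27₃ : MvPolynomial (Fin 3) ℂ := C (1 / 24300) * bord U27₁ U27₂

/-- The number `(√5 - 1)(3 + i√15)/4`; the covector `[1, 1, w27]` defines a mirror of `G27`. -/
def w27 : ℂ := (r5 - 1) * (3 + Complex.I * r15) / 4

/-- The data of the groups. The covectors of the generating reflections refer to the linear
coordinates in which the invariants are written. -/
def STGroup.data : STGroup → GroupData
  | .G4 =>
    { n := 2, h := 1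
      gens := [(![-1 - Complex.I, r3 - 1], 3), (![1 - Complex.I, r3 + 1], 3)]
      deg := ![4, 6], u := ![phi4, f6]
      N := 6, table := [(3, 4)] }
  | .G5 =>
    { n := 2, h := 1
      gens := [(![-1 - Complex.I, r3 - 1], 3), (![1, (1 - r3) / 2 * (1 + Complex.I)], 3)]
      deg := ![6, 12], u := ![f6, phi4 ^ 3 - C (6 * Complex.I * r3) * f6 ^ 2]
      N := 12, table := [(3, 8)] }
  | .G6 =>
    { n := 2, h := 1
      gens := [(![1, 0], 2), (![-1 - Complex.I, r3 - 1], 3)]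
      deg := ![4, 12], u := ![phi4, f6 ^ 2 + C (5 / 288 * Complex.I * r3) * phi4 ^ 3]
      N := 12, table := [(2, 6), (3, 4)] }
  | .G8 =>
    { n := 2, h := 1
      gens := [(![1, 0], 4), (![1, 1], 4)]
      deg := ![8, 12], u := ![h8, t12]
      N := 12, table := [(4, 6)] }
  | .G9 =>
    { n := 2, h := 1
      gens := [(![1, r2 - 1], 2), (![1, 0], 4)]
      deg := ![8, 24], u := ![h8, t12 ^ 2 - C (11 / 16) * h8 ^ 3]
      N := 24, table := [(2, 12), (4, 6)] }
  | .G10 =>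
    { n := 2, h := 1
      gens := [(![1, (1 - r3) / 2 * (1 + Complex.I)], 3), (![1, 0], 4)]
      deg := ![12, 24], u := ![t12, h8 ^ 3 - C (7 / 12) * t12 ^ 2]
      N := 24, table := [(3, 8), (4, 6)] }
  | .G14 =>
    { n := 2, h := 1
      gens := [(![1, 1 - r2], 2), (![1, (1 - r3) / 2 * (1 + Complex.I)], 3)]
      deg := ![6, 24], u := ![f6, t12 ^ 2 + 66 * f6 ^ 4]
      N := 24, table := [(2, 12), (3, 8)] }
  | .G16 =>
    { n := 2, h := 1
      gens := [(![1, (r5 - 1 - lam) / 2], 5), (![1, (1 - r5 + lam) / 2], 5)]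
      deg := ![20, 30], u := ![F20, F30]
      N := 30, table := [(5, 12)] }
  | .G17 =>
    { n := 2, h := 1
      gens := [(![1, 0], 2), (![1, (r5 - 1 - lam) / 2], 5)]
      deg := ![20, 60], u := ![F20, F30 ^ 2 + C (29 / 12000 * r5) * F20 ^ 3]
      N := 60, table := [(2, 30), (5, 12)] }
  | .G18 =>
    { n := 2, h := 1
      gens := [(![1, (1 - r3) / 2 * (1 - Complex.I)], 3), (![1, (r5 - 1 - lam) / 2], 5)]
      deg := ![30, 60], u := ![F30, F20 ^ 3 + C (38 * r5) * F30 ^ 2]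
      N := 60, table := [(3, 20), (5, 12)] }
  | .G20 =>
    { n := 2, h := 1
      gens := [(![1, (1 - r3) / 2 * (1 - Complex.I)], 3), (![1, (r3 + r15 + r5 + 3) / 2], 3)]
      deg := ![12, 30], u := ![F12, F30]
      N := 30, table := [(3, 20)] }
  | .G21 =>
    { n := 2, h := 1
      gens := [(![1, 0], 2), (![1, (r3 + r15 + r5 + 3) / 2], 3)]
      deg := ![12, 60], u := ![F12, F30 ^ 2 - C (29 / 14400 * r5) * F12 ^ 5]
      N := 60, table := [(2, 30), (3, 20)] }
  | .G23 =>
    { n := 3, h := 1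
      gens := [(![1, 0, 0], 2), (![0, 1, 0], 2), (![-2, r5 - 1, r5 + 1], 2)]
      deg := ![2, 6, 10]
      u := ![pow3 2, U23₂ - 2 * pow3 2 ^ 3,
        U23₃ + C (33 / 7) * pow3 2 ^ 2 * U23₂ - C (2091 / 175) * pow3 2 ^ 5]
      N := 10, table := [(2, 15)] }
  | .G24 =>
    { n := 3, h := 1
      gens := [(![1, cos7, -1 - cos7], 2),
        (![zeta 7, zeta 7 ^ 4 * cos7, zeta 7 ^ 2 * (-1 - cos7)], 2),
        (![cos7, -1 - cos7, 1], 2)]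
      deg := ![4, 6, 14]
      u := ![U24₁, U24₂, U24₃ + 34 * U24₁ ^ 2 * U24₂]
      N := 14, table := [(2, 21)] }
  | .G25 =>
    { n := 3, h := 1
      gens := [(![1, 0, 0], 3), (![1, 1, 1], 3), (![0, 1, 0], 3)]
      deg := ![6, 9, 12]
      u := ![U25₁, U25₂, U25₃ - C (5 / 8) * U25₁ ^ 2]
      N := 12, table := [(3, 12)] }
  | .G26 =>
    { n := 3, h := 1
      gens := [(![1, -1, 0], 2), (![1, 0, 0], 3), (![1, 1, 1], 3)]
      deg := ![6, 12, 18]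
      u := ![U25₁, U25₃ - C (1 / 6) * U25₁ ^ 2,
        U26₃ - C (1 / 2) * U25₁ * U25₃ + C (1 / 9) * U25₁ ^ 3]
      N := 18, table := [(2, 9), (3, 12)] }
  | .G27 =>
    { n := 3, h := Matrix.diagonal ![1, 1, 3]
      gens := [(![1, -zeta 5, 0], 2), (![1, 1, w27], 2), (![1, 1, star w27], 2)]
      deg := ![6, 12, 30]
      u := ![U27₁, U27₂ - C (1 / 9) * U27₁ ^ 2,
        U27₃ - C (17 / 18) * U27₂ ^ 2 * U27₁ + C (29 / 27) * U27₂ * U27₁ ^ 3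
          - C (43 / 486) * U27₁ ^ 5]
      N := 30, table := [(2, 45)] }

end ReflectionDuality

end

/-! Multiplied by the Jacobian determinant det J, the dual product becomes the polynomial tensor
`ptensor`, with entries ∑_l (d_l - 1)⁻¹ ∂_j∂_k u^l adj(J)^i_l, homogeneous of degree deg(det J) - 1.
The asserted formula, multiplied by det J, is a polynomial tensor of the same degree. It therefore
suffices to show, mirror by mirror, that the difference of the two is divisible by α_H^(κ_H - 1):
forms of distinct mirrors are coprime, so the difference is then divisible by det J, and its degree
is too small unless it vanishes (`ptensor_eq`). In other words, a tensor of degree -1 with simple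
poles along the mirrors is determined by its residues.

The residue at a mirror is computed in a frame with one vector, number o, orthogonal to the mirror
and the others inside it. The reflection is then diagonal, and invariance of the u^l gives ∂_o u^l =
X_o^(κ-1) w_l. This disposes of all components except two kinds (`LocalGood`, `LocalGood.dvd`): the
purely normal component must have residue κ/N, and the normal component with two tangential
arguments must vanish on the mirror. Here the flat coordinates matter; arbitrary basic invariants
would not do. Both conditions are transported by the group, so one mirror per orbit is enough. In
rank two Euler's relation yields the second condition, homogeneity makes the residue a constant, and
the residues add up to the rank (`sum_residue`), so that one orbit comes for free. In rank three
both conditions are verified on explicit expansions along a mirror.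

The mirrors are controlled by det J as well. If an element of the group is a reflection with
eigenvalue ζ along ker α, and α^m is the exact power of α in det J, then the transformation law of
det J gives ζ^(m+1) = 1 (`pow_eq_one`). Hence a reflection of order κ forces α^(κ-1) to divide det
J, and a list of distinct mirrors for which the numbers κ - 1 add up to ∑(d_l - 1) exhausts det J.
Such a list is complete and yields the factorization and the stabilizers (`det_eq`, `mirrors_eq`,
`kappa_eq`). Candidates arise by applying generators repeatedly to their covectors. Only
distinctness has to be seen, and it may be seen after reducing algebraic integers modulo a prime,
which leaves a finite computation (`exists_mirrorFamily`). The order of the group is never needed.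

Invariance of the u^l under a generator is checked in an adapted frame, where it is a condition on
exponents or a parity. For most groups only one ground form is treated in this way; the others are
its Hessian, Jacobian or bordered Hessian covariants and inherit the invariance.

For a standard bi-flat structure, the compatibility of the two connections is contracted with the
Euler field. Together with ∇²E = 0, Γ₂ = -* and Euler's relation for the u^l it becomes a linear
equation whose only solution is the dual product (`standard_eq`). -/

noncomputable section

namespace ReflectionDuality

open MvPolynomial

/-! ## Linear forms and linear substitutions -/

section Subst

variable {n : ℕ}

/-- The linear form with given coefficients, as a polynomial. -/
def lin (α : Fin n → ℂ) : MvPolynomial (Fin n) ℂ := ∑ i, C (α i) * X i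

/-- The substitution `f ↦ f ∘ g` for a linear map `g`. -/
def subst (g : Matrix (Fin n) (Fin n) ℂ) : MvPolynomial (Fin n) ℂ →ₐ[ℂ] MvPolynomial (Fin n) ℂ :=
  aeval fun i => lin (g i)

@[simp] lemma eval_lin (α p : Fin n → ℂ) : eval p (lin α) = α ⬝ᵥ p := by
  simp [lin, dotProduct]

@[simp] lemma subst_X (g : Matrix (Fin n) (Fin n) ℂ) (i : Fin n) : subst g (X i) = lin (g i) := by
  simp [subst]

@[simp] lemma subst_C (g : Matrix (Fin n) (Fin n) ℂ) (a : ℂ) : subst g (C a) = C a := by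
  simp [subst]

lemma eval_subst (g : Matrix (Fin n) (Fin n) ℂ) (p : Fin n → ℂ) (f : MvPolynomial (Fin n) ℂ) :
    eval p (subst g f) = eval (g.mulVec p) f := by
  induction f using MvPolynomial.induction_on with
  | C a => simp
  | add f f' h h' => simp [h, h']
  | mul_X f i h => simp [h, Matrix.mulVec]

lemma pderiv_lin (α : Fin n → ℂ) (j : Fin n) : pderiv j (lin α) = C (α j) := by
  simp [lin, pderiv_X, Pi.single_apply]

lemma pderiv_subst (g : Matrix (Fin n) (Fin n) ℂ) (j : Fin n) (f : MvPolynomial (Fin n) ℂ) :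
    pderiv j (subst g f) = ∑ i, C (g i j) * subst g (pderiv i f) := by
  induction f using MvPolynomial.induction_on with
  | C a => simp
  | add f f' h h' => simp [h, h', mul_add, Finset.sum_add_distrib]
  | mul_X f i h =>
    simp only [map_mul, Derivation.leibniz, smul_eq_mul, subst_X, pderiv_lin, h, pderiv_X, map_add,
      mul_add, Finset.sum_add_distrib, Finset.mul_sum]
    refine congr_arg₂ (· + ·) ?_ ?_
    · rw [Finset.sum_eq_single i]
      · simp [mul_comm]
      · intro b _ hb; simp [hb.symm]
      · simp
    · exact Finset.sum_congr rfl fun _ _ => by ring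

lemma subst_subst (g g' : Matrix (Fin n) (Fin n) ℂ) (f : MvPolynomial (Fin n) ℂ) :
    subst g (subst g' f) = subst (g' * g) f := by
  apply MvPolynomial.funext
  intro p
  simp [eval_subst]

lemma subst_one (f : MvPolynomial (Fin n) ℂ) : subst 1 f = f := by
  apply MvPolynomial.funext
  intro p
  simp [eval_subst]

lemma subst_lin (g : Matrix (Fin n) (Fin n) ℂ) (α : Fin n → ℂ) :
    subst g (lin α) = lin (Matrix.vecMul α g) := by
  apply MvPolynomial.funext
  intro p
  simp [eval_subst, Matrix.dotProduct_mulVec]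

lemma lin_single (o : Fin n) : lin (Pi.single o 1) = X o := by
  apply MvPolynomial.funext
  intro p
  simp

lemma lin_smul (c : ℂ) (α : Fin n → ℂ) : lin (c • α) = C c * lin α := by
  apply MvPolynomial.funext
  intro p
  simp

lemma subst_dvd_iff {g g' : Matrix (Fin n) (Fin n) ℂ} (hg : g * g' = 1)
    {a b : MvPolynomial (Fin n) ℂ} : subst g a ∣ subst g b ↔ a ∣ b := by
  refine ⟨fun h => ?_, fun h => map_dvd _ h⟩
  have := map_dvd (subst g') h
  rwa [subst_subst, subst_subst, hg, subst_one, subst_one] at this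

/-- Setting `X o` to zero changes a polynomial by a multiple of `X o`, and the result is determined
by the values on the hyperplane, ℂ being infinite. -/
lemma X_dvd_iff (o : Fin n) (f : MvPolynomial (Fin n) ℂ) :
    X o ∣ f ↔ ∀ p : Fin n → ℂ, p o = 0 → eval p f = 0 := by
  refine ⟨fun ⟨q, hq⟩ p hp => by simp [hq, hp], fun h => ?_⟩
  let ρ : MvPolynomial (Fin n) ℂ →ₐ[ℂ] MvPolynomial (Fin n) ℂ :=
    aeval fun i => if i = o then 0 else X i
  have key : ∀ f, X o ∣ f - ρ f := by
    intro f
    induction f using MvPolynomial.induction_on with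
    | C a => simp [ρ]
    | add f f' h h' => rw [map_add, add_sub_add_comm]; exact dvd_add h h'
    | mul_X f i h =>
      rw [map_mul]
      have : f * X i - ρ f * ρ (X i) = (f - ρ f) * X i + ρ f * (X i - ρ (X i)) := by ring
      rw [this]
      refine dvd_add (h.mul_right _) (Dvd.dvd.mul_left ?_ _)
      by_cases hi : i = o
      · simp [ρ, hi]
      · simp [ρ, hi]
  have hz : ρ f = 0 := by
    apply MvPolynomial.funext
    intro p
    have : ∀ f, eval p (ρ f) = eval (Function.update p o 0) f := by
      intro f
      induction f using MvPolynomial.induction_on with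
      | C a => simp [ρ]
      | add f f' h h' => simp [h, h']
      | mul_X f i h =>
        rw [map_mul, map_mul, h, map_mul, eval_X]
        by_cases hi : i = o
        · subst hi; simp [ρ]
        · simp [ρ, hi]
    rw [this, h _ (by simp), map_zero]
  simpa [hz] using key f

lemma prime_X (o : Fin n) : Prime (X o : MvPolynomial (Fin n) ℂ) := by
  refine ⟨X_ne_zero o, ?_, fun a b h => X_dvd_mul_iff.mp h⟩
  intro h
  have := (X_dvd_iff o 1).mp h.dvd 0 rfl
  simp at this

/-- The identity matrix with row `o` replaced by `α` has determinant `α o`. It reduces statements on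
arbitrary hyperplanes to coordinate hyperplanes. -/
lemma exists_adapted {α : Fin n → ℂ} {o : Fin n} (ho : α o ≠ 0) :
    ∃ g g' : Matrix (Fin n) (Fin n) ℂ, g * g' = 1 ∧ g' * g = 1 ∧
      subst g' (X o) = lin α ∧ subst g (lin α) = X o := by
  let g' : Matrix (Fin n) (Fin n) ℂ := (1 : Matrix (Fin n) (Fin n) ℂ).updateRow o α
  have hdet : g'.det = α o := by
    have : α = ∑ k, α k • (1 : Matrix (Fin n) (Fin n) ℂ) k := by
      ext j
      simp [Matrix.one_apply]
    simp only [g']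
    rw [this, Matrix.det_updateRow_sum]
    simp [Matrix.one_apply]
  have hu : IsUnit g'.det := by rw [hdet]; exact isUnit_iff_ne_zero.mpr ho
  have h1 : subst g' (X o) = lin α := by simp [g']
  have h2 := Matrix.nonsing_inv_mul g' hu
  have h3 := Matrix.mul_nonsing_inv g' hu
  exact ⟨g'⁻¹, g', h2, h3, h1, by rw [← h1, subst_subst, h3, subst_one]⟩

lemma exists_ne_of_ne_zero {α : Fin n → ℂ} (hα : α ≠ 0) : ∃ o, α o ≠ 0 :=
  Function.ne_iff.mp hα

lemma prime_lin {α : Fin n → ℂ} (hα : α ≠ 0) : Prime (lin α) := by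
  obtain ⟨o, ho⟩ := exists_ne_of_ne_zero hα
  obtain ⟨g, g', h1, h2, h3, h4⟩ := exists_adapted ho
  let e : MvPolynomial (Fin n) ℂ ≃* MvPolynomial (Fin n) ℂ :=
    { toFun := subst g'
      invFun := subst g
      left_inv := fun f => by rw [subst_subst, h2, subst_one]
      right_inv := fun f => by rw [subst_subst, h1, subst_one]
      map_mul' := map_mul _ }
  have : Prime (e (X o)) := (MulEquiv.prime_iff e).mpr (prime_X o)
  simpa [e, h3] using this

lemma lin_ne_zero {α : Fin n → ℂ} (hα : α ≠ 0) : lin α ≠ 0 := (prime_lin hα).ne_zero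

lemma lin_dvd_iff {α : Fin n → ℂ} (hα : α ≠ 0) (f : MvPolynomial (Fin n) ℂ) :
    lin α ∣ f ↔ ∀ p : Fin n → ℂ, α ⬝ᵥ p = 0 → eval p f = 0 := by
  refine ⟨fun ⟨q, hq⟩ p hp => by simp [hq, hp], fun h => ?_⟩
  obtain ⟨o, ho⟩ := exists_ne_of_ne_zero hα
  obtain ⟨g, g', h1, h2, h3, h4⟩ := exists_adapted ho
  rw [← subst_dvd_iff h1, h4, X_dvd_iff]
  intro p hp
  rw [eval_subst]
  apply h
  rw [← eval_lin, ← eval_subst, h4, eval_X, hp]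

/-- A covector that vanishes on the kernel of `α` is a multiple of `α`. -/
lemma eq_smul_of_ker_le {α β : Fin n → ℂ} {o : Fin n} (ho : α o ≠ 0)
    (h : ∀ v, α ⬝ᵥ v = 0 → β ⬝ᵥ v = 0) : β = (β o / α o) • α := by
  ext j
  -- These vectors lie in the kernel of `α`, and evaluating `β` on them gives the proportionality
  -- entry by entry.
  have := h (α o • Pi.single j 1 - α j • Pi.single o 1) (by
    simp [dotProduct_sub, dotProduct_smul, mul_comm])
  simp only [dotProduct_sub, dotProduct_smul, dotProduct_single, mul_one, smul_eq_mul] at this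
  simp only [Pi.smul_apply, smul_eq_mul]
  field_simp
  linear_combination this

lemma exists_smul_of_ker_eq {α β : Fin n → ℂ} (hα : α ≠ 0) (hβ : β ≠ 0)
    (h : ∀ v, α ⬝ᵥ v = 0 → β ⬝ᵥ v = 0) : ∃ c : ℂ, c ≠ 0 ∧ β = c • α := by
  obtain ⟨o, ho⟩ := exists_ne_of_ne_zero hα
  have := eq_smul_of_ker_le ho h
  refine ⟨_, ?_, this⟩
  intro h0
  rw [h0, zero_smul] at this
  exact hβ this

lemma lin_dvd_lin {α β : Fin n → ℂ} (hα : α ≠ 0) (h : lin α ∣ lin β) :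
    ∀ v, α ⬝ᵥ v = 0 → β ⬝ᵥ v = 0 := by
  intro v hv
  have := (lin_dvd_iff hα _).mp h v hv
  simpa using this

/-- The Jacobian matrix of a family of polynomials. -/
def jacOf (v : Fin n → MvPolynomial (Fin n) ℂ) :
    Matrix (Fin n) (Fin n) (MvPolynomial (Fin n) ℂ) :=
  Matrix.of fun l j => pderiv j (v l)

lemma jacOf_subst (g : Matrix (Fin n) (Fin n) ℂ) (v : Fin n → MvPolynomial (Fin n) ℂ) :
    jacOf (fun l => subst g (v l)) = (jacOf v).map (subst g) * g.map C := by
  ext1 l j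
  simp [jacOf, pderiv_subst, Matrix.mul_apply, mul_comm]

lemma det_jacOf_subst (g : Matrix (Fin n) (Fin n) ℂ) (v : Fin n → MvPolynomial (Fin n) ℂ) :
    (jacOf (fun l => subst g (v l))).det = subst g (jacOf v).det * C g.det := by
  rw [jacOf_subst, Matrix.det_mul]
  refine congr_arg₂ (· * ·) ?_ ?_
  · exact (AlgHom.map_det (subst g) (jacOf v)).symm
  · exact (RingHom.map_det C g).symm

/-! ## Determinants of matrices with homogeneous rows -/

lemma isHomogeneous_det {M : Matrix (Fin n) (Fin n) (MvPolynomial (Fin n) ℂ)} {d : Fin n → ℕ}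
    (h : ∀ l j, (M l j).IsHomogeneous (d l)) : M.det.IsHomogeneous (∑ l, d l) := by
  rw [Matrix.det_apply]
  refine IsHomogeneous.sum _ _ _ fun σ _ => ?_
  have h1 : (∏ i, M (σ i) i).IsHomogeneous (∑ l, d l) := by
    rw [← Equiv.sum_comp σ d]
    exact IsHomogeneous.prod _ _ _ fun i _ => h _ _
  rw [Units.smul_def, zsmul_eq_mul]
  have h2 : ((((Equiv.Perm.sign σ : ℤˣ) : ℤ) : MvPolynomial (Fin n) ℂ)).IsHomogeneous 0 := by
    have : ((((Equiv.Perm.sign σ : ℤˣ) : ℤ) : MvPolynomial (Fin n) ℂ)) =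
        C (((Equiv.Perm.sign σ : ℤˣ) : ℤ) : ℂ) := by simp
    rw [this]
    exact isHomogeneous_C _ _
  simpa using h2.mul h1

/-- The entry is the determinant of `M` with row `l` replaced by a constant unit row, so the degree
`d l` is replaced by zero. -/
lemma isHomogeneous_adjugate {M : Matrix (Fin n) (Fin n) (MvPolynomial (Fin n) ℂ)} {d : Fin n → ℕ}
    (h : ∀ l j, (M l j).IsHomogeneous (d l)) (i l : Fin n) :
    (M.adjugate i l).IsHomogeneous (∑ k, d k - d l) := by
  rw [Matrix.adjugate_apply]
  have : ∑ k, d k - d l = ∑ k, Function.update d l 0 k := by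
    rw [← Finset.add_sum_erase _ _ (Finset.mem_univ l),
      ← Finset.add_sum_erase _ (Function.update d l 0) (Finset.mem_univ l)]
    simp only [Function.update_self, zero_add, add_tsub_cancel_left]
    exact Finset.sum_congr rfl fun k hk => by rw [Function.update_of_ne (Finset.ne_of_mem_erase hk)]
  rw [this]
  apply isHomogeneous_det
  intro k j
  by_cases hk : k = l
  · subst hk
    simp only [Matrix.updateRow_self, Function.update_self, Pi.single_apply]
    split_ifs
    · exact isHomogeneous_one _ _
    · exact isHomogeneous_zero _ _ _
  · simpa [hk] using h k j

lemma isHomogeneous_lin (α : Fin n → ℂ) : (lin α).IsHomogeneous 1 :=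
  IsHomogeneous.sum _ _ _ fun i _ => by
    simpa using (isHomogeneous_C (Fin n) (α i)).mul (isHomogeneous_X ℂ i)

end Subst

/-! ## Unitary reflections -/

section Unitary

variable {n : ℕ}

/-- The metric is diagonal with positive entries. -/
def IsMetric (h : Matrix (Fin n) (Fin n) ℂ) : Prop :=
  ∃ c : Fin n → ℝ, (∀ i, 0 < c i) ∧ h = Matrix.diagonal fun i => (c i : ℂ)

/-- The vector dual to a covector. -/
def sharp (h : Matrix (Fin n) (Fin n) ℂ) (α : Fin n → ℂ) (i : Fin n) : ℂ :=
  ∑ m, h⁻¹ i m * star (α m)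

/-- The unitary reflection with mirror `ker α` and eigenvalue `ζ`. -/
def unitaryRefl (h : Matrix (Fin n) (Fin n) ℂ) (α : Fin n → ℂ) (ζ : ℂ) :
    Matrix (Fin n) (Fin n) ℂ := 1 - (1 - ζ) • proj h α

lemma proj_eq (h : Matrix (Fin n) (Fin n) ℂ) (α : Fin n → ℂ) :
    proj h α = (normSq h α)⁻¹ • Matrix.vecMulVec (sharp h α) α := by
  ext i k
  simp [proj, sharp, Matrix.vecMulVec_apply, div_eq_mul_inv, mul_comm]

lemma dotProduct_sharp (h : Matrix (Fin n) (Fin n) ℂ) (α : Fin n → ℂ) :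
    α ⬝ᵥ sharp h α = normSq h α := by
  simp only [dotProduct, sharp, normSq, Finset.mul_sum]
  exact Finset.sum_congr rfl fun _ _ => Finset.sum_congr rfl fun _ _ => by ring

section

variable {h : Matrix (Fin n) (Fin n) ℂ} (hh : IsMetric h) {α : Fin n → ℂ} (hα : α ≠ 0)
include hh

lemma IsMetric.inv_eq : ∃ c : Fin n → ℝ, (∀ i, 0 < c i) ∧
    h = Matrix.diagonal (fun i => (c i : ℂ)) ∧ h⁻¹ = Matrix.diagonal fun i => ((c i)⁻¹ : ℂ) := by
  obtain ⟨c, hc, rfl⟩ := hh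
  refine ⟨c, hc, rfl, ?_⟩
  apply Matrix.inv_eq_right_inv
  rw [Matrix.diagonal_mul_diagonal, ← Matrix.diagonal_one]
  congr 1
  ext i
  exact mul_inv_cancel₀ (Complex.ofReal_ne_zero.mpr (hc i).ne')

lemma IsMetric.mulVec_sharp (α : Fin n → ℂ) : h.mulVec (sharp h α) = star α := by
  obtain ⟨c, hc, hd, hi⟩ := hh.inv_eq
  ext i
  have h0 := Complex.ofReal_ne_zero.mpr (hc i).ne'
  have h1 : sharp h α i = (c i : ℂ)⁻¹ * star (α i) := by
    simp [sharp, hi, Matrix.diagonal_apply]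
  rw [show h.mulVec (sharp h α) i = c i * sharp h α i by
    conv_lhs => enter [1]; rw [hd]
    rw [Matrix.mulVec_diagonal], h1, Pi.star_apply, mul_inv_cancel_left₀ h0]

lemma IsMetric.normSq_eq (α : Fin n → ℂ) : ∃ r : ℝ, normSq h α = r ∧ (α ≠ 0 → 0 < r) := by
  obtain ⟨c, hc, hd, hi⟩ := hh.inv_eq
  refine ⟨∑ i, (c i)⁻¹ * ‖α i‖ ^ 2, ?_, ?_⟩
  · simp only [normSq, hi, Matrix.diagonal_apply, ite_mul, zero_mul, Finset.sum_ite_eq,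
      Finset.mem_univ, if_true]
    push_cast
    refine Finset.sum_congr rfl fun i _ => ?_
    rw [mul_assoc, Complex.star_def, Complex.mul_conj, Complex.normSq_eq_norm_sq]
    simp
  · intro hα
    obtain ⟨o, ho⟩ := exists_ne_of_ne_zero hα
    refine Finset.sum_pos' (fun i _ => by have := hc i; positivity) ⟨o, Finset.mem_univ _, ?_⟩
    have := hc o
    have := norm_pos_iff.mpr ho
    positivity

lemma IsMetric.det_ne_zero : h.det ≠ 0 := by
  obtain ⟨c, hc, rfl⟩ := hh
  rw [Matrix.det_diagonal]
  exact Finset.prod_ne_zero_iff.mpr fun i _ => Complex.ofReal_ne_zero.mpr (hc i).ne'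

/-- Self-adjointness of the projection for `h`: up to the real factor ‖α‖⁻², the product of `h` and
the projection is the Hermitian matrix of entries conj(α_i) α_k. -/
lemma IsMetric.conjTranspose_proj_mul (α : Fin n → ℂ) :
    (proj h α).conjTranspose * h = h * proj h α := by
  obtain ⟨r, hr, -⟩ := hh.normSq_eq α
  have hs := hh.mulVec_sharp α
  have hH : h.conjTranspose = h := by
    obtain ⟨c, -, rfl⟩ := hh
    rw [Matrix.diagonal_conjTranspose]
    congr 1
    ext i
    simp
  have h1 : h * proj h α = (normSq h α)⁻¹ • Matrix.vecMulVec (star α) α := by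
    rw [proj_eq, Matrix.mul_smul, Matrix.mul_vecMulVec, hs]
  have h2 : (proj h α).conjTranspose * h = (h * proj h α).conjTranspose := by
    rw [Matrix.conjTranspose_mul, hH]
  rw [h2, h1, Matrix.conjTranspose_smul, Matrix.conjTranspose_vecMulVec, hr]
  simp

include hα

lemma IsMetric.normSq_ne_zero : normSq h α ≠ 0 := by
  obtain ⟨r, hr, h0⟩ := hh.normSq_eq α
  rw [hr]
  exact Complex.ofReal_ne_zero.mpr (h0 hα).ne'

lemma IsMetric.vecMul_proj : Matrix.vecMul α (proj h α) = α := by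
  rw [proj_eq, Matrix.vecMul_smul, Matrix.vecMul_vecMulVec, dotProduct_sharp]
  rw [smul_smul, inv_mul_cancel₀ (hh.normSq_ne_zero hα), one_smul]

lemma IsMetric.proj_mul_proj : proj h α * proj h α = proj h α := by
  conv_lhs => enter [1]; rw [proj_eq]
  rw [Matrix.smul_mul, Matrix.vecMulVec_mul, hh.vecMul_proj hα, ← proj_eq]

lemma IsMetric.trace_proj : (proj h α).trace = 1 := by
  rw [proj_eq, Matrix.trace_smul, Matrix.trace_vecMulVec, dotProduct_comm, dotProduct_sharp,
    smul_eq_mul, inv_mul_cancel₀ (hh.normSq_ne_zero hα)]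

lemma IsMetric.unitaryRefl_mul (ζ ξ : ℂ) :
    unitaryRefl h α ζ * unitaryRefl h α ξ = unitaryRefl h α (ζ * ξ) := by
  simp only [unitaryRefl, sub_mul, mul_sub, one_mul, mul_one, Matrix.smul_mul, Matrix.mul_smul,
    hh.proj_mul_proj hα]
  module

omit hh hα in
lemma unitaryRefl_one : unitaryRefl h α 1 = 1 := by simp [unitaryRefl]

lemma IsMetric.unitaryRefl_pow (ζ : ℂ) (k : ℕ) :
    unitaryRefl h α ζ ^ k = unitaryRefl h α (ζ ^ k) := by
  induction k with
  | zero => simp [unitaryRefl]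
  | succ k ih => rw [pow_succ, ih, hh.unitaryRefl_mul hα, pow_succ]

lemma IsMetric.vecMul_unitaryRefl (ζ : ℂ) : Matrix.vecMul α (unitaryRefl h α ζ) = ζ • α := by
  rw [unitaryRefl, Matrix.vecMul_sub, Matrix.vecMul_one, Matrix.vecMul_smul, hh.vecMul_proj hα]
  module

lemma IsMetric.det_unitaryRefl (ζ : ℂ) : (unitaryRefl h α ζ).det = ζ := by
  have h1 : unitaryRefl h α ζ = 1 + Matrix.replicateCol Unit (-((1 - ζ) * (normSq h α)⁻¹) • sharp h α) *
      Matrix.replicateRow Unit α := by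
    rw [unitaryRefl, proj_eq, ← Matrix.vecMulVec_eq, Matrix.smul_vecMulVec, smul_smul, neg_smul,
      sub_eq_add_neg]
  rw [h1, Matrix.det_one_add_replicateCol_mul_replicateRow, dotProduct_smul, dotProduct_sharp,
    smul_eq_mul]
  have := hh.normSq_ne_zero hα
  field_simp
  ring

lemma IsMetric.unitaryRefl_injective {ζ ξ : ℂ} (he : unitaryRefl h α ζ = unitaryRefl h α ξ) :
    ζ = ξ := by
  rw [← hh.det_unitaryRefl hα ζ, he, hh.det_unitaryRefl hα]

lemma IsMetric.unitaryRefl_unitary {ζ : ℂ} (hζ : star ζ * ζ = 1) :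
    (unitaryRefl h α ζ).conjTranspose * h * unitaryRefl h α ζ = h := by
  have h1 : (unitaryRefl h α ζ).conjTranspose * h = h * unitaryRefl h α (star ζ) := by
    simp only [unitaryRefl, Matrix.conjTranspose_sub, Matrix.conjTranspose_one,
      Matrix.conjTranspose_smul, sub_mul, mul_sub, one_mul, mul_one, Matrix.smul_mul,
      Matrix.mul_smul, hh.conjTranspose_proj_mul, star_sub, star_one]
  rw [h1, mul_assoc, hh.unitaryRefl_mul hα, hζ, unitaryRefl_one, mul_one]

/-- A unitary transformation that fixes a hyperplane pointwise is a unitary reflection. -/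
lemma IsMetric.eq_unitaryRefl {x : Matrix (Fin n) (Fin n) ℂ} (hx : x.conjTranspose * h * x = h)
    (hfix : ∀ v, α ⬝ᵥ v = 0 → x.mulVec v = v) : ∃ ζ, x = unitaryRefl h α ζ := by
  have hN := hh.normSq_ne_zero hα
  obtain ⟨o, ho⟩ := exists_ne_of_ne_zero hα
  -- `x - 1` has rank at most one
  obtain ⟨w, hw⟩ : ∃ w, x = 1 + Matrix.vecMulVec w α := by
    refine ⟨fun i => (x - 1) i o / α o, ?_⟩
    have : ∀ i, (x - 1) i = ((x - 1) i o / α o) • α := fun i =>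
      eq_smul_of_ker_le ho fun v hv => by
        have := congrFun (hfix v hv) i
        rw [← sub_eq_zero] at this
        rw [← this]
        change ((x - 1).mulVec v) i = _
        rw [Matrix.sub_mulVec, Matrix.one_mulVec, Pi.sub_apply]
    ext i j
    have := congrFun (this i) j
    simp only [Matrix.sub_apply, Pi.smul_apply, smul_eq_mul] at this
    simp only [Matrix.add_apply, Matrix.vecMulVec_apply, Matrix.sub_apply]
    linear_combination this
  -- apply the unitarity relation to the normal vector
  have h1 : h.mulVec (x.mulVec (sharp h α)) + Matrix.mulVec (Matrix.vecMulVec (star α) (star w))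
      (h.mulVec (x.mulVec (sharp h α))) = star α := by
    have := congrArg (fun M => Matrix.mulVec M (sharp h α)) hx
    simp only [hh.mulVec_sharp, ← Matrix.mulVec_mulVec] at this
    have hc : x.conjTranspose = 1 + Matrix.vecMulVec (star α) (star w) := by
      conv_lhs => rw [hw]
      rw [Matrix.conjTranspose_add, Matrix.conjTranspose_one, Matrix.conjTranspose_vecMulVec]
    rw [hc, Matrix.add_mulVec, Matrix.one_mulVec] at this
    exact this
  -- The conjugate transpose of `x - 1` has its image in the line of `star α`, so unitarity makes
  -- the normal vector `sharp h α` an eigenvector of `x`; its eigenvalue determines `w`.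
  obtain ⟨s, hs⟩ : ∃ s : ℂ, h.mulVec (x.mulVec (sharp h α)) = s • star α := by
    refine ⟨1 - star w ⬝ᵥ h.mulVec (x.mulVec (sharp h α)), ?_⟩
    rw [Matrix.vecMulVec_mulVec] at h1
    ext i
    have := congrFun h1 i
    simp only [Pi.add_apply, Pi.smul_apply, MulOpposite.smul_eq_mul_unop, MulOpposite.unop_op]
      at this
    simp only [Pi.smul_apply, smul_eq_mul]
    linear_combination this
  rw [← hh.mulVec_sharp, ← Matrix.mulVec_smul] at hs
  have hinj := Matrix.mulVec_injective_of_isUnit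
    ((Matrix.isUnit_iff_isUnit_det _).mpr (isUnit_iff_ne_zero.mpr hh.det_ne_zero))
  have hs' := hinj hs
  rw [hw, Matrix.add_mulVec, Matrix.one_mulVec, Matrix.vecMulVec_mulVec, dotProduct_sharp] at hs'
  refine ⟨s, ?_⟩
  have hw' : w = -((1 - s) * (normSq h α)⁻¹) • sharp h α := by
    ext i
    have := congrFun hs' i
    simp at this
    simp only [Pi.smul_apply, smul_eq_mul]
    field_simp
    linear_combination this
  rw [hw, hw', unitaryRefl, proj_eq, Matrix.smul_vecMulVec, smul_smul, neg_smul]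
  abel

lemma IsMetric.unitaryRefl_mulVec_eq_iff {ζ : ℂ} (hζ : ζ ≠ 1) (v : Fin n → ℂ) :
    (unitaryRefl h α ζ).mulVec v = v ↔ α ⬝ᵥ v = 0 := by
  have hN := hh.normSq_ne_zero hα
  constructor
  · intro he
    have : α ⬝ᵥ (unitaryRefl h α ζ).mulVec v = ζ * (α ⬝ᵥ v) := by
      rw [Matrix.dotProduct_mulVec, hh.vecMul_unitaryRefl hα, smul_dotProduct, smul_eq_mul]
    rw [he] at this
    have h2 : (1 - ζ) * (α ⬝ᵥ v) = 0 := by linear_combination this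
    exact (mul_eq_zero.mp h2).resolve_left (sub_ne_zero.mpr hζ.symm)
  · intro h0
    rw [unitaryRefl, proj_eq, Matrix.sub_mulVec, Matrix.one_mulVec, Matrix.smul_mulVec,
      Matrix.smul_mulVec, Matrix.vecMulVec_mulVec, h0]
    simp

lemma IsMetric.proj_smul {c : ℂ} (hc : c ≠ 0) : proj h (c • α) = proj h α := by
  have hN := hh.normSq_ne_zero hα
  have h1 : normSq h (c • α) = c * star c * normSq h α := by
    simp only [normSq, Pi.smul_apply, smul_eq_mul, star_mul', Finset.mul_sum]
    exact Finset.sum_congr rfl fun _ _ => Finset.sum_congr rfl fun _ _ => by ring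
  have h2 : sharp h (c • α) = star c • sharp h α := by
    ext i
    simp only [sharp, Pi.smul_apply, smul_eq_mul, star_mul', Finset.mul_sum]
    exact Finset.sum_congr rfl fun _ _ => by ring
  have hc' : star c ≠ 0 := star_ne_zero.mpr hc
  rw [proj_eq, proj_eq, h1, h2]
  ext i k
  simp only [Matrix.smul_apply, Matrix.vecMulVec_apply, Pi.smul_apply, smul_eq_mul]
  field_simp

end

end Unitary

/-! ## Hyperplanes and covectors -/

section Forms

variable {n : ℕ}

/-- `α` is a covector with kernel `H`. -/
def IsForm (α : Fin n → ℂ) (H : Submodule ℂ (Fin n → ℂ)) : Prop := ∀ v, v ∈ H ↔ α ⬝ᵥ v = 0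

/-- The kernel of a covector. -/
def kerForm (α : Fin n → ℂ) : Submodule ℂ (Fin n → ℂ) := LinearMap.ker (dotProductBilin ℂ ℂ α)

lemma isForm_kerForm (α : Fin n → ℂ) : IsForm α (kerForm α) := fun v => by
  simp [kerForm]

lemma finrank_of_isForm {α : Fin n → ℂ} {H : Submodule ℂ (Fin n → ℂ)} (hα : α ≠ 0)
    (h : IsForm α H) : Module.finrank ℂ H + 1 = n := by
  have hH : H = LinearMap.ker (dotProductBilin ℂ ℂ α) := by
    ext v
    simp [h v]
  obtain ⟨o, ho⟩ := exists_ne_of_ne_zero hα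
  have hs : LinearMap.range (dotProductBilin ℂ ℂ α) = ⊤ := by
    rw [LinearMap.range_eq_top]
    intro c
    refine ⟨Pi.single o (c / α o), ?_⟩
    simp
    field_simp
  have := LinearMap.finrank_range_add_finrank_ker (dotProductBilin ℂ ℂ α)
  rw [hs, finrank_top, Module.finrank_self, Module.finrank_fin_fun] at this
  rw [hH, add_comm]
  exact this

lemma IsForm.ne_zero {α : Fin n → ℂ} {H : Submodule ℂ (Fin n → ℂ)} (h : IsForm α H)
    (hH : Module.finrank ℂ H + 1 = n) : α ≠ 0 := by
  rintro rfl
  have : H = ⊤ := by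
    ext v
    simp [h v]
  rw [this, finrank_top, Module.finrank_fin_fun] at hH
  omega

lemma exists_isForm {H : Submodule ℂ (Fin n → ℂ)} (hH : Module.finrank ℂ H + 1 = n) :
    ∃ α, α ≠ 0 ∧ IsForm α H := by
  have hlt : H < ⊤ := by
    rw [lt_top_iff_ne_top]
    rintro rfl
    rw [finrank_top, Module.finrank_fin_fun] at hH
    omega
  obtain ⟨f, hf, hle⟩ := Submodule.exists_le_ker_of_lt_top H hlt
  let α : Fin n → ℂ := fun i => f (Pi.single i 1)
  have hfα : ∀ v, f v = α ⬝ᵥ v := by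
    intro v
    conv_lhs => rw [← Finset.univ_sum_single v, map_sum]
    refine Finset.sum_congr rfl fun i _ => ?_
    have : Pi.single i (v i) = v i • Pi.single i (1 : ℂ) := by
      rw [← Pi.single_smul, smul_eq_mul, mul_one]
    rw [this, map_smul, smul_eq_mul, mul_comm]
  have hα : α ≠ 0 := by
    intro h0
    apply hf
    ext v
    simp [hfα, h0]
  have hk := isForm_kerForm α
  have hHk : H = kerForm α := by
    apply Submodule.eq_of_le_of_finrank_eq
    · intro v hv
      have := hle hv
      rw [LinearMap.mem_ker, hfα] at this
      exact (hk v).mpr this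
    · have := finrank_of_isForm hα hk
      omega
  exact ⟨α, hα, hHk ▸ hk⟩

lemma IsForm.eq {α : Fin n → ℂ} {H H' : Submodule ℂ (Fin n → ℂ)} (h : IsForm α H)
    (h' : IsForm α H') : H = H' := by
  ext v
  rw [h v, h' v]

end Forms

/-! ### Mirrors of the group and factorization of the Jacobian determinant. -/

namespace GroupData

variable {D : GroupData}

/-- The elementary properties of the data: invariance of the coordinates under the generators,
homogeneity and independence. -/
structure Basic (D : GroupData) : Prop where
  metric : IsMetric D.h
  gens : ∀ a ∈ D.gens, a.1 ≠ 0 ∧ 2 ≤ a.2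
  inv : ∀ a ∈ D.gens, ∀ l, subst (reflection D.h a.1 a.2) (D.u l) = D.u l
  hom : ∀ l, (D.u l).IsHomogeneous (D.deg l)
  two_le : ∀ l, 2 ≤ D.deg l
  jac_ne : D.jac.det ≠ 0

lemma reflection_eq {n : ℕ} (h : Matrix (Fin n) (Fin n) ℂ) (α : Fin n → ℂ) (m : ℕ) :
    reflection h α m = unitaryRefl h α (Complex.exp (2 * Real.pi * Complex.I / m)) := rfl

lemma star_mul_self_of_isPrimitiveRoot {ζ : ℂ} {m : ℕ} (hm : m ≠ 0) (h : IsPrimitiveRoot ζ m) :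
    star ζ * ζ = 1 := by
  have h1 : ‖ζ‖ = 1 := h.norm'_eq_one hm
  rw [Complex.star_def, mul_comm, Complex.mul_conj, Complex.normSq_eq_norm_sq, h1]
  simp

namespace Basic

variable (hD : D.Basic)
include hD

lemma exists_gen {a} (ha : a ∈ D.gens) : ∃ s ∈ D.group, ∃ ζ : ℂ, IsPrimitiveRoot ζ a.2 ∧
    (s : Matrix (Fin D.n) (Fin D.n) ℂ) = unitaryRefl D.h a.1 ζ := by
  obtain ⟨h0, h2⟩ := hD.gens a ha
  have hp := Complex.isPrimitiveRoot_exp a.2 (by omega)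
  have hdet : (reflection D.h a.1 a.2).det ≠ 0 := by
    rw [reflection_eq, hD.metric.det_unitaryRefl h0]
    exact hp.ne_zero (by omega)
  refine ⟨Matrix.GeneralLinearGroup.mkOfDetNeZero _ hdet, Subgroup.subset_closure ⟨a, ha, rfl⟩,
    _, hp, rfl⟩

lemma unitary {x} (hx : x ∈ D.group) :
    (x : Matrix (Fin D.n) (Fin D.n) ℂ).conjTranspose * D.h * x = D.h := by
  induction hx using Subgroup.closure_induction with
  | mem x hx =>
    obtain ⟨a, ha, hx⟩ := hx
    obtain ⟨h0, h2⟩ := hD.gens a ha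
    rw [hx, reflection_eq]
    exact hD.metric.unitaryRefl_unitary h0 (star_mul_self_of_isPrimitiveRoot (by omega)
      (Complex.isPrimitiveRoot_exp a.2 (by omega)))
  | one => simp
  | mul x y _ _ hx hy =>
    rw [Units.val_mul, Matrix.conjTranspose_mul]
    calc _ = (y : Matrix (Fin D.n) (Fin D.n) ℂ).conjTranspose *
          ((x : Matrix (Fin D.n) (Fin D.n) ℂ).conjTranspose * D.h * x) * y := by
          simp only [mul_assoc]
      _ = D.h := by rw [hx, hy]
  | inv x _ hx =>
    have h1 : (x : Matrix (Fin D.n) (Fin D.n) ℂ) * (x⁻¹ : Matrix.GeneralLinearGroup _ ℂ) = 1 := by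
      rw [← Units.val_mul, mul_inv_cancel, Units.val_one]
    have h2 := congrArg Matrix.conjTranspose h1
    rw [Matrix.conjTranspose_mul, Matrix.conjTranspose_one] at h2
    conv_lhs => rw [← hx]
    calc _ = ((x⁻¹ : Matrix.GeneralLinearGroup _ ℂ) : Matrix (Fin D.n) (Fin D.n) ℂ).conjTranspose
          * (x : Matrix (Fin D.n) (Fin D.n) ℂ).conjTranspose * D.h *
          ((x : Matrix (Fin D.n) (Fin D.n) ℂ) * (x⁻¹ : Matrix.GeneralLinearGroup _ ℂ)) := by
          simp only [mul_assoc]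
      _ = D.h := by rw [h2, h1, one_mul, mul_one]

lemma subst_u {x} (hx : x ∈ D.group) (l : Fin D.n) :
    subst (x : Matrix (Fin D.n) (Fin D.n) ℂ) (D.u l) = D.u l := by
  induction hx using Subgroup.closure_induction with
  | mem x hx =>
    obtain ⟨a, ha, hx⟩ := hx
    rw [hx, hD.inv a ha]
  | one => simp [subst_one]
  | mul x y _ _ hx hy => rw [Units.val_mul, ← subst_subst, hx, hy]
  | inv x _ hx =>
    conv_lhs => rw [← hx]
    rw [subst_subst, ← Units.val_mul, mul_inv_cancel, Units.val_one, subst_one]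

lemma subst_det {x} (hx : x ∈ D.group) :
    subst (x : Matrix (Fin D.n) (Fin D.n) ℂ) D.jac.det *
      C (x : Matrix (Fin D.n) (Fin D.n) ℂ).det = D.jac.det := by
  have := det_jacOf_subst (x : Matrix (Fin D.n) (Fin D.n) ℂ) D.u
  simp only [hD.subst_u hx] at this
  exact this.symm

/-- The eigenvalue of an element with mirror `ker α` is constrained by the order of vanishing of
the Jacobian determinant. -/
lemma pow_eq_one {α : Fin D.n → ℂ} (hα : α ≠ 0) {x} (hx : x ∈ D.group) {ζ : ℂ}
    (hxζ : (x : Matrix (Fin D.n) (Fin D.n) ℂ) = unitaryRefl D.h α ζ) {m : ℕ}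
    {q : MvPolynomial (Fin D.n) ℂ} (hq : D.jac.det = lin α ^ m * q) (hnd : ¬ lin α ∣ q) :
    ζ ^ (m + 1) = 1 := by
  have h1 := hD.subst_det hx
  rw [hxζ, hD.metric.det_unitaryRefl hα, hq, map_mul, map_pow, subst_lin,
    hD.metric.vecMul_unitaryRefl hα, lin_smul] at h1
  -- The reflection multiplies `lin α` by `ζ`, and its determinant contributes one more factor `ζ`;
  -- then `lin α ^ m` is cancelled.
  have h2 : C (ζ ^ (m + 1)) * subst (unitaryRefl D.h α ζ) q = q := by
    apply mul_left_cancel₀ (pow_ne_zero m (lin_ne_zero hα))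
    rw [← h1, map_pow]
    ring
  -- The relation is evaluated at a point of the mirror where `q` does not vanish; such a point is
  -- fixed by the reflection.
  rw [lin_dvd_iff hα] at hnd
  push Not at hnd
  obtain ⟨p, hp, hqp⟩ := hnd
  have h3 := congrArg (eval p) h2
  have hfix : (unitaryRefl D.h α ζ).mulVec p = p := by
    by_cases hζ : ζ = 1
    · rw [hζ, unitaryRefl_one, Matrix.one_mulVec]
    · exact (hD.metric.unitaryRefl_mulVec_eq_iff hα hζ p).mpr hp
  rw [map_mul, eval_subst, hfix, eval_C] at h3
  exact mul_right_cancel₀ hqp (by rw [h3, one_mul])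

lemma exists_eq_unitaryRefl {α : Fin D.n → ℂ} (hα : α ≠ 0) {x} (hx : x ∈ D.group)
    (hfix : ∀ v, α ⬝ᵥ v = 0 → (x : Matrix (Fin D.n) (Fin D.n) ℂ).mulVec v = v) :
    ∃ ζ, (x : Matrix (Fin D.n) (Fin D.n) ℂ) = unitaryRefl D.h α ζ :=
  hD.metric.eq_unitaryRefl hα (hD.unitary hx) hfix

lemma exists_multiplicity {α : Fin D.n → ℂ} (hα : α ≠ 0) :
    ∃ (m : ℕ) (q : MvPolynomial (Fin D.n) ℂ), D.jac.det = lin α ^ m * q ∧ ¬ lin α ∣ q := by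
  have hf : FiniteMultiplicity (lin α) D.jac.det :=
    FiniteMultiplicity.of_not_isUnit (prime_lin hα).not_isUnit hD.jac_ne
  obtain ⟨q, hq, hnd⟩ := hf.exists_eq_pow_mul_and_not_dvd
  exact ⟨_, q, hq, hnd⟩

omit hD in
lemma orderOf_eq (h : IsMetric D.h) {α : Fin D.n → ℂ} (hα : α ≠ 0)
    {x : Matrix.GeneralLinearGroup (Fin D.n) ℂ} {ζ : ℂ}
    (hxζ : (x : Matrix (Fin D.n) (Fin D.n) ℂ) = unitaryRefl D.h α ζ) : orderOf x = orderOf ζ := by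
  rw [orderOf_eq_orderOf_iff]
  intro k
  rw [← Units.val_inj, Units.val_pow_eq_pow_val, hxζ, h.unitaryRefl_pow hα, Units.val_one]
  constructor
  · intro he
    exact h.unitaryRefl_injective hα (he.trans unitaryRefl_one.symm)
  · intro he
    rw [he, unitaryRefl_one]

omit hD in
lemma mem_fixedSpace {n : ℕ} (x : Matrix.GeneralLinearGroup (Fin n) ℂ) (v : Fin n → ℂ) :
    v ∈ fixedSpace x ↔ (x : Matrix (Fin n) (Fin n) ℂ).mulVec v = v := by
  simp [fixedSpace, sub_eq_zero]

end Basic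

/-- `H` is the image of the mirror of the generator `a` under the group. -/
def InOrbit (D : GroupData) (a : (Fin D.n → ℂ) × ℕ) (H : Submodule ℂ (Fin D.n → ℂ)) : Prop :=
  ∃ x ∈ D.group, ∀ v, (x : Matrix (Fin D.n) (Fin D.n) ℂ).mulVec v ∈ H ↔ a.1 ⬝ᵥ v = 0

/-- A family of distinct mirrors in the orbits of the mirrors of the generators, complete by the
degree of the Jacobian determinant. -/
structure MirrorFamily (D : GroupData) (ι : Type) [Fintype ι] where
  /-- the mirrors -/
  mir : ι → Submodule ℂ (Fin D.n → ℂ)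
  /-- a generator in the orbit of which the mirror lies -/
  gen : ι → (Fin D.n → ℂ) × ℕ
  gen_mem : ∀ i, gen i ∈ D.gens
  inOrbit : ∀ i, InOrbit D (gen i) (mir i)
  inj : Function.Injective mir
  sum_eq : ∑ i, ((gen i).2 - 1) = ∑ l, (D.deg l - 1)

namespace Basic

variable (hD : D.Basic)
include hD

/-- The required element is the conjugate of the generating reflection by the element that carries
its mirror to `H`. -/
lemma mirror_of_inOrbit {a} (ha : a ∈ D.gens) {H} (hH : InOrbit D a H) :
    ∃ y ∈ D.group, fixedSpace y = H ∧ orderOf y = a.2 ∧ ∃ α, α ≠ 0 ∧ IsForm α H := by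
  obtain ⟨h0, h2⟩ := hD.gens a ha
  obtain ⟨s, hs, ζ, hζ, hsζ⟩ := hD.exists_gen ha
  obtain ⟨x, hx, hxH⟩ := hH
  have hζ1 : ζ ≠ 1 := hζ.ne_one (by omega)
  have hxx : (x : Matrix (Fin D.n) (Fin D.n) ℂ) * (x⁻¹ : Matrix.GeneralLinearGroup _ ℂ) = 1 := by
    rw [← Units.val_mul, mul_inv_cancel, Units.val_one]
  have hxx' : ((x⁻¹ : Matrix.GeneralLinearGroup _ ℂ) : Matrix (Fin D.n) (Fin D.n) ℂ) * x = 1 := by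
    rw [← Units.val_mul, inv_mul_cancel, Units.val_one]
  have hH : ∀ v, v ∈ H ↔ a.1 ⬝ᵥ ((x⁻¹ : Matrix.GeneralLinearGroup _ ℂ) :
      Matrix (Fin D.n) (Fin D.n) ℂ).mulVec v = 0 := by
    intro v
    rw [← hxH, Matrix.mulVec_mulVec, hxx, Matrix.one_mulVec]
  refine ⟨x * s * x⁻¹, mul_mem (mul_mem hx hs) (inv_mem hx), ?_, ?_, ?_⟩
  · ext v
    rw [mem_fixedSpace, hH, ← hD.metric.unitaryRefl_mulVec_eq_iff h0 hζ1, ← hsζ]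
    simp only [Units.val_mul, ← Matrix.mulVec_mulVec]
    constructor
    · intro h
      have := congrArg ((x⁻¹ : Matrix.GeneralLinearGroup _ ℂ) :
        Matrix (Fin D.n) (Fin D.n) ℂ).mulVec h
      rwa [Matrix.mulVec_mulVec, hxx', Matrix.one_mulVec] at this
    · intro h
      rw [h, Matrix.mulVec_mulVec, hxx, Matrix.one_mulVec]
  · have : orderOf (x * s * x⁻¹) = orderOf s := by
      rw [orderOf_eq_orderOf_iff]
      intro k
      rw [conj_pow]
      exact conj_eq_one_iff
    rw [this, orderOf_eq hD.metric h0 hsζ, ← hζ.eq_orderOf]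
  · refine ⟨Matrix.vecMul a.1 ((x⁻¹ : Matrix.GeneralLinearGroup _ ℂ) :
      Matrix (Fin D.n) (Fin D.n) ℂ), ?_, ?_⟩
    · intro h
      apply h0
      have := congrArg (fun w => Matrix.vecMul w (x : Matrix (Fin D.n) (Fin D.n) ℂ)) h
      simpa [Matrix.vecMul_vecMul, hxx'] using this
    · intro v
      rw [hH, Matrix.dotProduct_mulVec]

variable {ι : Type} [Fintype ι] (F : MirrorFamily D ι)

lemma mir_mem (i : ι) : F.mir i ∈ D.mirrors := by
  obtain ⟨y, hy, hf, -, α, hα, hH⟩ := hD.mirror_of_inOrbit (F.gen_mem i) (F.inOrbit i)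
  exact ⟨finrank_of_isForm hα hH, y, hy, hf⟩

lemma exists_reflection {i : ι} {α : Fin D.n → ℂ} (hα : α ≠ 0) (hH : IsForm α (F.mir i)) :
    ∃ y ∈ D.group, fixedSpace y = F.mir i ∧ orderOf y = (F.gen i).2 ∧
      ∃ ζ, IsPrimitiveRoot ζ (F.gen i).2 ∧
        (y : Matrix (Fin D.n) (Fin D.n) ℂ) = unitaryRefl D.h α ζ := by
  obtain ⟨y, hy, hf, ho, -⟩ := hD.mirror_of_inOrbit (F.gen_mem i) (F.inOrbit i)
  obtain ⟨ζ, hζ⟩ := hD.exists_eq_unitaryRefl hα hy fun v hv => by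
    rw [← mem_fixedSpace, hf, hH]
    exact hv
  refine ⟨y, hy, hf, ho, ζ, ?_, hζ⟩
  rw [IsPrimitiveRoot.iff_orderOf, ← ho, orderOf_eq hD.metric hα hζ]

lemma two_le_order (i : ι) : 2 ≤ (F.gen i).2 := (hD.gens _ (F.gen_mem i)).2

omit hD in
lemma isRelPrime_lin {α : ι → Fin D.n → ℂ} (hα : ∀ i, α i ≠ 0)
    (hH : ∀ i, IsForm (α i) (F.mir i)) {i j : ι} (hij : i ≠ j) (a b : ℕ) :
    IsRelPrime (lin (α i) ^ a) (lin (α j) ^ b) := by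
  apply IsRelPrime.pow
  rw [(prime_lin (hα i)).irreducible.isRelPrime_iff_not_dvd]
  intro h
  obtain ⟨c, hc, he⟩ := exists_smul_of_ker_eq (hα i) (hα j) (lin_dvd_lin (hα i) h)
  apply hij
  apply F.inj
  apply (hH i).eq
  intro v
  rw [hH j, he, smul_dotProduct, smul_eq_mul]
  simp [hc]

/-- The factorization of the Jacobian determinant. -/
lemma det_eq {α : ι → Fin D.n → ℂ} (hα : ∀ i, α i ≠ 0) (hH : ∀ i, IsForm (α i) (F.mir i)) :
    ∃ a : ℂ, a ≠ 0 ∧ D.jac.det = C a * ∏ i, lin (α i) ^ ((F.gen i).2 - 1) := by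
  classical
  have hdvd : ∏ i, lin (α i) ^ ((F.gen i).2 - 1) ∣ D.jac.det := by
    refine Fintype.prod_dvd_of_isRelPrime (fun i j hij => isRelPrime_lin F hα hH hij _ _) ?_
    intro i
    obtain ⟨y, hy, -, -, ζ, hζ, hyζ⟩ := hD.exists_reflection F (hα i) (hH i)
    obtain ⟨m, q, hq, hnd⟩ := hD.exists_multiplicity (hα i)
    -- The order of the primitive root `ζ` divides `m + 1`, so the multiplicity `m` is at least the
    -- order minus one.
    have := hζ.dvd_of_pow_eq_one _ (hD.pow_eq_one (hα i) hy hyζ hq hnd)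
    have hle := Nat.le_of_dvd (Nat.succ_pos m) this
    rw [hq]
    exact (pow_dvd_pow _ (by omega)).mul_right _
  obtain ⟨q, hq⟩ := hdvd
  have hhomD : D.jac.det.IsHomogeneous (∑ l, (D.deg l - 1)) :=
    isHomogeneous_det fun l j => (hD.hom l).pderiv
  have hhomP : (∏ i, lin (α i) ^ ((F.gen i).2 - 1)).IsHomogeneous (∑ l, (D.deg l - 1)) := by
    rw [← F.sum_eq]
    refine IsHomogeneous.prod _ _ _ fun i _ => ?_
    simpa using (isHomogeneous_lin (α i)).pow ((F.gen i).2 - 1)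
  have hne : ∏ i, lin (α i) ^ ((F.gen i).2 - 1) ≠ 0 :=
    Finset.prod_ne_zero_iff.mpr fun i _ => pow_ne_zero _ (lin_ne_zero (hα i))
  have hq0 : q ≠ 0 := by
    rintro rfl
    exact hD.jac_ne (by rw [hq, mul_zero])
  -- By `F.sum_eq` the product already has the degree of the Jacobian determinant, so the remaining
  -- factor is a constant.
  have hdeg : q.totalDegree = 0 := by
    have h1 := hhomD.totalDegree hD.jac_ne
    rw [hq, totalDegree_mul_of_isDomain hne hq0, hhomP.totalDegree hne] at h1
    omega
  rw [totalDegree_eq_zero_iff_eq_C] at hdeg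
  refine ⟨coeff 0 q, ?_, ?_⟩
  · intro h0
    apply hq0
    rw [hdeg, h0, map_zero]
  · rw [hq, ← hdeg, mul_comm]

lemma exists_form_family : ∃ α : ι → Fin D.n → ℂ, (∀ i, α i ≠ 0) ∧
    ∀ i, IsForm (α i) (F.mir i) := by
  choose α hα hH using fun i => exists_isForm (hD.mir_mem F i).1
  exact ⟨α, hα, hH⟩

/-- The family contains all mirrors. -/
lemma mirrors_eq : D.mirrors = Set.range F.mir := by
  apply Set.Subset.antisymm
  · rintro H ⟨hfin, x, hx, hxH⟩
    obtain ⟨β, hβ, hβH⟩ := exists_isForm hfin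
    obtain ⟨ζ, hζ⟩ := hD.exists_eq_unitaryRefl hβ hx fun v hv => by
      rw [← mem_fixedSpace, hxH, hβH]
      exact hv
    have hζ1 : ζ ≠ 1 := by
      rintro rfl
      rw [unitaryRefl_one] at hζ
      have : H = ⊤ := by
        rw [← hxH]
        ext v
        simp [mem_fixedSpace, hζ]
      rw [this, finrank_top, Module.finrank_fin_fun] at hfin
      omega
    -- A non-trivial eigenvalue excludes multiplicity zero. Hence `lin β` divides the Jacobian
    -- determinant and, by the factorization, is proportional to a form of the family.
    obtain ⟨m, q, hq, hnd⟩ := hD.exists_multiplicity hβ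
    have hm := hD.pow_eq_one hβ hx hζ hq hnd
    have hm0 : m ≠ 0 := by
      rintro rfl
      exact hζ1 (by simpa using hm)
    have hdvd : lin β ∣ D.jac.det := by
      rw [hq]
      exact (dvd_pow_self _ hm0).mul_right _
    obtain ⟨α, hα, hH⟩ := hD.exists_form_family F
    obtain ⟨a, ha, he⟩ := hD.det_eq F hα hH
    rw [he] at hdvd
    rcases (prime_lin hβ).dvd_or_dvd hdvd with h | h
    · exact absurd (isUnit_of_dvd_unit h ((isUnit_iff_ne_zero.mpr ha).map C))
        (prime_lin hβ).not_isUnit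
    · obtain ⟨i, -, hi⟩ := (prime_lin hβ).exists_mem_finset_dvd h
      have hi := (prime_lin hβ).dvd_of_dvd_pow hi
      obtain ⟨c, hc, hce⟩ := exists_smul_of_ker_eq hβ (hα i) (lin_dvd_lin hβ hi)
      refine ⟨i, (hH i).eq fun v => ?_⟩
      rw [hβH, hce, smul_dotProduct, smul_eq_mul]
      simp [hc]
  · rintro _ ⟨i, rfl⟩
    exact hD.mir_mem F i

/-- The order of the pointwise stabilizer of a mirror. -/
lemma kappa_eq (i : ι) : D.kappa (F.mir i) = (F.gen i).2 := by
  classical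
  obtain ⟨α, hα, hH⟩ := hD.exists_form_family F
  obtain ⟨y, hy, hf, ho, ζ, hζ, hyζ⟩ := hD.exists_reflection F (hα i) (hH i)
  obtain ⟨a, ha, he⟩ := hD.det_eq F hα hH
  have h2 := hD.two_le_order F i
  have hset : {x : Matrix.GeneralLinearGroup (Fin D.n) ℂ | x ∈ D.group ∧ ∀ v ∈ F.mir i,
      (x : Matrix (Fin D.n) (Fin D.n) ℂ).mulVec v = v} = Subgroup.zpowers y := by
    ext x
    simp only [Set.mem_ofPred_eq, SetLike.mem_coe]
    constructor
    · rintro ⟨hx, hfix⟩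
      obtain ⟨ξ, hξ⟩ := hD.exists_eq_unitaryRefl (hα i) hx fun v hv => hfix v ((hH i v).mpr hv)
      -- The exact multiplicity of `lin (α i)` is the order minus one. By `pow_eq_one` every
      -- eigenvalue `ξ` that occurs is therefore a root of unity of this order, hence a power of
      -- `ζ`.
      rw [← Finset.mul_prod_erase _ _ (Finset.mem_univ i), mul_left_comm] at he
      have hnd : ¬ lin (α i) ∣ C a * ∏ j ∈ Finset.univ.erase i, lin (α j) ^ ((F.gen j).2 - 1) := by
        intro h
        rcases (prime_lin (hα i)).dvd_or_dvd h with h | h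
        · exact absurd (isUnit_of_dvd_unit h ((isUnit_iff_ne_zero.mpr ha).map C))
            (prime_lin (hα i)).not_isUnit
        · obtain ⟨j, hj, hj'⟩ := (prime_lin (hα i)).exists_mem_finset_dvd h
          have hr := isRelPrime_lin F hα hH (Finset.ne_of_mem_erase hj).symm 1
            ((F.gen j).2 - 1)
          rw [pow_one, (prime_lin (hα i)).irreducible.isRelPrime_iff_not_dvd] at hr
          exact hr hj'
      have h1 := hD.pow_eq_one (hα i) hx hξ he hnd
      rw [Nat.sub_add_cancel (by omega)] at h1
      have : NeZero (F.gen i).2 := ⟨by omega⟩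
      obtain ⟨k, -, hk⟩ := hζ.eq_pow_of_pow_eq_one h1
      refine ⟨k, ?_⟩
      rw [← Units.val_inj]
      simp only [zpow_natCast, Units.val_pow_eq_pow_val]
      rw [hyζ, hD.metric.unitaryRefl_pow (hα i), hk, hξ]
    · intro hx
      refine ⟨(Subgroup.zpowers_le.mpr hy) hx, ?_⟩
      obtain ⟨k, rfl⟩ := Subgroup.mem_zpowers_iff.mp hx
      intro v hv
      rw [← hf, mem_fixedSpace] at hv
      let S : Subgroup (Matrix.GeneralLinearGroup (Fin D.n) ℂ) :=
        MulAction.stabilizer _ v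
      have : y ∈ S := hv
      exact zpow_mem this k
  have : D.kappa (F.mir i) = Nat.card (Subgroup.zpowers y) := by
    change Nat.card {x : Matrix.GeneralLinearGroup (Fin D.n) ℂ | x ∈ D.group ∧ ∀ v ∈ F.mir i,
      (x : Matrix (Fin D.n) (Fin D.n) ℂ).mulVec v = v} = _
    rw [hset]
    rfl
  rw [this, Nat.card_zpowers, ho]

end Basic

end GroupData

/-! ## The dual product as a polynomial tensor -/

section Local

variable {n : ℕ}

/-- The numerator of the dual product: `∑_l (1/(d_l - 1)) ∂_j ∂_k v^l adj(∂v)^i_l`. -/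
def ptensor (d : Fin n → ℕ) (v : Fin n → MvPolynomial (Fin n) ℂ) (i j k : Fin n) :
    MvPolynomial (Fin n) ℂ :=
  ∑ l, C (1 / ((d l : ℂ) - 1)) * pderiv j (pderiv k (v l)) * (jacOf v).adjugate i l

lemma pderiv_comm' (i j : Fin n) (f : MvPolynomial (Fin n) ℂ) :
    pderiv i (pderiv j f) = pderiv j (pderiv i f) := by
  induction f using MvPolynomial.induction_on with
  | C a => simp
  | add f f' h h' => simp [h, h']
  | mul_X f k h =>
    simp only [Derivation.leibniz, smul_eq_mul, map_add, h, pderiv_X]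
    have h0 : ∀ a b : Fin n, pderiv a ((Pi.single b 1 : Fin n → MvPolynomial (Fin n) ℂ) k) = 0 := by
      intro a b
      by_cases hb : k = b
      · subst hb; simp
      · simp [hb]
    rw [h0, h0]
    ring

/-- Second derivatives along a linear substitution transform without correction terms, and the
adjugate of `g` is `g.det • g'`. The numerator is thus a tensor of type (1,2), twisted by the
determinant. -/
lemma ptensor_subst (d : Fin n → ℕ) (v : Fin n → MvPolynomial (Fin n) ℂ)
    {g g' : Matrix (Fin n) (Fin n) ℂ} (hg : g * g' = 1) (a b c : Fin n) :
    ptensor d (fun l => subst g (v l)) a b c = C g.det * ∑ i, ∑ j, ∑ k,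
      C (g' a i * g j b * g k c) * subst g (ptensor d v i j k) := by
  have hadj : g.adjugate = g.det • g' := by
    have h1 : g.adjugate * (g * g') = g.adjugate := by rw [hg, mul_one]
    rw [← h1, ← mul_assoc, Matrix.adjugate_mul, Matrix.smul_mul, one_mul]
  have h2 : ∀ l, pderiv b (pderiv c (subst g (v l))) =
      ∑ j, ∑ k, C (g j b * g k c) * subst g (pderiv j (pderiv k (v l))) := by
    intro l
    rw [pderiv_subst, map_sum, Finset.sum_comm]
    refine Finset.sum_congr rfl fun k _ => ?_
    rw [pderiv_C_mul, pderiv_subst, Finset.mul_sum]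
    exact Finset.sum_congr rfl fun j _ => by rw [C_mul]; ring
  have h3 : ∀ l, (jacOf fun l => subst g (v l)).adjugate a l =
      C g.det * ∑ i, C (g' a i) * subst g ((jacOf v).adjugate i l) := by
    intro l
    have e1 : (g.map C).adjugate = (g.adjugate).map (C : ℂ →+* MvPolynomial (Fin n) ℂ) :=
      (RingHom.map_adjugate C g).symm
    have e2 : ((jacOf v).map (subst g)).adjugate = (jacOf v).adjugate.map (subst g) :=
      (AlgHom.map_adjugate (subst g) (jacOf v)).symm
    rw [jacOf_subst, Matrix.adjugate_mul_distrib, e1, e2, hadj, Matrix.mul_apply, Finset.mul_sum]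
    exact Finset.sum_congr rfl fun i _ => by simp [mul_assoc]
  simp only [ptensor, h2, h3, map_sum, map_mul, subst_C, Finset.mul_sum, Finset.sum_mul]
  rw [Finset.sum_comm]
  refine (Finset.sum_congr rfl fun i _ => Finset.sum_comm).trans ?_
  refine Finset.sum_congr rfl fun i _ => Finset.sum_congr rfl fun j _ => ?_
  rw [Finset.sum_comm]
  exact Finset.sum_congr rfl fun k _ => Finset.sum_congr rfl fun l _ => by ring

/-- The polynomials whose derivative in the direction `o` is divisible by `X_o ^ m`. -/
def flatAlong (o : Fin n) (m : ℕ) : Subring (MvPolynomial (Fin n) ℂ) where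
  carrier := {f | X o ^ m ∣ pderiv o f}
  mul_mem' := fun {a b} ha hb => by
    change X o ^ m ∣ pderiv o (a * b)
    rw [Derivation.leibniz, smul_eq_mul, smul_eq_mul]
    exact dvd_add (Dvd.dvd.mul_left hb _) (Dvd.dvd.mul_left ha _)
  one_mem' := by simp
  add_mem' := fun {a b} ha hb => by
    change X o ^ m ∣ pderiv o (a + b)
    rw [map_add]
    exact dvd_add ha hb
  zero_mem' := by simp
  neg_mem' := fun {a} ha => by
    change X o ^ m ∣ pderiv o (-a)
    rw [map_neg]
    exact (dvd_neg).mpr ha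

lemma mem_flatAlong {o : Fin n} {m : ℕ} {f : MvPolynomial (Fin n) ℂ} :
    f ∈ flatAlong o m ↔ X o ^ m ∣ pderiv o f := Iff.rfl

lemma det_mem_subring {R : Type*} [CommRing R] (S : Subring R) {k : ℕ} {M : Matrix (Fin k) (Fin k) R}
    (h : ∀ i j, M i j ∈ S) : M.det ∈ S := by
  rw [Matrix.det_apply]
  refine sum_mem fun σ _ => ?_
  rw [Units.smul_def]
  exact zsmul_mem (prod_mem fun i _ => h _ _) _

/-- If f = X_o^(k+1) q with k < m, then ∂_o f equals (k+1) X_o^k q modulo X_o^(k+1). Since k + 1 is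
invertible, the divisibility of ∂_o f by X_o^(k+1) forces X_o to divide q. -/
lemma X_pow_dvd_of_flatAlong {o : Fin n} {m : ℕ} {f : MvPolynomial (Fin n) ℂ}
    (hf : f ∈ flatAlong o m) (h0 : X o ∣ f) : X o ^ (m + 1) ∣ f := by
  suffices ∀ k ≤ m, X o ^ (k + 1) ∣ f from this m le_rfl
  intro k hk
  induction k with
  | zero => simpa using h0
  | succ k ih =>
    obtain ⟨q, rfl⟩ := ih (by omega)
    have h1 : X o ^ (k + 1) ∣ pderiv o (X o ^ (k + 1) * q) := (pow_dvd_pow _ hk).trans hf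
    rw [Derivation.leibniz, smul_eq_mul, smul_eq_mul, Derivation.leibniz_pow, pderiv_X_self,
      dvd_add_right (dvd_mul_right _ _)] at h1
    have h2 : (X o : MvPolynomial (Fin n) ℂ) ^ k * X o ∣ X o ^ k * (C ((k : ℂ) + 1) * q) := by
      have he : q * ((k + 1) • (X o : MvPolynomial (Fin n) ℂ) ^ (k + 1 - 1) • 1) =
          X o ^ k * (C ((k : ℂ) + 1) * q) := by
        simp only [add_tsub_cancel_right, smul_eq_mul, mul_one, nsmul_eq_mul, map_add, map_natCast,
          map_one]
        push_cast
        ring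
      rwa [he, pow_succ] at h1
    rw [mul_dvd_mul_iff_left (pow_ne_zero _ (X_ne_zero (R := ℂ) o))] at h2
    have hu : IsUnit (C ((k : ℂ) + 1) : MvPolynomial (Fin n) ℂ) :=
      (isUnit_iff_ne_zero.mpr (by exact_mod_cast Nat.succ_ne_zero k)).map C
    rw [hu.dvd_mul_left] at h2
    rw [pow_succ]
    exact mul_dvd_mul_left _ h2

/-- The conditions, in coordinates adapted to a mirror `X_o = 0` with a reflection of order
`m + 1`, under which the dual product has a simple pole with residue `r`. -/
def LocalGood (d : Fin n → ℕ) (v : Fin n → MvPolynomial (Fin n) ℂ) (o : Fin n) (m : ℕ) (r : ℂ) :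
    Prop :=
  -- The first clause is what invariance gives. The second says that the purely normal component has
  -- residue `r`, since ∂_o∂_o v^l has leading part m X_o^(m-1) w_l. The third kills the normal
  -- component of products of tangential vectors on the mirror.
  ∃ w : Fin n → MvPolynomial (Fin n) ℂ, (∀ l, pderiv o (v l) = X o ^ m * w l) ∧
    X o ∣ ∑ l, C ((m : ℂ) / ((d l : ℂ) - 1) - r) * (w l * (jacOf v).adjugate o l) ∧
    ∀ j k, j ≠ o → k ≠ o → X o ∣ ptensor d v o j k

lemma det_eq_sum_adjugate (v : Fin n → MvPolynomial (Fin n) ℂ) (o : Fin n) :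
    (jacOf v).det = ∑ l, pderiv o (v l) * (jacOf v).adjugate o l := by
  have := congrFun (congrFun (Matrix.adjugate_mul (jacOf v)) o) o
  rw [Matrix.mul_apply, Matrix.smul_apply, Matrix.one_apply_eq, smul_eq_mul, mul_one] at this
  rw [← this]
  exact Finset.sum_congr rfl fun l _ => mul_comm _ _

/-- For `a ≠ o` the cofactor still involves column `o` of the Jacobian matrix, all of whose entries
are divisible by `X o ^ m`. -/
lemma dvd_adjugate {v w : Fin n → MvPolynomial (Fin n) ℂ} {o : Fin n} {m : ℕ}
    (hw : ∀ l, pderiv o (v l) = X o ^ m * w l) {a : Fin n} (ha : a ≠ o) (l : Fin n) :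
    X o ^ m ∣ (jacOf v).adjugate a l := by
  rw [Matrix.adjugate_apply, Matrix.det_apply]
  refine Finset.dvd_sum fun σ _ => ?_
  rw [Units.smul_def, zsmul_eq_mul]
  refine Dvd.dvd.mul_left ?_ _
  refine Dvd.dvd.trans ?_ (Finset.dvd_prod_of_mem _ (Finset.mem_univ o))
  by_cases hl : σ o = l
  · rw [hl, Matrix.updateRow_self, Pi.single_apply, if_neg (Ne.symm ha)]
    exact dvd_zero _
  · rw [Matrix.updateRow_ne hl]
    exact ⟨w (σ o), hw _⟩

/-- The cofactor omits column `o`. Its entries are tangential derivatives ∂_j v^i, for which ∂_o∂_j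
v^i = X_o^m ∂_j w_i, and the polynomials with this property form a subring. -/
lemma adjugate_mem_flatAlong {v w : Fin n → MvPolynomial (Fin n) ℂ} {o : Fin n} {m : ℕ}
    (hw : ∀ l, pderiv o (v l) = X o ^ m * w l) (l : Fin n) :
    (jacOf v).adjugate o l ∈ flatAlong o m := by
  cases n with
  | zero => exact o.elim0
  | succ n =>
    rw [Matrix.adjugate_fin_succ_eq_det_submatrix]
    refine mul_mem (pow_mem (neg_mem (one_mem _)) _) (det_mem_subring _ fun i j => ?_)
    rw [mem_flatAlong, Matrix.submatrix_apply]
    change _ ∣ pderiv o (pderiv _ _)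
    rw [pderiv_comm', hw, Derivation.leibniz, smul_eq_mul, smul_eq_mul, Derivation.leibniz_pow,
      pderiv_X_of_ne (Fin.succAbove_ne _ _).symm]
    simp

/-- Where the determinant vanishes exactly to order `m`, this is a simple pole with purely normal
residue `r`. A tangential upper index gets `X o ^ m` from the adjugate, a mixed pair of lower
indices from ∂_j∂_o v^l. For two tangential lower indices the component is flat along `o` to order
`m` and vanishes on the mirror, so `X_pow_dvd_of_flatAlong` applies. The purely normal component is
the second clause of `LocalGood`. -/
lemma LocalGood.dvd {d : Fin n → ℕ} {v : Fin n → MvPolynomial (Fin n) ℂ} {o : Fin n} {m : ℕ} {r : ℂ}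
    (h : LocalGood d v o m r) (a b c : Fin n) :
    X o ^ (m + 1) ∣ X o * ptensor d v a b c -
      C (if a = o ∧ b = o ∧ c = o then r else 0) * (jacOf v).det := by
  obtain ⟨w, hw, hc2, hc1⟩ := h
  have hmix : ∀ j, j ≠ o → ∀ l, pderiv j (pderiv o (v l)) = X o ^ m * pderiv j (w l) := by
    intro j hj l
    rw [hw, Derivation.leibniz, smul_eq_mul, smul_eq_mul, Derivation.leibniz_pow,
      pderiv_X_of_ne (Ne.symm hj)]
    simp
  by_cases ha : a = o
  · subst ha
    by_cases hb : b = a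
    · subst hb
      by_cases hc : c = b
      · subst hc
        simp only [and_self, if_true]
        have h1 : ∀ l, X c * pderiv c (pderiv c (v l)) =
            X c ^ m * (C (m : ℂ) * w l) + X c ^ (m + 1) * pderiv c (w l) := by
          intro l
          rw [hw, Derivation.leibniz, smul_eq_mul, smul_eq_mul, Derivation.leibniz_pow,
            pderiv_X_self]
          cases m with
          | zero => simp
          | succ m =>
            simp only [Nat.add_sub_cancel, smul_eq_mul, mul_one, nsmul_eq_mul, map_natCast]
            ring
        have h2 : X c * ptensor d v c c c - C r * (jacOf v).det =
            X c ^ m * ∑ l, C ((m : ℂ) / ((d l : ℂ) - 1) - r) *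
              (w l * (jacOf v).adjugate c l) +
            X c ^ (m + 1) * ∑ l, C (1 / ((d l : ℂ) - 1)) * pderiv c (w l) *
              (jacOf v).adjugate c l := by
          rw [det_eq_sum_adjugate v c, ptensor, Finset.mul_sum, Finset.mul_sum, Finset.mul_sum,
            Finset.mul_sum, ← Finset.sum_sub_distrib, ← Finset.sum_add_distrib]
          refine Finset.sum_congr rfl fun l _ => ?_
          have e : X c * (C (1 / ((d l : ℂ) - 1)) * pderiv c (pderiv c (v l)) *
              (jacOf v).adjugate c l) = C (1 / ((d l : ℂ) - 1)) *
              (X c * pderiv c (pderiv c (v l))) * (jacOf v).adjugate c l := by ring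
          rw [e, h1, hw]
          have e2 : (C ((m : ℂ) / ((d l : ℂ) - 1) - r) : MvPolynomial (Fin n) ℂ) =
              C (1 / ((d l : ℂ) - 1)) * C (m : ℂ) - C r := by
            rw [← C_mul, ← C_sub]
            congr 1
            ring
          rw [e2]
          ring
        rw [h2]
        refine dvd_add ?_ (dvd_mul_right _ _)
        rw [pow_succ]
        exact mul_dvd_mul_left _ hc2
      · rw [if_neg (by tauto), map_zero, zero_mul, sub_zero, pow_succ', ptensor]
        refine mul_dvd_mul_left _ (Finset.dvd_sum fun l _ => ?_)
        rw [pderiv_comm', hmix c hc]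
        exact ((dvd_mul_right _ _).mul_left _).mul_right _
    · rw [if_neg (by tauto), map_zero, zero_mul, sub_zero, pow_succ']
      refine mul_dvd_mul_left _ ?_
      by_cases hc : c = a
      · rw [ptensor]
        refine Finset.dvd_sum fun l _ => ?_
        rw [hc, hmix b hb]
        exact ((dvd_mul_right _ _).mul_left _).mul_right _
      · refine (pow_dvd_pow _ (Nat.le_succ m)).trans
          (X_pow_dvd_of_flatAlong ?_ (hc1 b c hb hc))
        refine sum_mem fun l _ => mul_mem (mul_mem ?_ ?_) (adjugate_mem_flatAlong hw l)
        · rw [mem_flatAlong, pderiv_C]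
          exact dvd_zero _
        · rw [mem_flatAlong, pderiv_comm', pderiv_comm' a c, hmix c hc, Derivation.leibniz,
            smul_eq_mul, smul_eq_mul, Derivation.leibniz_pow, pderiv_X_of_ne (Ne.symm hb)]
          simp
  · rw [if_neg (by tauto), map_zero, zero_mul, sub_zero, pow_succ', ptensor]
    exact mul_dvd_mul_left _ (Finset.dvd_sum fun l _ => (dvd_adjugate hw ha l).mul_left _)

end Local

/-! ### From the local conditions at the generators to the global formula. -/

namespace GroupData

variable {D : GroupData}

/-- In coordinates adapted to the kernel of `β` the local conditions hold. -/
def GoodAt (D : GroupData) (β : Fin D.n → ℂ) (m : ℕ) (r : ℂ) : Prop :=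
  ∃ (o : Fin D.n) (g : Matrix (Fin D.n) (Fin D.n) ℂ) (s t : ℂ), g.det ≠ 0 ∧
    Matrix.vecMul β g = s • Pi.single o 1 ∧ (∀ i, g i o = t * sharp D.h β i) ∧
    LocalGood D.deg (fun l => subst g (D.u l)) o m r

/-- A unitary transformation carries the normal vector of a hyperplane to that of its image. -/
lemma sharp_vecMul (hh : IsMetric D.h) {x y : Matrix (Fin D.n) (Fin D.n) ℂ}
    (hx : x.conjTranspose * D.h * x = D.h) (hxy : x * y = 1) (β : Fin D.n → ℂ) :
    sharp D.h (Matrix.vecMul β y) = x.mulVec (sharp D.h β) := by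
  have hinj := Matrix.mulVec_injective_of_isUnit
    ((Matrix.isUnit_iff_isUnit_det _).mpr (isUnit_iff_ne_zero.mpr hh.det_ne_zero))
  apply hinj
  have h1 : D.h * x = y.conjTranspose * D.h := by
    have h2 : y.conjTranspose * x.conjTranspose = 1 := by
      rw [← Matrix.conjTranspose_mul, hxy, Matrix.conjTranspose_one]
    calc D.h * x = y.conjTranspose * x.conjTranspose * (D.h * x) := by rw [h2, one_mul]
      _ = y.conjTranspose * (x.conjTranspose * D.h * x) := by simp only [mul_assoc]
      _ = _ := by rw [hx]
  rw [hh.mulVec_sharp, Matrix.mulVec_mulVec, h1, ← Matrix.mulVec_mulVec, hh.mulVec_sharp,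
    Matrix.star_vecMul]

namespace Basic

variable (hD : D.Basic)
include hD

/-- The frame `g` is replaced by `x * g`: invariance leaves the substituted coordinates unchanged,
and unitarity keeps the first column of the definition normal to the mirror. -/
lemma goodAt_orbit {β : Fin D.n → ℂ} {m : ℕ} {r : ℂ} (h : GoodAt D β m r)
    {x : Matrix.GeneralLinearGroup (Fin D.n) ℂ} (hx : x ∈ D.group) :
    GoodAt D (Matrix.vecMul β ((x⁻¹ : Matrix.GeneralLinearGroup _ ℂ) :
      Matrix (Fin D.n) (Fin D.n) ℂ)) m r := by
  obtain ⟨o, g, s, t, hg, hs, ht, hl⟩ := h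
  have hxx : (x : Matrix (Fin D.n) (Fin D.n) ℂ) * (x⁻¹ : Matrix.GeneralLinearGroup _ ℂ) = 1 := by
    rw [← Units.val_mul, mul_inv_cancel, Units.val_one]
  have hxx' : ((x⁻¹ : Matrix.GeneralLinearGroup _ ℂ) : Matrix (Fin D.n) (Fin D.n) ℂ) * x = 1 := by
    rw [← Units.val_mul, inv_mul_cancel, Units.val_one]
  refine ⟨o, x * g, s, t, ?_, ?_, ?_, ?_⟩
  · rw [Matrix.det_mul]
    refine mul_ne_zero ?_ hg
    intro h0
    have := congrArg Matrix.det hxx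
    rw [Matrix.det_mul, h0, zero_mul, Matrix.det_one] at this
    exact zero_ne_one this
  · rw [Matrix.vecMul_vecMul, ← mul_assoc, hxx', one_mul, hs]
  · intro i
    rw [sharp_vecMul hD.metric (hD.unitary hx) hxx, Matrix.mul_apply, Matrix.mulVec, dotProduct,
      Finset.mul_sum]
    exact Finset.sum_congr rfl fun j _ => by rw [ht]; ring
  · convert hl using 2 with l
    rw [← subst_subst, hD.subst_u hx]

/-- `LocalGood.dvd` is pulled back from the adapted frame to the original coordinates. The purely
normal residue becomes the projection times the covector. -/
lemma goodAt_dvd {β : Fin D.n → ℂ} (hβ : β ≠ 0) {m : ℕ} {r : ℂ} (h : GoodAt D β m r)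
    (i j k : Fin D.n) : lin β ^ (m + 1) ∣ lin β * ptensor D.deg D.u i j k -
      C (r * proj D.h β i k * β j) * D.jac.det := by
  obtain ⟨o, g, s, t, hg, hs, ht, hl⟩ := h
  have hN := hD.metric.normSq_ne_zero hβ
  have hu : IsUnit g.det := isUnit_iff_ne_zero.mpr hg
  have h1 : g * g⁻¹ = 1 := Matrix.mul_nonsing_inv g hu
  have h2 : g⁻¹ * g = 1 := Matrix.nonsing_inv_mul g hu
  set g' := g⁻¹ with hg'
  have hβ' : β = s • g' o := by
    have : Matrix.vecMul (Matrix.vecMul β g) g' = β := by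
      rw [Matrix.vecMul_vecMul, h1, Matrix.vecMul_one]
    rw [← this, hs, Matrix.smul_vecMul, Matrix.single_one_vecMul]
    rfl
  have hs0 : s ≠ 0 := by
    rintro rfl
    rw [zero_smul] at hβ'
    exact hβ hβ'
  have hst : s = t * normSq D.h β := by
    have := congrFun hs o
    rw [Pi.smul_apply, Pi.single_eq_same, smul_eq_mul, mul_one] at this
    rw [← this, ← dotProduct_sharp, Matrix.vecMul, dotProduct, dotProduct, Finset.mul_sum]
    exact Finset.sum_congr rfl fun i _ => by rw [ht]; ring
  -- Column `o` of the frame is `t` times the normal vector, row `o` of its inverse is `β / s`, and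
  -- s = t ‖β‖², so the scaling of the frame drops out.
  have hproj : ∀ i k, proj D.h β i k = g i o * g' o k := by
    intro i k
    have hk := congrFun hβ' k
    rw [Pi.smul_apply, smul_eq_mul] at hk
    rw [proj_eq, Matrix.smul_apply, Matrix.vecMulVec_apply, smul_eq_mul, ht, hk, hst]
    field_simp
  have hlin : lin β = C s * lin (g' o) := by
    conv_lhs => rw [hβ']
    rw [lin_smul]
  have hu' : ∀ l, subst g' (subst g (D.u l)) = D.u l := fun l => by
    rw [subst_subst, h1, subst_one]
  have hP := ptensor_subst D.deg (fun l => subst g (D.u l)) h2 i j k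
  simp only [hu'] at hP
  have hJ := det_jacOf_subst g' (fun l => subst g (D.u l))
  simp only [hu'] at hJ
  have key : lin (g' o) * ptensor D.deg D.u i j k -
      C (r * (g i o * g' o k) * g' o j) * D.jac.det = C g'.det * ∑ a, ∑ b, ∑ c,
      C (g i a * g' b j * g' c k) * subst g' (X o * ptensor D.deg (fun l => subst g (D.u l)) a b c -
        C (if a = o ∧ b = o ∧ c = o then r else 0) *
          (jacOf fun l => subst g (D.u l)).det) := by
    have e1 : ∑ a, ∑ b, ∑ c, C (g i a * g' b j * g' c k) * (C (if a = o ∧ b = o ∧ c = o then r else 0)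
        * subst g' (jacOf fun l => subst g (D.u l)).det) = C (r * (g i o * g' o k) * g' o j) *
        subst g' (jacOf fun l => subst g (D.u l)).det := by
      rw [Finset.sum_eq_single o, Finset.sum_eq_single o, Finset.sum_eq_single o]
      · simp only [and_self, if_true]
        rw [← mul_assoc, ← C_mul]
        congr 2
        ring
      · intro c _ hc; simp [hc]
      · simp
      · intro c _ hc; simp [hc]
      · simp
      · intro c _ hc; simp [hc]
      · simp
    have hJ' : D.jac.det = subst g' (jacOf fun l => subst g (D.u l)).det * C g'.det := hJ
    have e2 : ∀ a b c, C (g i a * g' b j * g' c k) * subst g' (X o *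
        ptensor D.deg (fun l => subst g (D.u l)) a b c -
        C (if a = o ∧ b = o ∧ c = o then r else 0) * (jacOf fun l => subst g (D.u l)).det) =
        lin (g' o) * (C (g i a * g' b j * g' c k) *
          subst g' (ptensor D.deg (fun l => subst g (D.u l)) a b c)) -
        C (g i a * g' b j * g' c k) * (C (if a = o ∧ b = o ∧ c = o then r else 0)
        * subst g' (jacOf fun l => subst g (D.u l)).det) := by
      intro a b c
      rw [map_sub, map_mul (subst g'), map_mul (subst g'), subst_X, subst_C]
      ring
    simp only [e2, Finset.sum_sub_distrib, ← Finset.mul_sum]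
    rw [e1, hJ', hP]
    ring
  have hdvd : lin (g' o) ^ (m + 1) ∣ lin (g' o) * ptensor D.deg D.u i j k -
      C (r * (g i o * g' o k) * g' o j) * D.jac.det := by
    rw [key]
    refine Dvd.dvd.mul_left (Finset.dvd_sum fun a _ => Finset.dvd_sum fun b _ =>
      Finset.dvd_sum fun c _ => Dvd.dvd.mul_left ?_ _) _
    have := map_dvd (subst g') (hl.dvd a b c)
    rwa [map_pow, subst_X] at this
  have hfin : lin β * ptensor D.deg D.u i j k - C (r * proj D.h β i k * β j) * D.jac.det =
      C s * (lin (g' o) * ptensor D.deg D.u i j k -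
        C (r * (g i o * g' o k) * g' o j) * D.jac.det) := by
    have hj := congrFun hβ' j
    rw [Pi.smul_apply, smul_eq_mul] at hj
    rw [hlin, hproj, hj]
    simp only [C_mul]
    ring
  rw [hfin, hlin, mul_pow, ← map_pow]
  exact mul_dvd_mul ((isUnit_iff_ne_zero.mpr (pow_ne_zero _ hs0)).map C).dvd hdvd

lemma goodAt_dvd_smul {β : Fin D.n → ℂ} (hβ : β ≠ 0) {m : ℕ} {r c : ℂ} (h : GoodAt D β m r)
    (hc : c ≠ 0) (i j k : Fin D.n) : lin (c • β) ^ (m + 1) ∣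
      lin (c • β) * ptensor D.deg D.u i j k -
      C (r * proj D.h (c • β) i k * (c • β) j) * D.jac.det := by
  have h1 := hD.goodAt_dvd hβ h i j k
  rw [hD.metric.proj_smul hβ hc, lin_smul, mul_pow, ← map_pow]
  have : C c * lin β * ptensor D.deg D.u i j k - C (r * proj D.h β i k * (c • β) j) * D.jac.det =
      C c * (lin β * ptensor D.deg D.u i j k - C (r * proj D.h β i k * β j) * D.jac.det) := by
    simp only [Pi.smul_apply, smul_eq_mul, C_mul]
    ring
  rw [this]
  exact mul_dvd_mul ((isUnit_iff_ne_zero.mpr (pow_ne_zero _ hc)).map C).dvd h1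

variable {ι : Type} [Fintype ι] (F : MirrorFamily D ι)

/-- The polynomial form of the formula for the dual product. -/
lemma ptensor_eq [DecidableEq ι] {α : ι → Fin D.n → ℂ} (hα : ∀ i, α i ≠ 0)
    (hH : ∀ i, IsForm (α i) (F.mir i)) {r : ι → ℂ}
    (hr : ∀ i, GoodAt D (F.gen i).1 ((F.gen i).2 - 1) (r i)) {a : ℂ}
    (hdet : D.jac.det = C a * ∏ i, lin (α i) ^ ((F.gen i).2 - 1)) (i j k : Fin D.n) :
    ptensor D.deg D.u i j k = C a * ∑ e, C (r e * proj D.h (α e) i k * α e j) *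
      (lin (α e) ^ ((F.gen e).2 - 2) * ∏ f ∈ Finset.univ.erase e,
        lin (α f) ^ ((F.gen f).2 - 1)) := by
  rw [← sub_eq_zero]
  set q : ι → MvPolynomial (Fin D.n) ℂ := fun e => lin (α e) ^ ((F.gen e).2 - 2) *
    ∏ f ∈ Finset.univ.erase e, lin (α f) ^ ((F.gen f).2 - 1) with hq
  have h2 := hD.two_le_order F
  -- relation of the cofactors with the Jacobian determinant
  have hq1 : ∀ e, C a * (lin (α e) * q e) = D.jac.det := by
    intro e
    rw [hdet, ← Finset.mul_prod_erase _ _ (Finset.mem_univ e), hq]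
    have : (F.gen e).2 - 1 = (F.gen e).2 - 2 + 1 := by have := h2 e; omega
    simp only [this, pow_succ]
    ring
  have hdvd : ∏ e, lin (α e) ^ ((F.gen e).2 - 1) ∣ ptensor D.deg D.u i j k -
      C a * ∑ e, C (r e * proj D.h (α e) i k * α e j) * q e := by
    refine Fintype.prod_dvd_of_isRelPrime (fun e f hef => isRelPrime_lin F hα hH hef _ _) ?_
    intro e
    obtain ⟨x, hx, hxH⟩ := F.inOrbit e
    have hgood := hD.goodAt_orbit (hr e) hx
    have hxx : (x : Matrix (Fin D.n) (Fin D.n) ℂ) * (x⁻¹ : Matrix.GeneralLinearGroup _ ℂ) = 1 := by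
      rw [← Units.val_mul, mul_inv_cancel, Units.val_one]
    have hxx' : ((x⁻¹ : Matrix.GeneralLinearGroup _ ℂ) : Matrix (Fin D.n) (Fin D.n) ℂ) * x = 1 := by
      rw [← Units.val_mul, inv_mul_cancel, Units.val_one]
    set β := Matrix.vecMul (F.gen e).1 ((x⁻¹ : Matrix.GeneralLinearGroup _ ℂ) :
      Matrix (Fin D.n) (Fin D.n) ℂ) with hβdef
    have hβ : β ≠ 0 := by
      intro h0
      apply (hD.gens _ (F.gen_mem e)).1
      have := congrArg (fun w => Matrix.vecMul w (x : Matrix (Fin D.n) (Fin D.n) ℂ)) h0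
      simpa [hβdef, Matrix.vecMul_vecMul, hxx'] using this
    obtain ⟨c, hc, hce⟩ := exists_smul_of_ker_eq hβ (hα e) fun v hv => by
      rw [← hH e v]
      have h3 := (hxH (((x⁻¹ : Matrix.GeneralLinearGroup _ ℂ) :
        Matrix (Fin D.n) (Fin D.n) ℂ).mulVec v)).mpr (by rwa [Matrix.dotProduct_mulVec])
      rwa [Matrix.mulVec_mulVec, hxx, Matrix.one_mulVec] at h3
    have h4 := hD.goodAt_dvd_smul hβ hgood hc i j k
    rw [← hce, ← hq1 e] at h4
    have h5 : lin (α e) ^ ((F.gen e).2 - 1) ∣ ptensor D.deg D.u i j k -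
        C a * (C (r e * proj D.h (α e) i k * α e j) * q e) := by
      rw [← mul_dvd_mul_iff_left (lin_ne_zero (hα e)), ← pow_succ']
      convert h4 using 1
      ring
    -- Only the summand of `e` itself is matched with the residue; every other summand contains the
    -- full power of `lin (α e)`.
    rw [← Finset.add_sum_erase _ _ (Finset.mem_univ e), mul_add, ← sub_sub]
    refine dvd_sub h5 (Dvd.dvd.mul_left (Finset.dvd_sum fun f hf => Dvd.dvd.mul_left ?_ _) _)
    exact Dvd.dvd.mul_left (Finset.dvd_prod_of_mem (fun f => lin (α f) ^ ((F.gen f).2 - 1))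
      (Finset.mem_erase.mpr ⟨(Finset.ne_of_mem_erase hf).symm, Finset.mem_univ e⟩)) _
  -- comparison of degrees
  by_contra hne
  obtain ⟨y, hy⟩ := hdvd
  have hprod_ne : ∏ i, lin (α i) ^ ((F.gen i).2 - 1) ≠ 0 :=
    Finset.prod_ne_zero_iff.mpr fun i _ => pow_ne_zero _ (lin_ne_zero (hα i))
  have hhomP : (∏ i, lin (α i) ^ ((F.gen i).2 - 1)).IsHomogeneous (∑ l, (D.deg l - 1)) := by
    rw [← F.sum_eq]
    refine IsHomogeneous.prod _ _ _ fun i _ => ?_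
    simpa using (isHomogeneous_lin (α i)).pow ((F.gen i).2 - 1)
  have hC : ∀ (c : ℂ) {f : MvPolynomial (Fin D.n) ℂ} {d : ℕ}, f.IsHomogeneous d →
      (C c * f).IsHomogeneous d := fun c f d hf => by
    simpa using (isHomogeneous_C (Fin D.n) c).mul hf
  have hle : ∀ l, D.deg l - 1 ≤ ∑ k, (D.deg k - 1) := fun l =>
    Finset.single_le_sum (f := fun k => D.deg k - 1) (fun _ _ => Nat.zero_le _) (Finset.mem_univ l)
  have hhom1 : (ptensor D.deg D.u i j k).IsHomogeneous (∑ l, (D.deg l - 1) - 1) := by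
    refine IsHomogeneous.sum _ _ _ fun l _ => ?_
    have := (hC (1 / ((D.deg l : ℂ) - 1)) (IsHomogeneous.pderiv (i := j) ((hD.hom l).pderiv (i := k)))).mul
      (isHomogeneous_adjugate (M := jacOf D.u) (d := fun l => D.deg l - 1)
        (fun l j => (hD.hom l).pderiv) i l)
    convert this using 1
    have := hle l
    have := hD.two_le l
    omega
  have hhom2 : (C a * ∑ e, C (r e * proj D.h (α e) i k * α e j) * q e).IsHomogeneous
      (∑ l, (D.deg l - 1) - 1) := by
    refine hC _ (IsHomogeneous.sum _ _ _ fun e _ => hC _ ?_)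
    have h6 : (q e).IsHomogeneous (((F.gen e).2 - 2) + ∑ f ∈ Finset.univ.erase e,
        ((F.gen f).2 - 1)) := by
      refine IsHomogeneous.mul (by simpa using (isHomogeneous_lin (α e)).pow ((F.gen e).2 - 2)) ?_
      refine IsHomogeneous.prod _ _ _ fun i _ => ?_
      simpa using (isHomogeneous_lin (α i)).pow ((F.gen i).2 - 1)
    convert h6 using 1
    rw [← F.sum_eq, ← Finset.add_sum_erase _ _ (Finset.mem_univ e)]
    have := h2 e
    omega
  have h7 := (hhom1.sub hhom2).totalDegree hne
  have hy0 : y ≠ 0 := by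
    rintro rfl
    rw [mul_zero] at hy
    exact hne hy
  rw [hy, totalDegree_mul_of_isDomain hprod_ne hy0, hhomP.totalDegree hprod_ne] at h7
  -- The sum of the `D.deg l - 1` is positive, so subtracting one is not truncated and the degrees
  -- contradict each other.
  have := hle i
  have := hD.two_le i
  omega

end Basic

end GroupData

/-! ### The dual product, the dual connection and standard bi-flat structures. -/

namespace GroupData

variable {D : GroupData}

/-- The assertion of the main theorem for given data. -/
def Conclusion (D : GroupData) : Prop :=
    (∀ l, (D.u l).IsHomogeneous (D.deg l)) ∧
    (∀ x ∈ D.group, ∀ l, ∀ p : Fin D.n → ℂ,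
      MvPolynomial.eval ((x : Matrix (Fin D.n) (Fin D.n) ℂ).mulVec p) (D.u l)
        = MvPolynomial.eval p (D.u l)) ∧
    D.mirrors.Finite ∧
    D.mirrors.ncard = (D.table.map Prod.snd).sum ∧
    (∀ a ∈ D.table, {H | H ∈ D.mirrors ∧ D.kappa H = a.1}.ncard = a.2) ∧
    (∀ H ∈ D.mirrors, ∃ x ∈ D.group,
      ReflectionDuality.GroupData.fixedSpace x = H ∧ orderOf x = D.kappa H) ∧
    ∀ α : Submodule ℂ (Fin D.n → ℂ) → Fin D.n → ℂ, D.IsMirrorForms α →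
      (∃ a : ℂ, a ≠ 0 ∧ D.jac.det = MvPolynomial.C a *
        ∏ᶠ H ∈ D.mirrors,
          (∑ i, MvPolynomial.C (α H i) * MvPolynomial.X i) ^ (D.kappa H - 1)) ∧
      (∀ p ∈ D.regularSet, IsUnit (D.jacAt p).det ∧
        (∀ i j, ∑ k, D.dunklKohno α p i j k * p k = if i = j then 1 else 0) ∧
        ∀ i j k, D.dualProduct p i j k = D.dunklKohno α p i j k ∧
          D.dualConnection p i j k = - D.dunklKohno α p i j k) ∧
      (∀ (Ω : Set (Fin D.n → ℂ)) (Γ₁ Γ₂ c cs : ReflectionDuality.Field12 D.n)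
        (e : ReflectionDuality.VField D.n), D.IsStandard Ω Γ₁ Γ₂ c cs e →
        ∀ p ∈ Ω, ∀ i j k, cs p i j k = D.dunklKohno α p i j k ∧
          Γ₂ p i j k = - D.dunklKohno α p i j k)

lemma det_jacAt (p : Fin D.n → ℂ) : (D.jacAt p).det = eval p D.jac.det :=
  (RingHom.map_det (eval p) D.jac).symm

lemma adjugate_jacAt (p : Fin D.n → ℂ) (i l : Fin D.n) :
    (D.jacAt p).adjugate i l = eval p (D.jac.adjugate i l) := by
  have := RingHom.map_adjugate (eval p) D.jac
  exact (congrFun (congrFun this i) l).symm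

lemma dualProduct_mul_det {p : Fin D.n → ℂ} (hp : IsUnit (D.jacAt p).det) (i j k : Fin D.n) :
    D.dualProduct p i j k * (D.jacAt p).det = eval p (ptensor D.deg D.u i j k) := by
  rw [dualProduct, ptensor, map_sum, Finset.sum_mul]
  refine Finset.sum_congr rfl fun l _ => ?_
  rw [Matrix.inv_def, Matrix.smul_apply, adjugate_jacAt, map_mul, map_mul, eval_C, smul_eq_mul]
  have : Ring.inverse (D.jacAt p).det * (D.jacAt p).det = 1 := Ring.inverse_mul_cancel _ hp
  rw [hessAt]
  change _ = _ * eval p (D.jac.adjugate i l)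
  linear_combination (1 / ((D.deg l : ℂ) - 1) * eval p (pderiv j (pderiv k (D.u l))) *
    eval p (D.jac.adjugate i l)) * this

/-- The inhomogeneous term of the coordinate change contributes 1, and 1 - d/(d - 1) = -1/(d - 1).
-/
lemma dualConnection_eq (hd : ∀ l, 2 ≤ D.deg l) (p : Fin D.n → ℂ) (i j k : Fin D.n) :
    D.dualConnection p i j k = - D.dualProduct p i j k := by
  rw [dualConnection, dualProduct, ← Finset.sum_neg_distrib]
  refine Finset.sum_congr rfl fun l _ => ?_
  have : (D.deg l : ℂ) - 1 ≠ 0 := by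
    have := hd l
    rw [sub_ne_zero]
    exact_mod_cast (by omega : D.deg l ≠ 1)
  field_simp
  ring

namespace Basic

variable (hD : D.Basic)
include hD

lemma deg_ne (l : Fin D.n) : (D.deg l : ℂ) - 1 ≠ 0 := by
  have := hD.two_le l
  rw [sub_ne_zero]
  exact_mod_cast (by omega : D.deg l ≠ 1)

lemma euler_hess (p : Fin D.n → ℂ) (l j : Fin D.n) :
    ∑ k, D.hessAt p l j k * p k = ((D.deg l : ℂ) - 1) * D.jacAt p l j := by
  have h1 := ((hD.hom l).pderiv (i := j)).sum_X_mul_pderiv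
  have h2 := congrArg (eval p) h1
  simp only [map_sum, map_mul, eval_X, nsmul_eq_mul, map_natCast] at h2
  have h3 : ((D.deg l - 1 : ℕ) : ℂ) = (D.deg l : ℂ) - 1 := by
    have := hD.two_le l
    push_cast [Nat.cast_sub (by omega : 1 ≤ D.deg l)]
    ring
  rw [h3] at h2
  change _ = _ * eval p (pderiv j (D.u l))
  rw [← h2]
  exact Finset.sum_congr rfl fun k _ => by rw [hessAt, pderiv_comm', mul_comm]

/-- The weights 1/(d_l - 1) cancel the factors of Euler's relation for the first derivatives, which
leaves J⁻¹J. The normalization by N is thus a consequence of the formula. -/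
lemma dualProduct_euler {p : Fin D.n → ℂ} (hp : IsUnit (D.jacAt p).det) (i j : Fin D.n) :
    ∑ k, D.dualProduct p i j k * p k = if i = j then 1 else 0 := by
  simp only [dualProduct, Finset.sum_mul]
  rw [Finset.sum_comm]
  have h1 : ∀ l, ∑ k, 1 / ((D.deg l : ℂ) - 1) * D.hessAt p l j k * (D.jacAt p)⁻¹ i l * p k =
      (D.jacAt p)⁻¹ i l * D.jacAt p l j := by
    intro l
    have := hD.deg_ne l
    calc _ = 1 / ((D.deg l : ℂ) - 1) * (D.jacAt p)⁻¹ i l * ∑ k, D.hessAt p l j k * p k := by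
          rw [Finset.mul_sum]
          exact Finset.sum_congr rfl fun k _ => by ring
      _ = _ := by
          rw [hD.euler_hess]
          field_simp
  simp only [h1]
  rw [← Matrix.mul_apply, Matrix.nonsing_inv_mul _ hp, Matrix.one_apply]

variable {ι : Type} [Fintype ι] (F : MirrorFamily D ι)

lemma dotProduct_ne {α : ι → Fin D.n → ℂ} (hH : ∀ i, IsForm (α i) (F.mir i)) {p : Fin D.n → ℂ}
    (hp : p ∈ D.regularSet) (e : ι) : α e ⬝ᵥ p ≠ 0 := fun h =>
  hp _ (hD.mir_mem F e) ((hH e p).mpr h)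

include F in
lemma isUnit_det {p : Fin D.n → ℂ} (hp : p ∈ D.regularSet) : IsUnit (D.jacAt p).det := by
  obtain ⟨α, hα, hH⟩ := hD.exists_form_family F
  obtain ⟨a, ha, hdet⟩ := hD.det_eq F hα hH
  rw [det_jacAt, hdet, map_mul, map_prod, eval_C]
  refine isUnit_iff_ne_zero.mpr (mul_ne_zero ha (Finset.prod_ne_zero_iff.mpr fun e _ => ?_))
  rw [map_pow, eval_lin]
  exact pow_ne_zero _ (hD.dotProduct_ne F hH hp e)

lemma dualProduct_eq {α : ι → Fin D.n → ℂ} (hα : ∀ i, α i ≠ 0)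
    (hH : ∀ i, IsForm (α i) (F.mir i)) {r : ι → ℂ}
    (hr : ∀ i, GoodAt D (F.gen i).1 ((F.gen i).2 - 1) (r i)) {p : Fin D.n → ℂ}
    (hp : p ∈ D.regularSet) (i j k : Fin D.n) :
    D.dualProduct p i j k = ∑ e, r e * (α e j / (α e ⬝ᵥ p)) * proj D.h (α e) i k := by
  classical
  obtain ⟨a, ha, hdet⟩ := hD.det_eq F hα hH
  have hu := hD.isUnit_det F hp
  have h1 := dualProduct_mul_det hu i j k
  rw [hD.ptensor_eq F hα hH hr hdet] at h1
  have hdet' := congrArg (eval p) hdet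
  rw [← det_jacAt] at hdet'
  apply mul_right_cancel₀ hu.ne_zero
  rw [h1, map_mul, map_sum, Finset.mul_sum, Finset.sum_mul]
  refine Finset.sum_congr rfl fun e _ => ?_
  have hne := hD.dotProduct_ne F hH hp e
  have h2 := hD.two_le_order F e
  have h3 : (F.gen e).2 - 1 = (F.gen e).2 - 2 + 1 := by omega
  rw [hdet', ← Finset.mul_prod_erase _ _ (Finset.mem_univ e), h3, pow_succ]
  simp only [map_mul, eval_C, map_pow, eval_lin]
  field_simp

/-- The sum of the residues is the rank. -/
lemma sum_residue {α : ι → Fin D.n → ℂ} (hα : ∀ i, α i ≠ 0)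
    (hH : ∀ i, IsForm (α i) (F.mir i)) {r : ι → ℂ}
    (hr : ∀ i, GoodAt D (F.gen i).1 ((F.gen i).2 - 1) (r i)) : ∑ e, r e = D.n := by
  obtain ⟨p, hp⟩ : ∃ p : Fin D.n → ℂ, p ∈ D.regularSet := by
    obtain ⟨p, hp⟩ : ∃ p, eval p D.jac.det ≠ 0 := by
      by_contra h
      push Not at h
      exact hD.jac_ne (MvPolynomial.funext fun p => by rw [h p, map_zero])
    refine ⟨p, ?_⟩
    rw [regularSet, hD.mirrors_eq F]
    rintro _ ⟨e, rfl⟩ hpe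
    apply hp
    obtain ⟨a, ha, hdet⟩ := hD.det_eq F hα hH
    rw [hdet, map_mul, map_prod]
    rw [Finset.prod_eq_zero (Finset.mem_univ e), mul_zero]
    rw [map_pow, eval_lin, (hH e p).mp hpe, zero_pow]
    have := hD.two_le_order F e
    omega
  have hu := hD.isUnit_det F hp
  -- Contracting the formula with the Euler field cancels each denominator, so the projections
  -- weighted by the residues add up to the identity. The trace then gives the claim, a projection
  -- having trace one.
  have h1 : ∀ i j, ∑ e, r e * proj D.h (α e) i j = if i = j then 1 else 0 := by
    intro i j
    rw [← hD.dualProduct_euler hu i j]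
    simp only [hD.dualProduct_eq F hα hH hr hp, Finset.sum_mul]
    rw [Finset.sum_comm]
    refine Finset.sum_congr rfl fun e _ => ?_
    have hne := hD.dotProduct_ne F hH hp e
    have hN := hD.metric.normSq_ne_zero (hα e)
    have h2 : ∑ k, proj D.h (α e) i k * p k = (normSq D.h (α e))⁻¹ * sharp D.h (α e) i *
        (α e ⬝ᵥ p) := by
      rw [dotProduct, Finset.mul_sum]
      refine Finset.sum_congr rfl fun k _ => ?_
      rw [proj_eq, Matrix.smul_apply, Matrix.vecMulVec_apply, smul_eq_mul]
      ring
    calc r e * proj D.h (α e) i j = r e * (α e j / (α e ⬝ᵥ p)) * ∑ k, proj D.h (α e) i k * p k := by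
          rw [h2, proj_eq, Matrix.smul_apply, Matrix.vecMulVec_apply, smul_eq_mul]
          field_simp
      _ = _ := by
          rw [Finset.mul_sum]
          exact Finset.sum_congr rfl fun k _ => by ring
  have h3 : ∑ i, ∑ e, r e * proj D.h (α e) i i = D.n := by
    simp [h1]
  rw [Finset.sum_comm] at h3
  rw [← h3]
  refine Finset.sum_congr rfl fun e _ => ?_
  rw [← Finset.mul_sum]
  have := hD.metric.trace_proj (hα e)
  rw [Matrix.trace] at this
  simp only [Matrix.diag_apply] at this
  rw [this, mul_one]

/-- The product `*` of a standard bi-flat structure is the dual product. -/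
lemma standard_eq {Ω : Set (Fin D.n → ℂ)} {Γ₁ Γ₂ c cs : Field12 D.n} {e : VField D.n}
    (hS : D.IsStandard Ω Γ₁ Γ₂ c cs e) {p : Fin D.n → ℂ} (hp : p ∈ Ω)
    (hu : IsUnit (D.jacAt p).det) (i j k : Fin D.n) : cs p i j k = D.dualProduct p i j k := by
  have hB := hS.biflat
  obtain ⟨Einv, hE⟩ := hB.dual
  obtain ⟨-, hcs⟩ := hE p hp
  -- the algebraic part of the compatibility of the two connections
  have h1 : ∀ (Z : Fin D.n → ℂ) (k i j : Fin D.n),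
      ∑ l, (Γ₁ p k i l - Γ₂ p k i l) * ∑ m, c p l m j * Z m =
        ∑ l, (Γ₁ p k j l - Γ₂ p k j l) * ∑ m, c p l m i * Z m := by
    intro Z k i j
    -- The derivative terms of the two exterior derivatives are the same and cancel, so a constant
    -- field with arbitrary value is enough.
    have := hB.almost_hydro (fun _ => Z) (fun i => differentiableOn_const _) p hp k i j
    simp only [extCov] at this
    simp only [sub_mul, Finset.sum_sub_distrib]
    linear_combination this
  have h2 : ∀ l m j, cs p l m j = ∑ s, c p l s j * ∑ t, c p s t m * Einv p t := by
    intro l m j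
    rw [hcs]
    have hass := hB.product₁.assoc p hp
    -- `Einv ∘ (∂_m ∘ ∂_j) = (Einv ∘ ∂_m) ∘ ∂_j`
    calc ∑ s, ∑ t, c p l s t * Einv p s * c p t m j
        = ∑ s, Einv p s * ∑ t, c p l s t * c p t m j := by
          refine Finset.sum_congr rfl fun s _ => ?_
          rw [Finset.mul_sum]
          exact Finset.sum_congr rfl fun t _ => by ring
      _ = ∑ s, Einv p s * ∑ t, c p l t j * c p t s m := by
          refine Finset.sum_congr rfl fun s _ => ?_
          rw [hass l s m j]
      _ = _ := by
          simp only [Finset.mul_sum]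
          rw [Finset.sum_comm]
          exact Finset.sum_congr rfl fun s _ => Finset.sum_congr rfl fun t _ => by ring
  -- The choice of E⁻¹ ∘ ∂_m for the vector turns multiplication by ∘ into multiplication of ∂_m by
  -- *.
  have h3 : ∀ k m i j, ∑ l, (Γ₁ p k i l - Γ₂ p k i l) * cs p l m j =
      ∑ l, (Γ₁ p k j l - Γ₂ p k j l) * cs p l m i := by
    intro k m i j
    simp only [h2]
    exact h1 (fun s => ∑ t, c p s t m * Einv p t) k i j
  have hunit := hB.product₂.unit p hp
  have hcomm := hB.product₂.comm p hp
  have hpd : ∀ l k : Fin D.n, pd l (fun q : Fin D.n → ℂ => q k) p = if k = l then 1 else 0 := by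
    intro l k
    rw [pd]
    have : HasFDerivAt (fun q : Fin D.n → ℂ => q k) (ContinuousLinearMap.proj k) p :=
      (ContinuousLinearMap.proj (R := ℂ) (φ := fun _ : Fin D.n => ℂ) k).hasFDerivAt
    rw [this.fderiv]
    simp [Pi.single_apply]
  -- Since E = p has the identity as derivative, ∇²E = 0 says that Γ₂ contracted with E is minus the
  -- identity.
  have h4 : ∀ k l, ∑ j, (Γ₁ p k j l - Γ₂ p k j l) * p j =
      (if k = l then 1 else 0) + ∑ j, Γ₁ p k l j * p j := by
    intro k l
    have hf := hB.flat_unit₂ p hp k l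
    rw [covV, hpd] at hf
    have t1 := hB.connection₁.torsionless p hp k
    have t2 := hB.connection₂.torsionless p hp k
    have e1 : ∑ j, Γ₁ p k j l * p j = ∑ j, Γ₁ p k l j * p j :=
      Finset.sum_congr rfl fun j _ => by rw [t1 j l]
    have e2 : ∑ j, Γ₂ p k j l * p j = ∑ j, Γ₂ p k l j * p j :=
      Finset.sum_congr rfl fun j _ => by rw [t2 j l]
    simp only [sub_mul, Finset.sum_sub_distrib]
    rw [e1, e2]
    linear_combination -hf
  -- `h3` is contracted with E. On one side E is the unit of * and Γ₂ = -*; on the other side `h4`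
  -- applies.
  have h5 : ∀ k i m, Γ₁ p k i m + cs p k i m =
      ∑ l, ((if k = l then 1 else 0) + ∑ j, Γ₁ p k l j * p j) * cs p l m i := by
    intro k i m
    have h6 : ∑ j, (∑ l, (Γ₁ p k i l - Γ₂ p k i l) * cs p l m j) * p j =
        ∑ j, (∑ l, (Γ₁ p k j l - Γ₂ p k j l) * cs p l m i) * p j :=
      Finset.sum_congr rfl fun j _ => by rw [h3]
    have h7 : ∑ j, (∑ l, (Γ₁ p k i l - Γ₂ p k i l) * cs p l m j) * p j =
        Γ₁ p k i m + cs p k i m := by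
      simp only [Finset.sum_mul]
      rw [Finset.sum_comm]
      have : ∀ l, ∑ j, (Γ₁ p k i l - Γ₂ p k i l) * cs p l m j * p j =
          (Γ₁ p k i l - Γ₂ p k i l) * if l = m then 1 else 0 := by
        intro l
        rw [← hunit l m, Finset.mul_sum]
        exact Finset.sum_congr rfl fun j _ => by rw [hcomm l m j]; ring
      simp only [this, mul_ite, mul_one, mul_zero, Finset.sum_ite_eq', Finset.mem_univ, if_true]
      rw [hS.dual_eq p hp]
      ring
    rw [← h7, h6]
    simp only [Finset.sum_mul]
    rw [Finset.sum_comm]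
    refine Finset.sum_congr rfl fun l _ => ?_
    rw [← h4, Finset.sum_mul]
    exact Finset.sum_congr rfl fun j _ => by ring
  have hflat := hS.flatCoordinates p hp
  -- contract with the Jacobian matrix
  have h8 : ∀ a j k, ((D.deg a : ℂ) - 1) * ∑ s, D.jacAt p a s * cs p s j k = D.hessAt p a j k := by
    intro a j k
    have h9 : ∑ s, D.jacAt p a s * (Γ₁ p s j k + cs p s j k) =
        ∑ s, D.jacAt p a s * ∑ l, ((if s = l then 1 else 0) + ∑ t, Γ₁ p s l t * p t) *
          cs p l k j := Finset.sum_congr rfl fun s _ => by rw [h5]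
    have h10 : ∑ s, D.jacAt p a s * ∑ l, ((if s = l then 1 else 0) + ∑ t, Γ₁ p s l t * p t) *
          cs p l k j = ∑ l, (D.deg a : ℂ) * D.jacAt p a l * cs p l k j := by
      simp only [Finset.mul_sum]
      rw [Finset.sum_comm]
      refine Finset.sum_congr rfl fun l _ => ?_
      -- Flatness of u^a rewrites J Γ₁ as the Hessian, and Euler's relation turns J + Hess · p into
      -- d_a J. The difference between d_a and the coefficient 1 of * on the other side produces d_a
      -- - 1.
      have h11 : ∑ s, D.jacAt p a s * ((if s = l then 1 else 0) + ∑ t, Γ₁ p s l t * p t) =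
          (D.deg a : ℂ) * D.jacAt p a l := by
        have h12 : ∑ s, D.jacAt p a s * ∑ t, Γ₁ p s l t * p t = ∑ t, D.hessAt p a l t * p t := by
          simp only [hflat, Finset.mul_sum, Finset.sum_mul]
          rw [Finset.sum_comm]
          exact Finset.sum_congr rfl fun s _ => Finset.sum_congr rfl fun t _ => by ring
        simp only [mul_add, Finset.sum_add_distrib, h12, hD.euler_hess, mul_ite, mul_one, mul_zero,
          Finset.sum_ite_eq', Finset.mem_univ, if_true]
        ring
      rw [← h11, Finset.sum_mul]
      exact Finset.sum_congr rfl fun s _ => by ring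
    rw [h10] at h9
    simp only [mul_add, Finset.sum_add_distrib] at h9
    have h13 : ∑ s, D.jacAt p a s * Γ₁ p s j k = D.hessAt p a j k := by
      rw [hflat]
      exact Finset.sum_congr rfl fun s _ => by ring
    have h14 : ∑ l, (D.deg a : ℂ) * D.jacAt p a l * cs p l k j =
        (D.deg a : ℂ) * ∑ s, D.jacAt p a s * cs p s j k := by
      rw [Finset.mul_sum]
      exact Finset.sum_congr rfl fun s _ => by rw [hcomm s k j]; ring
    rw [h13, h14] at h9
    linear_combination -h9
  have h15 : ∀ l, 1 / ((D.deg l : ℂ) - 1) * D.hessAt p l j k =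
      ∑ s, D.jacAt p l s * cs p s j k := by
    intro l
    rw [← h8]
    have := hD.deg_ne l
    field_simp
  rw [dualProduct]
  simp only [h15, Finset.sum_mul]
  rw [Finset.sum_comm]
  have h16 : ∀ s, ∑ l, D.jacAt p l s * cs p s j k * (D.jacAt p)⁻¹ i l =
      (if i = s then 1 else 0) * cs p s j k := by
    intro s
    rw [← Matrix.one_apply, ← Matrix.nonsing_inv_mul _ hu, Matrix.mul_apply, Finset.sum_mul]
    exact Finset.sum_congr rfl fun l _ => by ring
  simp [h16]

/-- The main theorem, from the elementary properties, the list of mirrors and the local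
conditions. -/
theorem conclusion (hgood : ∀ i, GoodAt D (F.gen i).1 ((F.gen i).2 - 1) ((F.gen i).2 / D.N))
    (hcard : Fintype.card ι = (D.table.map Prod.snd).sum)
    (htable : ∀ a ∈ D.table, (Finset.univ.filter fun i => (F.gen i).2 = a.1).card = a.2) :
    D.Conclusion := by
  classical
  have hM := hD.mirrors_eq F
  refine ⟨hD.hom, ?_, ?_, ?_, ?_, ?_, ?_⟩
  · intro x hx l p
    rw [← eval_subst, hD.subst_u hx]
  · rw [hM]
    exact Set.finite_range _
  · rw [hM, ← Set.image_univ, Set.ncard_image_of_injective _ F.inj, Set.ncard_univ,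
      Nat.card_eq_fintype_card, hcard]
  · intro a ha
    rw [← htable a ha]
    have : {H | H ∈ D.mirrors ∧ D.kappa H = a.1} =
        F.mir '' (Finset.univ.filter fun i => (F.gen i).2 = a.1 : Finset ι) := by
      ext H
      rw [hM]
      simp only [Set.mem_ofPred_eq, Set.mem_image, Finset.coe_filter, Finset.mem_univ, true_and]
      constructor
      · rintro ⟨⟨i, rfl⟩, hk⟩
        exact ⟨i, by rwa [hD.kappa_eq F] at hk, rfl⟩
      · rintro ⟨i, hi, rfl⟩
        exact ⟨⟨i, rfl⟩, by rw [hD.kappa_eq F, hi]⟩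
    rw [this, Set.ncard_image_of_injective _ F.inj, Set.ncard_coe_finset]
  · rw [hM]
    rintro _ ⟨i, rfl⟩
    obtain ⟨y, hy, hf, ho, -⟩ := hD.mirror_of_inOrbit (F.gen_mem i) (F.inOrbit i)
    exact ⟨y, hy, hf, by rw [ho, hD.kappa_eq F]⟩
  · intro α hαM
    have hH : ∀ i, IsForm (α (F.mir i)) (F.mir i) := fun i => hαM _ (hD.mir_mem F i)
    have hα : ∀ i, α (F.mir i) ≠ 0 := fun i => (hH i).ne_zero (hD.mir_mem F i).1
    have hDK : ∀ p i j k, D.dunklKohno α p i j k = ∑ e, ((F.gen e).2 / D.N : ℂ) *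
        (α (F.mir e) j / (α (F.mir e) ⬝ᵥ p)) * proj D.h (α (F.mir e)) i k := by
      intro p i j k
      rw [dunklKohno, hM, finsum_mem_range F.inj, finsum_eq_sum_of_fintype, Finset.mul_sum]
      refine Finset.sum_congr rfl fun e _ => ?_
      rw [hD.kappa_eq F]
      ring
    have hprod : ∀ p ∈ D.regularSet, ∀ i j k, D.dualProduct p i j k = D.dunklKohno α p i j k := by
      intro p hp i j k
      rw [hDK, hD.dualProduct_eq F hα hH hgood hp]
    refine ⟨?_, ?_, ?_⟩
    · obtain ⟨a, ha, he⟩ := hD.det_eq F hα hH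
      refine ⟨a, ha, ?_⟩
      rw [he, hM, finprod_mem_range F.inj, finprod_eq_prod_of_fintype]
      congr 1
      exact Finset.prod_congr rfl fun e _ => by rw [hD.kappa_eq F]; rfl
    · intro p hp
      have hu := hD.isUnit_det F hp
      refine ⟨hu, ?_, ?_⟩
      · intro i j
        rw [← hD.dualProduct_euler hu]
        exact Finset.sum_congr rfl fun k _ => by rw [hprod p hp]
      · intro i j k
        rw [dualConnection_eq hD.two_le, hprod p hp]
        exact ⟨rfl, rfl⟩
    · intro Ω Γ₁ Γ₂ c cs e hS p hp i j k
      have hreg := hS.subset hp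
      rw [hS.dual_eq p hp, hD.standard_eq hS hp (hD.isUnit_det F hreg), hprod p hreg]
      exact ⟨rfl, rfl⟩

end Basic

end GroupData

/-! ## Adapted coordinates -/

section Adapted

variable {n : ℕ}

/-- The diagonal matrix with entry `ζ` in position `o` and `1` elsewhere. -/
def diagRefl (o : Fin n) (ζ : ℂ) : Matrix (Fin n) (Fin n) ℂ :=
  Matrix.diagonal (Function.update 1 o ζ)

lemma diagRefl_mulVec_of_eq_zero (o : Fin n) (ζ : ℂ) {p : Fin n → ℂ} (hp : p o = 0) :
    (diagRefl o ζ).mulVec p = p := by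
  ext i
  rw [diagRefl, Matrix.mulVec_diagonal]
  by_cases hi : i = o
  · subst hi; simp [hp]
  · simp [hi]

lemma subst_diagRefl_X (o : Fin n) (ζ : ℂ) : subst (diagRefl o ζ) (X o) = C ζ * X o := by
  apply MvPolynomial.funext
  intro p
  rw [eval_subst, eval_X, diagRefl, Matrix.mulVec_diagonal]
  simp

lemma subst_diagRefl_X_of_ne {o i : Fin n} (hi : i ≠ o) (ζ : ℂ) :
    subst (diagRefl o ζ) (X i) = X i := by
  apply MvPolynomial.funext
  intro p
  rw [eval_subst, eval_X, diagRefl, Matrix.mulVec_diagonal]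
  simp [hi]

/-- A polynomial invariant under a diagonal reflection of order `m + 1` has a normal derivative
that vanishes to order `m`. -/
lemma exists_pderiv_eq {o : Fin n} {m : ℕ} {ζ : ℂ} (hζ : IsPrimitiveRoot ζ (m + 1))
    {v : MvPolynomial (Fin n) ℂ} (hv : subst (diagRefl o ζ) v = v) :
    ∃ w, pderiv o v = X o ^ m * w := by
  have h1 : C ζ * subst (diagRefl o ζ) (pderiv o v) = pderiv o v := by
    conv_rhs => rw [← hv, pderiv_subst]
    rw [Finset.sum_eq_single o]
    · simp [diagRefl]
    · intro i _ hi
      simp [diagRefl, hi]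
    · simp
  suffices ∀ k ≤ m, X o ^ k ∣ pderiv o v from this m le_rfl
  intro k
  induction k with
  | zero => simp
  | succ k ih =>
    intro hk
    obtain ⟨q, hq⟩ := ih (by omega)
    rw [hq, map_mul, map_pow, subst_diagRefl_X] at h1
    have h2 : C (ζ ^ (k + 1)) * subst (diagRefl o ζ) q = q := by
      apply mul_left_cancel₀ (pow_ne_zero k (X_ne_zero (R := ℂ) o))
      rw [← h1, map_pow]
      ring
    rw [hq, pow_succ]
    -- At a point fixed by the diagonal reflection, `h2` reads (ζ^(k+1) - 1) q(p) = 0, and 0 < k + 1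
    -- < m + 1.
    refine mul_dvd_mul_left _ ((X_dvd_iff o q).mpr fun p hp => ?_)
    have h3 := congrArg (eval p) h2
    rw [map_mul, eval_subst, eval_C, diagRefl_mulVec_of_eq_zero o ζ hp] at h3
    have h4 : ζ ^ (k + 1) ≠ 1 := hζ.pow_ne_one_of_pos_of_lt (by omega) (by omega)
    have h5 : (ζ ^ (k + 1) - 1) * eval p q = 0 := by linear_combination h3
    exact (mul_eq_zero.mp h5).resolve_left (sub_ne_zero.mpr h4)

/-- Column `o` of the frame is an eigenvector for `ζ`, being normal to the mirror, and the other
columns lie in the mirror and are fixed. -/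
lemma unitaryRefl_mul_adapted {h : Matrix (Fin n) (Fin n) ℂ} (hh : IsMetric h) {β : Fin n → ℂ}
    (hβ : β ≠ 0) {o : Fin n} {g : Matrix (Fin n) (Fin n) ℂ} {s t : ℂ}
    (hs : Matrix.vecMul β g = s • Pi.single o 1) (ht : ∀ i, g i o = t * sharp h β i) (ζ : ℂ) :
    unitaryRefl h β ζ * g = g * diagRefl o ζ := by
  have hN := hh.normSq_ne_zero hβ
  have hst : s = t * normSq h β := by
    have := congrFun hs o
    rw [Pi.smul_apply, Pi.single_eq_same, smul_eq_mul, mul_one] at this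
    rw [← this, ← dotProduct_sharp, Matrix.vecMul, dotProduct, dotProduct, Finset.mul_sum]
    exact Finset.sum_congr rfl fun i _ => by rw [ht]; ring
  have h1 : unitaryRefl h β ζ * g = g - ((1 - ζ) * (normSq h β)⁻¹ * s) •
      Matrix.vecMulVec (sharp h β) (Pi.single o 1) := by
    rw [unitaryRefl, proj_eq, sub_mul, one_mul, Matrix.smul_mul, Matrix.smul_mul,
      Matrix.vecMulVec_mul, hs]
    ext i j
    simp only [Matrix.sub_apply, Matrix.smul_apply, Matrix.vecMulVec_apply, Pi.smul_apply,
      smul_eq_mul]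
    ring
  rw [h1]
  ext i j
  rw [diagRefl, Matrix.mul_diagonal, Matrix.sub_apply, Matrix.smul_apply, Matrix.vecMulVec_apply,
    smul_eq_mul]
  by_cases hj : j = o
  · subst hj
    rw [Pi.single_eq_same, Function.update_self, ht, hst]
    field_simp
    ring
  · rw [Pi.single_eq_of_ne hj, Function.update_of_ne hj]
    simp

/-- Semi-invariance under a reflection, checked in adapted coordinates. -/
lemma subst_unitaryRefl_of_adapted {h : Matrix (Fin n) (Fin n) ℂ} (hh : IsMetric h)
    {β : Fin n → ℂ} (hβ : β ≠ 0) {o : Fin n} {g : Matrix (Fin n) (Fin n) ℂ} {s t : ℂ}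
    (hg : g.det ≠ 0) (hs : Matrix.vecMul β g = s • Pi.single o 1)
    (ht : ∀ i, g i o = t * sharp h β i) {ζ χ : ℂ} {f : MvPolynomial (Fin n) ℂ}
    (hf : subst (diagRefl o ζ) (subst g f) = C χ * subst g f) :
    subst (unitaryRefl h β ζ) f = C χ * f := by
  have hu : IsUnit g.det := isUnit_iff_ne_zero.mpr hg
  rw [subst_subst, ← unitaryRefl_mul_adapted hh hβ hs ht, ← subst_subst] at hf
  have h1 := congrArg (subst g⁻¹) hf
  rwa [map_mul, subst_C, subst_subst, subst_subst, Matrix.mul_nonsing_inv g hu, mul_one,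
    subst_subst, Matrix.mul_nonsing_inv g hu, subst_one] at h1

/-- Euler's relation for the dual product. -/
lemma ptensor_euler {d : Fin n → ℕ} (hd : ∀ l, 2 ≤ d l) {v : Fin n → MvPolynomial (Fin n) ℂ}
    (hv : ∀ l, (v l).IsHomogeneous (d l)) {o j : Fin n} (hj : j ≠ o) :
    ∑ k, X k * ptensor d v o j k = 0 := by
  have h1 : ∀ l, ∑ k, X k * pderiv j (pderiv k (v l)) = C ((d l : ℂ) - 1) * pderiv j (v l) := by
    intro l
    have := ((hv l).pderiv (i := j)).sum_X_mul_pderiv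
    have h3 : ((d l - 1 : ℕ) : ℂ) = (d l : ℂ) - 1 := by
      have := hd l
      push_cast [Nat.cast_sub (by omega : 1 ≤ d l)]
      ring
    rw [nsmul_eq_mul, ← map_natCast (C : ℂ →+* MvPolynomial (Fin n) ℂ), h3] at this
    rw [← this]
    exact Finset.sum_congr rfl fun k _ => by rw [pderiv_comm']
  have h2 : ∑ k, X k * ptensor d v o j k = ∑ l, pderiv j (v l) * (jacOf v).adjugate o l := by
    simp only [ptensor, Finset.mul_sum]
    rw [Finset.sum_comm]
    refine Finset.sum_congr rfl fun l _ => ?_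
    have hne : (d l : ℂ) - 1 ≠ 0 := by
      have := hd l
      rw [sub_ne_zero]
      exact_mod_cast (by omega : d l ≠ 1)
    calc _ = C (1 / ((d l : ℂ) - 1)) * (∑ k, X k * pderiv j (pderiv k (v l))) *
          (jacOf v).adjugate o l := by
          rw [Finset.mul_sum, Finset.sum_mul]
          exact Finset.sum_congr rfl fun k _ => by ring
      _ = _ := by
          rw [h1, ← mul_assoc, ← C_mul, one_div, inv_mul_cancel₀ hne, C_1, one_mul]
  rw [h2]
  have := congrFun (congrFun (Matrix.adjugate_mul (jacOf v)) o) j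
  rw [Matrix.mul_apply, Matrix.smul_apply, Matrix.one_apply_ne (Ne.symm hj), smul_zero] at this
  rw [← this]
  exact Finset.sum_congr rfl fun l _ => mul_comm _ _

lemma ptensor_symm (d : Fin n → ℕ) (v : Fin n → MvPolynomial (Fin n) ℂ) (i j k : Fin n) :
    ptensor d v i j k = ptensor d v i k j :=
  Finset.sum_congr rfl fun l _ => by rw [pderiv_comm']

lemma isHomogeneous_subst (g : Matrix (Fin n) (Fin n) ℂ) {f : MvPolynomial (Fin n) ℂ} {d : ℕ}
    (hf : f.IsHomogeneous d) : (subst g f).IsHomogeneous d := by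
  have := hf.aeval (fun i => lin (g i)) (fun i => isHomogeneous_lin (g i))
  simpa [subst] using this

lemma X_dvd_of_X_mul {o k : Fin n} (h : k ≠ o) {f : MvPolynomial (Fin n) ℂ}
    (hf : X o ∣ X k * f) : X o ∣ f := by
  rcases (prime_X o).dvd_or_dvd hf with h1 | h1
  · have := (X_dvd_iff o (X k : MvPolynomial (Fin n) ℂ)).mp h1 (Pi.single k 1)
      (by simp [Ne.symm h])
    simp at this
  · exact h1

end Adapted

/-! ## Rank two -/

/-- The exact order of vanishing of the Jacobian determinant along a mirror. -/
lemma GroupData.Basic.not_dvd_det_subst {D : GroupData} (hD : D.Basic) {ι : Type} [Fintype ι]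
    (F : GroupData.MirrorFamily D ι) (i : ι) {g : Matrix (Fin D.n) (Fin D.n) ℂ}
    (hg : IsUnit g.det) {o : Fin D.n} {s : ℂ}
    (hs : Matrix.vecMul (F.gen i).1 g = s • Pi.single o 1) :
    ¬ X o ^ ((F.gen i).2 - 1 + 1) ∣ (jacOf fun l => subst g (D.u l)).det := by
  classical
  intro hdet
  obtain ⟨α, hα, hH⟩ := hD.exists_form_family F
  obtain ⟨c, hc, he⟩ := hD.det_eq F hα hH
  obtain ⟨x, hx, hxH⟩ := F.inOrbit i
  have hxu : IsUnit (x : Matrix (Fin D.n) (Fin D.n) ℂ).det := by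
    rw [← Matrix.isUnit_iff_isUnit_det]
    exact x.isUnit
  -- By invariance `g` may be followed by `x`, so that the adapted hyperplane becomes `F.mir i`
  -- itself. The assumed divisibility would then put one factor `lin (α i)` too many into the
  -- Jacobian determinant.
  set y : Matrix (Fin D.n) (Fin D.n) ℂ := (x : Matrix (Fin D.n) (Fin D.n) ℂ) * g with hy
  have e1 : (jacOf fun l => subst g (D.u l)).det = subst y D.jac.det * C y.det := by
    have h1 := det_jacOf_subst y D.u
    have h2 : ∀ l, subst y (D.u l) = subst g (D.u l) := fun l => by
      rw [hy, ← subst_subst, hD.subst_u hx]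
    simp only [h2] at h1
    exact h1
  have hgu : IsUnit y.det := by
    rw [hy, Matrix.det_mul]
    exact hxu.mul hg
  rw [e1, (hgu.map C).dvd_mul_right] at hdet
  have e2 : subst y (lin (α i)) ∣ X o := by
    have hle : ∀ v, (Pi.single o 1 : Fin D.n → ℂ) ⬝ᵥ v = 0 →
        Matrix.vecMul (α i) y ⬝ᵥ v = 0 := by
      intro v hv
      rw [← Matrix.dotProduct_mulVec, hy, ← Matrix.mulVec_mulVec, ← hH i, hxH,
        Matrix.dotProduct_mulVec, hs, smul_dotProduct, hv, smul_zero]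
    have hne : Matrix.vecMul (α i) y ≠ 0 := by
      intro h4
      apply hα i
      have := congrArg (fun z => Matrix.vecMul z y⁻¹) h4
      simpa only [Matrix.vecMul_vecMul, Matrix.mul_nonsing_inv _ hgu, Matrix.vecMul_one,
        Matrix.zero_vecMul] using this
    obtain ⟨s, hs, hse⟩ := exists_smul_of_ker_eq
      (by intro h5; simpa using congrFun h5 o) hne hle
    rw [subst_lin, hse, lin_smul, lin_single]
    exact (((isUnit_iff_ne_zero.mpr hs).map C).mul_left_dvd).mpr dvd_rfl
  have e3 := (pow_dvd_pow_of_dvd e2 ((F.gen i).2 - 1 + 1)).trans hdet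
  rw [← map_pow, subst_dvd_iff (Matrix.mul_nonsing_inv _ hgu), he,
    ((isUnit_iff_ne_zero.mpr hc).map C).dvd_mul_left,
    ← Finset.mul_prod_erase _ _ (Finset.mem_univ i), pow_succ,
    mul_dvd_mul_iff_left (pow_ne_zero _ (lin_ne_zero (hα i)))] at e3
  obtain ⟨j, hj, hj'⟩ := (prime_lin (hα i)).exists_mem_finset_dvd e3
  have hr := GroupData.Basic.isRelPrime_lin F hα hH (Finset.ne_of_mem_erase hj).symm 1
    ((F.gen j).2 - 1)
  rw [pow_one, (prime_lin (hα i)).irreducible.isRelPrime_iff_not_dvd] at hr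
  exact hr hj'

section RankTwo

lemma eval_smul_of_isHomogeneous {n d : ℕ} {f : MvPolynomial (Fin n) ℂ} (hf : f.IsHomogeneous d)
    (t : ℂ) (p : Fin n → ℂ) : eval (t • p) f = t ^ d * eval p f := by
  rw [eval_eq', eval_eq', Finset.mul_sum]
  refine Finset.sum_congr rfl fun e he => ?_
  have hd : ∑ i, e i = d := by
    have := hf (mem_support_iff.mp he)
    rw [Finsupp.weight_apply] at this
    simpa [Finsupp.sum_fintype] using this
  simp only [Pi.smul_apply, smul_eq_mul, mul_pow, Finset.prod_mul_distrib, Finset.prod_pow_eq_pow_sum,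
    hd]
  ring

lemma adjugate_zero_apply (v : Fin 2 → MvPolynomial (Fin 2) ℂ) :
    (jacOf v).adjugate 0 0 = pderiv 1 (v 1) ∧ (jacOf v).adjugate 0 1 = -pderiv 1 (v 0) := by
  rw [Matrix.adjugate_fin_two]
  simp [jacOf]

/-- On the line X_0 = 0 a binary form is a constant times a power of X_1, so one value decides. The
scaling behaviour of `w l` follows from that of the derivative after cancelling `X 0 ^ m`. -/
lemma X_dvd_sum_iff {d : Fin 2 → ℕ} {v w : Fin 2 → MvPolynomial (Fin 2) ℂ} {m : ℕ}
    (hv : ∀ l, (v l).IsHomogeneous (d l)) (hw : ∀ l, pderiv 0 (v l) = X 0 ^ m * w l)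
    (c : Fin 2 → ℂ) :
    X 0 ∣ ∑ l, C (c l) * (w l * (jacOf v).adjugate 0 l) ↔
      eval ![0, 1] (∑ l, C (c l) * (w l * (jacOf v).adjugate 0 l)) = 0 := by
  refine ⟨fun h => (X_dvd_iff 0 _).mp h _ rfl, fun h => ?_⟩
  have hwt : ∀ l (t : ℂ), t ^ m * eval ![0, t] (w l) = t ^ (d l - 1) * eval ![0, 1] (w l) := by
    intro l t
    have h1 : (X 0 : MvPolynomial (Fin 2) ℂ) ^ m * (C (t ^ m) * subst (t • 1) (w l)) =
        X 0 ^ m * (C (t ^ (d l - 1)) * w l) := by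
      apply MvPolynomial.funext
      intro p
      have h2 := eval_smul_of_isHomogeneous ((hv l).pderiv (i := 0)) t p
      rw [hw] at h2
      simp only [map_mul, map_pow, eval_X, Pi.smul_apply, smul_eq_mul] at h2
      simp only [map_mul, map_pow, eval_X, eval_C, eval_subst, Matrix.smul_mulVec,
        Matrix.one_mulVec]
      linear_combination h2
    have h3 := congrArg (eval ![0, 1]) (mul_left_cancel₀ (pow_ne_zero m (X_ne_zero 0)) h1)
    simpa [eval_subst, Matrix.smul_mulVec] using h3
  have hat : ∀ l (t : ℂ), eval ![0, t] (pderiv 1 (v l)) =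
      t ^ (d l - 1) * eval ![0, 1] (pderiv 1 (v l)) := by
    intro l t
    have := eval_smul_of_isHomogeneous ((hv l).pderiv (i := 1)) t ![0, 1]
    simpa using this
  obtain ⟨e0, e1⟩ := adjugate_zero_apply v
  -- The extra factor `X 1` makes the origin harmless, where scaling from the point (0, 1) fails.
  apply X_dvd_of_X_mul (k := 1) (by decide)
  rw [X_dvd_iff]
  intro p hp
  have hp' : p = ![0, p 1] := by
    ext i
    fin_cases i
    · exact hp
    · rfl
  rw [hp']
  by_cases ht : p 1 = 0
  · simp [ht]
  have hm : (p 1) ^ m ≠ 0 := pow_ne_zero _ ht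
  simp only [Fin.sum_univ_two, e0, e1, map_add, map_mul, map_neg, eval_C] at h
  rw [map_mul, mul_eq_zero]
  right
  apply mul_left_cancel₀ hm
  simp only [Fin.sum_univ_two, e0, e1, map_add, map_mul, map_neg, eval_C]
  rw [hat 0 (p 1), hat 1 (p 1)]
  have h0 := hwt 0 (p 1)
  have h1 := hwt 1 (p 1)
  linear_combination (c 0 * (p 1) ^ (d 1 - 1) * eval ![0, 1] (pderiv 1 (v 1))) * h0 -
    (c 1 * (p 1) ^ (d 0 - 1) * eval ![0, 1] (pderiv 1 (v 0))) * h1 +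
    ((p 1) ^ (d 0 - 1) * (p 1) ^ (d 1 - 1)) * h

/-- The tangential condition is automatic: Euler's relation expresses X_1 times the component with
lower indices 1, 1 as a multiple of X_0. -/
lemma localGood_two_of_eval {d : Fin 2 → ℕ} (hd : ∀ l, 2 ≤ d l)
    {v w : Fin 2 → MvPolynomial (Fin 2) ℂ} {m : ℕ}
    (hv : ∀ l, (v l).IsHomogeneous (d l)) (hw : ∀ l, pderiv 0 (v l) = X 0 ^ m * w l) {r : ℂ}
    (h : eval ![0, 1] (∑ l, C ((m : ℂ) / ((d l : ℂ) - 1) - r) *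
      (w l * (jacOf v).adjugate 0 l)) = 0) : LocalGood d v 0 m r := by
  refine ⟨w, hw, (X_dvd_sum_iff hv hw _).mpr h, ?_⟩
  intro j k hj hk
  obtain rfl : j = 1 := by omega
  obtain rfl : k = 1 := by omega
  have h1 := ptensor_euler hd hv (o := 0) (j := 1) (by decide)
  rw [Fin.sum_univ_two] at h1
  apply X_dvd_of_X_mul (k := 1) (by decide)
  rw [eq_neg_of_add_eq_zero_right h1]
  exact (dvd_mul_right _ _).neg_right

/-- The unitary frame of `ℂ²` adapted to the kernel of a covector. -/
def frame (β : Fin 2 → ℂ) : Matrix (Fin 2) (Fin 2) ℂ := !![star (β 0), -β 1; star (β 1), β 0]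

lemma isMetric_one {n : ℕ} : IsMetric (1 : Matrix (Fin n) (Fin n) ℂ) :=
  ⟨fun _ => 1, fun _ => one_pos, by ext i j; simp [Matrix.one_apply, Matrix.diagonal_apply]⟩

lemma sharp_one {n : ℕ} (β : Fin n → ℂ) (i : Fin n) : sharp 1 β i = star (β i) := by
  simp [sharp, Matrix.one_apply]

lemma normSq_one_two (β : Fin 2 → ℂ) :
    normSq 1 β = β 0 * star (β 0) + β 1 * star (β 1) := by
  rw [← dotProduct_sharp, dotProduct, Fin.sum_univ_two, sharp_one, sharp_one]

lemma det_frame (β : Fin 2 → ℂ) : (frame β).det = normSq 1 β := by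
  rw [frame, Matrix.det_fin_two_of, normSq_one_two]
  ring

lemma vecMul_frame (β : Fin 2 → ℂ) :
    Matrix.vecMul β (frame β) = normSq 1 β • Pi.single 0 1 := by
  rw [normSq_one_two]
  ext j
  fin_cases j
  · simp [frame, Matrix.vecMul, dotProduct, Fin.sum_univ_two]
  · simp [frame, Matrix.vecMul, dotProduct, Fin.sum_univ_two]
    ring

lemma frame_zero (β : Fin 2 → ℂ) (i : Fin 2) : frame β i 0 = 1 * sharp 1 β i := by
  rw [sharp_one, one_mul]
  fin_cases i <;> simp [frame]

/-- The data in rank two. -/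
abbrev dataTwo (gens : List ((Fin 2 → ℂ) × ℕ)) (deg : Fin 2 → ℕ)
    (u : Fin 2 → MvPolynomial (Fin 2) ℂ) (N : ℕ) (table : List (ℕ × ℕ)) : GroupData :=
  { n := 2, h := 1, gens := gens, deg := deg, u := u, N := N, table := table }

variable {gens : List ((Fin 2 → ℂ) × ℕ)} {deg : Fin 2 → ℕ}
  {u : Fin 2 → MvPolynomial (Fin 2) ℂ} {N : ℕ} {table : List (ℕ × ℕ)}

lemma exists_pderiv_frame (hD : (dataTwo gens deg u N table).Basic) {a} (ha : a ∈ gens) :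
    ∃ w : Fin 2 → MvPolynomial (Fin 2) ℂ, ∀ l,
      pderiv 0 (subst (frame a.1) (u l)) = X 0 ^ (a.2 - 1) * w l := by
  obtain ⟨h0, h2⟩ := hD.gens a ha
  have hζ := Complex.isPrimitiveRoot_exp a.2 (by omega)
  have h1 : a.2 = a.2 - 1 + 1 := by omega
  rw [h1] at hζ
  have : ∀ l, ∃ w, pderiv 0 (subst (frame a.1) (u l)) = X 0 ^ (a.2 - 1) * w := by
    intro l
    apply exists_pderiv_eq hζ
    have h3 := unitaryRefl_mul_adapted isMetric_one h0 (vecMul_frame a.1) (frame_zero a.1)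
      (Complex.exp (2 * Real.pi * Complex.I / a.2))
    rw [← h1, subst_subst, ← h3, ← subst_subst]
    congr 1
    exact hD.inv a ha l
  choose w hw using this
  exact ⟨w, hw⟩

/-- The local conditions at a generator of a group of rank two reduce to one number. -/
lemma goodAt_two_of_eval (hD : (dataTwo gens deg u N table).Basic) {a} (ha : a ∈ gens)
    {w : Fin 2 → MvPolynomial (Fin 2) ℂ}
    (hw : ∀ l, pderiv 0 (subst (frame a.1) (u l)) = X 0 ^ (a.2 - 1) * w l) {r : ℂ}
    (h : eval ![0, 1] (∑ l, C (((a.2 - 1 : ℕ) : ℂ) / ((deg l : ℂ) - 1) - r) *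
      (w l * (jacOf fun l => subst (frame a.1) (u l)).adjugate 0 l)) = 0) :
    (dataTwo gens deg u N table).GoodAt a.1 (a.2 - 1) r := by
  obtain ⟨h0, h2⟩ := hD.gens a ha
  refine ⟨0, frame a.1, normSq 1 a.1, 1, ?_, vecMul_frame a.1, frame_zero a.1,
    localGood_two_of_eval hD.two_le (fun l => isHomogeneous_subst _ (hD.hom l)) hw h⟩
  rw [det_frame]
  exact isMetric_one.normSq_ne_zero h0

/-- In rank two the local conditions hold for some residue. -/
lemma exists_goodAt_two (hD : (dataTwo gens deg u N table).Basic) {ι : Type} [Fintype ι]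
    (F : GroupData.MirrorFamily (dataTwo gens deg u N table) ι) (i : ι) :
    ∃ r, (dataTwo gens deg u N table).GoodAt (F.gen i).1 ((F.gen i).2 - 1) r := by
  classical
  have ha := F.gen_mem i
  obtain ⟨h0, h2⟩ := hD.gens _ ha
  obtain ⟨w, hw⟩ := exists_pderiv_frame hD ha
  set β := (F.gen i).1 with hβ
  set m := (F.gen i).2 - 1 with hm
  have hv : ∀ l, (subst (frame β) (u l)).IsHomogeneous (deg l) :=
    fun l => isHomogeneous_subst _ (hD.hom l)
  have hNS := isMetric_one.normSq_ne_zero h0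
  set W := eval ![0, 1] (∑ l, C 1 *
      (w l * (jacOf fun l => subst (frame β) (u l)).adjugate 0 l)) with hW
  -- Otherwise the Jacobian determinant would vanish to order `m + 1` along the mirror. The
  -- condition on the residue is linear in `r` with leading coefficient `-W`, hence solvable.
  have hW0 : W ≠ 0 := by
    intro h
    have h3 := (X_dvd_sum_iff hv hw (fun _ => 1)).mpr h
    have hdet : X 0 ^ (m + 1) ∣ (jacOf fun l => subst (frame β) (u l)).det := by
      rw [det_eq_sum_adjugate _ 0, pow_succ]
      have : ∑ l, pderiv 0 (subst (frame β) (u l)) *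
          (jacOf fun l => subst (frame β) (u l)).adjugate 0 l = X 0 ^ m * ∑ l, C 1 *
          (w l * (jacOf fun l => subst (frame β) (u l)).adjugate 0 l) := by
        rw [Finset.mul_sum]
        exact Finset.sum_congr rfl fun l _ => by rw [hw, C_1]; ring
      rw [this]
      exact mul_dvd_mul_left _ h3
    refine hD.not_dvd_det_subst F i (g := frame β) (o := 0) ?_ (vecMul_frame β) hdet
    rw [det_frame]
    exact isUnit_iff_ne_zero.mpr hNS
  refine ⟨eval ![0, 1] (∑ l, C ((m : ℂ) / ((deg l : ℂ) - 1)) *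
      (w l * (jacOf fun l => subst (frame β) (u l)).adjugate 0 l)) / W, ?_⟩
  apply goodAt_two_of_eval hD ha hw
  set W' := eval ![0, 1] (∑ l, C ((m : ℂ) / ((deg l : ℂ) - 1)) *
      (w l * (jacOf fun l => subst (frame β) (u l)).adjugate 0 l)) with hW'
  have : ∀ r : ℂ, eval ![0, 1] (∑ l, C ((m : ℂ) / ((deg l : ℂ) - 1) - r) *
      (w l * (jacOf fun l => subst (frame β) (u l)).adjugate 0 l)) = W' - r * W := by
    intro r
    rw [hW, hW']
    simp only [Fin.sum_univ_two, map_add, map_mul, eval_C]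
    ring
  rw [this, div_mul_cancel₀ _ hW0, sub_self]

/-- In rank two the residues in one orbit are determined by the residues in the others. -/
lemma goodAt_two (hD : (dataTwo gens deg u N table).Basic) {ι : Type} [Fintype ι]
    (F : GroupData.MirrorFamily (dataTwo gens deg u N table) ι) (hN : N ≠ 0)
    (hsum : ∑ i, (F.gen i).2 = 2 * N) (a : (Fin 2 → ℂ) × ℕ)
    (h : ∀ i, F.gen i = a ∨
      (dataTwo gens deg u N table).GoodAt (F.gen i).1 ((F.gen i).2 - 1) ((F.gen i).2 / N)) (i : ι) :
    (dataTwo gens deg u N table).GoodAt (F.gen i).1 ((F.gen i).2 - 1) ((F.gen i).2 / N) := by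
  classical
  rcases h i with hi | hi
  swap
  · exact hi
  obtain ⟨r, hr⟩ := exists_goodAt_two hD F i
  rw [hi] at hr
  obtain ⟨α, hα, hH⟩ := hD.exists_form_family F
  have hN' : (N : ℂ) ≠ 0 := Nat.cast_ne_zero.mpr hN
  -- The same unknown `r` serves all mirrors labelled by `a`. Both these residues and the expected
  -- ones add up to the rank 2, so a positive multiple of `r - a.2 / N` vanishes.
  have h1 := hD.sum_residue F hα hH (r := fun j => if F.gen j = a then r else (F.gen j).2 / N)
    (fun j => by
      by_cases hj : F.gen j = a
      · simp only [hj, if_true]; exact hr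
      · simp only [hj, if_false]; exact (h j).resolve_left hj)
  have h2 : ∑ j, ((F.gen j).2 / N : ℂ) = 2 := by
    rw [← Finset.sum_div, ← Nat.cast_sum, hsum]
    push_cast
    field_simp
  have h3 : ∑ j, ((if F.gen j = a then r else (F.gen j).2 / N) - ((F.gen j).2 / N : ℂ)) = 0 := by
    rw [Finset.sum_sub_distrib, h1, h2]
    simp
  have h4 : ∑ j, ((if F.gen j = a then r else (F.gen j).2 / N) - ((F.gen j).2 / N : ℂ)) =
      ((Finset.univ.filter fun j => F.gen j = a).card : ℂ) * (r - a.2 / N) := by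
    rw [← nsmul_eq_mul, ← Finset.sum_const, Finset.sum_filter]
    refine Finset.sum_congr rfl fun j _ => ?_
    by_cases hj : F.gen j = a
    · simp [hj]
    · simp [hj]
  rw [h4] at h3
  have h5 : ((Finset.univ.filter fun j => F.gen j = a).card : ℂ) ≠ 0 := by
    rw [Nat.cast_ne_zero]
    exact Finset.card_ne_zero_of_mem (Finset.mem_filter.mpr ⟨Finset.mem_univ i, hi⟩)
  rw [hi, ← sub_eq_zero.mp ((mul_eq_zero.mp h3).resolve_left h5)]
  exact hr

end RankTwo

/-! ## Reduction of the mirrors modulo a prime -/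

section Reduction

/-- A residue field of characteristic `p` of the ring of algebraic integers. -/
lemma exists_residueField (p : ℕ) [Fact p.Prime] : ∃ (k : Type) (_ : Field k) (_ : CharP k p),
    Nonempty (integralClosure ℤ ℂ →+* k) := by
  have hp : Prime (p : ℤ) := Nat.prime_iff_prime_int.mp (Fact.out : p.Prime)
  have : (Ideal.span {(p : ℤ)}).IsMaximal :=
    PrincipalIdealRing.isMaximal_of_irreducible hp.irreducible
  obtain ⟨Q, hQ, hQp⟩ := Ideal.exists_ideal_over_maximal_of_isIntegral
    (S := integralClosure ℤ ℂ) (Ideal.span {(p : ℤ)}) (by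
      rw [(RingHom.injective_iff_ker_eq_bot _).mp (FaithfulSMul.algebraMap_injective ℤ _)]
      exact bot_le)
  let := Ideal.Quotient.field Q
  refine ⟨integralClosure ℤ ℂ ⧸ Q, inferInstance, ?_, ⟨Ideal.Quotient.mk Q⟩⟩
  have h0 : ((p : ℕ) : integralClosure ℤ ℂ ⧸ Q) = 0 := by
    have h1 : (p : ℤ) ∈ Q.comap (algebraMap ℤ (integralClosure ℤ ℂ)) := by
      rw [hQp]
      exact Ideal.mem_span_singleton_self _
    rw [Ideal.mem_comap, ← Ideal.Quotient.eq_zero_iff_mem] at h1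
    simpa using h1
  exact (CharP.charP_iff_prime_eq_zero Fact.out).mpr h0

variable {k : Type} [Field k] {p : ℕ} (φ : integralClosure ℤ ℂ →+* k)

/-- The algebraic integer `z` reduces to the class of the integer `a`. -/
def Red (z : ℂ) (a : ℤ) : Prop := ∃ hz : IsIntegral ℤ z, φ ⟨z, hz⟩ = (a : k)

variable {φ}

lemma Red.add {z w : ℂ} {a b : ℤ} (hz : Red φ z a) (hw : Red φ w b) : Red φ (z + w) (a + b) := by
  obtain ⟨iz, hz⟩ := hz
  obtain ⟨iw, hw⟩ := hw
  refine ⟨iz.add iw, ?_⟩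
  rw [Int.cast_add, ← hz, ← hw, ← map_add]
  rfl

lemma Red.mul {z w : ℂ} {a b : ℤ} (hz : Red φ z a) (hw : Red φ w b) : Red φ (z * w) (a * b) := by
  obtain ⟨iz, hz⟩ := hz
  obtain ⟨iw, hw⟩ := hw
  refine ⟨iz.mul iw, ?_⟩
  rw [Int.cast_mul, ← hz, ← hw, ← map_mul]
  rfl

lemma Red.intCast (a : ℤ) : Red φ (a : ℂ) a :=
  ⟨isIntegral_algebraMap (R := ℤ) (x := a), by
    rw [← map_intCast φ]
    rfl⟩

lemma Red.zero : Red φ 0 0 := by simpa using Red.intCast (φ := φ) 0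

lemma Red.one : Red φ 1 1 := by simpa using Red.intCast (φ := φ) 1

lemma Red.ofNat (a : ℕ) [a.AtLeastTwo] : Red φ (OfNat.ofNat a) (OfNat.ofNat a) := by
  simpa using Red.intCast (φ := φ) (OfNat.ofNat a)

lemma Red.neg {z : ℂ} {a : ℤ} (hz : Red φ z a) : Red φ (-z) (-a) := by
  simpa using (Red.intCast (φ := φ) (-1)).mul hz

lemma Red.sub {z w : ℂ} {a b : ℤ} (hz : Red φ z a) (hw : Red φ w b) : Red φ (z - w) (a - b) := by
  simpa [sub_eq_add_neg] using hz.add hw.neg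

lemma Red.pow {z : ℂ} {a : ℤ} (hz : Red φ z a) (m : ℕ) : Red φ (z ^ m) (a ^ m) := by
  induction m with
  | zero => simpa using Red.one
  | succ m ih => simpa [pow_succ] using ih.mul hz

lemma Red.sum {ι : Type*} (s : Finset ι) {f : ι → ℂ} {a : ι → ℤ} (h : ∀ i ∈ s, Red φ (f i) (a i)) :
    Red φ (∑ i ∈ s, f i) (∑ i ∈ s, a i) := by
  classical
  induction s using Finset.induction_on with
  | empty => simpa using Red.zero
  | insert i s hi ih =>
    rw [Finset.sum_insert hi, Finset.sum_insert hi]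
    exact (h i (Finset.mem_insert_self _ _)).add
      (ih fun j hj => h j (Finset.mem_insert_of_mem hj))

section CharP

variable [CharP k p]

lemma Red.congr {z : ℂ} {a b : ℤ} (hz : Red φ z a) (hab : (p : ℤ) ∣ a - b) : Red φ z b := by
  obtain ⟨iz, hz⟩ := hz
  refine ⟨iz, ?_⟩
  rw [hz, ← sub_eq_zero, ← Int.cast_sub, CharP.intCast_eq_zero_iff k p]
  exact hab

lemma Red.dvd {a : ℤ} (h : Red φ 0 a) : (p : ℤ) ∣ a := by
  obtain ⟨iz, hz⟩ := h
  rw [← CharP.intCast_eq_zero_iff k p, ← hz]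
  exact map_zero φ

/-- The reductions of the roots of a quadratic equation. -/
lemma Red.of_quadratic {z s t : ℂ} (h : z ^ 2 = s * z - t) {a b : ℤ} (hs : Red φ s (a + b))
    (ht : Red φ t (a * b)) : Red φ z a ∨ Red φ z b := by
  have iz : IsIntegral ℤ z := by
    have : IsIntegral (integralClosure ℤ ℂ) z := by
      refine ⟨Polynomial.X ^ 2 - (Polynomial.C ⟨s, hs.1⟩ * Polynomial.X - Polynomial.C ⟨t, ht.1⟩),
        ?_, ?_⟩
      · monicity!
      · rw [Polynomial.eval₂_sub, Polynomial.eval₂_pow, Polynomial.eval₂_X, Polynomial.eval₂_sub,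
          Polynomial.eval₂_mul, Polynomial.eval₂_C, Polynomial.eval₂_X, Polynomial.eval₂_C, h]
        exact sub_self _
    exact isIntegral_trans _ this
  obtain ⟨is, hs⟩ := hs
  obtain ⟨it, ht⟩ := ht
  have e : (⟨z, iz⟩ : integralClosure ℤ ℂ) ^ 2 = ⟨s, is⟩ * ⟨z, iz⟩ - ⟨t, it⟩ := Subtype.ext h
  have h1 := congrArg φ e
  rw [map_pow, map_sub, map_mul, hs, ht] at h1
  push_cast at h1
  have h2 : (φ ⟨z, iz⟩ - a) * (φ ⟨z, iz⟩ - b) = 0 := by linear_combination h1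
  rcases mul_eq_zero.mp h2 with h3 | h3
  · exact Or.inl ⟨iz, sub_eq_zero.mp h3⟩
  · exact Or.inr ⟨iz, sub_eq_zero.mp h3⟩

lemma Red.of_sq {z t : ℂ} (h : z ^ 2 = t) {a b : ℤ} (ht : Red φ t b) (hab : (p : ℤ) ∣ b - a ^ 2) :
    Red φ z a ∨ Red φ z (-a) := by
  apply Red.of_quadratic (s := 0) (t := -t) (by rw [h]; ring)
  · simpa using Red.zero
  · apply ht.neg.congr
    rw [show -b - a * -a = -(b - a ^ 2) by ring]
    exact (dvd_neg).mpr hab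

/-- The root satisfies the cyclotomic equation, which has integer coefficients and, in
characteristic prime to `m`, only primitive roots as solutions. -/
lemma isPrimitiveRoot_red [NeZero p] {m : ℕ} (hm : 0 < m) (hmp : ¬ p ∣ m) {ζ : ℂ}
    (hζ : IsPrimitiveRoot ζ m) :
    ∃ iz : IsIntegral ℤ ζ, IsPrimitiveRoot (φ ⟨ζ, iz⟩) m := by
  have iz := hζ.isIntegral hm
  refine ⟨iz, ?_⟩
  have hmk : NeZero (m : k) := ⟨fun h => hmp ((CharP.cast_eq_zero_iff k p m).mp h)⟩
  rw [← Polynomial.isRoot_cyclotomic_iff]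
  have hprim : IsPrimitiveRoot (⟨ζ, iz⟩ : integralClosure ℤ ℂ) m := by
    rw [← IsPrimitiveRoot.map_iff_of_injective (f := (integralClosure ℤ ℂ).val)
      Subtype.val_injective]
    exact hζ
  have h1 := hprim.isRoot_cyclotomic hm
  have h2 := h1.map (f := φ)
  rwa [Polynomial.map_cyclotomic] at h2

/-- A suitable power of a primitive root of unity has a prescribed reduction. -/
lemma exists_pow_red [NeZero p] {m : ℕ} (hm : 0 < m) (hmp : ¬ p ∣ m) {ζ : ℂ}
    (hζ : IsPrimitiveRoot ζ m) {a : ℤ} (ha : (p : ℤ) ∣ a ^ m - 1) :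
    ∃ j : ℕ, Red φ (ζ ^ j) a := by
  obtain ⟨iz, h⟩ := isPrimitiveRoot_red (φ := φ) hm hmp hζ
  have ha' : (a : k) ^ m = 1 := by
    rw [← sub_eq_zero, ← Int.cast_pow, ← Int.cast_one, ← Int.cast_sub,
      CharP.intCast_eq_zero_iff k p]
    exact ha
  have : NeZero m := ⟨hm.ne'⟩
  obtain ⟨j, -, hj⟩ := h.eq_pow_of_pow_eq_one ha'
  refine ⟨j, iz.pow j, ?_⟩
  rw [← hj, ← map_pow]
  rfl

end CharP

/-! ### Lists of mirrors modulo `p` -/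

/-- Evaluates the number before passing it on, for efficient reduction. -/
def force {α : Type} (x : ℕ) (f : ℕ → α) : α := Nat.rec (f 0) (fun y _ => f (y + 1)) x

lemma force_eq {α : Type} (x : ℕ) (f : ℕ → α) : force x f = f x := by cases x <;> rfl

/-- Evaluates the entries of a list before passing it on. -/
def forceList {α : Type} : List ℕ → (List ℕ → α) → α
  | [], f => f []
  | x :: l, f => force x fun y => forceList l fun l' => f (y :: l')

lemma forceList_eq {α : Type} (l : List ℕ) (f : List ℕ → α) : forceList l f = f l := by
  induction l generalizing f with
  | nil => rfl
  | cons x l ih => rw [forceList, force_eq, ih]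

/-- The scalar product of two lists. -/
def dotList : List ℕ → List ℕ → ℕ
  | a :: l, b :: m => a * b + dotList l m
  | _, _ => 0

/-- `x A + y B` modulo `p`. -/
def combList (p x y : ℕ) : List ℕ → List ℕ → List ℕ
  | a :: l, b :: m => (x * a + y * b) % p :: combList p x y l m
  | _, _ => []

/-- The reduction of a reflection: a covector, the dual vector and the eigenvalue minus one. -/
abbrev RedRefl := List ℕ × List ℕ × ℕ

/-- The action of a reflection on a covector modulo `p`, up to a factor. -/
def stepList (p : ℕ) (s : RedRefl) (b : List ℕ) : List ℕ :=
  combList p (dotList s.1 s.2.1 % p) (s.2.2 * dotList b s.2.1 % p) b s.1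

/-- Two lists of length `n` are not proportional modulo `p`. -/
def indepList (p n : ℕ) (a b : List ℕ) : Bool :=
  (List.range n).any fun i => (List.range i).any fun j =>
    ! ((a.getD i 0 * b.getD j 0) % p == (a.getD j 0 * b.getD i 0) % p)

/-- Successively adds the covector of the generator `j` for a move `(0, j)`, and the image of the
covector in position `i` under the generator `j` for a move `(i + 1, j)`; checks that the covectors
remain pairwise independent. -/
def checkMoves (p n : ℕ) (S : List RedRefl) : List (ℕ × ℕ) → List (List ℕ) → Bool
  | [], _ => true
  | (0, j) :: l, acc => Nat.blt j S.length &&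
      forceList (S.getD j ([], [], 0)).1 fun b =>
        acc.all (indepList p n b) && checkMoves p n S l (b :: acc)
  | (i + 1, j) :: l, acc => Nat.blt j S.length && Nat.blt i acc.length &&
      forceList (stepList p (S.getD j ([], [], 0)) (acc.getD i [])) fun b =>
        acc.all (indepList p n b) && checkMoves p n S l (b :: acc)

/-- The generators to the orbits of which the covectors belong. -/
def labelList : List (ℕ × ℕ) → List ℕ → List ℕ
  | [], acc => acc
  | (0, j) :: l, acc => labelList l (j :: acc)
  | (i + 1, _) :: l, acc => labelList l (acc.getD i 0 :: acc)

variable {D : GroupData}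

/-- The list reduces the covector. -/
def RedVec (φ : integralClosure ℤ ℂ →+* k) {n : ℕ} (β : Fin n → ℂ) (b : List ℕ) : Prop :=
  b.length = n ∧ ∀ i : Fin n, Red φ (β i) (b.getD i 0 : ℕ)

lemma dotList_eq {n : ℕ} : ∀ {a b : List ℕ}, a.length = n → b.length = n →
    dotList a b = ∑ i : Fin n, a.getD i 0 * b.getD i 0 := by
  induction n with
  | zero =>
    intro a b ha hb
    rw [List.length_eq_zero_iff] at ha
    subst ha
    simp [dotList]
  | succ n ih =>
    intro a b ha hb
    match a, b, ha, hb with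
    | x :: a, y :: b, ha, hb =>
      rw [dotList, Fin.sum_univ_succ, ih (by simpa using ha) (by simpa using hb)]
      simp

lemma combList_getD (p x y : ℕ) {n : ℕ} : ∀ {a b : List ℕ}, a.length = n → b.length = n →
    (combList p x y a b).length = n ∧ ∀ i : Fin n, (combList p x y a b).getD i 0 =
      (x * a.getD i 0 + y * b.getD i 0) % p := by
  induction n with
  | zero =>
    intro a b ha hb
    rw [List.length_eq_zero_iff] at ha
    subst ha
    simp [combList]
  | succ n ih =>
    intro a b ha hb
    match a, b, ha, hb with
    | x' :: a, y' :: b, ha, hb =>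
      obtain ⟨h1, h2⟩ := ih (a := a) (b := b) (by simpa using ha) (by simpa using hb)
      refine ⟨by simp [combList, h1], fun i => ?_⟩
      refine Fin.cases ?_ (fun i => ?_) i
      · simp [combList]
      · have := h2 i
        simpa [combList] using this

lemma dvd_cast_mod_sub (x p : ℕ) : (p : ℤ) ∣ (x : ℤ) - ((x % p : ℕ) : ℤ) := by
  rw [Int.natCast_mod]
  exact Int.dvd_self_sub_emod

lemma RedVec.dot [CharP k p] {n : ℕ} {β γ : Fin n → ℂ} {a b : List ℕ} (hβ : RedVec φ β a)
    (hγ : RedVec φ γ b) : Red φ (β ⬝ᵥ γ) (dotList a b : ℕ) := by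
  rw [dotList_eq hβ.1 hγ.1]
  push_cast
  exact Red.sum _ fun i _ => (hβ.2 i).mul (hγ.2 i)

/-- The covector `(α·σ) β + (ζ - 1) (β·σ) α`. -/
def stepVec {n : ℕ} (α σ : Fin n → ℂ) (ζ : ℂ) (β : Fin n → ℂ) : Fin n → ℂ :=
  (α ⬝ᵥ σ) • β + ((ζ - 1) * (β ⬝ᵥ σ)) • α

lemma RedVec.step [CharP k p] {n : ℕ} {α σ β : Fin n → ℂ} {ζ : ℂ} {s : RedRefl} {b : List ℕ}
    (hα : RedVec φ α s.1) (hσ : RedVec φ σ s.2.1) (hζ : Red φ (ζ - 1) (s.2.2 : ℕ))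
    (hβ : RedVec φ β b) : RedVec φ (stepVec α σ ζ β) (stepList p s b) := by
  obtain ⟨h1, h2⟩ := combList_getD p (dotList s.1 s.2.1 % p) (s.2.2 * dotList b s.2.1 % p)
    hβ.1 hα.1
  refine ⟨h1, fun i => ?_⟩
  rw [stepList, h2]
  refine Red.congr (p := p) ?_ (dvd_cast_mod_sub _ p)
  push_cast
  refine ((hα.dot (p := p) hσ).congr (p := p) ?_).mul (hβ.2 i) |>.add
    (((hζ.mul (hβ.dot (p := p) hσ)).congr (p := p) ?_).mul (hα.2 i))
  · exact_mod_cast dvd_cast_mod_sub _ p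
  · exact_mod_cast dvd_cast_mod_sub _ p

namespace GroupData

/-- The covector `β` lies in the orbit of the covector of `a`, up to a factor. -/
def OrbitForm (D : GroupData) (a : (Fin D.n → ℂ) × ℕ) (β : Fin D.n → ℂ) : Prop :=
  ∃ x ∈ D.group, ∃ c : ℂ, c ≠ 0 ∧ Matrix.vecMul β (x : Matrix (Fin D.n) (Fin D.n) ℂ) = c • a.1

lemma OrbitForm.inOrbit {a : (Fin D.n → ℂ) × ℕ} {β : Fin D.n → ℂ} (h : OrbitForm D a β) :
    InOrbit D a (kerForm β) := by
  obtain ⟨x, hx, c, hc, he⟩ := h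
  refine ⟨x, hx, fun v => ?_⟩
  rw [isForm_kerForm β, Matrix.dotProduct_mulVec, he, smul_dotProduct, smul_eq_mul]
  simp [hc]

/-- The reduction of a generator. -/
def GenRed (φ : integralClosure ℤ ℂ →+* k) (p : ℕ) {n : ℕ} (h : Matrix (Fin n) (Fin n) ℂ)
    (a : (Fin n → ℂ) × ℕ) (s : RedRefl) : Prop :=
  -- The factors `c` and `d` clear denominators. The number `s.2.2 + 1` is any root of unity of the
  -- given order modulo `p`; it need not be the reduction of the eigenvalue itself.
  ∃ c d : ℂ, c ≠ 0 ∧ d ≠ 0 ∧ RedVec φ (c • a.1) s.1 ∧ RedVec φ (d • sharp h a.1) s.2.1 ∧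
    ¬ p ∣ a.2 ∧ (p : ℤ) ∣ ((s.2.2 : ℤ) + 1) ^ a.2 - 1

/-- A power of the generating reflection is used whose eigenvalue reduces to the prescribed root of
unity. Since every power lies in the group, this root may be chosen freely for each generator. -/
lemma Basic.orbitForm_step (hD : D.Basic) [NeZero p] [CharP k p] {a : (Fin D.n → ℂ) × ℕ}
    {b : (Fin D.n → ℂ) × ℕ} (hb : b ∈ D.gens) {s : RedRefl} (hs : GenRed φ p D.h b s)
    {β : Fin D.n → ℂ} {B : List ℕ} (hβ : OrbitForm D a β) (hB : RedVec φ β B) :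
    ∃ β', OrbitForm D a β' ∧ RedVec φ β' (stepList p s B) := by
  obtain ⟨c, d, hc, hd, hA, hS, hpb, hz⟩ := hs
  obtain ⟨h0, h2⟩ := hD.gens b hb
  obtain ⟨g, hg, ζ, hζ, hgζ⟩ := hD.exists_gen hb
  obtain ⟨j, hj⟩ := exists_pow_red (φ := φ) (by omega) hpb hζ hz
  refine ⟨stepVec (c • b.1) (d • sharp D.h b.1) (ζ ^ j) β, ?_, ?_⟩
  · obtain ⟨x, hx, e, he, hxe⟩ := hβ
    have hN := hD.metric.normSq_ne_zero h0
    have h1 : ((g ^ j : Matrix.GeneralLinearGroup (Fin D.n) ℂ) : Matrix (Fin D.n) (Fin D.n) ℂ) =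
        unitaryRefl D.h b.1 (ζ ^ j) := by
      rw [Units.val_pow_eq_pow_val, hgζ, hD.metric.unitaryRefl_pow h0]
    -- `stepVec` is the image of `β` multiplied by a non-zero factor that removes the division by
    -- ‖α‖², so that it reduces modulo `p`.
    have h3 : stepVec (c • b.1) (d • sharp D.h b.1) (ζ ^ j) β = (c * d * normSq D.h b.1) •
        Matrix.vecMul β (unitaryRefl D.h b.1 (ζ ^ j)) := by
      rw [unitaryRefl, proj_eq, Matrix.vecMul_sub, Matrix.vecMul_one, Matrix.vecMul_smul,
        Matrix.vecMul_smul, Matrix.vecMul_vecMulVec, stepVec, ← dotProduct_sharp]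
      rw [← dotProduct_sharp] at hN
      ext i
      simp only [smul_dotProduct, dotProduct_smul, Pi.add_apply, Pi.sub_apply, Pi.smul_apply,
        smul_eq_mul]
      field_simp
      ring
    refine ⟨(g ^ j)⁻¹ * x, mul_mem (inv_mem (pow_mem hg j)) hx, c * d * normSq D.h b.1 * e,
      by positivity, ?_⟩
    rw [h3, ← h1, Matrix.smul_vecMul, Matrix.vecMul_vecMul, ← Units.val_mul, mul_inv_cancel_left,
      hxe, smul_smul]
  · refine hA.step hS ?_ hB
    refine (hj.sub Red.one).congr (p := p) ?_
    simp

lemma forall₂_getD {α β : Type*} {R : α → β → Prop} {l : List α} {m : List β}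
    (h : List.Forall₂ R l m) (a : α) (b : β) {i : ℕ} (hi : i < m.length) :
    l.getD i a ∈ l ∧ R (l.getD i a) (m.getD i b) := by
  have hi' : i < l.length := by rw [h.length_eq]; exact hi
  rw [List.getD_eq_getElem _ _ hi, List.getD_eq_getElem _ _ hi']
  exact ⟨List.getElem_mem _, List.forall₂_iff_get.mp h |>.2 i hi' hi⟩

/-- The covectors in the first list are reductions of covectors in the orbits of the generators in
the second list. -/
def Reduces (φ : integralClosure ℤ ℂ →+* k) (D : GroupData) (acc : List (List ℕ))
    (lab : List ℕ) : Prop :=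
  List.Forall₂ (fun b j => j < D.gens.length ∧ ∃ β, OrbitForm D (D.gens.getD j 0) β ∧
    RedVec φ β b) acc lab

/-- Induction along the moves: the reduced covectors and the labels of their orbits grow in
parallel, each reduced covector having a lift in the orbit of its label. -/
lemma Basic.reduces_of_checkMoves (hD : D.Basic) [NeZero p] [CharP k p] {S : List RedRefl}
    (hS : List.Forall₂ (GenRed φ p D.h) D.gens S) (moves : List (ℕ × ℕ)) :
    ∀ {acc : List (List ℕ)} {lab : List ℕ}, Reduces φ D acc lab →
      acc.Pairwise (fun b b' => indepList p D.n b b' = true) →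
      checkMoves p D.n S moves acc = true → ∃ acc', Reduces φ D acc' (labelList moves lab) ∧
        acc'.Pairwise (fun b b' => indepList p D.n b b' = true) := by
  induction moves with
  | nil => exact fun {acc lab} h hp _ => ⟨acc, h, hp⟩
  | cons m moves ih =>
    intro acc lab h hp hc
    match m with
    | (0, j) =>
      rw [checkMoves, forceList_eq, Bool.and_eq_true, Bool.and_eq_true, List.all_eq_true,
        Nat.blt_eq] at hc
      obtain ⟨hj, hall, hc⟩ := hc
      obtain ⟨hmem, c, d, hc0, hd0, hA, -⟩ := forall₂_getD hS 0 ([], [], 0) hj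
      rw [labelList]
      refine ih (List.Forall₂.cons ⟨by rwa [hS.length_eq], _, ?_, hA⟩ h)
        (List.pairwise_cons.mpr ⟨hall, hp⟩) hc
      exact ⟨1, one_mem _, c, hc0, by simp⟩
    | (i + 1, j) =>
      rw [checkMoves, forceList_eq, Bool.and_eq_true, Bool.and_eq_true, Bool.and_eq_true,
        List.all_eq_true, Nat.blt_eq, Nat.blt_eq] at hc
      obtain ⟨⟨hj, hi⟩, hall, hc⟩ := hc
      obtain ⟨hmem, hgen⟩ := forall₂_getD hS 0 ([], [], 0) hj
      rw [h.length_eq] at hi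
      obtain ⟨-, hlt, β, hβ, hB⟩ := forall₂_getD h [] 0 hi
      rw [labelList]
      exact ih (List.Forall₂.cons ⟨hlt, hD.orbitForm_step hmem hgen hβ hB⟩ h)
        (List.pairwise_cons.mpr ⟨hall, hp⟩) hc

/-- Equal kernels make all 2×2 minors vanish, and this survives reduction. A minor that is non-zero
modulo `p` therefore separates the hyperplanes; the converse is not needed. -/
lemma not_kerForm_eq [CharP k p] {n : ℕ} {β γ : Fin n → ℂ} {b c : List ℕ}
    (hb : RedVec φ β b) (hc : RedVec φ γ c) (h : indepList p n b c = true) :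
    kerForm β ≠ kerForm γ := by
  intro he
  have hprop : ∀ i j, β i * γ j - β j * γ i = 0 := by
    intro i j
    by_cases hβ : β = 0
    · simp [hβ]
    by_cases hγ : γ = 0
    · simp [hγ]
    obtain ⟨s, -, hs⟩ := exists_smul_of_ker_eq hβ hγ fun v hv => by
      rw [← isForm_kerForm γ, ← he, isForm_kerForm β]
      exact hv
    simp only [hs, Pi.smul_apply, smul_eq_mul]
    ring
  simp only [indepList, List.any_eq_true, List.mem_range, Bool.not_eq_true', beq_eq_false_iff_ne]
    at h
  obtain ⟨i, hi, j, hj, hne⟩ := h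
  apply hne
  have h1 := ((hb.2 ⟨i, hi⟩).mul (hc.2 ⟨j, hj.trans hi⟩)).sub
    ((hb.2 ⟨j, hj.trans hi⟩).mul (hc.2 ⟨i, hi⟩))
  rw [hprop] at h1
  have h2 := h1.dvd (p := p)
  have h4 := (Int.emod_eq_emod_iff_emod_sub_eq_zero).mpr (Int.emod_eq_zero_of_dvd h2)
  exact_mod_cast h4

lemma sum_getD {α : Type*} [AddCommMonoid α] (l : List ℕ) (f : ℕ → α) :
    ∑ i : Fin l.length, f (l.getD i 0) = (l.map f).sum := by
  rw [← List.sum_ofFn]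
  congr 1
  apply List.ext_getElem <;> simp

/-- A list of moves that passes the check yields a complete family of mirrors. -/
lemma Basic.exists_mirrorFamily (hD : D.Basic) (p : ℕ) [Fact p.Prime] (moves : List (ℕ × ℕ))
    (h : ∀ (k : Type) [Field k] [CharP k p] (φ : integralClosure ℤ ℂ →+* k),
      ∃ S, List.Forall₂ (GenRed φ p D.h) D.gens S ∧ checkMoves p D.n S moves [] = true)
    (hsum : ((labelList moves []).map fun j => (D.gens.getD j 0).2 - 1).sum =
      ∑ l, (D.deg l - 1)) :
    ∃ F : MirrorFamily D (Fin (labelList moves []).length),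
      ∀ i, F.gen i = D.gens.getD ((labelList moves []).getD i 0) 0 := by
  obtain ⟨k, _, _, ⟨φ⟩⟩ := exists_residueField p
  obtain ⟨S, hS, hc⟩ := h k φ
  obtain ⟨acc, hr, hp⟩ := hD.reduces_of_checkMoves hS moves List.Forall₂.nil List.Pairwise.nil hc
  have hf : ∀ i : Fin (labelList moves []).length, _ :=
    fun i => (forall₂_getD hr [] 0 i.2).2
  choose hlt β hβ hB using hf
  refine ⟨⟨fun i => kerForm (β i), fun i => D.gens.getD ((labelList moves []).getD i 0) 0,
    fun i => ?_, fun i => (hβ i).inOrbit, ?_, ?_⟩, fun i => rfl⟩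
  · rw [List.getD_eq_getElem _ _ (hlt i)]
    exact List.getElem_mem _
  · have key : ∀ i j : Fin (labelList moves []).length, i < j → kerForm (β i) ≠ kerForm (β j) := by
      intro i j hij
      refine not_kerForm_eq (p := p) (hB i) (hB j) ?_
      have hi : (i : ℕ) < acc.length := by rw [hr.length_eq]; exact i.2
      have hj : (j : ℕ) < acc.length := by rw [hr.length_eq]; exact j.2
      rw [List.getD_eq_getElem _ _ hi, List.getD_eq_getElem _ _ hj]
      exact List.pairwise_iff_getElem.mp hp i j hi hj hij
    intro i j hij
    by_contra hne
    rcases lt_or_gt_of_ne hne with h1 | h1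
    · exact key i j h1 hij
    · exact key j i h1 hij.symm
  · rw [← hsum]
    exact sum_getD (labelList moves []) fun j => (D.gens.getD j 0).2 - 1

/-- The theorem follows from a list of moves and from the local conditions at the generators. -/
lemma Basic.conclusion_of_moves (hD : D.Basic) (moves : List (ℕ × ℕ))
    (F : MirrorFamily D (Fin (labelList moves []).length))
    (hF : ∀ i, F.gen i = D.gens.getD ((labelList moves []).getD i 0) 0)
    (hgood : ∀ i, GoodAt D (F.gen i).1 ((F.gen i).2 - 1) ((F.gen i).2 / D.N))
    (hcard : (labelList moves []).length = (D.table.map Prod.snd).sum)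
    (htable : ∀ a ∈ D.table, ((labelList moves []).map fun j =>
      if (D.gens.getD j 0).2 = a.1 then 1 else 0).sum = a.2) : D.Conclusion := by
  refine hD.conclusion F hgood (by rw [Fintype.card_fin, hcard]) fun a ha => ?_
  rw [Finset.card_filter, ← htable a ha, ← sum_getD]
  exact Finset.sum_congr rfl fun i _ => by rw [hF]

end GroupData

end Reduction

/-! ## The constants -/

section Constants

lemma ofReal_sqrt_sq {x : ℝ} (hx : 0 ≤ x) : ((Real.sqrt x : ℝ) : ℂ) ^ 2 = x := by
  rw [← Complex.ofReal_pow, Real.sq_sqrt hx]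

lemma r2_sq : r2 ^ 2 = 2 := by simpa [r2] using ofReal_sqrt_sq (x := 2) (by norm_num)

lemma r3_sq : r3 ^ 2 = 3 := by simpa [r3] using ofReal_sqrt_sq (x := 3) (by norm_num)

lemma r5_sq : r5 ^ 2 = 5 := by simpa [r5] using ofReal_sqrt_sq (x := 5) (by norm_num)

lemma r15_eq : r15 = r3 * r5 := by
  rw [r15, r3, r5, ← Complex.ofReal_mul, ← Real.sqrt_mul (by norm_num)]
  norm_num

lemma lam_sq : lam ^ 2 = 10 - 2 * r5 := by
  have h : Real.sqrt 5 ≤ 5 := by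
    rw [Real.sqrt_le_left (by norm_num)]
    norm_num
  rw [lam, ofReal_sqrt_sq (by linarith), r5]
  push_cast
  rfl

@[simp] lemma star_r2 : star r2 = r2 := Complex.conj_ofReal _

@[simp] lemma star_r3 : star r3 = r3 := Complex.conj_ofReal _

@[simp] lemma star_r5 : star r5 = r5 := Complex.conj_ofReal _

@[simp] lemma star_r15 : star r15 = r15 := Complex.conj_ofReal _

@[simp] lemma star_lam : star lam = lam := Complex.conj_ofReal _

@[simp] lemma star_I : star Complex.I = -Complex.I := Complex.conj_I

lemma isPrimitiveRoot_zeta {m : ℕ} (hm : m ≠ 0) : IsPrimitiveRoot (zeta m) m :=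
  Complex.isPrimitiveRoot_exp m hm

lemma zeta_pow {m : ℕ} (hm : m ≠ 0) : zeta m ^ m = 1 := (isPrimitiveRoot_zeta hm).pow_eq_one

lemma zeta_ne_zero (m : ℕ) : zeta m ≠ 0 := Complex.exp_ne_zero _

end Constants

/-! ## Binary covariants -/

section Covariants

/-- The Jacobian determinant of two binary forms. -/
def jac2 (f f' : MvPolynomial (Fin 2) ℂ) : MvPolynomial (Fin 2) ℂ :=
  pderiv 0 f * pderiv 1 f' - pderiv 1 f * pderiv 0 f'

/-- The Hessian determinant of a binary form. -/
def hess2 (f : MvPolynomial (Fin 2) ℂ) : MvPolynomial (Fin 2) ℂ :=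
  pderiv 0 (pderiv 0 f) * pderiv 1 (pderiv 1 f) - pderiv 0 (pderiv 1 f) ^ 2

lemma jac2_subst (g : Matrix (Fin 2) (Fin 2) ℂ) (f f' : MvPolynomial (Fin 2) ℂ) :
    jac2 (subst g f) (subst g f') = C g.det * subst g (jac2 f f') := by
  simp only [jac2, pderiv_subst, Fin.sum_univ_two, Matrix.det_fin_two, map_sub, map_mul]
  ring

lemma hess2_subst (g : Matrix (Fin 2) (Fin 2) ℂ) (f : MvPolynomial (Fin 2) ℂ) :
    hess2 (subst g f) = C (g.det ^ 2) * subst g (hess2 f) := by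
  simp only [hess2, pderiv_subst, Fin.sum_univ_two, Matrix.det_fin_two, map_sub, map_mul, map_add,
    pderiv_C_mul, map_pow, pderiv_comm' 1 0]
  ring

lemma jac2_C_mul (a b : ℂ) (f f' : MvPolynomial (Fin 2) ℂ) :
    jac2 (C a * f) (C b * f') = C (a * b) * jac2 f f' := by
  simp only [jac2, pderiv_C_mul, map_mul]
  ring

lemma hess2_C_mul (a : ℂ) (f : MvPolynomial (Fin 2) ℂ) :
    hess2 (C a * f) = C (a ^ 2) * hess2 f := by
  simp only [hess2, pderiv_C_mul, map_pow]
  ring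

/-- Covariants of semi-invariants are semi-invariants, with the character corrected by the
determinant. Hence only one ground form has to be examined in the frames. -/
lemma subst_jac2 {s : Matrix (Fin 2) (Fin 2) ℂ} (hs : s.det ≠ 0) {f f' : MvPolynomial (Fin 2) ℂ}
    {χ χ' : ℂ} (hf : subst s f = C χ * f) (hf' : subst s f' = C χ' * f') :
    subst s (jac2 f f') = C (χ * χ' / s.det) * jac2 f f' := by
  have h := jac2_subst s f f'
  rw [hf, hf', jac2_C_mul] at h
  rw [div_eq_inv_mul, C_mul, mul_assoc, h, ← mul_assoc, ← C_mul, inv_mul_cancel₀ hs, C_1, one_mul]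

lemma subst_hess2 {s : Matrix (Fin 2) (Fin 2) ℂ} (hs : s.det ≠ 0) {f : MvPolynomial (Fin 2) ℂ}
    {χ : ℂ} (hf : subst s f = C χ * f) :
    subst s (hess2 f) = C (χ ^ 2 / s.det ^ 2) * hess2 f := by
  have h := hess2_subst s f
  rw [hf, hess2_C_mul] at h
  rw [div_eq_inv_mul, C_mul, mul_assoc, h, ← mul_assoc, ← C_mul,
    inv_mul_cancel₀ (pow_ne_zero 2 hs), C_1, one_mul]

/-- The Jacobian determinant of `f` and of a polynomial in `f` and `f'`. -/
lemma jac2_pow_add (f f' : MvPolynomial (Fin 2) ℂ) (k m : ℕ) (c : ℂ) :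
    jac2 f (f' ^ k + C c * f ^ m) = C (k : ℂ) * f' ^ (k - 1) * jac2 f f' := by
  have h : (C (k : ℂ) : MvPolynomial (Fin 2) ℂ) = (k : MvPolynomial (Fin 2) ℂ) := map_natCast C k
  simp only [jac2, map_add, pderiv_C_mul, Derivation.leibniz_pow, nsmul_eq_mul, smul_eq_mul, h]
  ring

lemma jac2_pow_add_ne_zero {f f' : MvPolynomial (Fin 2) ℂ} {k : ℕ} (hk : k ≠ 0) (m : ℕ) (c : ℂ)
    (h : jac2 f f' ≠ 0) : jac2 f (f' ^ k + C c * f ^ m) ≠ 0 := by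
  rw [jac2_pow_add]
  have h0 : f' ≠ 0 := by
    rintro rfl
    exact h (by simp [jac2])
  exact mul_ne_zero (mul_ne_zero (by simpa using hk) (pow_ne_zero _ h0)) h

lemma jac2_comm (f f' : MvPolynomial (Fin 2) ℂ) : jac2 f f' = -jac2 f' f := by
  simp only [jac2]
  ring

lemma jac2_ne_zero_comm {f f' : MvPolynomial (Fin 2) ℂ} (h : jac2 f f' ≠ 0) : jac2 f' f ≠ 0 := by
  rw [jac2_comm]
  exact neg_ne_zero.mpr h

lemma subst_reflection_of_frame {β : Fin 2 → ℂ} (hβ : β ≠ 0) {m : ℕ} {χ : ℂ}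
    {f : MvPolynomial (Fin 2) ℂ} (hf : subst (diagRefl 0 (zeta m)) (subst (frame β) f) =
      C χ * subst (frame β) f) : subst (reflection 1 β m) f = C χ * f := by
  refine subst_unitaryRefl_of_adapted isMetric_one hβ ?_ (vecMul_frame β) (frame_zero β) hf
  rw [det_frame]
  exact isMetric_one.normSq_ne_zero hβ

lemma det_reflection_two {β : Fin 2 → ℂ} (hβ : β ≠ 0) (m : ℕ) :
    (reflection 1 β m).det = zeta m := isMetric_one.det_unitaryRefl hβ _

/-- The substitution of the adapted frame, as a polynomial function. -/
lemma eval_subst_frame (β : Fin 2 → ℂ) (f : MvPolynomial (Fin 2) ℂ) (p : Fin 2 → ℂ) :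
    eval p (subst (frame β) f) =
      eval ![star (β 0) * p 0 - β 1 * p 1, star (β 1) * p 0 + β 0 * p 1] f := by
  have h : (frame β).mulVec p =
      ![star (β 0) * p 0 - β 1 * p 1, star (β 1) * p 0 + β 0 * p 1] := by
    ext i
    fin_cases i <;> simp [frame, Matrix.mulVec, dotProduct, Fin.sum_univ_two, sub_eq_add_neg]
  rw [eval_subst, h]

end Covariants

/-! ## Tools for the verification of the groups -/

/-- A polynomial function which scales like a homogeneous one comes from a homogeneous
polynomial. -/
lemma isHomogeneous_of_eval {n d : ℕ} {f : MvPolynomial (Fin n) ℂ}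
    (h : ∀ (t : ℂ) (p : Fin n → ℂ), eval (t • p) f = t ^ d * eval p f) : f.IsHomogeneous d := by
  have hdec := sum_homogeneousComponent f
  have key : ∀ i, i ≠ d → homogeneousComponent i f = 0 := by
    intro i hi
    by_cases hlt : i ∈ Finset.range (f.totalDegree + 1)
    swap
    · apply homogeneousComponent_eq_zero
      simpa [Nat.lt_succ_iff] using hlt
    apply MvPolynomial.funext
    intro p
    rw [map_zero]
    -- For fixed `p` both sides of the scaling relation are polynomials in `t`; comparing
    -- coefficients kills the components of degree other than `d`.
    have hq : ∑ j ∈ Finset.range (f.totalDegree + 1),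
        Polynomial.C (eval p (homogeneousComponent j f)) * Polynomial.X ^ j -
        Polynomial.C (eval p f) * Polynomial.X ^ d = 0 := by
      apply Polynomial.funext
      intro t
      have h1 := h t p
      rw [← hdec, map_sum] at h1
      simp only [eval_smul_of_isHomogeneous (homogeneousComponent_isHomogeneous _ f)] at h1
      rw [hdec] at h1
      simp only [Polynomial.eval_sub, Polynomial.eval_finsetSum, Polynomial.eval_mul,
        Polynomial.eval_C, Polynomial.eval_pow, Polynomial.eval_X, Polynomial.eval_zero]
      rw [sub_eq_zero, mul_comm (eval p f), ← h1]
      exact Finset.sum_congr rfl fun j _ => mul_comm _ _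
    have h2 := congrArg (fun q => Polynomial.coeff q i) hq
    simp only [Polynomial.coeff_sub, Polynomial.finsetSum_coeff, Polynomial.coeff_C_mul,
      Polynomial.coeff_X_pow, Polynomial.coeff_zero, mul_ite, mul_one, mul_zero, hi, if_false,
      sub_zero, Finset.sum_ite_eq, hlt, if_true] at h2
    exact h2
  have : f = homogeneousComponent d f := by
    conv_lhs => rw [← hdec]
    by_cases hd : d ∈ Finset.range (f.totalDegree + 1)
    · exact Finset.sum_eq_single d (fun i _ hi => key i hi) (fun h0 => absurd hd h0)
    · rw [Finset.sum_eq_zero fun i hi => key i (fun e => hd (e ▸ hi)),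
        homogeneousComponent_eq_zero]
      simpa [Nat.lt_succ_iff] using hd
  rw [this]
  exact homogeneousComponent_isHomogeneous d f

/-! ### Reduction of the generators -/

section Reduction

variable {k : Type} [Field k] {p : ℕ} {φ : integralClosure ℤ ℂ →+* k}

/-- The residue of an integer. -/
def residue (p : ℕ) (x : ℤ) : ℕ := (x % p).toNat

lemma Red.residue [CharP k p] (hp : p ≠ 0) {z : ℂ} {x : ℤ} (h : Red φ z x) :
    Red φ z (residue p x : ℕ) := by
  apply h.congr (p := p)
  rw [ReflectionDuality.residue, Int.toNat_of_nonneg (Int.emod_nonneg _ (by exact_mod_cast hp))]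
  exact Int.dvd_self_sub_emod

lemma Red.of_eq {z w : ℂ} {x : ℤ} (h : Red φ z x) (e : w = z) : Red φ w x := e ▸ h

lemma genRed_two [CharP k p] (c d : ℂ) {α : Fin 2 → ℂ} {m : ℕ} {x₀ x₁ y₀ y₁ : ℤ}
    (h₀ : Red φ (c * α 0) x₀) (h₁ : Red φ (c * α 1) x₁) (k₀ : Red φ (d * star (α 0)) y₀)
    (k₁ : Red φ (d * star (α 1)) y₁) (z : ℕ) (hz : p ≠ 0 ∧ ¬ p ∣ m ∧ (p : ℤ) ∣ ((z : ℤ) + 1) ^ m - 1)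
    (hc : c ≠ 0) (hd : d ≠ 0) :
    GroupData.GenRed φ p (1 : Matrix (Fin 2) (Fin 2) ℂ) (α, m)
      ([residue p x₀, residue p x₁], [residue p y₀, residue p y₁], z) := by
  refine ⟨c, d, hc, hd, ⟨rfl, fun i => ?_⟩, ⟨rfl, fun i => ?_⟩, hz.2⟩
  · fin_cases i
    · exact h₀.residue hz.1
    · exact h₁.residue hz.1
  · fin_cases i
    · simpa [sharp_one] using k₀.residue hz.1
    · simpa [sharp_one] using k₁.residue hz.1

end Reduction

/-! ### Groups of rank two -/

section RankTwo

variable {gens : List ((Fin 2 → ℂ) × ℕ)} {deg : Fin 2 → ℕ}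
  {u : Fin 2 → MvPolynomial (Fin 2) ℂ} {N : ℕ} {table : List (ℕ × ℕ)}

lemma basic_two (hgens : ∀ a ∈ gens, a.1 ≠ 0 ∧ 2 ≤ a.2 ∧
      ∀ l, subst (reflection 1 a.1 a.2) (u l) = u l)
    (hom : ∀ l, (u l).IsHomogeneous (deg l)) (two_le : ∀ l, 2 ≤ deg l)
    (hjac : jac2 (u 0) (u 1) ≠ 0) : (dataTwo gens deg u N table).Basic where
  metric := isMetric_one
  gens a ha := ⟨(hgens a ha).1, (hgens a ha).2.1⟩
  inv a ha := (hgens a ha).2.2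
  hom := hom
  two_le := two_le
  jac_ne := by
    rw [Matrix.det_fin_two]
    exact hjac

/-- At most two labels occur. The local condition is required for label `j` only, and the sum of the
residues settles label `i`; when `i = j` nothing local is left to verify. -/
lemma conclusion_two (hD : (dataTwo gens deg u N table).Basic) (p : ℕ) [Fact p.Prime]
    (moves : List (ℕ × ℕ))
    (h : ∀ (k : Type) [Field k] [CharP k p] (φ : integralClosure ℤ ℂ →+* k),
      ∃ S, List.Forall₂ (GroupData.GenRed φ p (1 : Matrix (Fin 2) (Fin 2) ℂ)) gens S ∧
        checkMoves p 2 S moves [] = true) (i j : ℕ)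
    (hnum : (((labelList moves []).map fun j => (gens.getD j 0).2 - 1).sum = ∑ l, (deg l - 1)) ∧
      ((labelList moves []).length = (table.map Prod.snd).sum) ∧
      (∀ a ∈ table, ((labelList moves []).map fun j =>
        if (gens.getD j 0).2 = a.1 then 1 else 0).sum = a.2) ∧
      N ≠ 0 ∧ ((labelList moves []).map fun j => (gens.getD j 0).2).sum = 2 * N ∧
      (∀ t ∈ labelList moves [], t = i ∨ t = j))
    (hgood : i = j ∨ (dataTwo gens deg u N table).GoodAt (gens.getD j 0).1
      ((gens.getD j 0).2 - 1) ((gens.getD j 0).2 / N)) :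
    (dataTwo gens deg u N table).Conclusion := by
  obtain ⟨hsum, hcard, htable, hN, hsum2, hlab⟩ := hnum
  obtain ⟨F, hF⟩ := hD.exists_mirrorFamily p moves h hsum
  refine hD.conclusion_of_moves moves F hF ?_ hcard htable
  refine goodAt_two hD F hN ?_ (gens.getD i 0) fun t => ?_
  · rw [← hsum2, ← GroupData.sum_getD]
    exact Finset.sum_congr rfl fun i _ => by rw [hF]
  · rw [hF]
    have hmem : (labelList moves []).getD t 0 ∈ labelList moves [] := by
      rw [List.getD_eq_getElem _ _ t.2]
      exact List.getElem_mem _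
    rcases hlab _ hmem with h1 | h1
    · exact Or.inl (by rw [h1])
    · rw [h1]
      rcases hgood with h2 | h2
      · exact Or.inl (by rw [h2])
      · exact Or.inr h2

/-- `f = V z ^ d + W x ^ κ z ^ (d - κ) + …` -/
def Expand (κ d : ℕ) (f : MvPolynomial (Fin 2) ℂ) (V W : ℂ) : Prop :=
  ∃ b, f = C V * X 1 ^ d + X 0 ^ κ * b ∧ eval ![0, 1] b = W

section Expand

variable {κ d d' : ℕ} {f f' : MvPolynomial (Fin 2) ℂ} {V V' W W' : ℂ}

lemma Expand.add (hf : Expand κ d f V W) (hf' : Expand κ d f' V' W') :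
    Expand κ d (f + f') (V + V') (W + W') := by
  obtain ⟨b, rfl, rfl⟩ := hf
  obtain ⟨b', rfl, rfl⟩ := hf'
  exact ⟨b + b', by rw [C_add]; ring, by simp⟩

lemma Expand.C_mul (hf : Expand κ d f V W) (c : ℂ) :
    Expand κ d (C c * f) (c * V) (c * W) := by
  obtain ⟨b, rfl, rfl⟩ := hf
  exact ⟨C c * b, by rw [MvPolynomial.C_mul]; ring, by simp⟩

lemma Expand.mul (hκ : κ ≠ 0) (hf : Expand κ d f V W) (hf' : Expand κ d' f' V' W') :
    Expand κ (d + d') (f * f') (V * V') (V * W' + W * V') := by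
  obtain ⟨b, rfl, rfl⟩ := hf
  obtain ⟨b', rfl, rfl⟩ := hf'
  refine ⟨C V * X 1 ^ d * b' + b * (C V' * X 1 ^ d') + X 0 ^ κ * (b * b'), ?_, ?_⟩
  · rw [MvPolynomial.C_mul]; ring
  · simp [hκ]

lemma Expand.pow (hκ : κ ≠ 0) (hf : Expand κ d f V W) (j : ℕ) :
    Expand κ (d * j) (f ^ j) (V ^ j) (j * V ^ (j - 1) * W) := by
  induction j with
  | zero => exact ⟨0, by simp, by simp⟩
  | succ j ih =>
    have h := ih.mul hκ hf
    rw [pow_succ f, mul_add d, mul_one]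
    convert h using 1
    · ring
    · rcases j with _ | j
      · simp
      · push_cast
        ring

end Expand

/-- The local conditions at a generator, from the lowest terms of the coordinates. -/
lemma goodAt_two_of_expand (hD : (dataTwo gens deg u N table).Basic) {a} (ha : a ∈ gens)
    {V W : Fin 2 → ℂ} (hv : ∀ l, Expand a.2 (deg l) (subst (frame a.1) (u l)) (V l) (W l)) {r : ℂ}
    (h : (((a.2 : ℂ) - 1) / ((deg 0 : ℂ) - 1) - r) * W 0 * (deg 1 * V 1) =
      (((a.2 : ℂ) - 1) / ((deg 1 : ℂ) - 1) - r) * W 1 * (deg 0 * V 0)) :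
    (dataTwo gens deg u N table).GoodAt a.1 (a.2 - 1) r := by
  have h2 := (hD.gens a ha).2
  choose b hb hbW using hv
  have e1 : ((a.2 : ℕ) : MvPolynomial (Fin 2) ℂ) = C (a.2 : ℂ) := (map_natCast C _).symm
  have hw : ∀ l, pderiv 0 (subst (frame a.1) (u l)) =
      X 0 ^ (a.2 - 1) * (C (a.2 : ℂ) * b l + X 0 * pderiv 0 (b l)) := by
    intro l
    obtain ⟨j, hj⟩ : ∃ j, a.2 = j + 1 := ⟨a.2 - 1, by omega⟩
    rw [hb, ← e1, hj]
    simp only [map_add, pderiv_C, Derivation.leibniz, Derivation.leibniz_pow, pderiv_X_self,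
      pderiv_X_of_ne (show (1 : Fin 2) ≠ 0 by decide), smul_eq_mul, nsmul_eq_mul,
      Nat.add_sub_cancel]
    push_cast
    ring
  have hz : ∀ l, eval ![0, 1] (pderiv 1 (subst (frame a.1) (u l))) = deg l * V l := by
    intro l
    rw [hb]
    simp only [map_add, pderiv_C, Derivation.leibniz, Derivation.leibniz_pow, pderiv_X_self,
      pderiv_X_of_ne (show (0 : Fin 2) ≠ 1 by decide), smul_eq_mul, nsmul_eq_mul]
    simp [show a.2 ≠ 0 by omega]
    ring
  apply goodAt_two_of_eval hD ha hw
  obtain ⟨a0, a1⟩ := adjugate_zero_apply fun l => subst (frame a.1) (u l)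
  rw [Fin.sum_univ_two, a0, a1]
  simp only [map_add, map_mul, map_neg, eval_C, eval_X, hz, hbW, Matrix.cons_val_zero, zero_mul,
    add_zero]
  push_cast [Nat.cast_sub (show 1 ≤ a.2 by omega)]
  linear_combination (a.2 : ℂ) * h

lemma frame_one_zero : frame ![1, 0] = 1 := by
  ext i j
  fin_cases i <;> fin_cases j <;> simp [frame]

end RankTwo

@[simp] lemma pderiv_ofNat {n : ℕ} (i : Fin n) (a : ℕ) [a.AtLeastTwo] :
    pderiv i (ofNat(a) : MvPolynomial (Fin n) ℂ) = 0 := by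
  rw [← map_ofNat C, pderiv_C]

/-! ## Tetrahedral and octahedral forms -/

section Octahedral

lemma I_pow_three : Complex.I ^ 3 = -Complex.I := Complex.I_pow_three

lemma I_pow_five : Complex.I ^ 5 = Complex.I := by
  linear_combination Complex.I * Complex.I_pow_four

lemma I_pow_six : Complex.I ^ 6 = -1 := by
  linear_combination Complex.I ^ 2 * Complex.I_pow_four + Complex.I_sq

lemma r3_pow_three : r3 ^ 3 = 3 * r3 := by linear_combination r3 * r3_sq

lemma r3_pow_four : r3 ^ 4 = 9 := by linear_combination (r3 ^ 2 + 3) * r3_sq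

lemma r3_pow_five : r3 ^ 5 = 9 * r3 := by linear_combination (r3 ^ 3 + 3 * r3) * r3_sq

lemma r3_pow_six : r3 ^ 6 = 27 := by linear_combination (r3 ^ 4 + 3 * r3 ^ 2 + 9) * r3_sq

set_option maxRecDepth 100000 in
-- In a frame adapted to a mirror of order three only exponents of X_0 divisible by three survive,
-- which makes the invariance visible and yields the lowest terms along the mirror.
lemma subst_frame_f6 : subst (frame ![1, (1 - r3) / 2 * (1 + Complex.I)]) f6 =
    C ((6 * r3 - 10) * (Complex.I - 1)) * X 0 ^ 6 +
    C ((60 * r3 - 100) * Complex.I) * X 0 ^ 3 * X 1 ^ 3 +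
    C ((10 - 6 * r3) * (Complex.I + 1)) * X 1 ^ 6 := by
  apply MvPolynomial.funext
  intro p
  rw [eval_subst_frame]
  simp [f6]
  ring_nf
  simp only [Complex.I_sq, I_pow_three, Complex.I_pow_four, I_pow_five, I_pow_six, r3_sq,
    r3_pow_three, r3_pow_four, r3_pow_five, r3_pow_six]
  ring

set_option maxRecDepth 100000 in
lemma subst_frame_f6_neg : subst (frame ![-1 - Complex.I, r3 - 1]) f6 =
    C ((48 * r3 - 80) * (1 - Complex.I)) * X 0 ^ 6 +
    C ((800 - 480 * r3) * Complex.I) * X 0 ^ 3 * X 1 ^ 3 +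
    C ((48 * r3 - 80) * (Complex.I + 1)) * X 1 ^ 6 := by
  apply MvPolynomial.funext
  intro p
  rw [eval_subst_frame]
  simp [f6]
  ring_nf
  simp only [Complex.I_sq, I_pow_three, Complex.I_pow_four, I_pow_five, I_pow_six, r3_sq,
    r3_pow_three, r3_pow_four, r3_pow_five, r3_pow_six]
  ring

set_option maxRecDepth 100000 in
lemma subst_frame_f6_pos : subst (frame ![1 - Complex.I, r3 + 1]) f6 =
    C (-(48 * r3 + 80) * (Complex.I + 1)) * X 0 ^ 6 +
    C (-(480 * r3 + 800) * Complex.I) * X 0 ^ 3 * X 1 ^ 3 +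
    C ((48 * r3 + 80) * (Complex.I - 1)) * X 1 ^ 6 := by
  apply MvPolynomial.funext
  intro p
  rw [eval_subst_frame]
  simp [f6]
  ring_nf
  simp only [Complex.I_sq, I_pow_three, Complex.I_pow_four, I_pow_five, I_pow_six, r3_sq,
    r3_pow_three, r3_pow_four, r3_pow_five, r3_pow_six]
  ring

set_option maxRecDepth 100000 in
lemma subst_frame_phi4 : subst (frame ![1, (1 - r3) / 2 * (1 + Complex.I)]) phi4 =
    C (8 * r3 - 12) * X 0 ^ 4 + C ((16 * r3 - 24) * (Complex.I - 1)) * X 0 * X 1 ^ 3 := by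
  apply MvPolynomial.funext
  intro p
  rw [eval_subst_frame]
  simp [phi4]
  ring_nf
  simp only [Complex.I_sq, I_pow_three, Complex.I_pow_four, I_pow_five, r3_sq, r3_pow_three,
    r3_pow_four, r3_pow_five]
  ring

set_option maxRecDepth 100000 in
lemma subst_frame_phi4_neg : subst (frame ![-1 - Complex.I, r3 - 1]) phi4 =
    C ((96 - 64 * r3) * (Complex.I + 1)) * X 0 ^ 3 * X 1 + C (48 - 32 * r3) * X 1 ^ 4 := by
  apply MvPolynomial.funext
  intro p
  rw [eval_subst_frame]
  simp [phi4]
  ring_nf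
  simp only [Complex.I_sq, I_pow_three, Complex.I_pow_four, I_pow_five, r3_sq, r3_pow_three,
    r3_pow_four, r3_pow_five]
  ring

set_option maxRecDepth 100000 in
lemma subst_frame_phi4_pos : subst (frame ![1 - Complex.I, r3 + 1]) phi4 =
    C ((64 * r3 + 96) * (1 - Complex.I)) * X 0 ^ 3 * X 1 + C (32 * r3 + 48) * X 1 ^ 4 := by
  apply MvPolynomial.funext
  intro p
  rw [eval_subst_frame]
  simp [phi4]
  ring_nf
  simp only [Complex.I_sq, I_pow_three, Complex.I_pow_four, I_pow_five, r3_sq, r3_pow_three,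
    r3_pow_four, r3_pow_five]
  ring

lemma subst_frame_f6_one : subst (frame ![1, 1]) f6 =
    C (-8) * X 0 ^ 5 * X 1 + C 8 * X 0 * X 1 ^ 5 := by
  apply MvPolynomial.funext
  intro p
  rw [eval_subst_frame]
  simp [f6]
  ring

/-- In the frame adapted to a mirror of order two. -/
lemma subst_frame_f6_sqrt {ε : ℂ} (hε : ε = 1 ∨ ε = -1) {b : ℂ} (hb : b = ε * (r2 - 1)) :
    subst (frame ![1, b]) f6 = C (ε * (28 * r2 - 40)) * (-X 0 ^ 6 + 5 * X 0 ^ 4 * X 1 ^ 2 +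
      5 * X 0 ^ 2 * X 1 ^ 4 - X 1 ^ 6) := by
  have h3 : r2 ^ 3 = 2 * r2 := by linear_combination r2 * r2_sq
  have h4 : r2 ^ 4 = 4 := by linear_combination (r2 ^ 2 + 2) * r2_sq
  have h5 : r2 ^ 5 = 4 * r2 := by linear_combination (r2 ^ 3 + 2 * r2) * r2_sq
  have h6 : r2 ^ 6 = 8 := by linear_combination (r2 ^ 4 + 2 * r2 ^ 2 + 4) * r2_sq
  apply MvPolynomial.funext
  intro p
  rw [eval_subst_frame]
  rcases hε with rfl | rfl <;>
  · simp only [f6, hb, Matrix.cons_val_zero, Matrix.cons_val_one, star_one, star_sub, star_mul',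
      star_neg, star_r2, map_add, map_sub, map_mul, map_pow, map_neg, eval_X, eval_C, map_ofNat]
    ring_nf
    simp only [r2_sq, h3, h4, h5, h6]
    ring

/-- Together with the next identity this presents `h8` and `t12` as covariants of `f6`, so that the
action of a reflection on `f6` determines its action on all three. -/
lemma hess2_f6 : hess2 f6 = C (-25) * h8 := by
  apply MvPolynomial.funext
  intro p
  simp [hess2, f6, h8, Derivation.leibniz, Derivation.leibniz_pow]
  ring

lemma jac2_f6_h8 : jac2 f6 h8 = C (-8) * t12 := by
  apply MvPolynomial.funext
  intro p
  simp [jac2, f6, h8, t12, Derivation.leibniz, Derivation.leibniz_pow]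
  ring

lemma isHomogeneous_f6 : f6.IsHomogeneous 6 := isHomogeneous_of_eval fun t p => by
  simp [f6]
  ring

lemma isHomogeneous_phi4 : phi4.IsHomogeneous 4 := isHomogeneous_of_eval fun t p => by
  simp [phi4]
  ring

lemma isHomogeneous_h8 : h8.IsHomogeneous 8 := isHomogeneous_of_eval fun t p => by
  simp [h8]
  ring

lemma isHomogeneous_t12 : t12.IsHomogeneous 12 := isHomogeneous_of_eval fun t p => by
  simp [t12]
  ring

/-- The covariants of a semi-invariant. -/
lemma subst_h8_t12 {β : Fin 2 → ℂ} (hβ : β ≠ 0) {m : ℕ} {χ : ℂ}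
    (h : subst (reflection 1 β m) f6 = C χ * f6) :
    subst (reflection 1 β m) h8 = C ((χ / zeta m) ^ 2) * h8 ∧
      subst (reflection 1 β m) t12 = C ((χ / zeta m) ^ 3) * t12 := by
  have hz := zeta_ne_zero m
  have hd := det_reflection_two hβ m
  have hd0 : (reflection 1 β m).det ≠ 0 := by rw [hd]; exact hz
  have h1 : subst (reflection 1 β m) h8 = C ((χ / zeta m) ^ 2) * h8 := by
    have := subst_hess2 hd0 h
    rw [hess2_f6, map_mul, subst_C, hd, mul_left_comm] at this
    rw [div_pow]
    exact mul_left_cancel₀ (by simp) this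
  refine ⟨h1, ?_⟩
  have := subst_jac2 hd0 h h1
  rw [jac2_f6_h8, map_mul, subst_C, hd, mul_left_comm] at this
  rw [mul_left_cancel₀ (by simp) this]
  congr 2
  field_simp

end Octahedral

/-! ### Characters of the reflections on the octahedral forms, and the group G8. -/

section Octahedral

lemma subst_diagRefl_zero_two (ζ : ℂ) (a b : ℕ) (c : ℂ) :
    subst (diagRefl (0 : Fin 2) ζ) (C c * X 0 ^ a * X 1 ^ b) = C (ζ ^ a) * (C c * X 0 ^ a * X 1 ^ b) := by
  rw [map_mul, map_mul, map_pow, map_pow, subst_C, subst_diagRefl_X,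
    subst_diagRefl_X_of_ne (by decide), mul_pow, ← C_pow]
  ring

lemma jac2_pow_sub_ne_zero {f f' : MvPolynomial (Fin 2) ℂ} {k : ℕ} (hk : k ≠ 0) (m : ℕ) (c : ℂ)
    (h : jac2 f f' ≠ 0) : jac2 f (f' ^ k - C c * f ^ m) ≠ 0 := by
  have := jac2_pow_add_ne_zero hk m (-c) h
  rwa [C_neg, neg_mul, ← sub_eq_add_neg] at this

lemma subst_reflection_sextic {β : Fin 2 → ℂ} (hβ : β ≠ 0) {f : MvPolynomial (Fin 2) ℂ} {a b c : ℂ}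
    (h : subst (frame β) f = C a * X 0 ^ 6 + C b * X 0 ^ 3 * X 1 ^ 3 + C c * X 1 ^ 6) :
    subst (reflection 1 β 3) f = C 1 * f := by
  apply subst_reflection_of_frame hβ
  have h3 := zeta_pow (m := 3) (by norm_num)
  have h6 : zeta 3 ^ 6 = 1 := by linear_combination (zeta 3 ^ 3 + 1) * h3
  have e : C a * X 0 ^ 6 + C b * X 0 ^ 3 * X 1 ^ 3 + C c * X 1 ^ 6 =
    C a * X 0 ^ 6 * X 1 ^ 0 + C b * X 0 ^ 3 * X 1 ^ 3 + C c * X 0 ^ 0 * X (1 : Fin 2) ^ 6 := by ring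
  rw [h, e]
  simp only [map_add, subst_diagRefl_zero_two]
  simp only [h3, h6, pow_zero, C_1]
  ring

lemma neg_one_sub_I_ne_zero : (-1 - Complex.I : ℂ) ≠ 0 := fun h => by
  simpa using congrArg Complex.im h

lemma one_sub_I_ne_zero : (1 - Complex.I : ℂ) ≠ 0 := fun h => by
  simpa using congrArg Complex.im h

lemma vec_ne_zero_two {a b : ℂ} (h : a ≠ 0) : ![a, b] ≠ 0 := fun e => h (by simpa using congrFun e 0)

lemma one_vec_ne_zero_two {b : ℂ} : ![1, b] ≠ 0 := vec_ne_zero_two one_ne_zero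

/-- Reflections of order three of the octahedral group. -/
lemma subst_reflection_f6 :
    subst (reflection 1 ![1, (1 - r3) / 2 * (1 + Complex.I)] 3) f6 = C 1 * f6 :=
  subst_reflection_sextic one_vec_ne_zero_two subst_frame_f6

lemma subst_reflection_f6_neg :
    subst (reflection 1 ![-1 - Complex.I, r3 - 1] 3) f6 = C 1 * f6 :=
  subst_reflection_sextic (vec_ne_zero_two neg_one_sub_I_ne_zero) subst_frame_f6_neg

lemma subst_reflection_f6_pos :
    subst (reflection 1 ![1 - Complex.I, r3 + 1] 3) f6 = C 1 * f6 :=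
  subst_reflection_sextic (vec_ne_zero_two one_sub_I_ne_zero) subst_frame_f6_pos

lemma subst_reflection_quartic {β : Fin 2 → ℂ} (hβ : β ≠ 0) {f : MvPolynomial (Fin 2) ℂ} {a b : ℂ}
    (h : subst (frame β) f = C a * X 0 ^ 3 * X 1 + C b * X 1 ^ 4) :
    subst (reflection 1 β 3) f = C 1 * f := by
  apply subst_reflection_of_frame hβ
  have h3 := zeta_pow (m := 3) (by norm_num)
  have e : C a * X 0 ^ 3 * X 1 + C b * X 1 ^ 4 =
    C a * X 0 ^ 3 * X 1 ^ 1 + C b * X 0 ^ 0 * X (1 : Fin 2) ^ 4 := by ring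
  rw [h, e]
  simp only [map_add, subst_diagRefl_zero_two]
  simp only [h3, pow_zero, C_1]
  ring

/-- The exponents of X_0 in the frame are 4 and 1, both congruent to 1 modulo 3. Under this class of
reflections `phi4` has a non-trivial character, and only its cube is a coordinate of G5. -/
lemma subst_reflection_phi4 :
    subst (reflection 1 ![1, (1 - r3) / 2 * (1 + Complex.I)] 3) phi4 = C (zeta 3) * phi4 := by
  apply subst_reflection_of_frame one_vec_ne_zero_two
  have h3 := zeta_pow (m := 3) (by norm_num)
  have h4 : zeta 3 ^ 4 = zeta 3 := by linear_combination zeta 3 * h3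
  have e : ∀ a b : ℂ, C a * X 0 ^ 4 + C b * X 0 * X 1 ^ 3 =
    C a * X 0 ^ 4 * X 1 ^ 0 + C b * X 0 ^ 1 * X (1 : Fin 2) ^ 3 := fun a b => by ring
  rw [subst_frame_phi4, e]
  simp only [map_add, subst_diagRefl_zero_two]
  simp only [h4, pow_one]
  ring

lemma subst_reflection_phi4_neg :
    subst (reflection 1 ![-1 - Complex.I, r3 - 1] 3) phi4 = C 1 * phi4 :=
  subst_reflection_quartic (vec_ne_zero_two neg_one_sub_I_ne_zero) subst_frame_phi4_neg

lemma subst_reflection_phi4_pos :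
    subst (reflection 1 ![1 - Complex.I, r3 + 1] 3) phi4 = C 1 * phi4 :=
  subst_reflection_quartic (vec_ne_zero_two one_sub_I_ne_zero) subst_frame_phi4_pos

lemma subst_reflection_f6_one_zero {m : ℕ} (hm : zeta m ^ 4 = 1) :
    subst (reflection 1 ![1, 0] m) f6 = C (zeta m) * f6 := by
  apply subst_reflection_of_frame one_vec_ne_zero_two
  have h5 : zeta m ^ 5 = zeta m := by linear_combination zeta m * hm
  have e : f6 = C 1 * X 0 ^ 5 * X 1 ^ 1 + C (-1) * X 0 ^ 1 * X 1 ^ 5 := by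
    rw [f6, C_neg, C_1]
    ring
  rw [frame_one_zero, subst_one, e]
  simp only [map_add, subst_diagRefl_zero_two]
  simp only [h5, pow_one]
  ring

lemma subst_reflection_phi4_one_zero : subst (reflection 1 ![1, 0] 2) phi4 = C 1 * phi4 := by
  apply subst_reflection_of_frame one_vec_ne_zero_two
  have h2 := zeta_pow (m := 2) (by norm_num)
  have h4 : zeta 2 ^ 4 = 1 := by linear_combination (zeta 2 ^ 2 + 1) * h2
  have e : phi4 = C 1 * X 0 ^ 4 * X 1 ^ 0 + C (2 * Complex.I * r3) * X 0 ^ 2 * X 1 ^ 2 +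
      C 1 * X 0 ^ 0 * X 1 ^ 4 := by
    rw [phi4, C_1]
    ring
  rw [frame_one_zero, subst_one, e]
  simp only [map_add, subst_diagRefl_zero_two]
  simp only [h2, h4, pow_zero, C_1]
  ring

lemma subst_reflection_f6_one_one : subst (reflection 1 ![1, 1] 4) f6 = C (zeta 4) * f6 := by
  apply subst_reflection_of_frame one_vec_ne_zero_two
  have h4 := zeta_pow (m := 4) (by norm_num)
  have h5 : zeta 4 ^ 5 = zeta 4 := by linear_combination zeta 4 * h4
  have e : C (-8) * X 0 ^ 5 * X 1 + C 8 * X 0 * X 1 ^ 5 =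
    C (-8) * X 0 ^ 5 * X 1 ^ 1 + C (8 : ℂ) * X 0 ^ 1 * X (1 : Fin 2) ^ 5 := by ring
  rw [subst_frame_f6_one, e]
  simp only [map_add, subst_diagRefl_zero_two]
  simp only [h5, pow_one]
  ring

lemma subst_reflection_f6_sqrt {ε : ℂ} (hε : ε = 1 ∨ ε = -1) {b : ℂ} (hb : b = ε * (r2 - 1)) :
    subst (reflection 1 ![1, b] 2) f6 = C 1 * f6 := by
  apply subst_reflection_of_frame one_vec_ne_zero_two
  have h2 := zeta_pow (m := 2) (by norm_num)
  have h4 : zeta 2 ^ 4 = 1 := by linear_combination (zeta 2 ^ 2 + 1) * h2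
  have h6 : zeta 2 ^ 6 = 1 := by linear_combination (zeta 2 ^ 4 + zeta 2 ^ 2 + 1) * h2
  have e : ∀ k : ℂ, C k * (-X 0 ^ 6 + 5 * X 0 ^ 4 * X 1 ^ 2 + 5 * X 0 ^ 2 * X 1 ^ 4 - X 1 ^ 6) =
      C (-k) * X 0 ^ 6 * X 1 ^ 0 + C (5 * k) * X 0 ^ 4 * X 1 ^ 2 + C (5 * k) * X 0 ^ 2 * X 1 ^ 4
        + C (-k) * X 0 ^ 0 * X (1 : Fin 2) ^ 6 := by
    intro k
    rw [C_neg, C_mul, map_ofNat]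
    ring
  rw [subst_frame_f6_sqrt hε hb, e]
  simp only [map_add, subst_diagRefl_zero_two]
  simp only [h2, h4, h6, pow_zero, C_1]
  ring

lemma jac2_phi4_f6_ne_zero : jac2 phi4 f6 ≠ 0 := fun h => by
  have := congrArg (eval ![1, 0]) h
  simp [jac2, phi4, f6, Derivation.leibniz, Derivation.leibniz_pow] at this

lemma jac2_h8_t12_ne_zero : jac2 h8 t12 ≠ 0 := fun h => by
  have := congrArg (eval ![2, 1]) h
  simp [jac2, h8, t12, Derivation.leibniz, Derivation.leibniz_pow] at this
  norm_num at this

lemma jac2_f6_t12_ne_zero : jac2 f6 t12 ≠ 0 := fun h => by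
  have := congrArg (eval ![2, 1]) h
  simp [jac2, f6, t12, Derivation.leibniz, Derivation.leibniz_pow] at this
  norm_num at this

lemma basic_G8 : (dataTwo [(![1, 0], 4), (![1, 1], 4)] ![8, 12] ![h8, t12] 12 [(4, 6)]).Basic := by
  have hz := zeta_ne_zero 4
  apply basic_two
  · simp only [List.forall_mem_cons, Fin.forall_fin_two]
    refine ⟨⟨one_vec_ne_zero_two, by norm_num, ?_⟩, ⟨one_vec_ne_zero_two, by norm_num, ?_⟩, by simp⟩
    · simpa [hz] using subst_h8_t12 one_vec_ne_zero_two
        (subst_reflection_f6_one_zero (zeta_pow (m := 4) (by norm_num)))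
    · simpa [hz] using subst_h8_t12 one_vec_ne_zero_two subst_reflection_f6_one_one
  · exact Fin.forall_fin_two.mpr ⟨isHomogeneous_h8, isHomogeneous_t12⟩
  · decide
  · exact jac2_h8_t12_ne_zero

lemma conclusion_G8 : (STGroup.data .G8).Conclusion := by
  have : Fact (Nat.Prime 5) := ⟨by norm_num⟩
  -- Modulo 5 the eigenvalue is 2, a primitive fourth root of unity. Positions in the moves count
  -- back from the most recent covector, and a single seed `(0, 0)` means a single label.
  refine conclusion_two basic_G8 5 [(0, 0), (1, 1), (1, 0), (1, 0), (1, 0), (4, 1)] ?_ 0 0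
    (by decide) (Or.inl rfl)
  intro k _ _ φ
  refine ⟨_, .cons (genRed_two 1 1 (Red.one.of_eq (by simp)) (Red.zero.of_eq (by simp))
    (Red.one.of_eq (by simp)) (Red.zero.of_eq (by simp)) 1 (by decide) one_ne_zero one_ne_zero)
    (.cons (genRed_two 1 1 (Red.one.of_eq (by simp)) (Red.one.of_eq (by simp))
    (Red.one.of_eq (by simp)) (Red.one.of_eq (by simp)) 1 (by decide) one_ne_zero one_ne_zero)
    .nil), by decide +kernel⟩

end Octahedral

/-! ### The remaining tetrahedral and octahedral groups. -/

section Octahedral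

section Reduction

variable {k : Type} [Field k] {p : ℕ} {φ : integralClosure ℤ ℂ →+* k} [CharP k p]

lemma genRed_neg {x y : ℤ} (hi : Red φ Complex.I x) (hr : Red φ r3 y) (z : ℕ)
    (hz : p ≠ 0 ∧ ¬ p ∣ 3 ∧ (p : ℤ) ∣ ((z : ℤ) + 1) ^ 3 - 1) :
    GroupData.GenRed φ p (1 : Matrix (Fin 2) (Fin 2) ℂ) (![-1 - Complex.I, r3 - 1], 3)
      ([residue p (-1 - x), residue p (y - 1)], [residue p (-1 + x), residue p (y - 1)], z) :=
  genRed_two 1 1 ((Red.one.neg.sub hi).of_eq (by simp)) ((hr.sub Red.one).of_eq (by simp))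
    ((Red.one.neg.add hi).of_eq (by simp [sub_eq_add_neg])) ((hr.sub Red.one).of_eq (by simp)) z hz
    one_ne_zero one_ne_zero

lemma genRed_pos {x y : ℤ} (hi : Red φ Complex.I x) (hr : Red φ r3 y) (z : ℕ)
    (hz : p ≠ 0 ∧ ¬ p ∣ 3 ∧ (p : ℤ) ∣ ((z : ℤ) + 1) ^ 3 - 1) :
    GroupData.GenRed φ p (1 : Matrix (Fin 2) (Fin 2) ℂ) (![1 - Complex.I, r3 + 1], 3)
      ([residue p (1 - x), residue p (y + 1)], [residue p (1 + x), residue p (y + 1)], z) :=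
  genRed_two 1 1 ((Red.one.sub hi).of_eq (by simp)) ((hr.add Red.one).of_eq (by simp))
    ((Red.one.add hi).of_eq (by simp [sub_eq_add_neg])) ((hr.add Red.one).of_eq (by simp)) z hz
    one_ne_zero one_ne_zero

lemma genRed_half {x y : ℤ} (hi : Red φ Complex.I x) (hr : Red φ r3 y) (z : ℕ)
    (hz : p ≠ 0 ∧ ¬ p ∣ 3 ∧ (p : ℤ) ∣ ((z : ℤ) + 1) ^ 3 - 1) :
    GroupData.GenRed φ p (1 : Matrix (Fin 2) (Fin 2) ℂ) (![1, (1 - r3) / 2 * (1 + Complex.I)], 3)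
      ([residue p 2, residue p ((1 - y) * (1 + x))],
        [residue p 2, residue p ((1 - y) * (1 - x))], z) :=
  genRed_two 2 2 ((Red.ofNat 2).of_eq (by simp))
    (((Red.one.sub hr).mul (Red.one.add hi)).of_eq (by simp; ring)) ((Red.ofNat 2).of_eq (by simp))
    (((Red.one.sub hr).mul (Red.one.sub hi)).of_eq (by simp; ring)) z hz two_ne_zero two_ne_zero

lemma genRed_one_zero (m z : ℕ) (hz : p ≠ 0 ∧ ¬ p ∣ m ∧ (p : ℤ) ∣ ((z : ℤ) + 1) ^ m - 1) :
    GroupData.GenRed φ p (1 : Matrix (Fin 2) (Fin 2) ℂ) (![1, 0], m)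
      ([residue p 1, residue p 0], [residue p 1, residue p 0], z) :=
  genRed_two 1 1 (Red.one.of_eq (by simp)) (Red.zero.of_eq (by simp)) (Red.one.of_eq (by simp))
    (Red.zero.of_eq (by simp)) z hz one_ne_zero one_ne_zero

end Reduction

lemma Expand.of_sextic {f : MvPolynomial (Fin 2) ℂ} {a b c : ℂ}
    (h : f = C a * X 0 ^ 6 + C b * X 0 ^ 3 * X 1 ^ 3 + C c * X 1 ^ 6) : Expand 3 6 f c b :=
  ⟨C a * X 0 ^ 3 + C b * X 1 ^ 3, by rw [h]; ring, by simp⟩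

lemma expand_subst_one {κ d : ℕ} {f : MvPolynomial (Fin 2) ℂ} {V W : ℂ} (h : Expand κ d f V W) :
    Expand κ d (subst (frame ![1, 0]) f) V W := by
  rw [frame_one_zero, subst_one]
  exact h

lemma basic_G4 : (dataTwo [(![-1 - Complex.I, r3 - 1], 3), (![1 - Complex.I, r3 + 1], 3)]
    ![4, 6] ![phi4, f6] 6 [(3, 4)]).Basic := by
  apply basic_two
  · simp only [List.forall_mem_cons, Fin.forall_fin_two]
    refine ⟨⟨vec_ne_zero_two neg_one_sub_I_ne_zero, by norm_num, ?_⟩,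
      ⟨vec_ne_zero_two one_sub_I_ne_zero, by norm_num, ?_⟩, by simp⟩
    · simpa using And.intro subst_reflection_phi4_neg subst_reflection_f6_neg
    · simpa using And.intro subst_reflection_phi4_pos subst_reflection_f6_pos
  · exact Fin.forall_fin_two.mpr ⟨isHomogeneous_phi4, isHomogeneous_f6⟩
  · decide
  · exact jac2_phi4_f6_ne_zero

lemma conclusion_G4 : (STGroup.data .G4).Conclusion := by
  have : Fact (Nat.Prime 13) := ⟨by norm_num⟩
  refine conclusion_two basic_G4 13 [(0, 0), (1, 1), (1, 0), (1, 0)] ?_ 0 0 (by decide) (Or.inl rfl)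
  intro k _ _ φ
  -- Modulo 13 one has 5² = -1, 4² = 3 and 3³ = 1. The reduction map is arbitrary, so both signs of
  -- both square roots have to be treated.
  have hi := Red.of_sq (φ := φ) (p := 13) Complex.I_sq (a := 5) Red.one.neg (by decide)
  have hr := Red.of_sq (φ := φ) (p := 13) r3_sq (a := 4) (Red.ofNat 3) (by decide)
  rcases hi with hi | hi <;> rcases hr with hr | hr <;>
  exact ⟨_, .cons (genRed_neg hi hr 2 (by decide)) (.cons (genRed_pos hi hr 2 (by decide)) .nil),
    by decide +kernel⟩

lemma basic_G5 : (dataTwo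
    [(![-1 - Complex.I, r3 - 1], 3), (![1, (1 - r3) / 2 * (1 + Complex.I)], 3)]
    ![6, 12] ![f6, phi4 ^ 3 - C (6 * Complex.I * r3) * f6 ^ 2] 12 [(3, 8)]).Basic := by
  apply basic_two
  · simp only [List.forall_mem_cons, Fin.forall_fin_two]
    refine ⟨⟨vec_ne_zero_two neg_one_sub_I_ne_zero, by norm_num, ?_⟩,
      ⟨one_vec_ne_zero_two, by norm_num, ?_⟩, by simp⟩
    · simp [subst_reflection_phi4_neg, subst_reflection_f6_neg]
    · simp [subst_reflection_phi4, subst_reflection_f6, mul_pow, ← C_pow, zeta_pow]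
  · exact Fin.forall_fin_two.mpr ⟨isHomogeneous_f6, (isHomogeneous_phi4.pow 3).sub
      ((isHomogeneous_f6.pow 2).C_mul _)⟩
  · decide
  · exact jac2_pow_sub_ne_zero (by norm_num) _ _ (jac2_ne_zero_comm jac2_phi4_f6_ne_zero)

lemma conclusion_G5 : (STGroup.data .G5).Conclusion := by
  have : Fact (Nat.Prime 13) := ⟨by norm_num⟩
  refine conclusion_two basic_G5 13
    [(0, 0), (0, 1), (1, 0), (1, 0), (1, 1), (5, 1), (1, 0), (1, 0)] ?_ 1 0 (by decide) (Or.inr ?_)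
  · intro k _ _ φ
    have hi := Red.of_sq (φ := φ) (p := 13) Complex.I_sq (a := 5) Red.one.neg (by decide)
    have hr := Red.of_sq (φ := φ) (p := 13) r3_sq (a := 4) (Red.ofNat 3) (by decide)
    rcases hi with hi | hi <;> rcases hr with hr | hr <;>
    exact ⟨_, .cons (genRed_neg hi hr 2 (by decide))
      (.cons (genRed_half hi hr 2 (by decide)) .nil), by decide +kernel⟩
  · have hf := Expand.of_sextic subst_frame_f6_neg
    have hphi : Expand 3 4 (subst (frame ![-1 - Complex.I, r3 - 1]) phi4) (48 - 32 * r3)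
        ((96 - 64 * r3) * (Complex.I + 1)) :=
      ⟨C ((96 - 64 * r3) * (Complex.I + 1)) * X 1, by rw [subst_frame_phi4_neg]; ring, by simp⟩
    have h2 := (hphi.pow (by norm_num) 3).add ((hf.pow (by norm_num) 2).C_mul (-(6 * Complex.I * r3)))
    rw [C_neg, neg_mul, ← sub_eq_add_neg, ← map_pow, ← map_pow,
      ← subst_C (frame ![-1 - Complex.I, r3 - 1]), ← map_mul, ← map_sub] at h2
    refine goodAt_two_of_expand basic_G5 (a := (![-1 - Complex.I, r3 - 1], 3)) (by simp)
      (V := ![_, _]) (W := ![_, _]) (Fin.forall_fin_two.mpr ⟨hf, h2⟩) ?_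
    simp
    ring_nf
    simp only [Complex.I_sq, I_pow_three, Complex.I_pow_four, r3_sq, r3_pow_three, r3_pow_four]
    ring

lemma basic_G6 : (dataTwo [(![1, 0], 2), (![-1 - Complex.I, r3 - 1], 3)]
    ![4, 12] ![phi4, f6 ^ 2 + C (5 / 288 * Complex.I * r3) * phi4 ^ 3] 12 [(2, 6), (3, 4)]).Basic := by
  have h2 := zeta_pow (m := 2) (by norm_num)
  apply basic_two
  · simp only [List.forall_mem_cons, Fin.forall_fin_two]
    refine ⟨⟨one_vec_ne_zero_two, by norm_num, ?_⟩,
      ⟨vec_ne_zero_two neg_one_sub_I_ne_zero, by norm_num, ?_⟩, by simp⟩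
    · simp [subst_reflection_phi4_one_zero, mul_pow, ← C_pow, h2,
        subst_reflection_f6_one_zero (m := 2) (by linear_combination (zeta 2 ^ 2 + 1) * h2)]
    · simp [subst_reflection_phi4_neg, subst_reflection_f6_neg]
  · exact Fin.forall_fin_two.mpr ⟨isHomogeneous_phi4, (isHomogeneous_f6.pow 2).add
      ((isHomogeneous_phi4.pow 3).C_mul _)⟩
  · decide
  · exact jac2_pow_add_ne_zero (by norm_num) _ _ jac2_phi4_f6_ne_zero

lemma conclusion_G6 : (STGroup.data .G6).Conclusion := by
  have : Fact (Nat.Prime 13) := ⟨by norm_num⟩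
  refine conclusion_two basic_G6 13 [(0, 0), (0, 1), (1, 0), (1, 1), (1, 0), (5, 1), (1, 0), (1, 1),
    (1, 0), (2, 1)] ?_ 1 0 (by decide) (Or.inr ?_)
  · intro k _ _ φ
    have hi := Red.of_sq (φ := φ) (p := 13) Complex.I_sq (a := 5) Red.one.neg (by decide)
    have hr := Red.of_sq (φ := φ) (p := 13) r3_sq (a := 4) (Red.ofNat 3) (by decide)
    rcases hi with hi | hi <;> rcases hr with hr | hr <;>
    exact ⟨_, .cons (genRed_one_zero 2 11 (by decide))
      (.cons (genRed_neg hi hr 2 (by decide)) .nil), by decide +kernel⟩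
  · have hphi : Expand 2 4 phi4 1 (2 * Complex.I * r3) :=
      ⟨C (2 * Complex.I * r3) * X 1 ^ 2 + X 0 ^ 2, by rw [phi4, C_1]; ring, by simp⟩
    -- `f6` is divisible by X_0, so its square contributes nothing to the restriction to the mirror
    -- and starts with the second order term.
    have hf : Expand 2 12 (f6 ^ 2) 0 1 :=
      ⟨(X 0 ^ 4 * X 1 - X 1 ^ 5) ^ 2, by rw [f6, C_0]; ring, by simp⟩
    have h2 := hf.add ((hphi.pow (by norm_num) 3).C_mul (5 / 288 * Complex.I * r3))
    refine goodAt_two_of_expand basic_G6 (a := (![1, 0], 2)) (by simp)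
      (V := ![_, _]) (W := ![_, _])
      (Fin.forall_fin_two.mpr ⟨expand_subst_one hphi, expand_subst_one h2⟩) ?_
    simp
    ring_nf
    simp only [Complex.I_sq, r3_sq]
    norm_num

lemma expand_h8 : Expand 4 8 h8 1 14 := ⟨14 * X 1 ^ 4 + X 0 ^ 4, by rw [h8, C_1]; ring, by simp⟩

lemma expand_t12 : Expand 4 12 t12 1 (-33) :=
  ⟨-33 * X 1 ^ 8 - 33 * X 0 ^ 4 * X 1 ^ 4 + X 0 ^ 8, by rw [t12, C_1]; ring, by simp⟩

lemma basic_G9 : (dataTwo [(![1, r2 - 1], 2), (![1, 0], 4)]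
    ![8, 24] ![h8, t12 ^ 2 - C (11 / 16) * h8 ^ 3] 24 [(2, 12), (4, 6)]).Basic := by
  have hz := zeta_ne_zero 4
  have h2 := zeta_pow (m := 2) (by norm_num)
  have h6 : zeta 2 ^ 6 = 1 := by linear_combination (zeta 2 ^ 4 + zeta 2 ^ 2 + 1) * h2
  apply basic_two
  · simp only [List.forall_mem_cons, Fin.forall_fin_two]
    refine ⟨⟨one_vec_ne_zero_two, by norm_num, ?_⟩, ⟨one_vec_ne_zero_two, by norm_num, ?_⟩, by simp⟩
    · obtain ⟨e1, e2⟩ := subst_h8_t12 one_vec_ne_zero_two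
        (subst_reflection_f6_sqrt (Or.inl rfl) (one_mul (r2 - 1)).symm)
      simp [e1, e2, mul_pow, ← C_pow, ← pow_mul, h2, h6]
    · obtain ⟨e1, e2⟩ := subst_h8_t12 one_vec_ne_zero_two
        (subst_reflection_f6_one_zero (zeta_pow (m := 4) (by norm_num)))
      simp [e1, e2, hz]
  · exact Fin.forall_fin_two.mpr ⟨isHomogeneous_h8, (isHomogeneous_t12.pow 2).sub
      ((isHomogeneous_h8.pow 3).C_mul _)⟩
  · decide
  · exact jac2_pow_sub_ne_zero (by norm_num) _ _ jac2_h8_t12_ne_zero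

lemma conclusion_G9 : (STGroup.data .G9).Conclusion := by
  have : Fact (Nat.Prime 17) := ⟨by norm_num⟩
  refine conclusion_two basic_G9 17 [(0, 0), (0, 1), (1, 0), (1, 1), (1, 0), (2, 1), (1, 0), (7, 1),
    (1, 0), (1, 1), (1, 0), (2, 1), (1, 0), (1, 1), (1, 0), (2, 1), (1, 0), (2, 1)] ?_ 0 1
    (by decide) (Or.inr ?_)
  · intro k _ _ φ
    have hr := Red.of_sq (φ := φ) (p := 17) r2_sq (a := 6) (Red.ofNat 2) (by decide)
    rcases hr with hr | hr <;>
    exact ⟨_, .cons (genRed_two 1 1 (Red.one.of_eq (by simp)) ((hr.sub Red.one).of_eq (by simp))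
      (Red.one.of_eq (by simp)) ((hr.sub Red.one).of_eq (by simp)) 15 (by decide) one_ne_zero
      one_ne_zero) (.cons (genRed_one_zero 4 3 (by decide)) .nil), by decide +kernel⟩
  · have h2 := (expand_t12.pow (by norm_num) 2).add ((expand_h8.pow (by norm_num) 3).C_mul (-(11 / 16)))
    rw [C_neg, neg_mul, ← sub_eq_add_neg] at h2
    refine goodAt_two_of_expand basic_G9 (a := (![1, 0], 4)) (by simp)
      (V := ![_, _]) (W := ![_, _])
      (Fin.forall_fin_two.mpr ⟨expand_subst_one expand_h8, expand_subst_one h2⟩) ?_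
    simp
    norm_num

lemma basic_G10 : (dataTwo [(![1, (1 - r3) / 2 * (1 + Complex.I)], 3), (![1, 0], 4)]
    ![12, 24] ![t12, h8 ^ 3 - C (7 / 12) * t12 ^ 2] 24 [(3, 8), (4, 6)]).Basic := by
  have hz := zeta_ne_zero 4
  have h3 := zeta_pow (m := 3) (by norm_num)
  have h6 : zeta 3 ^ 6 = 1 := by linear_combination (zeta 3 ^ 3 + 1) * h3
  apply basic_two
  · simp only [List.forall_mem_cons, Fin.forall_fin_two]
    refine ⟨⟨one_vec_ne_zero_two, by norm_num, ?_⟩, ⟨one_vec_ne_zero_two, by norm_num, ?_⟩, by simp⟩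
    · obtain ⟨e1, e2⟩ := subst_h8_t12 one_vec_ne_zero_two subst_reflection_f6
      simp [e1, e2, mul_pow, ← C_pow, ← pow_mul, h3, h6]
    · obtain ⟨e1, e2⟩ := subst_h8_t12 one_vec_ne_zero_two
        (subst_reflection_f6_one_zero (zeta_pow (m := 4) (by norm_num)))
      simp [e1, e2, hz]
  · exact Fin.forall_fin_two.mpr ⟨isHomogeneous_t12, (isHomogeneous_h8.pow 3).sub
      ((isHomogeneous_t12.pow 2).C_mul _)⟩
  · decide
  · exact jac2_pow_sub_ne_zero (by norm_num) _ _ (jac2_ne_zero_comm jac2_h8_t12_ne_zero)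

lemma conclusion_G10 : (STGroup.data .G10).Conclusion := by
  have : Fact (Nat.Prime 13) := ⟨by norm_num⟩
  refine conclusion_two basic_G10 13 [(0, 0), (0, 1), (1, 0), (1, 0), (1, 1), (1, 0), (1, 0), (7, 1),
    (1, 0), (1, 0), (1, 1), (1, 0), (1, 0), (3, 1)] ?_ 0 1 (by decide) (Or.inr ?_)
  · intro k _ _ φ
    have hi := Red.of_sq (φ := φ) (p := 13) Complex.I_sq (a := 5) Red.one.neg (by decide)
    have hr := Red.of_sq (φ := φ) (p := 13) r3_sq (a := 4) (Red.ofNat 3) (by decide)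
    -- The fourth root of unity modulo 13 is taken to be 5 or 8 according to the sign of √3, so that
    -- the same moves serve every reduction.
    rcases hr with hr | hr
    · rcases hi with hi | hi <;>
      exact ⟨_, .cons (genRed_half hi hr 2 (by decide)) (.cons (genRed_one_zero 4 4 (by decide)) .nil),
        by decide +kernel⟩
    · rcases hi with hi | hi <;>
      exact ⟨_, .cons (genRed_half hi hr 2 (by decide)) (.cons (genRed_one_zero 4 7 (by decide)) .nil),
        by decide +kernel⟩
  · have h2 := (expand_h8.pow (by norm_num) 3).add ((expand_t12.pow (by norm_num) 2).C_mul (-(7 / 12)))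
    rw [C_neg, neg_mul, ← sub_eq_add_neg] at h2
    refine goodAt_two_of_expand basic_G10 (a := (![1, 0], 4)) (by simp)
      (V := ![_, _]) (W := ![_, _])
      (Fin.forall_fin_two.mpr ⟨expand_subst_one expand_t12, expand_subst_one h2⟩) ?_
    simp
    norm_num

/-- Gives `t12` in a frame from the sextic alone, without a substitution in degree twelve. The
factor 200 is (-25)(-8); the Hessian contributes the square of the determinant and the Jacobian one
more factor. -/
lemma jac2_hess2_f6_subst (g : Matrix (Fin 2) (Fin 2) ℂ) :
    jac2 (subst g f6) (hess2 (subst g f6)) = C (200 * g.det ^ 3) * subst g t12 := by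
  have h1 := jac2_C_mul 1 (g.det ^ 2 * -25) (subst g f6) (subst g h8)
  rw [hess2_subst, hess2_f6, map_mul, subst_C, ← mul_assoc, ← C_mul]
  rw [C_1, one_mul, one_mul] at h1
  rw [h1, jac2_subst, jac2_f6_h8, map_mul (subst g), subst_C]
  simp only [← mul_assoc, ← C_mul]
  congr 2
  ring

lemma expand_jac2_hess2_sextic (a b c : ℂ) {f : MvPolynomial (Fin 2) ℂ}
    (h : f = C a * X 0 ^ 6 + C b * X 0 ^ 3 * X 1 ^ 3 + C c * X 1 ^ 6) :
    Expand 3 12 (jac2 f (hess2 f)) (-1080 * b * c ^ 2) (4320 * b ^ 2 * c - 21600 * a * c ^ 2) := by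
  refine ⟨C (1080 * a ^ 2 * b) * X 0 ^ 9 + C (21600 * a ^ 2 * c - 4320 * a * b ^ 2) * X 0 ^ 6 *
    X 1 ^ 3 + C (4320 * b ^ 2 * c - 21600 * a * c ^ 2) * X 1 ^ 9, ?_, by simp⟩
  apply MvPolynomial.funext
  intro p
  simp [h, jac2, hess2, Derivation.leibniz, Derivation.leibniz_pow]
  ring

lemma basic_G14 : (dataTwo [(![1, 1 - r2], 2), (![1, (1 - r3) / 2 * (1 + Complex.I)], 3)]
    ![6, 24] ![f6, t12 ^ 2 + 66 * f6 ^ 4] 24 [(2, 12), (3, 8)]).Basic := by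
  have h2 := zeta_pow (m := 2) (by norm_num)
  have h6 : zeta 2 ^ 6 = 1 := by linear_combination (zeta 2 ^ 4 + zeta 2 ^ 2 + 1) * h2
  have h3 := zeta_pow (m := 3) (by norm_num)
  apply basic_two
  · simp only [List.forall_mem_cons, Fin.forall_fin_two]
    refine ⟨⟨one_vec_ne_zero_two, by norm_num, ?_⟩, ⟨one_vec_ne_zero_two, by norm_num, ?_⟩, by simp⟩
    · have e := subst_reflection_f6_sqrt (Or.inr rfl) (show 1 - r2 = -1 * (r2 - 1) by ring)
      obtain ⟨-, e2⟩ := subst_h8_t12 one_vec_ne_zero_two e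
      simp [e, e2, mul_pow, ← C_pow, ← pow_mul, h6, map_ofNat]
    · obtain ⟨-, e2⟩ := subst_h8_t12 one_vec_ne_zero_two subst_reflection_f6
      simp [subst_reflection_f6, e2, h3, map_ofNat]
  · refine Fin.forall_fin_two.mpr ⟨isHomogeneous_f6, (isHomogeneous_t12.pow 2).add ?_⟩
    have := (isHomogeneous_f6.pow 4).C_mul 66
    rwa [map_ofNat] at this
  · decide
  · have := jac2_pow_add_ne_zero (k := 2) (by norm_num) 4 66 jac2_f6_t12_ne_zero
    rwa [map_ofNat] at this

lemma conclusion_G14 : (STGroup.data .G14).Conclusion := by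
  have : Fact (Nat.Prime 73) := ⟨by norm_num⟩
  refine conclusion_two basic_G14 73 [(0, 0), (0, 1), (1, 0), (1, 1), (1, 0), (1, 1), (1, 0), (2, 1),
    (1, 0), (9, 1), (1, 0), (1, 1), (1, 0), (1, 1), (1, 0), (2, 1), (1, 0), (1, 1), (1, 0), (2, 1)]
    ?_ 0 1 (by decide) (Or.inr ?_)
  · intro k _ _ φ
    -- Modulo 73 one has 27² = -1, 21² = 3, 32² = 2, and 8 is a cube root of unity.
    have hi := Red.of_sq (φ := φ) (p := 73) Complex.I_sq (a := 27) Red.one.neg (by decide)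
    have hr := Red.of_sq (φ := φ) (p := 73) r3_sq (a := 21) (Red.ofNat 3) (by decide)
    have hs := Red.of_sq (φ := φ) (p := 73) r2_sq (a := 32) (Red.ofNat 2) (by decide)
    rcases hi with hi | hi <;> rcases hr with hr | hr <;> rcases hs with hs | hs <;>
    exact ⟨_, .cons (genRed_two 1 1 (Red.one.of_eq (by simp)) ((Red.one.sub hs).of_eq (by simp))
      (Red.one.of_eq (by simp)) ((Red.one.sub hs).of_eq (by simp)) 71 (by decide) one_ne_zero
      one_ne_zero) (.cons (genRed_half hi hr 7 (by decide)) .nil), by decide +kernel⟩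
  · set g := frame ![1, (1 - r3) / 2 * (1 + Complex.I)] with hg
    have hf := Expand.of_sextic subst_frame_f6
    have ht := expand_jac2_hess2_sextic _ _ _ subst_frame_f6
    rw [← hg] at hf ht
    have hdet : g.det = 3 - r3 := by
      rw [hg, det_frame, normSq_one_two]
      simp
      linear_combination (-1 / 4 * (1 - r3) ^ 2) * Complex.I_sq + 1 / 2 * r3_sq
    have hd0 : 3 - r3 ≠ 0 := by
      intro h0
      have : (3 - r3) * (3 + r3) = 6 := by linear_combination -r3_sq
      rw [h0] at this
      norm_num at this
    obtain ⟨τ, hτ⟩ : ∃ τ : ℂ, τ * (200 * (3 - r3) ^ 3) = 1 :=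
      ⟨(200 * (3 - r3) ^ 3)⁻¹, inv_mul_cancel₀ (by simpa using hd0)⟩
    -- `t12` enters the second coordinate only through its square, so only τ² is needed, and it is
    -- rational up to the common factor 6√3 - 10 of the sextic.
    have hτ2 : 1080000 * τ ^ 2 * (6 * r3 - 10) ^ 2 = 1 := by
      have h1 : (200 * (3 - r3) ^ 3) ^ 2 = 1080000 * (6 * r3 - 10) ^ 2 := by
        ring_nf
        simp only [r3_sq, r3_pow_three, r3_pow_four, r3_pow_five, r3_pow_six]
        ring
      linear_combination (τ * (200 * (3 - r3) ^ 3) + 1) * hτ - τ ^ 2 * h1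
    rw [jac2_hess2_f6_subst, hdet] at ht
    have ht' := ht.C_mul τ
    rw [← mul_assoc, ← C_mul, hτ, C_1, one_mul] at ht'
    rw [show τ * (-1080 * ((60 * r3 - 100) * Complex.I) * ((10 - 6 * r3) * (Complex.I + 1)) ^ 2) =
        τ * (21600 * (6 * r3 - 10) ^ 3) by
          linear_combination (-10800 * τ * (6 * r3 - 10) ^ 3 * (Complex.I + 2)) * Complex.I_sq,
      show τ * (4320 * ((60 * r3 - 100) * Complex.I) ^ 2 * ((10 - 6 * r3) * (Complex.I + 1)) -
          21600 * ((6 * r3 - 10) * (Complex.I - 1)) * ((10 - 6 * r3) * (Complex.I + 1)) ^ 2) =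
        τ * (475200 * (6 * r3 - 10) ^ 3 * (Complex.I + 1)) by
          linear_combination (-453600 * τ * (6 * r3 - 10) ^ 3 * (Complex.I + 1)) * Complex.I_sq]
      at ht'
    have h2 := (ht'.pow (by norm_num) 2).add ((hf.pow (by norm_num) 4).C_mul 66)
    rw [← map_pow, ← map_pow, ← subst_C g, ← map_mul, ← map_add, map_ofNat] at h2
    refine goodAt_two_of_expand basic_G14 (a := (![1, (1 - r3) / 2 * (1 + Complex.I)], 3)) (by simp)
      (V := ![_, _]) (W := ![_, _]) (Fin.forall_fin_two.mpr ⟨hf, h2⟩) ?_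
    simp
    rw [show 60 * r3 - 100 = 10 * (6 * r3 - 10) by ring, show 10 - 6 * r3 = -(6 * r3 - 10) by ring]
    generalize 6 * r3 - 10 = k at *
    linear_combination (k ^ 5 * (456192 / 23 * Complex.I - 99792 / 23 * (Complex.I ^ 2 + 1))) * hτ2 +
      k ^ 5 * (114048 / 23 * Complex.I ^ 3 + 456192 / 23 * Complex.I ^ 2 + 570240 / 23 * Complex.I
        - 99792 / 23) * Complex.I_sq

end Octahedral

/-! ## Icosahedral forms -/

section Icosahedral

/-- The form is written as a polynomial in (x² + y²)² and (xy)², two expressions that stay short in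
the frames below. -/
lemma eval_F12 (x y : ℂ) : eval ![x, y] F12 = ((x ^ 2 + y ^ 2) ^ 2) ^ 3 +
    (22 / 5 * r5 - 6) * ((x ^ 2 + y ^ 2) ^ 2) ^ 2 * (x * y) ^ 2 -
    (88 / 5 * r5 + 24) * (x ^ 2 + y ^ 2) ^ 2 * ((x * y) ^ 2) ^ 2 + 64 * ((x * y) ^ 2) ^ 3 := by
  simp [F12]
  ring

set_option maxRecDepth 100000 in
-- As for the octahedral forms, `F20` and `F30` are covariants of `F12`; only `F12` is ever
-- substituted into a frame.
lemma hess2_F12 : hess2 F12 = C (5808 / 5 * r5) * F20 := by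
  apply MvPolynomial.funext
  intro p
  simp [hess2, F12, F20, Derivation.leibniz, Derivation.leibniz_pow]
  ring_nf
  simp only [r5_sq]
  ring

set_option maxRecDepth 100000 in
lemma jac2_F12_F20 : jac2 F12 F20 = C (-480 * r5) * F30 := by
  apply MvPolynomial.funext
  intro p
  simp [jac2, F12, F20, F30, Derivation.leibniz, Derivation.leibniz_pow]
  ring_nf
  simp only [r5_sq]
  ring

lemma isHomogeneous_F12 : F12.IsHomogeneous 12 := isHomogeneous_of_eval fun t p => by
  simp [F12]
  ring

lemma isHomogeneous_F20 : F20.IsHomogeneous 20 := isHomogeneous_of_eval fun t p => by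
  simp [F20]
  ring

lemma isHomogeneous_F30 : F30.IsHomogeneous 30 := isHomogeneous_of_eval fun t p => by
  simp [F30]
  ring

lemma r5_ne_zero : r5 ≠ 0 := fun h => by
  have := r5_sq
  rw [h] at this
  norm_num at this

/-- The covariants of a semi-invariant. -/
lemma subst_F20_F30 {β : Fin 2 → ℂ} (hβ : β ≠ 0) {m : ℕ} {χ : ℂ}
    (h : subst (reflection 1 β m) F12 = C χ * F12) :
    subst (reflection 1 β m) F20 = C ((χ / zeta m) ^ 2) * F20 ∧
      subst (reflection 1 β m) F30 = C ((χ / zeta m) ^ 3) * F30 := by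
  have hz := zeta_ne_zero m
  have h5 := r5_ne_zero
  have hd := det_reflection_two hβ m
  have hd0 : (reflection 1 β m).det ≠ 0 := by rw [hd]; exact hz
  have h1 : subst (reflection 1 β m) F20 = C ((χ / zeta m) ^ 2) * F20 := by
    have := subst_hess2 hd0 h
    rw [hess2_F12, map_mul, subst_C, hd, mul_left_comm] at this
    rw [div_pow]
    exact mul_left_cancel₀ (by simp [h5]) this
  refine ⟨h1, ?_⟩
  have := subst_jac2 hd0 h h1
  rw [jac2_F12_F20, map_mul, subst_C, hd, mul_left_comm] at this
  rw [mul_left_cancel₀ (by simp [h5]) this]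
  exact congrArg (fun c => C c * F30) (by field_simp)

/-- A real frame in which the roots of unity become visible. -/
lemma eval_subst_frame_F12 {b ρ : ℂ} (hb : b ^ 2 = 1 + ρ * b) (hs : star b = b) (p : Fin 2 → ℂ) :
    eval p (subst (frame ![1, b]) F12) = b ^ 6 *
      ((4 + ρ ^ 2) ^ 3 * (p 0 ^ 2 + p 1 ^ 2) ^ 6 +
      (22 / 5 * r5 - 6) * (4 + ρ ^ 2) ^ 2 * (p 0 ^ 2 + p 1 ^ 2) ^ 4 *
        (p 0 ^ 2 - p 1 ^ 2 - ρ * p 0 * p 1) ^ 2 -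
      (88 / 5 * r5 + 24) * (4 + ρ ^ 2) * (p 0 ^ 2 + p 1 ^ 2) ^ 2 *
        (p 0 ^ 2 - p 1 ^ 2 - ρ * p 0 * p 1) ^ 4 +
      64 * (p 0 ^ 2 - p 1 ^ 2 - ρ * p 0 * p 1) ^ 6) := by
  rw [eval_subst_frame]
  simp only [Matrix.cons_val_zero, Matrix.cons_val_one, star_one, one_mul, hs]
  generalize p 0 = x
  generalize p 1 = y
  -- By the quadratic equation both building blocks of `eval_F12` acquire a power of `b` as a common
  -- factor, and the rest depends on `ρ` alone.
  have hN : (1 + b ^ 2) ^ 2 = (4 + ρ ^ 2) * b ^ 2 := by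
    linear_combination (b ^ 2 - 1 + ρ * b) * hb
  have e1 : ((x - b * y) ^ 2 + (b * x + y) ^ 2) ^ 2 =
      (4 + ρ ^ 2) * b ^ 2 * (x ^ 2 + y ^ 2) ^ 2 := by
    linear_combination (x ^ 2 + y ^ 2) ^ 2 * hN
  have e2 : (x - b * y) * (b * x + y) = b * (x ^ 2 - y ^ 2 - ρ * x * y) := by
    linear_combination (-x * y) * hb
  rw [eval_F12, e1, e2]
  ring

set_option maxRecDepth 100000 in
-- This is Klein's normal form, with vertices of the icosahedron at 0 and ∞. All exponents of X_0
-- are 1 modulo 5, so the character is the eigenvalue itself and `F20`, `F30` are invariant. The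
-- sign `ε` separates the two generators of G16.
lemma subst_frame_F12_five {b ε : ℂ} (hε : ε ^ 2 = 1) (hb : b ^ 2 = 1 + ε * (r5 - 1) * b)
    (hs : star b = b) : subst (frame ![1, b]) F12 = C (b ^ 6 * (4096 * (r5 - 2))) *
      (C ε * X 0 ^ 11 * X 1 + 11 * X 0 ^ 6 * X 1 ^ 6 - C ε * X 0 * X 1 ^ 11) := by
  apply MvPolynomial.funext
  intro p
  have h3 : ε ^ 3 = ε := by linear_combination ε * hε
  have h4 : ε ^ 4 = 1 := by linear_combination (ε ^ 2 + 1) * hε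
  have h5 : ε ^ 5 = ε := by linear_combination (ε ^ 3 + ε) * hε
  have h6 : ε ^ 6 = 1 := by linear_combination (ε ^ 4 + ε ^ 2 + 1) * hε
  have k3 : r5 ^ 3 = 5 * r5 := by linear_combination r5 * r5_sq
  have k4 : r5 ^ 4 = 25 := by linear_combination (r5 ^ 2 + 5) * r5_sq
  have k5 : r5 ^ 5 = 25 * r5 := by linear_combination (r5 ^ 3 + 5 * r5) * r5_sq
  have k6 : r5 ^ 6 = 125 := by linear_combination (r5 ^ 4 + 5 * r5 ^ 2 + 25) * r5_sq
  have k7 : r5 ^ 7 = 125 * r5 := by linear_combination r5 * k6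
  rw [eval_subst_frame_F12 hb hs]
  simp only [map_add, map_sub, map_mul, map_pow, eval_X, eval_C, map_ofNat]
  rw [mul_assoc (b ^ 6)]
  congr 1
  ring_nf
  simp only [hε, h3, h4, h5, h6, r5_sq, k3, k4, k5, k6, k7]
  ring

set_option maxRecDepth 100000 in
-- Here the axis passes through the centre of a face, and the exponents of X_0 are multiples of
-- three.
lemma subst_frame_F12_three {b : ℂ} (hb : b ^ 2 = 1 + (3 + r5) * b) (hs : star b = b) :
    subst (frame ![1, b]) F12 = C b ^ 6 * (C (36864 / 5 * r5 + 16384) * X 0 ^ 12 +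
      C (180224 * r5 + 405504) * X 0 ^ 9 * X 1 ^ 3 +
      C (-1216512 / 5 * r5 - 540672) * X 0 ^ 6 * X 1 ^ 6 +
      C (-180224 * r5 - 405504) * X 0 ^ 3 * X 1 ^ 9 + C (36864 / 5 * r5 + 16384) * X 1 ^ 12) := by
  apply MvPolynomial.funext
  intro p
  have k3 : r5 ^ 3 = 5 * r5 := by linear_combination r5 * r5_sq
  have k4 : r5 ^ 4 = 25 := by linear_combination (r5 ^ 2 + 5) * r5_sq
  have k5 : r5 ^ 5 = 25 * r5 := by linear_combination (r5 ^ 3 + 5 * r5) * r5_sq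
  have k6 : r5 ^ 6 = 125 := by linear_combination (r5 ^ 4 + 5 * r5 ^ 2 + 25) * r5_sq
  have k7 : r5 ^ 7 = 125 * r5 := by linear_combination r5 * k6
  rw [eval_subst_frame_F12 hb hs]
  simp only [map_add, map_mul, map_pow, eval_X, eval_C]
  congr 1
  ring_nf
  simp only [r5_sq, k3, k4, k5, k6, k7]
  ring

set_option maxRecDepth 100000 in
-- The covector is not real, so `eval_subst_frame_F12` does not apply. Everything is reduced by c² =
-- c + 1/2 and i² = -1. Only the exponents matter for invariance, hence the existential
-- coefficients.
lemma subst_frame_F12_half :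
    ∃ c : Fin 5 → ℂ, subst (frame ![1, (1 - r3) / 2 * (1 - Complex.I)]) F12 =
      C (c 0) * X 0 ^ 12 + C (c 1) * X 0 ^ 9 * X 1 ^ 3 + C (c 2) * X 0 ^ 6 * X 1 ^ 6 +
        C (c 3) * X 0 ^ 3 * X 1 ^ 9 + C (c 4) * X 1 ^ 12 := by
  obtain ⟨c, hc⟩ : ∃ c, c = (1 - r3) / 2 := ⟨_, rfl⟩
  have hcc : c ^ 2 = c + 1 / 2 := by
    rw [hc]
    linear_combination 1 / 4 * r3_sq
  have hc3 : c ^ 3 = 3 / 2 * c + 1 / 2 := by linear_combination (c + 1) * hcc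
  have hs : star c = c := by simp [hc]
  have hI := Complex.I_sq
  refine ⟨![2112 * c * Complex.I * r5 + 3872 / 5 * Complex.I * r5 - 4992 * c - 1824,
    21120 * c * Complex.I * r5 + 109824 * c * Complex.I - 21120 * c * r5 + 7744 * Complex.I * r5 +
      109824 * c + 40128 * Complex.I - 7744 * r5 + 40128, -101376 * c * r5 - 185856 / 5 * r5,
    21120 * c * Complex.I * r5 + 109824 * c * Complex.I + 21120 * c * r5 + 7744 * Complex.I * r5 -
      109824 * c + 40128 * Complex.I + 7744 * r5 - 40128,
    -2112 * c * Complex.I * r5 - 3872 / 5 * Complex.I * r5 - 4992 * c - 1824], ?_⟩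
  apply MvPolynomial.funext
  intro p
  rw [← hc, eval_subst_frame, eval_F12]
  simp only [Matrix.cons_val, star_one, one_mul, star_mul', hs, star_sub, star_I, sub_neg_eq_add,
    map_add, map_mul, map_pow, eval_C, eval_X]
  generalize p 0 = x
  generalize p 1 = z
  generalize Complex.I = i at *
  have e1 : ((x - c * (1 - i) * z) ^ 2 + (c * (1 + i) * x + z) ^ 2) ^ 2 =
    8 * c * i * x * z ^ 3 + 8 * c * i * x ^ 3 * z + 4 * c * i * x ^ 4 - 4 * c * i * z ^ 4 +
      24 * c * x * z ^ 3 - 24 * c * x ^ 3 * z - 8 * c * x ^ 4 - 8 * c * z ^ 4 + 2 * i * x ^ 4 -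
      2 * i * z ^ 4 + 8 * x * z ^ 3 - 8 * x ^ 3 * z - 2 * x ^ 4 - 2 * z ^ 4 := by
    have h : (x - c * (1 - i) * z) ^ 2 + (c * (1 + i) * x + z) ^ 2 =
      4 * c * i * x * z + 2 * c * i * x ^ 2 - 2 * c * i * z ^ 2 + i * x ^ 2 - i * z ^ 2 + x ^ 2 +
        z ^ 2 := by
      linear_combination (c ^ 2 * (x ^ 2 + z ^ 2)) * hI + (2 * i * (x ^ 2 - z ^ 2)) * hcc
    rw [h]
    ring_nf
    simp only [hI, hcc]
    ring
  have e2 : ((x - c * (1 - i) * z) * (c * (1 + i) * x + z)) ^ 2 =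
    -4 * c * i * x * z ^ 3 - 4 * c * i * x ^ 3 * z + 2 * c * i * x ^ 4 - 2 * c * i * z ^ 4 +
      4 * c * x * z ^ 3 - 4 * c * x ^ 3 * z - 2 * i * x * z ^ 3 - 2 * i * x ^ 3 * z + i * x ^ 4 -
      i * z ^ 4 + 2 * x * z ^ 3 - 2 * x ^ 3 * z := by
    have h : (x - c * (1 - i) * z) * (c * (1 + i) * x + z) =
      c * i * x ^ 2 + c * i * z ^ 2 - 2 * c * x * z + c * x ^ 2 - c * z ^ 2 := by
      linear_combination (c ^ 2 * x * z) * hI - (2 * x * z) * hcc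
    rw [h]
    ring_nf
    simp only [hI, hcc]
    ring
  have hi3 : i ^ 3 = -i := by linear_combination i * hI
  rw [e1, e2]
  ring_nf
  simp only [hI, hi3, hcc, hc3]
  ring

end Icosahedral

section Icosahedral

/-! ### The generating reflections -/

lemma root5_sq : ((r5 - 1 - lam) / 2) ^ 2 = 1 + 1 * (r5 - 1) * ((r5 - 1 - lam) / 2) := by
  linear_combination 1 / 4 * lam_sq - 1 / 4 * r5_sq

lemma root5_neg_sq : ((1 - r5 + lam) / 2) ^ 2 = 1 + -1 * (r5 - 1) * ((1 - r5 + lam) / 2) := by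
  linear_combination 1 / 4 * lam_sq - 1 / 4 * r5_sq

lemma root3_sq : ((r3 + r15 + r5 + 3) / 2) ^ 2 = 1 + (3 + r5) * ((r3 + r15 + r5 + 3) / 2) := by
  rw [r15_eq]
  linear_combination (1 / 4 * (1 + r5) ^ 2) * r3_sq + 1 / 2 * r5_sq

lemma subst_reflection_F12_five {b ε : ℂ} (hε : ε ^ 2 = 1) (hb : b ^ 2 = 1 + ε * (r5 - 1) * b)
    (hs : star b = b) : subst (reflection 1 ![1, b] 5) F12 = C (zeta 5) * F12 := by
  apply subst_reflection_of_frame one_vec_ne_zero_two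
  have h5 := zeta_pow (m := 5) (by norm_num)
  have h6 : zeta 5 ^ 6 = zeta 5 := by linear_combination zeta 5 * h5
  have h11 : zeta 5 ^ 11 = zeta 5 := by linear_combination (zeta 5 ^ 6 + zeta 5) * h5
  have e : C ε * X 0 ^ 11 * X 1 + 11 * X 0 ^ 6 * X 1 ^ 6 - C ε * X 0 * X 1 ^ 11 =
      C ε * X 0 ^ 11 * X 1 ^ 1 + C 11 * X 0 ^ 6 * X 1 ^ 6 +
        C (-ε) * X 0 ^ 1 * X (1 : Fin 2) ^ 11 := by
    rw [C_neg, map_ofNat]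
    ring
  rw [subst_frame_F12_five hε hb hs, e]
  simp only [map_mul (subst (diagRefl 0 (zeta 5))) (C (b ^ 6 * (4096 * (r5 - 2)))), subst_C,
    map_add, subst_diagRefl_zero_two]
  simp only [h6, h11, pow_one]
  ring

lemma subst_reflection_twelve {β : Fin 2 → ℂ} (hβ : β ≠ 0) {f : MvPolynomial (Fin 2) ℂ}
    {c₀ c₁ c₂ c₃ c₄ : ℂ} (h : subst (frame β) f = C c₀ * X 0 ^ 12 + C c₁ * X 0 ^ 9 * X 1 ^ 3 +
      C c₂ * X 0 ^ 6 * X 1 ^ 6 + C c₃ * X 0 ^ 3 * X 1 ^ 9 + C c₄ * X 1 ^ 12) :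
    subst (reflection 1 β 3) f = C 1 * f := by
  apply subst_reflection_of_frame hβ
  have h3 := zeta_pow (m := 3) (by norm_num)
  have h6 : zeta 3 ^ 6 = 1 := by linear_combination (zeta 3 ^ 3 + 1) * h3
  have h9 : zeta 3 ^ 9 = 1 := by linear_combination (zeta 3 ^ 6 + zeta 3 ^ 3 + 1) * h3
  have h12 : zeta 3 ^ 12 = 1 := by linear_combination (zeta 3 ^ 6 + 1) * h6
  have e : C c₀ * X 0 ^ 12 + C c₁ * X 0 ^ 9 * X 1 ^ 3 +
      C c₂ * X 0 ^ 6 * X 1 ^ 6 + C c₃ * X 0 ^ 3 * X 1 ^ 9 + C c₄ * X 1 ^ 12 =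
      C c₀ * X 0 ^ 12 * X 1 ^ 0 + C c₁ * X 0 ^ 9 * X 1 ^ 3 +
      C c₂ * X 0 ^ 6 * X 1 ^ 6 + C c₃ * X 0 ^ 3 * X 1 ^ 9 + C c₄ * X 0 ^ 0 * X (1 : Fin 2) ^ 12 := by
    ring
  rw [h, e]
  simp only [map_add, subst_diagRefl_zero_two]
  simp only [h3, h6, h9, h12, pow_zero, C_1]
  ring

lemma subst_reflection_F12_gamma :
    subst (reflection 1 ![1, (r3 + r15 + r5 + 3) / 2] 3) F12 = C 1 * F12 := by
  have e := subst_frame_F12_three root3_sq (by simp)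
  simp only [← C_pow, mul_add, ← mul_assoc, ← C_mul] at e
  exact subst_reflection_twelve one_vec_ne_zero_two e

lemma subst_reflection_F12_half :
    subst (reflection 1 ![1, (1 - r3) / 2 * (1 - Complex.I)] 3) F12 = C 1 * F12 := by
  obtain ⟨c, hc⟩ := subst_frame_F12_half
  exact subst_reflection_twelve one_vec_ne_zero_two hc

lemma subst_reflection_F12_one_zero : subst (reflection 1 ![1, 0] 2) F12 = C 1 * F12 := by
  apply subst_reflection_of_frame one_vec_ne_zero_two
  have h2 := zeta_pow (m := 2) (by norm_num)
  have h4 : zeta 2 ^ 4 = 1 := by linear_combination (zeta 2 ^ 2 + 1) * h2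
  have h6 : zeta 2 ^ 6 = 1 := by linear_combination (zeta 2 ^ 4 + zeta 2 ^ 2 + 1) * h2
  have h8 : zeta 2 ^ 8 = 1 := by linear_combination (zeta 2 ^ 4 + 1) * h4
  have h10 : zeta 2 ^ 10 = 1 := by linear_combination zeta 2 ^ 4 * h6 + h4
  have h12 : zeta 2 ^ 12 = 1 := by linear_combination (zeta 2 ^ 6 + 1) * h6
  have e : F12 = C 1 * X 0 ^ 12 * X 1 ^ 0 + C (22 / 5 * r5) * X 0 ^ 10 * X 1 ^ 2 +
      C (-33) * X 0 ^ 8 * X 1 ^ 4 + C (-(44 / 5 * r5)) * X 0 ^ 6 * X 1 ^ 6 +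
      C (-33) * X 0 ^ 4 * X 1 ^ 8 + C (22 / 5 * r5) * X 0 ^ 2 * X 1 ^ 10 +
      C 1 * X 0 ^ 0 * X 1 ^ 12 := by
    simp only [F12, C_neg, C_1, map_ofNat]
    ring
  rw [frame_one_zero, subst_one, e]
  simp only [map_add, subst_diagRefl_zero_two]
  simp only [h2, h4, h6, h8, h10, h12, pow_zero, C_1]
  ring

lemma jac2_F20_F30_ne_zero : jac2 F20 F30 ≠ 0 := fun h => by
  have := congrArg (eval ![1, 0]) h
  simp [jac2, F20, F30, Derivation.leibniz, Derivation.leibniz_pow] at this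

lemma jac2_F12_F30_ne_zero : jac2 F12 F30 ≠ 0 := fun h => by
  have := congrArg (eval ![1, 0]) h
  simp [jac2, F12, F30, Derivation.leibniz, Derivation.leibniz_pow] at this

lemma subst_five {b ε : ℂ} (hε : ε ^ 2 = 1) (hb : b ^ 2 = 1 + ε * (r5 - 1) * b) (hs : star b = b) :
    subst (reflection 1 ![1, b] 5) F20 = F20 ∧ subst (reflection 1 ![1, b] 5) F30 = F30 := by
  have := subst_F20_F30 one_vec_ne_zero_two (subst_reflection_F12_five hε hb hs)
  simpa [zeta_ne_zero] using this

/-- With trivial character on `F12`, the covariants acquire ζ⁻² and ζ⁻³ = 1; this is why `F20`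
enters through its cube. -/
lemma subst_three {β : Fin 2 → ℂ} (hβ : β ≠ 0) (h : subst (reflection 1 β 3) F12 = C 1 * F12) :
    subst (reflection 1 β 3) (F20 ^ 3) = F20 ^ 3 ∧ subst (reflection 1 β 3) F30 = F30 := by
  obtain ⟨h1, h2⟩ := subst_F20_F30 hβ h
  have h3 := zeta_pow (m := 3) (by norm_num)
  refine ⟨?_, by simpa [h3] using h2⟩
  rw [map_pow, h1, mul_pow, ← C_pow, ← pow_mul, div_pow, one_pow,
    show zeta 3 ^ (2 * 3) = (zeta 3 ^ 3) ^ 2 by ring, h3]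
  simp

lemma subst_two : subst (reflection 1 ![1, 0] 2) F20 = F20 ∧
    subst (reflection 1 ![1, 0] 2) (F30 ^ 2) = F30 ^ 2 := by
  obtain ⟨h1, h2⟩ := subst_F20_F30 one_vec_ne_zero_two subst_reflection_F12_one_zero
  have h3 := zeta_pow (m := 2) (by norm_num)
  refine ⟨by simpa [h3] using h1, ?_⟩
  rw [map_pow, h2, mul_pow, ← C_pow, ← pow_mul, div_pow, one_pow,
    show zeta 2 ^ (3 * 2) = (zeta 2 ^ 2) ^ 3 by ring, h3]
  simp

/-! ### Reduction of the generators -/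

section Reduction

variable {k : Type} [Field k] {p : ℕ} {φ : integralClosure ℤ ℂ →+* k} [CharP k p]

/-- The covector entry satisfies z² = (√5 - 1) z + 1, so neither λ nor one half has to be reduced
separately. -/
lemma red_root5 {x : ℤ} (hr : Red φ r5 x) (a b : ℤ)
    (h : (p : ℤ) ∣ x - 1 - (a + b) ∧ (p : ℤ) ∣ -1 - a * b) :
    Red φ ((r5 - 1 - lam) / 2) a ∨ Red φ ((r5 - 1 - lam) / 2) b :=
  Red.of_quadratic (s := r5 - 1) (t := -1) (by linear_combination root5_sq)
    ((hr.sub Red.one).congr h.1) (Red.one.neg.congr h.2)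

lemma genRed_root5 {x : ℤ} (hr : Red φ ((r5 - 1 - lam) / 2) x) (z : ℕ)
    (hz : p ≠ 0 ∧ ¬ p ∣ 5 ∧ (p : ℤ) ∣ ((z : ℤ) + 1) ^ 5 - 1) :
    GroupData.GenRed φ p (1 : Matrix (Fin 2) (Fin 2) ℂ) (![1, (r5 - 1 - lam) / 2], 5)
      ([residue p 1, residue p x], [residue p 1, residue p x], z) :=
  genRed_two 1 1 (Red.one.of_eq (by simp)) (hr.of_eq (by simp)) (Red.one.of_eq (by simp))
    (hr.of_eq (by simp)) z hz one_ne_zero one_ne_zero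

lemma genRed_root5_neg {x : ℤ} (hr : Red φ ((r5 - 1 - lam) / 2) x) (z : ℕ)
    (hz : p ≠ 0 ∧ ¬ p ∣ 5 ∧ (p : ℤ) ∣ ((z : ℤ) + 1) ^ 5 - 1) :
    GroupData.GenRed φ p (1 : Matrix (Fin 2) (Fin 2) ℂ) (![1, (1 - r5 + lam) / 2], 5)
      ([residue p 1, residue p (-x)], [residue p 1, residue p (-x)], z) :=
  genRed_two 1 1 (Red.one.of_eq (by simp)) (hr.neg.of_eq (by simp; ring)) (Red.one.of_eq (by simp))
    (hr.neg.of_eq (by simp; ring)) z hz one_ne_zero one_ne_zero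

lemma genRed_root3 {x y : ℤ} (h3 : Red φ r3 x) (h5 : Red φ r5 y) (z : ℕ)
    (hz : p ≠ 0 ∧ ¬ p ∣ 3 ∧ (p : ℤ) ∣ ((z : ℤ) + 1) ^ 3 - 1) :
    GroupData.GenRed φ p (1 : Matrix (Fin 2) (Fin 2) ℂ) (![1, (r3 + r15 + r5 + 3) / 2], 3)
      ([residue p 2, residue p (x + x * y + y + 3)],
        [residue p 2, residue p (x + x * y + y + 3)], z) := by
  have h := ((h3.add (h3.mul h5)).add h5).add (Red.ofNat 3)
  exact genRed_two 2 2 ((Red.ofNat 2).of_eq (by simp)) (h.of_eq (by simp [r15_eq]; ring))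
    ((Red.ofNat 2).of_eq (by simp)) (h.of_eq (by simp [r15_eq]; ring)) z hz two_ne_zero two_ne_zero

lemma genRed_half_conj {x y : ℤ} (hi : Red φ Complex.I x) (hr : Red φ r3 y) (z : ℕ)
    (hz : p ≠ 0 ∧ ¬ p ∣ 3 ∧ (p : ℤ) ∣ ((z : ℤ) + 1) ^ 3 - 1) :
    GroupData.GenRed φ p (1 : Matrix (Fin 2) (Fin 2) ℂ) (![1, (1 - r3) / 2 * (1 - Complex.I)], 3)
      ([residue p 2, residue p ((1 - y) * (1 - x))],
        [residue p 2, residue p ((1 - y) * (1 + x))], z) :=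
  genRed_two 2 2 ((Red.ofNat 2).of_eq (by simp))
    (((Red.one.sub hr).mul (Red.one.sub hi)).of_eq (by simp; ring)) ((Red.ofNat 2).of_eq (by simp))
    (((Red.one.sub hr).mul (Red.one.add hi)).of_eq (by simp; ring)) z hz two_ne_zero two_ne_zero

end Reduction

/-! ### The groups -/

lemma basic_G16 : (dataTwo [(![1, (r5 - 1 - lam) / 2], 5), (![1, (1 - r5 + lam) / 2], 5)]
    ![20, 30] ![F20, F30] 30 [(5, 12)]).Basic := by
  apply basic_two
  · simp only [List.forall_mem_cons, Fin.forall_fin_two]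
    exact ⟨⟨one_vec_ne_zero_two, by norm_num, subst_five (by norm_num) root5_sq (by simp)⟩,
      ⟨one_vec_ne_zero_two, by norm_num, subst_five (by norm_num) root5_neg_sq (by simp)⟩, by simp⟩
  · exact Fin.forall_fin_two.mpr ⟨isHomogeneous_F20, isHomogeneous_F30⟩
  · decide
  · exact jac2_F20_F30_ne_zero

lemma conclusion_G16 : (STGroup.data .G16).Conclusion := by
  have : Fact (Nat.Prime 41) := ⟨by norm_num⟩
  refine conclusion_two basic_G16 41 [(0, 0), (1, 1), (1, 0), (1, 0), (1, 0), (1, 0), (4, 1), (1, 0),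
    (1, 0), (1, 0), (1, 0), (5, 1)] ?_ 0 0 (by decide) (Or.inl rfl)
  intro k _ _ φ
  -- Modulo 41 one has 13² = 5 and 10⁵ = 1. In the second case the eigenvalue of the second
  -- generator is taken to be 37 = 10⁴, so that one list of moves covers all cases.
  rcases Red.of_sq (φ := φ) (p := 41) r5_sq (a := 13) (Red.ofNat 5) (by decide) with hr | hr
  · rcases red_root5 (p := 41) hr 24 29 (by decide) with ha | ha <;>
    exact ⟨_, .cons (genRed_root5 ha 9 (by decide)) (.cons (genRed_root5_neg ha 9 (by decide)) .nil),
      by decide +kernel⟩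
  · rcases red_root5 (p := 41) hr 31 37 (by decide) with ha | ha <;>
    exact ⟨_, .cons (genRed_root5 ha 9 (by decide)) (.cons (genRed_root5_neg ha 36 (by decide)) .nil),
      by decide +kernel⟩

lemma basic_G17 : (dataTwo [(![1, 0], 2), (![1, (r5 - 1 - lam) / 2], 5)]
    ![20, 60] ![F20, F30 ^ 2 + C (29 / 12000 * r5) * F20 ^ 3] 60 [(2, 30), (5, 12)]).Basic := by
  apply basic_two
  · simp only [List.forall_mem_cons, Fin.forall_fin_two]
    refine ⟨⟨one_vec_ne_zero_two, by norm_num, ?_⟩, ⟨one_vec_ne_zero_two, by norm_num, ?_⟩, by simp⟩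
    · obtain ⟨h1, h2⟩ := subst_two
      refine ⟨h1, ?_⟩
      change subst _ (F30 ^ 2 + C _ * F20 ^ 3) = F30 ^ 2 + C _ * F20 ^ 3
      rw [map_add, h2, map_mul (subst _), subst_C, map_pow, h1]
    · obtain ⟨h1, h2⟩ := subst_five (by norm_num) root5_sq (by simp)
      simp [h1, h2]
  · exact Fin.forall_fin_two.mpr ⟨isHomogeneous_F20, (isHomogeneous_F30.pow 2).add
      ((isHomogeneous_F20.pow 3).C_mul _)⟩
  · decide
  · exact jac2_pow_add_ne_zero (by norm_num) _ _ jac2_F20_F30_ne_zero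

lemma expand_F20_two : Expand 2 20 F20 1 (-(38 / 3 * r5)) :=
  ⟨-C (38 / 3 * r5) * X 1 ^ 18 - 19 * X 0 ^ 2 * X 1 ^ 16 - C (152 * r5) * X 0 ^ 4 * X 1 ^ 14
    - 494 * X 0 ^ 6 * X 1 ^ 12 + C (988 / 3 * r5) * X 0 ^ 8 * X 1 ^ 10 - 494 * X 0 ^ 10 * X 1 ^ 8
    - C (152 * r5) * X 0 ^ 12 * X 1 ^ 6 - 19 * X 0 ^ 14 * X 1 ^ 4
    - C (38 / 3 * r5) * X 0 ^ 16 * X 1 ^ 2 + X 0 ^ 18, by rw [F20, C_1]; ring, by simp⟩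

lemma expand_F12_two : Expand 2 12 F12 1 (22 / 5 * r5) :=
  ⟨C (22 / 5 * r5) * X 1 ^ 10 - 33 * X 0 ^ 2 * X 1 ^ 8 - C (44 / 5 * r5) * X 0 ^ 4 * X 1 ^ 6
    - 33 * X 0 ^ 6 * X 1 ^ 4 + C (22 / 5 * r5) * X 0 ^ 8 * X 1 ^ 2 + X 0 ^ 10,
    by rw [F12, C_1]; ring, by simp⟩

lemma expand_F30_sq_two : Expand 2 60 (F30 ^ 2) 0 1 := by
  refine ⟨(X 0 ^ 28 * X 1 - C (116 / 45 * r5) * X 0 ^ 26 * X 1 ^ 3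
    + C (1769 / 25) * X 0 ^ 24 * X 1 ^ 5 + C (464 / 5 * r5) * X 0 ^ 22 * X 1 ^ 7
    + C (2001 / 5) * X 0 ^ 20 * X 1 ^ 9 - C (2668 / 15 * r5) * X 0 ^ 18 * X 1 ^ 11
    + C (12673 / 5) * X 0 ^ 16 * X 1 ^ 13 - C (12673 / 5) * X 0 ^ 12 * X 1 ^ 17
    + C (2668 / 15 * r5) * X 0 ^ 10 * X 1 ^ 19 - C (2001 / 5) * X 0 ^ 8 * X 1 ^ 21
    - C (464 / 5 * r5) * X 0 ^ 6 * X 1 ^ 23 - C (1769 / 25) * X 0 ^ 4 * X 1 ^ 25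
    + C (116 / 45 * r5) * X 0 ^ 2 * X 1 ^ 27 - X 1 ^ 29) ^ 2, ?_, by simp⟩
  rw [C_0, zero_mul, zero_add, ← mul_pow]
  refine congrArg (· ^ 2) ?_
  rw [F30]
  ring

lemma conclusion_G17 : (STGroup.data .G17).Conclusion := by
  have : Fact (Nat.Prime 41) := ⟨by norm_num⟩
  refine conclusion_two basic_G17 41 [(0, 0), (0, 1), (1, 0), (1, 1), (1, 0), (1, 1), (1, 0), (1, 1),
    (1, 0), (2, 1), (1, 0), (8, 1), (1, 0), (13, 1), (1, 0), (1, 1), (1, 0), (1, 1), (1, 0), (1, 1),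
    (1, 0), (2, 1), (1, 0), (1, 1), (1, 0), (1, 1), (1, 0), (1, 1), (1, 0), (2, 1), (1, 0), (1, 1),
    (1, 0), (1, 1), (1, 0), (1, 1), (1, 0), (4, 1), (1, 0), (1, 1), (15, 1), (1, 0)] ?_ 1 0
    (by decide +kernel) (Or.inr ?_)
  · intro k _ _ φ
    rcases Red.of_sq (φ := φ) (p := 41) r5_sq (a := 13) (Red.ofNat 5) (by decide) with hr | hr
    · rcases red_root5 (p := 41) hr 24 29 (by decide) with ha | ha <;>
      exact ⟨_, .cons (genRed_one_zero 2 39 (by decide)) (.cons (genRed_root5 ha 9 (by decide)) .nil),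
        by decide +kernel⟩
    · rcases red_root5 (p := 41) hr 31 37 (by decide) with ha | ha <;>
      exact ⟨_, .cons (genRed_one_zero 2 39 (by decide)) (.cons (genRed_root5 ha 15 (by decide)) .nil),
        by decide +kernel⟩
  · have h2 := expand_F30_sq_two.add ((expand_F20_two.pow (by norm_num) 3).C_mul (29 / 12000 * r5))
    refine goodAt_two_of_expand basic_G17 (a := (![1, 0], 2)) (by simp)
      (V := ![_, _]) (W := ![_, _])
      (Fin.forall_fin_two.mpr ⟨expand_subst_one expand_F20_two, expand_subst_one h2⟩) ?_
    simp
    ring_nf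
    simp only [r5_sq]
    norm_num

lemma basic_G20 : (dataTwo
    [(![1, (1 - r3) / 2 * (1 - Complex.I)], 3), (![1, (r3 + r15 + r5 + 3) / 2], 3)]
    ![12, 30] ![F12, F30] 30 [(3, 20)]).Basic := by
  apply basic_two
  · simp only [List.forall_mem_cons, Fin.forall_fin_two]
    exact ⟨⟨one_vec_ne_zero_two, by norm_num, by simpa using subst_reflection_F12_half,
        (subst_three one_vec_ne_zero_two subst_reflection_F12_half).2⟩,
      ⟨one_vec_ne_zero_two, by norm_num, by simpa using subst_reflection_F12_gamma,
        (subst_three one_vec_ne_zero_two subst_reflection_F12_gamma).2⟩, by simp⟩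
  · exact Fin.forall_fin_two.mpr ⟨isHomogeneous_F12, isHomogeneous_F30⟩
  · decide
  · exact jac2_F12_F30_ne_zero

lemma conclusion_G20 : (STGroup.data .G20).Conclusion := by
  have : Fact (Nat.Prime 61) := ⟨by norm_num⟩
  refine conclusion_two basic_G20 61 [(0, 0), (1, 1), (1, 0), (1, 0), (1, 1), (1, 0), (1, 0), (2, 1),
    (1, 0), (1, 0), (2, 1), (1, 0), (1, 0), (2, 1), (1, 0), (1, 0), (3, 1), (7, 1), (1, 0), (1, 0)]
    ?_ 0 0 (by decide) (Or.inl rfl)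
  intro k _ _ φ
  have hi := Red.of_sq (φ := φ) (p := 61) Complex.I_sq (a := 11) Red.one.neg (by decide)
  have h3 := Red.of_sq (φ := φ) (p := 61) r3_sq (a := 8) (Red.ofNat 3) (by decide)
  have h5 := Red.of_sq (φ := φ) (p := 61) r5_sq (a := 26) (Red.ofNat 5) (by decide)
  rcases hi with hi | hi <;> rcases h3 with h3 | h3 <;> rcases h5 with h5 | h5 <;>
  exact ⟨_, .cons (genRed_half_conj hi h3 12 (by decide))
    (.cons (genRed_root3 h3 h5 12 (by decide)) .nil), by decide +kernel⟩

lemma basic_G21 : (dataTwo [(![1, 0], 2), (![1, (r3 + r15 + r5 + 3) / 2], 3)]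
    ![12, 60] ![F12, F30 ^ 2 - C (29 / 14400 * r5) * F12 ^ 5] 60 [(2, 30), (3, 20)]).Basic := by
  apply basic_two
  · simp only [List.forall_mem_cons, Fin.forall_fin_two]
    refine ⟨⟨one_vec_ne_zero_two, by norm_num, ?_⟩, ⟨one_vec_ne_zero_two, by norm_num, ?_⟩, by simp⟩
    · have h1 := subst_reflection_F12_one_zero
      have h2 := subst_two.2
      rw [C_1, one_mul] at h1
      refine ⟨h1, ?_⟩
      change subst _ (F30 ^ 2 - C _ * F12 ^ 5) = F30 ^ 2 - C _ * F12 ^ 5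
      rw [map_sub, h2, map_mul (subst _), subst_C, map_pow, h1]
    · have h1 := subst_reflection_F12_gamma
      simp [h1, (subst_three one_vec_ne_zero_two h1).2]
  · exact Fin.forall_fin_two.mpr ⟨isHomogeneous_F12, (isHomogeneous_F30.pow 2).sub
      ((isHomogeneous_F12.pow 5).C_mul _)⟩
  · decide
  · exact jac2_pow_sub_ne_zero (by norm_num) _ _ jac2_F12_F30_ne_zero

lemma conclusion_G21 : (STGroup.data .G21).Conclusion := by
  have : Fact (Nat.Prime 61) := ⟨by norm_num⟩
  refine conclusion_two basic_G21 61 [(0, 0), (0, 1), (1, 0), (1, 1), (1, 0), (1, 1), (1, 0), (1, 1),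
    (1, 0), (2, 1), (1, 0), (1, 1), (1, 0), (1, 1), (1, 0), (2, 1), (1, 0), (1, 1), (1, 0), (2, 1),
    (1, 0), (21, 1), (1, 0), (1, 1), (1, 0), (1, 1), (1, 0), (1, 1), (1, 0), (2, 1), (1, 0), (1, 1),
    (1, 0), (1, 1), (1, 0), (2, 1), (1, 0), (1, 1), (1, 0), (1, 1), (1, 0), (2, 1), (1, 0), (1, 1),
    (1, 0), (2, 1), (1, 0), (1, 1), (1, 0), (2, 1)] ?_ 1 0 (by decide +kernel) (Or.inr ?_)
  · intro k _ _ φ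
    have h3 := Red.of_sq (φ := φ) (p := 61) r3_sq (a := 8) (Red.ofNat 3) (by decide)
    have h5 := Red.of_sq (φ := φ) (p := 61) r5_sq (a := 26) (Red.ofNat 5) (by decide)
    rcases h3 with h3 | h3 <;> rcases h5 with h5 | h5 <;>
    exact ⟨_, .cons (genRed_one_zero 2 59 (by decide))
      (.cons (genRed_root3 h3 h5 12 (by decide)) .nil), by decide +kernel⟩
  · have h2 := expand_F30_sq_two.add
      ((expand_F12_two.pow (by norm_num) 5).C_mul (-(29 / 14400 * r5)))
    rw [C_neg, neg_mul, ← sub_eq_add_neg] at h2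
    refine goodAt_two_of_expand basic_G21 (a := (![1, 0], 2)) (by simp)
      (V := ![_, _]) (W := ![_, _])
      (Fin.forall_fin_two.mpr ⟨expand_subst_one expand_F12_two, expand_subst_one h2⟩) ?_
    simp
    ring_nf
    simp only [r5_sq]
    norm_num

lemma basic_G18 : (dataTwo
    [(![1, (1 - r3) / 2 * (1 - Complex.I)], 3), (![1, (r5 - 1 - lam) / 2], 5)]
    ![30, 60] ![F30, F20 ^ 3 + C (38 * r5) * F30 ^ 2] 60 [(3, 20), (5, 12)]).Basic := by
  apply basic_two
  · simp only [List.forall_mem_cons, Fin.forall_fin_two]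
    refine ⟨⟨one_vec_ne_zero_two, by norm_num, ?_⟩, ⟨one_vec_ne_zero_two, by norm_num, ?_⟩, by simp⟩
    · obtain ⟨h1, h2⟩ := subst_three one_vec_ne_zero_two subst_reflection_F12_half
      refine ⟨h2, ?_⟩
      change subst _ (F20 ^ 3 + C _ * F30 ^ 2) = F20 ^ 3 + C _ * F30 ^ 2
      rw [map_add, h1, map_mul (subst _), subst_C, map_pow, h2]
    · obtain ⟨h1, h2⟩ := subst_five (by norm_num) root5_sq (by simp)
      simp [h1, h2]
  · exact Fin.forall_fin_two.mpr ⟨isHomogeneous_F30, (isHomogeneous_F20.pow 3).add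
      ((isHomogeneous_F30.pow 2).C_mul _)⟩
  · decide
  · exact jac2_pow_add_ne_zero (by norm_num) _ _ (jac2_ne_zero_comm jac2_F20_F30_ne_zero)

/-- Klein's icosahedral form and its covariants. -/
lemma expand_klein {f : MvPolynomial (Fin 2) ℂ}
    (hf : f = X 0 ^ 11 * X 1 + 11 * X 0 ^ 6 * X 1 ^ 6 - X 0 * X 1 ^ 11) :
    Expand 5 20 (hess2 f) (-121) (-27588) ∧ Expand 5 30 (jac2 f (hess2 f)) 2420 (-1263240) := by
  have e : hess2 f = -121 * X 0 ^ 20 + 27588 * X 0 ^ 15 * X 1 ^ 5 - 59774 * X 0 ^ 10 * X 1 ^ 10 -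
      27588 * X 0 ^ 5 * X 1 ^ 15 - 121 * X 1 ^ 20 := by
    apply MvPolynomial.funext
    intro p
    simp [hf, hess2, Derivation.leibniz, Derivation.leibniz_pow]
    ring
  constructor
  · refine ⟨-121 * X 0 ^ 15 + 27588 * X 0 ^ 10 * X 1 ^ 5 - 59774 * X 0 ^ 5 * X 1 ^ 10 -
      27588 * X 1 ^ 15, ?_, by simp⟩
    rw [e, C_neg, map_ofNat]
    ring
  · refine ⟨2420 * X 0 ^ 25 + 1263240 * X 0 ^ 20 * X 1 ^ 5 - 24212100 * X 0 ^ 15 * X 1 ^ 10 -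
      24212100 * X 0 ^ 5 * X 1 ^ 20 - 1263240 * X 1 ^ 25, ?_, by simp⟩
    rw [e]
    apply MvPolynomial.funext
    intro p
    simp [hf, jac2, Derivation.leibniz, Derivation.leibniz_pow]
    ring

/-- In the frame `F20` and `F30` are multiples of Klein's covariants. The coordinate of degree 60
combines the cube of one with the square of the other, so only the relation between s³ and t² is
needed; it survives the elimination of the factor `L` and of the determinant of the frame. -/
lemma expand_frame_five : ∃ s t : ℂ, 121 * s ^ 3 = 24000 * r5 * t ^ 2 ∧
    Expand 5 20 (subst (frame ![1, (r5 - 1 - lam) / 2]) F20) (s * -121) (s * -27588) ∧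
    Expand 5 30 (subst (frame ![1, (r5 - 1 - lam) / 2]) F30) (t * 2420) (t * -1263240) := by
  set g := frame ![1, (r5 - 1 - lam) / 2] with hg
  have hd : g.det ≠ 0 := by
    rw [hg, det_frame]
    exact isMetric_one.normSq_ne_zero one_vec_ne_zero_two
  have h5 := r5_ne_zero
  obtain ⟨f, hf⟩ : ∃ f : MvPolynomial (Fin 2) ℂ,
      f = X 0 ^ 11 * X 1 + 11 * X 0 ^ 6 * X 1 ^ 6 - X 0 * X 1 ^ 11 := ⟨_, rfl⟩
  obtain ⟨e20, e30⟩ := expand_klein hf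
  obtain ⟨L, hL⟩ : ∃ L : ℂ, subst g F12 = C L * f := by
    have e := subst_frame_F12_five (one_pow 2) root5_sq (by simp)
    rw [C_1, one_mul, one_mul, ← hf] at e
    exact ⟨_, e⟩
  obtain ⟨s, hs⟩ : ∃ s, s * (g.det ^ 2 * (5808 / 5 * r5)) = L ^ 2 :=
    ⟨L ^ 2 / (g.det ^ 2 * (5808 / 5 * r5)), div_mul_cancel₀ _ (by simp [hd, h5])⟩
  obtain ⟨t, ht⟩ : ∃ t, t * (g.det * (-480 * r5)) = L * s :=
    ⟨L * s / (g.det * (-480 * r5)), div_mul_cancel₀ _ (by simp [hd, h5])⟩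
  have h20 : subst g F20 = C s * hess2 f := by
    have h := hess2_subst g F12
    rw [hess2_F12, map_mul (subst g), subst_C, hL, hess2_C_mul, ← mul_assoc, ← C_mul, ← hs, C_mul,
      mul_assoc, mul_left_comm] at h
    exact (mul_left_cancel₀ (by simp [hd, h5]) h).symm
  have h30 : subst g F30 = C t * jac2 f (hess2 f) := by
    have h := jac2_subst g F12 F20
    rw [jac2_F12_F20, map_mul (subst g), subst_C, hL, h20, jac2_C_mul, ← mul_assoc, ← C_mul, ← ht,
      C_mul, mul_assoc, mul_left_comm] at h
    exact (mul_left_cancel₀ (by simp [hd, h5]) h).symm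
  refine ⟨s, t, ?_, h20 ▸ e20.C_mul s, h30 ▸ e30.C_mul t⟩
  refine mul_left_cancel₀ (pow_ne_zero 2 hd) ?_
  linear_combination (r5 / 48 * s ^ 2) * hs - (r5 / 48 * (t * (g.det * (-480 * r5)) + L * s)) * ht +
    (4800 * r5 * t ^ 2 - 121 / 5 * s ^ 3) * g.det ^ 2 * r5_sq

lemma conclusion_G18 : (STGroup.data .G18).Conclusion := by
  have : Fact (Nat.Prime 61) := ⟨by norm_num⟩
  refine conclusion_two basic_G18 61 [(0, 0), (0, 1), (1, 0), (1, 0), (2, 1), (1, 0), (1, 0), (2, 1),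
    (1, 0), (1, 0), (3, 1), (1, 0), (1, 0), (13, 1), (1, 0), (1, 0), (2, 1), (1, 0), (1, 0), (2, 1),
    (1, 0), (1, 0), (3, 1), (1, 0), (1, 0), (2, 1), (1, 0), (1, 0), (3, 1), (1, 0), (1, 0), (3, 1)]
    ?_ 0 1 (by decide) (Or.inr ?_)
  · intro k _ _ φ
    have hi := Red.of_sq (φ := φ) (p := 61) Complex.I_sq (a := 11) Red.one.neg (by decide)
    have h3 := Red.of_sq (φ := φ) (p := 61) r3_sq (a := 8) (Red.ofNat 3) (by decide)
    have h5 := Red.of_sq (φ := φ) (p := 61) r5_sq (a := 26) (Red.ofNat 5) (by decide)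
    -- Modulo 61 one has 26² = 5. The fifth root of unity (9, 34, 20 or 58, all powers of 9) is
    -- chosen case by case so that the same moves always pass.
    rcases h5 with h5 | h5
    · rcases red_root5 (p := 61) h5 34 52 (by decide) with ha | ha <;>
      rcases h3 with h3 | h3 <;> rcases hi with hi | hi <;>
      first
      | exact ⟨_, .cons (genRed_half_conj hi h3 12 (by decide))
          (.cons (genRed_root5 ha 8 (by decide)) .nil), by decide +kernel⟩
      | exact ⟨_, .cons (genRed_half_conj hi h3 12 (by decide))
          (.cons (genRed_root5 ha 33 (by decide)) .nil), by decide +kernel⟩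
    · rcases red_root5 (p := 61) h5 47 48 (by decide) with ha | ha <;>
      rcases h3 with h3 | h3 <;> rcases hi with hi | hi <;>
      first
      | exact ⟨_, .cons (genRed_half_conj hi h3 12 (by decide))
          (.cons (genRed_root5 ha 19 (by decide)) .nil), by decide +kernel⟩
      | exact ⟨_, .cons (genRed_half_conj hi h3 12 (by decide))
          (.cons (genRed_root5 ha 57 (by decide)) .nil), by decide +kernel⟩
  · obtain ⟨s, t, hst, hB, hT⟩ := expand_frame_five
    have h2 := (hB.pow (by norm_num) 3).add ((hT.pow (by norm_num) 2).C_mul (38 * r5))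
    rw [← map_pow, ← map_pow, ← subst_C (frame ![1, (r5 - 1 - lam) / 2]), ← map_mul, ← map_add] at h2
    refine goodAt_two_of_expand basic_G18 (a := (![1, (r5 - 1 - lam) / 2], 5)) (by simp)
      (V := ![_, _]) (W := ![_, _]) (Fin.forall_fin_two.mpr ⟨hT, h2⟩) ?_
    simp
    linear_combination (2908194537600/59 * t) * hst

end Icosahedral

/-! ## Groups of rank three -/

section RankThree

/-- The data in rank three. -/
abbrev dataThree (h : Matrix (Fin 3) (Fin 3) ℂ) (gens : List ((Fin 3 → ℂ) × ℕ)) (deg : Fin 3 → ℕ)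
    (u : Fin 3 → MvPolynomial (Fin 3) ℂ) (N : ℕ) (table : List (ℕ × ℕ)) : GroupData :=
  { n := 3, h := h, gens := gens, deg := deg, u := u, N := N, table := table }

lemma genRed_three {k : Type} [Field k] {p : ℕ} {φ : integralClosure ℤ ℂ →+* k} [CharP k p]
    {h : Matrix (Fin 3) (Fin 3) ℂ} (c d : ℂ) {α : Fin 3 → ℂ} {m : ℕ} {x₀ x₁ x₂ y₀ y₁ y₂ : ℤ}
    (h₀ : Red φ (c * α 0) x₀) (h₁ : Red φ (c * α 1) x₁) (h₂ : Red φ (c * α 2) x₂)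
    (k₀ : Red φ (d * sharp h α 0) y₀) (k₁ : Red φ (d * sharp h α 1) y₁)
    (k₂ : Red φ (d * sharp h α 2) y₂) (z : ℕ)
    (hz : p ≠ 0 ∧ ¬ p ∣ m ∧ (p : ℤ) ∣ ((z : ℤ) + 1) ^ m - 1) (hc : c ≠ 0) (hd : d ≠ 0) :
    GroupData.GenRed φ p h (α, m) ([residue p x₀, residue p x₁, residue p x₂],
      [residue p y₀, residue p y₁, residue p y₂], z) := by
  refine ⟨c, d, hc, hd, ⟨rfl, fun i => ?_⟩, ⟨rfl, fun i => ?_⟩, hz.2⟩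
  · fin_cases i
    · exact h₀.residue hz.1
    · exact h₁.residue hz.1
    · exact h₂.residue hz.1
  · fin_cases i
    · exact k₀.residue hz.1
    · exact k₁.residue hz.1
    · exact k₂.residue hz.1

/-- Unlike rank two, the tangential condition is not automatic, so the local conditions are required
for both labels. -/
lemma conclusion_three {h : Matrix (Fin 3) (Fin 3) ℂ} {gens : List ((Fin 3 → ℂ) × ℕ)}
    {deg : Fin 3 → ℕ} {u : Fin 3 → MvPolynomial (Fin 3) ℂ} {N : ℕ} {table : List (ℕ × ℕ)}
    (hD : (dataThree h gens deg u N table).Basic) (p : ℕ) [Fact p.Prime] (moves : List (ℕ × ℕ))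
    (hred : ∀ (k : Type) [Field k] [CharP k p] (φ : integralClosure ℤ ℂ →+* k),
      ∃ S, List.Forall₂ (GroupData.GenRed φ p h) gens S ∧ checkMoves p 3 S moves [] = true)
    (i j : ℕ)
    (hnum : (((labelList moves []).map fun j => (gens.getD j 0).2 - 1).sum = ∑ l, (deg l - 1)) ∧
      ((labelList moves []).length = (table.map Prod.snd).sum) ∧
      (∀ a ∈ table, ((labelList moves []).map fun j =>
        if (gens.getD j 0).2 = a.1 then 1 else 0).sum = a.2) ∧
      (∀ t ∈ labelList moves [], t = i ∨ t = j))
    (hi : (dataThree h gens deg u N table).GoodAt (gens.getD i 0).1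
      ((gens.getD i 0).2 - 1) ((gens.getD i 0).2 / N))
    (hj : (dataThree h gens deg u N table).GoodAt (gens.getD j 0).1
      ((gens.getD j 0).2 - 1) ((gens.getD j 0).2 / N)) :
    (dataThree h gens deg u N table).Conclusion := by
  obtain ⟨hsum, hcard, htable, hlab⟩ := hnum
  obtain ⟨F, hF⟩ := hD.exists_mirrorFamily p moves hred hsum
  refine hD.conclusion_of_moves moves F hF (fun t => ?_) hcard htable
  rw [hF]
  have hmem : (labelList moves []).getD t 0 ∈ labelList moves [] := by
    rw [List.getD_eq_getElem _ _ t.2]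
    exact List.getElem_mem _
  rcases hlab _ hmem with h1 | h1
  · rw [h1]
    exact hi
  · rw [h1]
    exact hj

/-- `f = A + x ^ κ c + …`, where `A` does not depend on the first variable `x`. -/
def NormalForm (κ : ℕ) (f A c : MvPolynomial (Fin 3) ℂ) : Prop :=
  pderiv 0 A = 0 ∧ ∃ e, f = A + X 0 ^ κ * (c + X 0 * e)

section NormalForm

variable {κ : ℕ} {f f' A A' c c' : MvPolynomial (Fin 3) ℂ}

lemma NormalForm.add (h : NormalForm κ f A c) (h' : NormalForm κ f' A' c') :
    NormalForm κ (f + f') (A + A') (c + c') := by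
  obtain ⟨hA, e, rfl⟩ := h
  obtain ⟨hA', e', rfl⟩ := h'
  exact ⟨by rw [map_add, hA, hA', add_zero], e + e', by ring⟩

lemma NormalForm.mul (hκ : κ ≠ 0) (h : NormalForm κ f A c) (h' : NormalForm κ f' A' c') :
    NormalForm κ (f * f') (A * A') (A * c' + c * A') := by
  obtain ⟨hA, e, rfl⟩ := h
  obtain ⟨hA', e', rfl⟩ := h'
  obtain ⟨j, rfl⟩ := Nat.exists_eq_succ_of_ne_zero hκ
  refine ⟨by rw [Derivation.leibniz, hA, hA', smul_zero, smul_zero, add_zero],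
    A * e' + e * A' + X 0 ^ j * (c + X 0 * e) * (c' + X 0 * e'), ?_⟩
  rw [Nat.succ_eq_add_one, pow_succ]
  ring

lemma NormalForm.C_mul (h : NormalForm κ f A c) (a : ℂ) :
    NormalForm κ (C a * f) (C a * A) (C a * c) := by
  obtain ⟨hA, e, rfl⟩ := h
  exact ⟨by rw [pderiv_C_mul, hA, mul_zero], C a * e, by ring⟩

lemma NormalForm.neg (h : NormalForm κ f A c) : NormalForm κ (-f) (-A) (-c) := by
  obtain ⟨hA, e, rfl⟩ := h
  exact ⟨by rw [map_neg, hA, neg_zero], -e, by ring⟩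

lemma NormalForm.congr (h : NormalForm κ f A c) (hf : f' = f) (hA : A' = A) (hc : c' = c) :
    NormalForm κ f' A' c' := by
  rw [hf, hA, hc]
  exact h

lemma NormalForm.pow (hκ : κ ≠ 0) (h : NormalForm κ f A c) (j : ℕ) :
    NormalForm κ (f ^ (j + 1)) (A ^ (j + 1)) (C ((j : ℂ) + 1) * A ^ j * c) := by
  induction j with
  | zero => exact h.congr (by ring) (by ring) (by simp)
  | succ j ih =>
    refine (ih.mul hκ h).congr (pow_succ _ _) (pow_succ _ _) ?_
    push_cast
    simp only [C_add, C_1]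
    ring

end NormalForm

/-- The cofactors of the derivatives along the mirror. -/
def cofactor (A : Fin 3 → MvPolynomial (Fin 3) ℂ) : Fin 3 → MvPolynomial (Fin 3) ℂ :=
  ![pderiv 1 (A 1) * pderiv 2 (A 2) - pderiv 2 (A 1) * pderiv 1 (A 2),
    pderiv 2 (A 0) * pderiv 1 (A 2) - pderiv 1 (A 0) * pderiv 2 (A 2),
    pderiv 1 (A 0) * pderiv 2 (A 1) - pderiv 2 (A 0) * pderiv 1 (A 1)]

lemma adjugate_jacOf_three (v : Fin 3 → MvPolynomial (Fin 3) ℂ) (l : Fin 3) :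
    (jacOf v).adjugate 0 l = cofactor v l := by
  rw [Matrix.adjugate_fin_three]
  fin_cases l <;> simp [jacOf, cofactor] <;> ring

variable {m : ℕ} {v A c : Fin 3 → MvPolynomial (Fin 3) ℂ}

lemma NormalForm.exists_pderiv {f A c : MvPolynomial (Fin 3) ℂ} (h : NormalForm (m + 1) f A c) :
    (∃ w, pderiv 0 f = X 0 ^ m * w ∧ ∀ p : Fin 3 → ℂ, p 0 = 0 → eval p w = (m + 1) * eval p c) ∧
    (∀ j, j ≠ 0 → ∃ e, pderiv j f = pderiv j A + X 0 ^ (m + 1) * e) := by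
  obtain ⟨hA, e, rfl⟩ := h
  constructor
  · refine ⟨C ((m : ℂ) + 1) * (c + X 0 * e) + X 0 * pderiv 0 (c + X 0 * e), ?_, fun p hp => ?_⟩
    · rw [map_add, hA, Derivation.leibniz, Derivation.leibniz_pow, pderiv_X_self, smul_eq_mul,
        smul_eq_mul, nsmul_eq_mul, smul_eq_mul, ← map_natCast C]
      push_cast
      ring
    · simp [hp]
  · intro j hj
    refine ⟨pderiv j (c + X 0 * e), ?_⟩
    rw [map_add, Derivation.leibniz, Derivation.leibniz_pow, pderiv_X_of_ne hj.symm]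
    simp

lemma eval_cofactor (h : ∀ l, NormalForm (m + 1) (v l) (A l) (c l)) {p : Fin 3 → ℂ} (hp : p 0 = 0)
    (l : Fin 3) : eval p (cofactor v l) = eval p (cofactor A l) := by
  have h1 : ∀ l j, j ≠ 0 → eval p (pderiv j (v l)) = eval p (pderiv j (A l)) := by
    intro l j hj
    obtain ⟨e, he⟩ := (h l).exists_pderiv.2 j hj
    simp [he, hp]
  have h11 := fun l => h1 l 1 (by decide)
  have h12 := fun l => h1 l 2 (by decide)
  fin_cases l <;> simp [cofactor, h11, h12]

/-- The local conditions in rank three, from the lowest terms along the mirror. -/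
lemma localGood_three {d : Fin 3 → ℕ} (hd : ∀ l, 2 ≤ d l) (hv : ∀ l, (v l).IsHomogeneous (d l))
    (h : ∀ l, NormalForm (m + 1) (v l) (A l) (c l)) {r : ℂ}
    (h1 : ∑ l, C ((m : ℂ) / ((d l : ℂ) - 1) - r) * (c l * cofactor A l) = 0)
    (h2 : ∑ l, C (1 / ((d l : ℂ) - 1)) * (pderiv 1 (pderiv 1 (A l)) * cofactor A l) = 0) :
    LocalGood d v 0 m r := by
  choose w hw hwc using fun l => (h l).exists_pderiv.1
  have key : X 0 ∣ ptensor d v 0 1 1 := by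
    rw [X_dvd_iff]
    intro p hp
    have h3 := congrArg (eval p) h2
    rw [map_zero] at h3
    rw [ptensor, ← h3, map_sum, map_sum]
    refine Finset.sum_congr rfl fun l _ => ?_
    have h4 : eval p (pderiv 1 (pderiv 1 (v l))) = eval p (pderiv 1 (pderiv 1 (A l))) := by
      obtain ⟨e, he⟩ := (h l).exists_pderiv.2 1 (by decide)
      rw [he, map_add, Derivation.leibniz, Derivation.leibniz_pow,
        pderiv_X_of_ne (show (0 : Fin 3) ≠ 1 by decide)]
      simp [hp]
    rw [adjugate_jacOf_three, map_mul, map_mul, map_mul, map_mul, h4, eval_cofactor h hp]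
    ring
  -- Modulo X_0, Euler's relation links the tangential components with lower indices (1,1), (1,2)
  -- and (2,2), so the vanishing of the first one entails that of the others.
  have e1 := ptensor_euler hd hv (o := 0) (j := 1) (by decide)
  have e2 := ptensor_euler hd hv (o := 0) (j := 2) (by decide)
  rw [Fin.sum_univ_three] at e1 e2
  have key2 : X 0 ∣ ptensor d v 0 1 2 := by
    apply X_dvd_of_X_mul (k := 2) (by decide)
    rw [eq_neg_of_add_eq_zero_right e1]
    exact ((dvd_mul_right _ _).add (key.mul_left _)).neg_right
  have key3 : X 0 ∣ ptensor d v 0 2 2 := by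
    apply X_dvd_of_X_mul (k := 2) (by decide)
    rw [eq_neg_of_add_eq_zero_right e2, ptensor_symm d v 0 2 1]
    exact ((dvd_mul_right _ _).add (key2.mul_left _)).neg_right
  refine ⟨w, hw, ?_, ?_⟩
  · rw [X_dvd_iff]
    intro p hp
    have h3 := congrArg (eval p) h1
    rw [map_sum, map_zero] at h3
    rw [map_sum, ← mul_zero ((m : ℂ) + 1), ← h3, Finset.mul_sum]
    refine Finset.sum_congr rfl fun l _ => ?_
    rw [adjugate_jacOf_three, map_mul, map_mul, map_mul, map_mul, hwc l p hp, eval_cofactor h hp]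
    ring
  · intro j k hj hk
    rcases (show j = 1 ∨ j = 2 by omega) with rfl | rfl <;>
      rcases (show k = 1 ∨ k = 2 by omega) with rfl | rfl
    · exact key
    · exact key2
    · rw [ptensor_symm]
      exact key2
    · exact key3

/-- Expanding along the normal column, the leading coefficient of the determinant along the mirror
is (m + 1) ∑ c_l times the cofactor, so one value decides. -/
lemma det_jacOf_ne_zero_three (h : ∀ l, NormalForm (m + 1) (v l) (A l) (c l)) (p : Fin 3 → ℂ)
    (hp : p 0 = 0) (hne : eval p (∑ l, c l * cofactor A l) ≠ 0) : (jacOf v).det ≠ 0 := by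
  choose w hw hwc using fun l => (h l).exists_pderiv.1
  intro h0
  rw [det_eq_sum_adjugate v 0] at h0
  have h1 : X 0 ^ m * ∑ l, w l * cofactor v l = 0 := by
    rw [← h0, Finset.mul_sum]
    exact Finset.sum_congr rfl fun l _ => by rw [hw, adjugate_jacOf_three, mul_assoc]
  have h2 := congrArg (eval p) ((mul_eq_zero.mp h1).resolve_left (pow_ne_zero m (X_ne_zero _)))
  rw [map_sum, map_zero] at h2
  have h3 : ((m : ℂ) + 1) * eval p (∑ l, c l * cofactor A l) = 0 := by
    rw [← h2, map_sum, Finset.mul_sum]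
    refine Finset.sum_congr rfl fun l _ => ?_
    rw [map_mul, map_mul, hwc l p hp, eval_cofactor h hp]
    ring
  rcases mul_eq_zero.mp h3 with h4 | h4
  · exact (Nat.cast_add_one_ne_zero (R := ℂ) m) h4
  · exact hne h4

lemma det_jacOf_ne_zero_of_subst {n : ℕ} {g : Matrix (Fin n) (Fin n) ℂ}
    {u : Fin n → MvPolynomial (Fin n) ℂ} (h : (jacOf fun l => subst g (u l)).det ≠ 0) :
    (jacOf u).det ≠ 0 := by
  intro h0
  rw [det_jacOf_subst, h0, map_zero, zero_mul] at h
  exact h rfl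

/-- A frame whose first vector is orthogonal to the mirror `ker β`, which contains the others. -/
def Adapted {n : ℕ} (h : Matrix (Fin (n + 1)) (Fin (n + 1)) ℂ) (β : Fin (n + 1) → ℂ)
    (g : Matrix (Fin (n + 1)) (Fin (n + 1)) ℂ) : Prop :=
  g.det ≠ 0 ∧ (∃ s : ℂ, Matrix.vecMul β g = s • Pi.single 0 1) ∧ ∃ t, ∀ i, g i 0 = t * sharp h β i

lemma Adapted.subst_reflection {n : ℕ} {h : Matrix (Fin (n + 1)) (Fin (n + 1)) ℂ} (hh : IsMetric h)
    {β : Fin (n + 1) → ℂ} (hβ : β ≠ 0) {g : Matrix (Fin (n + 1)) (Fin (n + 1)) ℂ}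
    (hg : Adapted h β g) {m : ℕ} {χ : ℂ} {f : MvPolynomial (Fin (n + 1)) ℂ}
    (hf : subst (diagRefl 0 (zeta m)) (subst g f) = C χ * subst g f) :
    subst (reflection h β m) f = C χ * f := by
  obtain ⟨h0, ⟨s, hs⟩, t, ht⟩ := hg
  exact subst_unitaryRefl_of_adapted hh hβ h0 hs ht hf

lemma Adapted.goodAt {h : Matrix (Fin 3) (Fin 3) ℂ} {gens : List ((Fin 3 → ℂ) × ℕ)}
    {deg : Fin 3 → ℕ} {u : Fin 3 → MvPolynomial (Fin 3) ℂ} {N : ℕ} {table : List (ℕ × ℕ)}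
    {β : Fin 3 → ℂ} {g : Matrix (Fin 3) (Fin 3) ℂ} (hg : Adapted h β g) {m : ℕ} {r : ℂ}
    (hu : LocalGood deg (fun l => subst g (u l)) 0 m r) :
    (dataThree h gens deg u N table).GoodAt β m r := by
  obtain ⟨h0, ⟨s, hs⟩, t, ht⟩ := hg
  exact ⟨0, g, s, t, h0, hs, ht, hu⟩

/-! ### Hessian covariants -/

lemma hessian_subst (g : Matrix (Fin 3) (Fin 3) ℂ) (f : MvPolynomial (Fin 3) ℂ) :
    hessian (subst g f) = (g.map C).transpose * (hessian f).map (subst g) * g.map C := by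
  refine Matrix.ext fun i j => ?_
  simp only [hessian, Matrix.of_apply, pderiv_subst, map_sum, pderiv_C_mul, Matrix.mul_apply,
    Matrix.transpose_apply, Matrix.map_apply, Finset.mul_sum, Finset.sum_mul]
  exact Finset.sum_congr rfl fun a _ => Finset.sum_congr rfl fun b _ => by ring

lemma det_hessian_subst (g : Matrix (Fin 3) (Fin 3) ℂ) (f : MvPolynomial (Fin 3) ℂ) :
    (hessian (subst g f)).det = C (g.det ^ 2) * subst g (hessian f).det := by
  have h1 : (g.map C).det = (C g.det : MvPolynomial (Fin 3) ℂ) := (RingHom.map_det C g).symm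
  have h2 : ((hessian f).map (subst g)).det = subst g (hessian f).det :=
    (AlgHom.map_det (subst g) (hessian f)).symm
  rw [hessian_subst, Matrix.det_mul, Matrix.det_mul, Matrix.det_transpose, h1, h2, C_pow]
  ring

/-- The bordered matrix changes by congruence with the block matrix g ⊕ 1, whose determinant is that
of `g`. -/
lemma bord_subst (g : Matrix (Fin 3) (Fin 3) ℂ) (f k : MvPolynomial (Fin 3) ℂ) :
    bord (subst g f) (subst g k) = C (g.det ^ 2) * subst g (bord f k) := by
  have h1 : (g.map C).det = (C g.det : MvPolynomial (Fin 3) ℂ) := (RingHom.map_det C g).symm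
  have h2 : Matrix.fromBlocks (hessian (subst g f)) (Matrix.of fun i (_ : Unit) => pderiv i (subst g k))
      (Matrix.of fun (_ : Unit) j => pderiv j (subst g k)) 0 =
      Matrix.fromBlocks (g.map C).transpose 0 0 (1 : Matrix Unit Unit (MvPolynomial (Fin 3) ℂ)) *
      (Matrix.fromBlocks (hessian f) (Matrix.of fun i (_ : Unit) => pderiv i k)
        (Matrix.of fun (_ : Unit) j => pderiv j k) 0).map (subst g) *
      Matrix.fromBlocks (g.map C) 0 0 1 := by
    rw [Matrix.fromBlocks_map, Matrix.fromBlocks_multiply, Matrix.fromBlocks_multiply]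
    simp only [Matrix.zero_mul, Matrix.mul_zero, Matrix.one_mul, Matrix.mul_one, add_zero, zero_add,
      hessian_subst]
    refine congr (congr (congrArg _ ?_) ?_) ?_
    · ext1 i j
      simp [pderiv_subst, Matrix.mul_apply]
    · ext1 i j
      simp [pderiv_subst, Matrix.mul_apply, mul_comm]
    · ext1 i j
      simp
  have h3 : ((Matrix.fromBlocks (hessian f) (Matrix.of fun i (_ : Unit) => pderiv i k)
      (Matrix.of fun (_ : Unit) j => pderiv j k) 0).map (subst g)).det = subst g (bord f k) :=
    (AlgHom.map_det (subst g) _).symm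
  rw [bord, h2, Matrix.det_mul, Matrix.det_mul, h3, Matrix.det_fromBlocks_zero₂₁,
    Matrix.det_fromBlocks_zero₂₁, Matrix.det_transpose, h1, Matrix.det_one, C_pow]
  ring

lemma det_hessian (f : MvPolynomial (Fin 3) ℂ) : (hessian f).det =
    pderiv 0 (pderiv 0 f) * pderiv 1 (pderiv 1 f) * pderiv 2 (pderiv 2 f) +
    2 * pderiv 0 (pderiv 1 f) * pderiv 0 (pderiv 2 f) * pderiv 1 (pderiv 2 f) -
    pderiv 0 (pderiv 0 f) * pderiv 1 (pderiv 2 f) ^ 2 -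
    pderiv 1 (pderiv 1 f) * pderiv 0 (pderiv 2 f) ^ 2 -
    pderiv 2 (pderiv 2 f) * pderiv 0 (pderiv 1 f) ^ 2 := by
  rw [Matrix.det_fin_three]
  simp only [hessian, Matrix.of_apply, pderiv_comm' 1 0, pderiv_comm' 2 0, pderiv_comm' 2 1]
  ring

lemma bord_eq (f k : MvPolynomial (Fin 3) ℂ) : bord f k =
    -(pderiv 0 k ^ 2 * (pderiv 1 (pderiv 1 f) * pderiv 2 (pderiv 2 f) - pderiv 1 (pderiv 2 f) ^ 2) +
      pderiv 1 k ^ 2 * (pderiv 0 (pderiv 0 f) * pderiv 2 (pderiv 2 f) - pderiv 0 (pderiv 2 f) ^ 2) +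
      pderiv 2 k ^ 2 * (pderiv 0 (pderiv 0 f) * pderiv 1 (pderiv 1 f) - pderiv 0 (pderiv 1 f) ^ 2) +
      2 * pderiv 0 k * pderiv 1 k * (pderiv 0 (pderiv 2 f) * pderiv 1 (pderiv 2 f) -
        pderiv 0 (pderiv 1 f) * pderiv 2 (pderiv 2 f)) +
      2 * pderiv 0 k * pderiv 2 k * (pderiv 0 (pderiv 1 f) * pderiv 1 (pderiv 2 f) -
        pderiv 0 (pderiv 2 f) * pderiv 1 (pderiv 1 f)) +
      2 * pderiv 1 k * pderiv 2 k * (pderiv 0 (pderiv 1 f) * pderiv 0 (pderiv 2 f) -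
        pderiv 0 (pderiv 0 f) * pderiv 1 (pderiv 2 f))) := by
  -- The block matrix is reindexed as a 4×4 matrix, to be expanded along its first row.
  let e : Fin 4 ≃ Fin 3 ⊕ Unit :=
    (finSumFinEquiv (m := 3) (n := 1)).symm.trans (Equiv.sumCongr (Equiv.refl _) (Equiv.ofUnique _ _))
  have h : (Matrix.fromBlocks (hessian f) (Matrix.of fun i (_ : Unit) => pderiv i k)
      (Matrix.of fun (_ : Unit) j => pderiv j k) 0).submatrix e e =
      !![hessian f 0 0, hessian f 0 1, hessian f 0 2, pderiv 0 k;
        hessian f 1 0, hessian f 1 1, hessian f 1 2, pderiv 1 k;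
        hessian f 2 0, hessian f 2 1, hessian f 2 2, pderiv 2 k;
        pderiv 0 k, pderiv 1 k, pderiv 2 k, 0] := by
    ext1 i j
    fin_cases i <;> fin_cases j <;> rfl
  rw [bord, ← Matrix.det_submatrix_equiv_self e, h, Matrix.det_succ_row_zero]
  simp only [Fin.sum_univ_four, Matrix.det_fin_three]
  simp [Fin.succAbove, hessian, pderiv_comm' 1 0, pderiv_comm' 2 0, pderiv_comm' 2 1]
  ring

end RankThree

section RankThree

lemma zeta_two : zeta 2 = -1 := (isPrimitiveRoot_zeta (by norm_num)).eq_neg_one_of_two_right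

lemma eval_subst_three (g : Matrix (Fin 3) (Fin 3) ℂ) (p : Fin 3 → ℂ) (f : MvPolynomial (Fin 3) ℂ) :
    eval p (subst g f) = eval ![g 0 0 * p 0 + g 0 1 * p 1 + g 0 2 * p 2,
      g 1 0 * p 0 + g 1 1 * p 1 + g 1 2 * p 2, g 2 0 * p 0 + g 2 1 * p 1 + g 2 2 * p 2] f := by
  have h : g.mulVec p = ![g 0 0 * p 0 + g 0 1 * p 1 + g 0 2 * p 2,
      g 1 0 * p 0 + g 1 1 * p 1 + g 1 2 * p 2, g 2 0 * p 0 + g 2 1 * p 1 + g 2 2 * p 2] := by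
    ext i
    fin_cases i <;> simp [Matrix.mulVec, dotProduct, Fin.sum_univ_three]
  rw [eval_subst, h]

lemma eval_subst_diagRefl_three (ζ : ℂ) (p : Fin 3 → ℂ) (f : MvPolynomial (Fin 3) ℂ) :
    eval p (subst (diagRefl 0 ζ) f) = eval ![ζ * p 0, p 1, p 2] f := by
  rw [eval_subst_three]
  simp [diagRefl]

lemma vec_ne_zero_three {a b c : ℂ} (h : a ≠ 0) : ![a, b, c] ≠ 0 :=
  fun e => h (by simpa using congrFun e 0)

lemma adapted_one_zero_zero : Adapted 1 ![1, 0, 0] (1 : Matrix (Fin 3) (Fin 3) ℂ) := by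
  refine ⟨by simp, ⟨1, ?_⟩, 1, fun i => ?_⟩
  · ext i
    fin_cases i <;> simp
  · fin_cases i <;> simp [sharp_one, Matrix.one_apply]

/-! ### The Hessian groups -/

section Hessian

/-- The discrete Fourier transform of order three. -/
def fourier : Matrix (Fin 3) (Fin 3) ℂ :=
  !![1, 1, 1; 1, zeta 3, zeta 3 ^ 2; 1, zeta 3 ^ 2, zeta 3]

/-- The transposition of the first two coordinates. -/
def swap01 : Matrix (Fin 3) (Fin 3) ℂ := !![0, 1, 0; 1, 0, 0; 0, 0, 1]

/-- The frame adapted to the mirror `p₁ = p₂`. -/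
def diffFrame : Matrix (Fin 3) (Fin 3) ℂ := !![1, 1, 0; -1, 1, 0; 0, 0, 1]

lemma zeta_three_sq : zeta 3 ^ 2 = -zeta 3 - 1 := by
  have h := (isPrimitiveRoot_zeta (m := 3) (by norm_num)).geom_sum_eq_zero (by norm_num)
  simp [Finset.sum_range_succ] at h
  linear_combination h

lemma adapted_fourier : Adapted 1 ![1, 1, 1] fourier := by
  have hω := zeta_three_sq
  refine ⟨fun h => ?_, ⟨3, ?_⟩, 1, fun i => ?_⟩
  · rw [fourier, Matrix.det_fin_three] at h
    simp at h
    -- The determinant of the Fourier matrix is 3(ω² - ω), whose square is -27.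
    have h2 : (3 * (zeta 3 ^ 2 - zeta 3)) ^ 2 = -27 := by
      linear_combination (9 * (zeta 3 ^ 2 - 3 * zeta 3 + 3)) * hω
    have h3 : 3 * (zeta 3 ^ 2 - zeta 3) = 0 := by
      linear_combination h + (zeta 3 ^ 2 - zeta 3) * hω
    rw [h3] at h2
    norm_num at h2
  · ext i
    fin_cases i
    · simp [fourier, Matrix.vecMul, dotProduct, Fin.sum_univ_three]
      norm_num
    · simp [fourier, Matrix.vecMul, dotProduct, Fin.sum_univ_three]
      linear_combination hω
    · simp [fourier, Matrix.vecMul, dotProduct, Fin.sum_univ_three]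
      linear_combination hω
  · fin_cases i <;> simp [sharp_one, fourier]

lemma adapted_swap01 : Adapted 1 ![0, 1, 0] swap01 := by
  refine ⟨by simp [swap01, Matrix.det_fin_three], ⟨1, ?_⟩, 1, fun i => ?_⟩
  · ext i
    fin_cases i <;> simp [swap01, Matrix.vecMul, dotProduct, Fin.sum_univ_three]
  · fin_cases i <;> simp [sharp_one, swap01]

lemma adapted_diffFrame : Adapted 1 ![1, -1, 0] diffFrame := by
  refine ⟨?_, ⟨2, ?_⟩, 1, fun i => ?_⟩
  · rw [diffFrame, Matrix.det_fin_three]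
    simp
  · ext i
    fin_cases i
    · simp [diffFrame, Matrix.vecMul, dotProduct, Fin.sum_univ_three]
      norm_num
    · simp [diffFrame, Matrix.vecMul, dotProduct, Fin.sum_univ_three]
    · simp [diffFrame, Matrix.vecMul, dotProduct, Fin.sum_univ_three]
  · fin_cases i <;> simp [sharp_one, diffFrame]

/-- The sum of the products of two cubes. -/
def cubes2 : MvPolynomial (Fin 3) ℂ :=
  X 0 ^ 3 * X 1 ^ 3 + X 0 ^ 3 * X 2 ^ 3 + X 1 ^ 3 * X 2 ^ 3

/-- The product of the cubes. -/
def cubes3 : MvPolynomial (Fin 3) ℂ := X 0 ^ 3 * X 1 ^ 3 * X 2 ^ 3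

/-- The invariants are expressed by the elementary symmetric functions of the cubes, whose Fourier
transforms are short. -/
lemma U25₁_eq : U25₁ = pow3 3 ^ 2 - 12 * cubes2 := by
  simp only [U25₁, pow3, cubes2]
  ring

lemma U25₃_eq : U25₃ = pow3 3 ^ 4 + 216 * cubes3 * pow3 3 := by
  simp only [U25₃, cubes3]
  ring

lemma U26₃_eq : U26₃ = pow3 3 ^ 6 - 540 * cubes3 * pow3 3 ^ 3 - 5832 * cubes3 ^ 2 := by
  simp only [U26₃, cubes3]
  ring

/-- The Fourier matrix, which is unitary up to scale, preserves the basic forms up to factors and is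
adapted to the mirror of [1,1,1]. Invariance under the reflection there thereby follows from that
along a coordinate plane. -/
lemma subst_fourier : subst fourier U25₁ = C (-27) * U25₁ ∧
    subst fourier U25₂ = C (81 * (2 * zeta 3 + 1)) * U25₂ ∧
    subst fourier U25₃ = C 729 * U25₃ ∧ subst fourier U26₃ = C (-19683) * U26₃ := by
  have hω := zeta_three_sq
  have h3 := zeta_pow (m := 3) (by norm_num)
  have h4 : zeta 3 ^ 4 = zeta 3 := by linear_combination zeta 3 * h3
  have h5 : zeta 3 ^ 5 = -zeta 3 - 1 := by linear_combination zeta 3 ^ 2 * h3 + hω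
  have h6 : zeta 3 ^ 6 = 1 := by linear_combination (zeta 3 ^ 3 + 1) * h3
  have e1 : subst fourier (pow3 3) = 3 * pow3 3 + 18 * (X 0 * X 1 * X 2) := by
    apply MvPolynomial.funext
    intro p
    rw [eval_subst_three]
    simp [fourier, pow3]
    ring_nf
    simp only [hω, h3, h4, h5, h6]
    ring
  have e2 : subst fourier cubes3 = (pow3 3 - 3 * (X 0 * X 1 * X 2)) ^ 3 := by
    apply MvPolynomial.funext
    intro p
    rw [eval_subst_three]
    simp [fourier, pow3, cubes3]
    rw [← mul_pow, ← mul_pow]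
    refine congrArg (· ^ 3) ?_
    ring_nf
    simp only [hω, h3, h4]
    ring
  have hb : ∀ x y z : ℂ, (x + zeta 3 * y + zeta 3 ^ 2 * z) ^ 3 =
      x ^ 3 + y ^ 3 + z ^ 3 + 6 * (x * y * z) + 3 * zeta 3 * (x ^ 2 * y + y ^ 2 * z + z ^ 2 * x) +
      3 * (-zeta 3 - 1) * (x * y ^ 2 + y * z ^ 2 + z * x ^ 2) := fun x y z => by
    ring_nf
    simp only [hω, h3, h4, h5, h6]
    ring
  have hc : ∀ x y z : ℂ, (x + zeta 3 ^ 2 * y + zeta 3 * z) ^ 3 =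
      x ^ 3 + y ^ 3 + z ^ 3 + 6 * (x * y * z) +
      3 * (-zeta 3 - 1) * (x ^ 2 * y + y ^ 2 * z + z ^ 2 * x) +
      3 * zeta 3 * (x * y ^ 2 + y * z ^ 2 + z * x ^ 2) := fun x y z => by
    ring_nf
    simp only [hω, h3, h4, h5, h6]
    ring
  have e3 : subst fourier cubes2 = 3 * (pow3 3 + 6 * (X 0 * X 1 * X 2)) ^ 2 -
      27 * ((X 0 ^ 2 * X 1 + X 1 ^ 2 * X 2 + X 2 ^ 2 * X 0) *
        (X 0 * X 1 ^ 2 + X 1 * X 2 ^ 2 + X 2 * X 0 ^ 2)) := by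
    apply MvPolynomial.funext
    intro p
    rw [eval_subst_three]
    simp [fourier, pow3, cubes2]
    rw [hb, hc]
    ring_nf
    simp only [hω]
    ring
  refine ⟨?_, ?_, ?_, ?_⟩
  · rw [U25₁_eq, map_sub, map_mul, map_pow, e1, e3, map_ofNat, C_neg, map_ofNat]
    simp only [pow3, cubes2]
    ring
  · apply MvPolynomial.funext
    intro p
    rw [eval_subst_three]
    simp [fourier, U25₂]
    rw [hb, hc]
    ring_nf
    simp only [hω, h3]
    ring
  · rw [U25₃_eq, map_add, map_mul, map_mul, map_pow, e1, e2, map_ofNat, map_ofNat]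
    simp only [pow3, cubes3]
    ring
  · rw [U26₃_eq, map_sub, map_sub, map_mul, map_mul, map_mul, map_pow, map_pow, map_pow, e1, e2,
      map_ofNat, map_ofNat, C_neg, map_ofNat]
    simp only [pow3, cubes3]
    ring

end Hessian

end RankThree

/-! ### Invariance and expansions for the Hessian groups. -/

section RankThree

lemma basic_three {h : Matrix (Fin 3) (Fin 3) ℂ} {gens : List ((Fin 3 → ℂ) × ℕ)} {deg : Fin 3 → ℕ}
    {u : Fin 3 → MvPolynomial (Fin 3) ℂ} {N : ℕ} {table : List (ℕ × ℕ)} (hh : IsMetric h)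
    (hgens : ∀ a ∈ gens, a.1 ≠ 0 ∧ 2 ≤ a.2 ∧ ∀ l, subst (reflection h a.1 a.2) (u l) = u l)
    (hom : ∀ l, (u l).IsHomogeneous (deg l)) (two_le : ∀ l, 2 ≤ deg l)
    (hjac : (jacOf u).det ≠ 0) : (dataThree h gens deg u N table).Basic where
  metric := hh
  gens a ha := ⟨(hgens a ha).1, (hgens a ha).2.1⟩
  inv a ha := (hgens a ha).2.2
  hom := hom
  two_le := two_le
  jac_ne := hjac

/-- The factor `χ` commutes with the diagonal reflection, so a frame may distort the normalization
of the form without affecting invariance. -/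
lemma Adapted.subst_reflection_of_semi {h : Matrix (Fin 3) (Fin 3) ℂ} (hh : IsMetric h)
    {β : Fin 3 → ℂ} (hβ : β ≠ 0) {g : Matrix (Fin 3) (Fin 3) ℂ} (hg : Adapted h β g) {m : ℕ} {χ : ℂ}
    {f f' : MvPolynomial (Fin 3) ℂ} (hf : subst g f = C χ * f')
    (hd : subst (diagRefl 0 (zeta m)) f' = f') : subst (reflection h β m) f = f := by
  have := hg.subst_reflection hh hβ (m := m) (χ := 1) (f := f)
    (by rw [hf, map_mul, subst_C, hd, C_1, one_mul])
  rwa [C_1, one_mul] at this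

section Hessian

lemma subst_diagRefl_cubes : subst (diagRefl 0 (zeta 3)) (pow3 3) = pow3 3 ∧
    subst (diagRefl 0 (zeta 3)) cubes2 = cubes2 ∧ subst (diagRefl 0 (zeta 3)) cubes3 = cubes3 := by
  have h3 := zeta_pow (m := 3) (by norm_num)
  refine ⟨?_, ?_, ?_⟩ <;>
  · apply MvPolynomial.funext
    intro p
    rw [eval_subst_diagRefl_three]
    simp [pow3, cubes2, cubes3, mul_pow, h3]

lemma subst_diagRefl_U25 : subst (diagRefl 0 (zeta 3)) U25₁ = U25₁ ∧
    subst (diagRefl 0 (zeta 3)) U25₂ = U25₂ ∧ subst (diagRefl 0 (zeta 3)) U25₃ = U25₃ ∧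
    subst (diagRefl 0 (zeta 3)) U26₃ = U26₃ := by
  have h3 := zeta_pow (m := 3) (by norm_num)
  obtain ⟨e1, e2, e3⟩ := subst_diagRefl_cubes
  refine ⟨by simp [U25₁_eq, e1, e2, map_ofNat], ?_, by simp [U25₃_eq, e1, e3, map_ofNat],
    by simp [U26₃_eq, e1, e3, map_ofNat]⟩
  apply MvPolynomial.funext
  intro p
  rw [eval_subst_diagRefl_three]
  simp [U25₂, mul_pow, h3]

lemma subst_swap01 : subst swap01 U25₁ = C 1 * U25₁ ∧ subst swap01 U25₂ = C (-1) * U25₂ ∧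
    subst swap01 U25₃ = C 1 * U25₃ ∧ subst swap01 U26₃ = C 1 * U26₃ := by
  refine ⟨?_, ?_, ?_, ?_⟩ <;>
  · apply MvPolynomial.funext
    intro p
    rw [eval_subst_three]
    simp [swap01, U25₁, U25₂, U25₃, U26₃, pow3]
    ring

/-- Invariance of the basic polynomials under the reflections of order three. -/
lemma subst_reflection_U25 {β : Fin 3 → ℂ} (hβ : β = ![1, 0, 0] ∨ β = ![1, 1, 1] ∨ β = ![0, 1, 0]) :
    subst (reflection 1 β 3) U25₁ = U25₁ ∧ subst (reflection 1 β 3) U25₂ = U25₂ ∧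
    subst (reflection 1 β 3) U25₃ = U25₃ ∧ subst (reflection 1 β 3) U26₃ = U26₃ := by
  obtain ⟨d1, d2, d3, d4⟩ := subst_diagRefl_U25
  have key : ∃ g χ₁ χ₂ χ₃ χ₄, Adapted 1 β g ∧ β ≠ 0 ∧ subst g U25₁ = C χ₁ * U25₁ ∧
      subst g U25₂ = C χ₂ * U25₂ ∧ subst g U25₃ = C χ₃ * U25₃ ∧ subst g U26₃ = C χ₄ * U26₃ := by
    rcases hβ with rfl | rfl | rfl
    · exact ⟨1, 1, 1, 1, 1, adapted_one_zero_zero, vec_ne_zero_three one_ne_zero,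
        by simp [subst_one]⟩
    · exact ⟨fourier, _, _, _, _, adapted_fourier, vec_ne_zero_three one_ne_zero, subst_fourier⟩
    · exact ⟨swap01, _, _, _, _, adapted_swap01, fun h => by simpa using congrFun h 1, subst_swap01⟩
  obtain ⟨g, χ₁, χ₂, χ₃, χ₄, hg, h0, e1, e2, e3, e4⟩ := key
  exact ⟨hg.subst_reflection_of_semi isMetric_one h0 e1 d1,
    hg.subst_reflection_of_semi isMetric_one h0 e2 d2,
    hg.subst_reflection_of_semi isMetric_one h0 e3 d3,
    hg.subst_reflection_of_semi isMetric_one h0 e4 d4⟩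

lemma isHomogeneous_U25₁ : U25₁.IsHomogeneous 6 := isHomogeneous_of_eval fun t p => by
  simp [U25₁, pow3]
  ring

lemma isHomogeneous_U25₂ : U25₂.IsHomogeneous 9 := isHomogeneous_of_eval fun t p => by
  simp [U25₂]
  ring

lemma isHomogeneous_U25₃ : U25₃.IsHomogeneous 12 := isHomogeneous_of_eval fun t p => by
  simp [U25₃, pow3]
  ring

lemma isHomogeneous_U26₃ : U26₃.IsHomogeneous 18 := isHomogeneous_of_eval fun t p => by
  simp [U26₃, pow3]
  ring

/-! #### Expansion along the mirror `p₁ = 0` -/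

lemma normalForm_U25₁ : NormalForm 3 U25₁ (X 1 ^ 6 - 10 * X 1 ^ 3 * X 2 ^ 3 + X 2 ^ 6)
    (-10 * X 1 ^ 3 - 10 * X 2 ^ 3) :=
  ⟨by simp [Derivation.leibniz, Derivation.leibniz_pow], X 0 ^ 2, by simp only [U25₁, pow3]; ring⟩

lemma normalForm_U25₂ : NormalForm 3 U25₂ (X 1 ^ 6 * X 2 ^ 3 - X 1 ^ 3 * X 2 ^ 6)
    (-X 1 ^ 6 + X 2 ^ 6) :=
  ⟨by simp [Derivation.leibniz, Derivation.leibniz_pow], X 0 ^ 2 * X 1 ^ 3 - X 0 ^ 2 * X 2 ^ 3,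
    by simp only [U25₂]; ring⟩

lemma normalForm_pow3 : NormalForm 3 (pow3 3) (X 1 ^ 3 + X 2 ^ 3) 1 :=
  ⟨by simp [Derivation.leibniz_pow], 0, by simp only [pow3]; ring⟩

lemma normalForm_cubes3 : NormalForm 3 (C 216 * cubes3) 0 (216 * (X 1 ^ 3 * X 2 ^ 3)) :=
  ⟨by simp, 0, by simp only [cubes3, map_ofNat]; ring⟩

lemma normalForm_U25₃ : NormalForm 3 U25₃ ((X 1 ^ 3 + X 2 ^ 3) ^ 4)
    (4 * (X 1 ^ 3 + X 2 ^ 3) ^ 3 + 216 * (X 1 ^ 3 * X 2 ^ 3) * (X 1 ^ 3 + X 2 ^ 3)) := by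
  have h := (normalForm_pow3.pow (by norm_num) 3).add
    (normalForm_cubes3.mul (by norm_num) normalForm_pow3)
  refine h.congr ?_ (by ring) ?_
  · rw [U25₃_eq, map_ofNat]
  · simp
    norm_num [map_ofNat]

lemma normalForm_U26₃ : NormalForm 3 U26₃ ((X 1 ^ 3 + X 2 ^ 3) ^ 6)
    (6 * (X 1 ^ 3 + X 2 ^ 3) ^ 5 - 540 * (X 1 ^ 3 * X 2 ^ 3) * (X 1 ^ 3 + X 2 ^ 3) ^ 3) := by
  have h1 := (normalForm_pow3.pow (by norm_num) 5).add
    ((normalForm_cubes3.mul (by norm_num) (normalForm_pow3.pow (by norm_num) 2)).C_mul (-5 / 2))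
  have h2 := h1.add ((normalForm_cubes3.mul (by norm_num) normalForm_cubes3).C_mul (-1 / 8))
  refine h2.congr ?_ ?_ ?_
  · rw [U26₃_eq]
    have e1 : (540 : MvPolynomial (Fin 3) ℂ) = -(C (-5 / 2) * C 216) := by
      rw [← C_mul, ← C_neg]; norm_num [map_ofNat]
    have e2 : (5832 : MvPolynomial (Fin 3) ℂ) = -(C (-1 / 8) * C 216 * C 216) := by
      rw [← C_mul, ← C_mul, ← C_neg]; norm_num [map_ofNat]
    rw [e1, e2]
    ring
  · ring
  · have e1 : (540 : MvPolynomial (Fin 3) ℂ) = -(C (-5 / 2) * 216) := by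
      rw [← map_ofNat C 216, ← C_mul, ← C_neg]; norm_num [map_ofNat]
    have e2 : (C ((5 : ℕ) + 1 : ℂ) : MvPolynomial (Fin 3) ℂ) = 6 := by norm_num [map_ofNat]
    rw [e1, e2]
    ring

end Hessian

end RankThree

/-! ### The group G25. -/

section RankThree

lemma NormalForm.sub {κ : ℕ} {f f' A A' c c' : MvPolynomial (Fin 3) ℂ} (h : NormalForm κ f A c)
    (h' : NormalForm κ f' A' c') : NormalForm κ (f - f') (A - A') (c - c') := by
  simpa only [sub_eq_add_neg] using h.add h'.neg

lemma NormalForm.subst_one {κ : ℕ} {f A c : MvPolynomial (Fin 3) ℂ} (h : NormalForm κ f A c) :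
    NormalForm κ (subst 1 f) A c := by
  rwa [ReflectionDuality.subst_one]

section Hessian

lemma forall_fin_three {P : Fin 3 → Prop} (h0 : P 0) (h1 : P 1) (h2 : P 2) : ∀ l, P l := by
  intro l
  fin_cases l
  · exact h0
  · exact h1
  · exact h2

lemma normalForm_G25 : ∀ l, NormalForm 3 (![U25₁, U25₂, U25₃ - C (5 / 8) * U25₁ ^ 2] l)
    (![X 1 ^ 6 - 10 * X 1 ^ 3 * X 2 ^ 3 + X 2 ^ 6, X 1 ^ 6 * X 2 ^ 3 - X 1 ^ 3 * X 2 ^ 6,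
      (X 1 ^ 3 + X 2 ^ 3) ^ 4 - C (5 / 8) * (X 1 ^ 6 - 10 * X 1 ^ 3 * X 2 ^ 3 + X 2 ^ 6) ^ 2] l)
    (![-10 * X 1 ^ 3 - 10 * X 2 ^ 3, -X 1 ^ 6 + X 2 ^ 6,
      (4 * (X 1 ^ 3 + X 2 ^ 3) ^ 3 + 216 * (X 1 ^ 3 * X 2 ^ 3) * (X 1 ^ 3 + X 2 ^ 3)) -
      C (5 / 8) * (2 * (X 1 ^ 6 - 10 * X 1 ^ 3 * X 2 ^ 3 + X 2 ^ 6) *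
        (-10 * X 1 ^ 3 - 10 * X 2 ^ 3))] l) := by
  refine forall_fin_three normalForm_U25₁ normalForm_U25₂ ?_
  refine (normalForm_U25₃.sub ((normalForm_U25₁.mul (by norm_num) normalForm_U25₁).C_mul (5 / 8))).congr
    ?_ ?_ ?_ <;> simp only [Matrix.cons_val] <;> ring

lemma basic_G25 : (dataThree 1 [(![1, 0, 0], 3), (![1, 1, 1], 3), (![0, 1, 0], 3)] ![6, 9, 12]
    ![U25₁, U25₂, U25₃ - C (5 / 8) * U25₁ ^ 2] 12 [(3, 12)]).Basic := by
  apply basic_three isMetric_one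
  · simp only [List.forall_mem_cons]
    have key : ∀ β : Fin 3 → ℂ, (β = ![1, 0, 0] ∨ β = ![1, 1, 1] ∨ β = ![0, 1, 0]) →
        ∀ l, subst (reflection 1 β 3) (![U25₁, U25₂, U25₃ - C (5 / 8) * U25₁ ^ 2] l) =
          ![U25₁, U25₂, U25₃ - C (5 / 8) * U25₁ ^ 2] l := by
      intro β hβ
      obtain ⟨e1, e2, e3, -⟩ := subst_reflection_U25 hβ
      exact forall_fin_three e1 e2 (by simp [e1, e3])
    exact ⟨⟨vec_ne_zero_three one_ne_zero, by norm_num, key _ (by simp)⟩,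
      ⟨vec_ne_zero_three one_ne_zero, by norm_num, key _ (by simp)⟩,
      ⟨fun h => by simpa using congrFun h 1, by norm_num, key _ (by simp)⟩, by simp⟩
  · exact forall_fin_three isHomogeneous_U25₁ isHomogeneous_U25₂
      (isHomogeneous_U25₃.sub ((isHomogeneous_U25₁.pow 2).C_mul _))
  · decide
  · refine det_jacOf_ne_zero_three normalForm_G25 ![0, 1, 1] rfl ?_
    simp [cofactor, Fin.sum_univ_three, Derivation.leibniz, Derivation.leibniz_pow]
    norm_num

section Reduction

variable {k : Type} [Field k] {p : ℕ} {φ : integralClosure ℤ ℂ →+* k} [CharP k p]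

/-- Reduction of generators with integral coordinates. -/
lemma genRed_int (x : Fin 3 → ℤ) {α : Fin 3 → ℂ} (hα : ∀ i, α i = x i) {m : ℕ} (z : ℕ)
    (hz : p ≠ 0 ∧ ¬ p ∣ m ∧ (p : ℤ) ∣ ((z : ℤ) + 1) ^ m - 1) :
    GroupData.GenRed φ p 1 (α, m) ([residue p (x 0), residue p (x 1), residue p (x 2)],
      [residue p (x 0), residue p (x 1), residue p (x 2)], z) := by
  have h : ∀ i, Red φ (1 * α i) (x i) := fun i => by
    rw [one_mul, hα]
    exact Red.intCast _
  have h' : ∀ i, Red φ (1 * sharp 1 α i) (x i) := fun i => by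
    rw [sharp_one, hα, one_mul, star_intCast]
    exact Red.intCast _
  exact genRed_three 1 1 (h 0) (h 1) (h 2) (h' 0) (h' 1) (h' 2) z hz one_ne_zero one_ne_zero

end Reduction

lemma goodAt_G25 : (dataThree 1 [(![1, 0, 0], 3), (![1, 1, 1], 3), (![0, 1, 0], 3)] ![6, 9, 12]
    ![U25₁, U25₂, U25₃ - C (5 / 8) * U25₁ ^ 2] 12 [(3, 12)]).GoodAt ![1, 0, 0] 2
      ((3 : ℕ) / (12 : ℕ)) := by
  refine adapted_one_zero_zero.goodAt (localGood_three basic_G25.two_le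
    (fun l => isHomogeneous_subst _ (basic_G25.hom l)) (fun l => (normalForm_G25 l).subst_one) ?_ ?_)
  all_goals
    apply MvPolynomial.funext
    intro p
    simp [cofactor, Fin.sum_univ_three, Derivation.leibniz, Derivation.leibniz_pow]
    ring

lemma conclusion_G25 : (STGroup.data .G25).Conclusion := by
  have : Fact (Nat.Prime 7) := ⟨by norm_num⟩
  -- Modulo 7 the number 2 is a cube root of unity. All twelve mirrors lie in the orbit of the first
  -- generator, so one local check is used twice.
  refine conclusion_three basic_G25 7 [(0, 0), (1, 1), (1, 0), (1, 0), (1, 2), (1, 0), (1, 0), (1, 1),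
    (1, 1), (1, 0), (1, 0), (1, 1)] ?_ 0 0 (by decide) goodAt_G25 goodAt_G25
  intro k _ _ φ
  exact ⟨_, .cons (genRed_int ![1, 0, 0] (forall_fin_three (by simp) (by simp) (by simp)) 1 (by decide))
    (.cons (genRed_int ![1, 1, 1] (forall_fin_three (by simp) (by simp) (by simp)) 1 (by decide))
    (.cons (genRed_int ![0, 1, 0] (forall_fin_three (by simp) (by simp) (by simp)) 1 (by decide)) .nil)),
    by decide +kernel⟩

end Hessian

end RankThree

/-! ### The group G26. -/

section RankThree

section Hessian

/-- The normal forms of the flat coordinates of `G26`, from those of the basic polynomials. -/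
lemma normalForm_G26 {κ : ℕ} (hκ : κ ≠ 0) {f₁ f₂ f₃ A₁ A₂ A₃ c₁ c₂ c₃ : MvPolynomial (Fin 3) ℂ}
    (h₁ : NormalForm κ f₁ A₁ c₁) (h₂ : NormalForm κ f₂ A₂ c₂) (h₃ : NormalForm κ f₃ A₃ c₃) :
    ∀ l, NormalForm κ (![f₁, f₂ - C (1 / 6) * f₁ ^ 2,
        f₃ - C (1 / 2) * f₁ * f₂ + C (1 / 9) * f₁ ^ 3] l)
      (![A₁, A₂ - C (1 / 6) * A₁ ^ 2, A₃ - C (1 / 2) * A₁ * A₂ + C (1 / 9) * A₁ ^ 3] l)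
      (![c₁, c₂ - C (1 / 6) * (2 * A₁ * c₁),
        c₃ - C (1 / 2) * (A₁ * c₂ + c₁ * A₂) + C (1 / 9) * (3 * A₁ ^ 2 * c₁)] l) := by
  refine forall_fin_three h₁ ?_ ?_
  · refine (h₂.sub ((h₁.mul hκ h₁).C_mul (1 / 6))).congr ?_ ?_ ?_ <;> simp only [Matrix.cons_val] <;>
      ring
  · refine ((h₃.sub ((h₁.mul hκ h₂).C_mul (1 / 2))).add
      (((h₁.mul hκ h₁).mul hκ h₁).C_mul (1 / 9))).congr ?_ ?_ ?_ <;> simp only [Matrix.cons_val] <;>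
      ring

lemma normalForm_diffFrame :
    NormalForm 2 (subst diffFrame (pow3 3)) (2 * X 1 ^ 3 + X 2 ^ 3) (6 * X 1) ∧
    NormalForm 2 (subst diffFrame cubes2) (X 1 ^ 6 + 2 * X 1 ^ 3 * X 2 ^ 3)
      (-3 * X 1 ^ 4 + 6 * X 1 * X 2 ^ 3) ∧
    NormalForm 2 (subst diffFrame cubes3) (X 1 ^ 6 * X 2 ^ 3) (-3 * X 1 ^ 4 * X 2 ^ 3) := by
  refine ⟨⟨?_, 0, ?_⟩, ⟨?_, 3 * X 0 * X 1 ^ 2 - X 0 ^ 3, ?_⟩,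
    ⟨?_, (3 * X 0 * X 1 ^ 2 - X 0 ^ 3) * X 2 ^ 3, ?_⟩⟩
  · simp [Derivation.leibniz, Derivation.leibniz_pow]
  · apply MvPolynomial.funext
    intro p
    rw [eval_subst_three]
    simp [diffFrame, pow3]
    ring
  · simp [Derivation.leibniz, Derivation.leibniz_pow]
  · apply MvPolynomial.funext
    intro p
    rw [eval_subst_three]
    simp [diffFrame, cubes2]
    ring
  · simp [Derivation.leibniz, Derivation.leibniz_pow]
  · apply MvPolynomial.funext
    intro p
    rw [eval_subst_three]
    simp [diffFrame, cubes3]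
    ring

lemma normalForm_diffFrame_U25₁ : NormalForm 2 (subst diffFrame U25₁)
    (-8 * X 1 ^ 6 - 20 * X 1 ^ 3 * X 2 ^ 3 + X 2 ^ 6) (60 * X 1 ^ 4 - 60 * X 1 * X 2 ^ 3) := by
  obtain ⟨h1, h2, -⟩ := normalForm_diffFrame
  refine ((h1.mul two_ne_zero h1).sub (h2.C_mul 12)).congr ?_ ?_ ?_
  · rw [U25₁_eq, map_sub, map_mul, map_pow, map_ofNat, map_ofNat, sq]
  · rw [map_ofNat]
    ring
  · rw [map_ofNat]
    ring

lemma normalForm_diffFrame_U25₃ : NormalForm 2 (subst diffFrame U25₃)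
    ((2 * X 1 ^ 3 + X 2 ^ 3) ^ 4 + 216 * (X 1 ^ 6 * X 2 ^ 3) * (2 * X 1 ^ 3 + X 2 ^ 3))
    (24 * X 1 * (2 * X 1 ^ 3 + X 2 ^ 3) ^ 3 -
      648 * X 1 ^ 4 * X 2 ^ 6) := by
  obtain ⟨h1, -, h3⟩ := normalForm_diffFrame
  refine ((h1.pow two_ne_zero 3).add ((h3.mul two_ne_zero h1).C_mul 216)).congr ?_ ?_ ?_
  · rw [U25₃_eq, map_add, map_mul, map_mul, map_pow, map_ofNat, map_ofNat, mul_assoc]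
  · rw [map_ofNat]
    ring
  · have e : (C ((3 : ℕ) + 1 : ℂ) : MvPolynomial (Fin 3) ℂ) = 4 := by norm_num [map_ofNat]
    rw [e, map_ofNat]
    ring

lemma normalForm_diffFrame_U26₃ : NormalForm 2 (subst diffFrame U26₃)
    ((2 * X 1 ^ 3 + X 2 ^ 3) ^ 6 - 540 * (X 1 ^ 6 * X 2 ^ 3) * (2 * X 1 ^ 3 + X 2 ^ 3) ^ 3 -
      5832 * (X 1 ^ 6 * X 2 ^ 3) ^ 2)
    (36 * X 1 * (2 * X 1 ^ 3 + X 2 ^ 3) ^ 5 - 540 * (X 1 ^ 6 * X 2 ^ 3 *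
      (18 * X 1 * (2 * X 1 ^ 3 + X 2 ^ 3) ^ 2) - 3 * X 1 ^ 4 * X 2 ^ 3 *
      (2 * X 1 ^ 3 + X 2 ^ 3) ^ 3) + 34992 * X 1 ^ 10 * X 2 ^ 6) := by
  obtain ⟨h1, -, h3⟩ := normalForm_diffFrame
  refine (((h1.pow two_ne_zero 5).sub
    ((h3.mul two_ne_zero (h1.pow two_ne_zero 2)).C_mul 540)).sub
    ((h3.mul two_ne_zero h3).C_mul 5832)).congr ?_ ?_ ?_
  · rw [U26₃_eq, map_sub, map_sub, map_mul, map_mul, map_mul, map_pow, map_pow, map_pow, map_ofNat,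
      map_ofNat, map_ofNat, map_ofNat, mul_assoc, sq (subst diffFrame cubes3)]
  · rw [map_ofNat, map_ofNat]
    ring
  · have e : (C ((5 : ℕ) + 1 : ℂ) : MvPolynomial (Fin 3) ℂ) = 6 := by norm_num [map_ofNat]
    have e' : (C ((2 : ℕ) + 1 : ℂ) : MvPolynomial (Fin 3) ℂ) = 3 := by norm_num [map_ofNat]
    rw [e, e', map_ofNat, map_ofNat]
    ring

/-- In this frame the diagonal reflection of order two is the transposition of the first two
coordinates. -/
lemma subst_diagRefl_diffFrame {f : MvPolynomial (Fin 3) ℂ} (hf : subst swap01 f = C 1 * f) :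
    subst (diagRefl 0 (zeta 2)) (subst diffFrame f) = subst diffFrame f := by
  rw [C_1, one_mul] at hf
  nth_rewrite 2 [← hf]
  apply MvPolynomial.funext
  intro p
  rw [eval_subst_diagRefl_three, eval_subst_three, eval_subst_three, eval_subst_three, zeta_two]
  simp [diffFrame, swap01]

lemma subst_reflection_diff {f : MvPolynomial (Fin 3) ℂ} (hf : subst swap01 f = C 1 * f) :
    subst (reflection 1 ![1, -1, 0] 2) f = f := by
  refine adapted_diffFrame.subst_reflection_of_semi isMetric_one (vec_ne_zero_three one_ne_zero)
    (χ := 1) (by rw [C_1, one_mul]) (subst_diagRefl_diffFrame hf)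

lemma basic_G26 : (dataThree 1 [(![1, -1, 0], 2), (![1, 0, 0], 3), (![1, 1, 1], 3)] ![6, 12, 18]
    ![U25₁, U25₃ - C (1 / 6) * U25₁ ^ 2, U26₃ - C (1 / 2) * U25₁ * U25₃ + C (1 / 9) * U25₁ ^ 3]
    18 [(2, 9), (3, 12)]).Basic := by
  apply basic_three isMetric_one
  · simp only [List.forall_mem_cons]
    have key : ∀ s : Matrix (Fin 3) (Fin 3) ℂ, subst s U25₁ = U25₁ → subst s U25₃ = U25₃ →
        subst s U26₃ = U26₃ → ∀ l, subst s (![U25₁, U25₃ - C (1 / 6) * U25₁ ^ 2,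
          U26₃ - C (1 / 2) * U25₁ * U25₃ + C (1 / 9) * U25₁ ^ 3] l) =
          ![U25₁, U25₃ - C (1 / 6) * U25₁ ^ 2,
            U26₃ - C (1 / 2) * U25₁ * U25₃ + C (1 / 9) * U25₁ ^ 3] l := by
      intro s e1 e3 e4
      exact forall_fin_three e1 (by simp [e1, e3]) (by simp [e1, e3, e4])
    obtain ⟨s1, -, s3, s4⟩ := subst_swap01
    obtain ⟨a1, -, a3, a4⟩ := subst_reflection_U25 (Or.inl rfl)
    obtain ⟨b1, -, b3, b4⟩ := subst_reflection_U25 (Or.inr (Or.inl rfl))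
    exact ⟨⟨vec_ne_zero_three one_ne_zero, by norm_num, key _ (subst_reflection_diff s1)
        (subst_reflection_diff s3) (subst_reflection_diff s4)⟩,
      ⟨vec_ne_zero_three one_ne_zero, by norm_num, key _ a1 a3 a4⟩,
      ⟨vec_ne_zero_three one_ne_zero, by norm_num, key _ b1 b3 b4⟩, by simp⟩
  · have h2 := (isHomogeneous_U25₁.mul isHomogeneous_U25₃).C_mul (1 / 2)
    rw [← mul_assoc] at h2
    have h1 := isHomogeneous_U25₃.sub ((isHomogeneous_U25₁.pow 2).C_mul (1 / 6))
    have h3 := (isHomogeneous_U26₃.sub h2).add ((isHomogeneous_U25₁.pow 3).C_mul (1 / 9))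
    exact forall_fin_three isHomogeneous_U25₁ h1 h3
  · decide
  · refine det_jacOf_ne_zero_three
      (normalForm_G26 (by norm_num) normalForm_U25₁ normalForm_U25₃ normalForm_U26₃) ![0, 1, 2] rfl ?_
    simp [cofactor, Fin.sum_univ_three, Derivation.leibniz, Derivation.leibniz_pow]
    norm_num

lemma goodAt_G26 : (dataThree 1 [(![1, -1, 0], 2), (![1, 0, 0], 3), (![1, 1, 1], 3)] ![6, 12, 18]
    ![U25₁, U25₃ - C (1 / 6) * U25₁ ^ 2, U26₃ - C (1 / 2) * U25₁ * U25₃ + C (1 / 9) * U25₁ ^ 3]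
    18 [(2, 9), (3, 12)]).GoodAt ![1, -1, 0] 1 ((2 : ℕ) / (18 : ℕ)) := by
  have hn : ∀ l, NormalForm 2 (subst diffFrame (![U25₁, U25₃ - C (1 / 6) * U25₁ ^ 2,
      U26₃ - C (1 / 2) * U25₁ * U25₃ + C (1 / 9) * U25₁ ^ 3] l)) _ _ := fun l =>
    (normalForm_G26 two_ne_zero normalForm_diffFrame_U25₁ normalForm_diffFrame_U25₃
      normalForm_diffFrame_U26₃ l).congr (by fin_cases l <;> simp) rfl rfl
  refine adapted_diffFrame.goodAt (localGood_three basic_G26.two_le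
    (fun l => isHomogeneous_subst _ (basic_G26.hom l)) hn ?_ ?_)
  all_goals
    apply MvPolynomial.funext
    intro p
    simp [cofactor, Fin.sum_univ_three, Derivation.leibniz, Derivation.leibniz_pow]
    ring

lemma goodAt_G26_cube : (dataThree 1 [(![1, -1, 0], 2), (![1, 0, 0], 3), (![1, 1, 1], 3)] ![6, 12, 18]
    ![U25₁, U25₃ - C (1 / 6) * U25₁ ^ 2, U26₃ - C (1 / 2) * U25₁ * U25₃ + C (1 / 9) * U25₁ ^ 3]
    18 [(2, 9), (3, 12)]).GoodAt ![1, 0, 0] 2 ((3 : ℕ) / (18 : ℕ)) := by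
  refine adapted_one_zero_zero.goodAt (localGood_three basic_G26.two_le
    (fun l => isHomogeneous_subst _ (basic_G26.hom l)) (fun l => (normalForm_G26 (by norm_num)
      normalForm_U25₁ normalForm_U25₃ normalForm_U26₃ l).subst_one) ?_ ?_)
  all_goals
    apply MvPolynomial.funext
    intro p
    simp [cofactor, Fin.sum_univ_three, Derivation.leibniz, Derivation.leibniz_pow]
    ring

lemma conclusion_G26 : (STGroup.data .G26).Conclusion := by
  have : Fact (Nat.Prime 7) := ⟨by norm_num⟩
  refine conclusion_three basic_G26 7 [(0, 0), (0, 1), (1, 0), (1, 2), (1, 0), (1, 1), (1, 1), (1, 0),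
    (1, 1), (1, 1), (1, 0), (1, 1), (1, 2), (13, 1), (1, 0), (1, 2), (1, 0), (1, 2), (1, 0), (2, 1),
    (1, 0)] ?_ 0 1 (by decide +kernel) goodAt_G26 goodAt_G26_cube
  intro k _ _ φ
  exact ⟨_, .cons (genRed_int ![1, -1, 0] (forall_fin_three (by simp) (by simp) (by simp)) 5 (by decide))
    (.cons (genRed_int ![1, 0, 0] (forall_fin_three (by simp) (by simp) (by simp)) 1 (by decide))
    (.cons (genRed_int ![1, 1, 1] (forall_fin_three (by simp) (by simp) (by simp)) 1 (by decide)) .nil)),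
    by decide +kernel⟩

end Hessian

end RankThree

section RankThree

/-! ### The icosahedral group of rank three -/

section Icosahedral

/-- An orthogonal frame of the icosahedral group, adapted to the mirror `[-2, √5 - 1, √5 + 1]`. -/
def icoFrame : Matrix (Fin 3) (Fin 3) ℂ :=
  !![-1 / 2, -((r5 - 1) / 4), -((r5 + 1) / 4); (r5 - 1) / 4, (r5 + 1) / 4, -1 / 2;
    (r5 + 1) / 4, -1 / 2, -((r5 - 1) / 4)]

lemma det_icoFrame : icoFrame.det = 1 := by
  rw [icoFrame, Matrix.det_fin_three]
  simp
  linear_combination (3 / 16) * r5_sq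

lemma adapted_icoFrame : Adapted 1 ![-2, r5 - 1, r5 + 1] icoFrame := by
  have h5 := r5_sq
  refine ⟨by rw [det_icoFrame]; exact one_ne_zero, ⟨4, ?_⟩, 1 / 4, fun i => ?_⟩
  · ext i
    fin_cases i
    · simp [icoFrame, Matrix.vecMul, dotProduct, Fin.sum_univ_three]
      linear_combination (1 / 2) * h5
    · simp [icoFrame, Matrix.vecMul, dotProduct, Fin.sum_univ_three]
      linear_combination (1 / 4) * h5
    · simp [icoFrame, Matrix.vecMul, dotProduct, Fin.sum_univ_three]
      linear_combination (-1 / 4) * h5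
  · fin_cases i <;> simp [sharp_one, icoFrame] <;> ring

/-- The invariant of degree ten is recovered from the lower ones by a bordered Hessian, so that a
symmetry of those is inherited without a substitution in degree ten. -/
lemma U23₃_eq : U23₃ = C (187 / 352800) * bord U23₂ (pow3 2) - C (1408 / 735) * pow3 2 ^ 2 * U23₂ -
    C (2176 / 735) * pow3 2 ^ 5 := by
  apply MvPolynomial.funext
  intro p
  rw [bord_eq]
  simp [U23₂, U23₃, pow3, sym3, delta23, Derivation.leibniz, Derivation.leibniz_pow]
  ring_nf
  simp only [r5_sq]
  ring

/-- The frame is itself a symmetry of the invariants. The reflection in the third generator is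
therefore reduced to the sign change of the first coordinate. -/
lemma subst_icoFrame : subst icoFrame (pow3 2) = pow3 2 ∧ subst icoFrame U23₂ = U23₂ ∧
    subst icoFrame U23₃ = U23₃ := by
  have h5 := r5_sq
  have h3 : r5 ^ 3 = 5 * r5 := by linear_combination r5 * h5
  have h4 : r5 ^ 4 = 25 := by linear_combination (r5 ^ 2 + 5) * h5
  -- The invariants of degrees two and six are polynomials in the squares of the coordinates, so the
  -- squares are simplified first.
  have hx : ∀ x y z : ℂ, (-1 / 2 * x + -((r5 - 1) / 4) * y + -((r5 + 1) / 4) * z) ^ 2 =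
      (4 * x ^ 2 + (6 - 2 * r5) * y ^ 2 + (6 + 2 * r5) * z ^ 2 + 4 * (r5 - 1) * x * y +
        4 * (r5 + 1) * x * z + 8 * y * z) / 16 := fun x y z => by
    linear_combination ((y + z) ^ 2 / 16) * h5
  have hy : ∀ x y z : ℂ, ((r5 - 1) / 4 * x + (r5 + 1) / 4 * y + -1 / 2 * z) ^ 2 =
      (4 * z ^ 2 + (6 - 2 * r5) * x ^ 2 + (6 + 2 * r5) * y ^ 2 - 4 * (r5 - 1) * x * z -
        4 * (r5 + 1) * y * z + 8 * x * y) / 16 := fun x y z => by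
    linear_combination ((x + y) ^ 2 / 16) * h5
  have hz : ∀ x y z : ℂ, ((r5 + 1) / 4 * x + -1 / 2 * y + -((r5 - 1) / 4) * z) ^ 2 =
      (4 * y ^ 2 + (6 - 2 * r5) * z ^ 2 + (6 + 2 * r5) * x ^ 2 + 4 * (r5 - 1) * y * z -
        4 * (r5 + 1) * x * y - 8 * x * z) / 16 := fun x y z => by
    linear_combination ((x - z) ^ 2 / 16) * h5
  have e4 : ∀ t : ℂ, t ^ 4 = (t ^ 2) ^ 2 := fun t => by ring
  have e6 : ∀ t : ℂ, t ^ 6 = (t ^ 2) ^ 3 := fun t => by ring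
  have e1 : subst icoFrame (pow3 2) = pow3 2 := by
    apply MvPolynomial.funext
    intro p
    rw [eval_subst_three]
    simp only [icoFrame, pow3, map_add, map_pow, eval_X, Matrix.of_apply, Matrix.cons_val]
    rw [hx, hy, hz]
    ring
  have e2 : subst icoFrame U23₂ = U23₂ := by
    apply MvPolynomial.funext
    intro p
    rw [eval_subst_three]
    simp only [icoFrame, U23₂, pow3, sym3, delta23, map_add, map_sub, map_mul, map_pow, eval_X,
      eval_C, map_ofNat, Matrix.of_apply, Matrix.cons_val]
    simp only [e4, e6, hx, hy, hz]
    ring_nf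
    simp only [h5, h3, h4]
    ring
  refine ⟨e1, e2, ?_⟩
  have h := bord_subst icoFrame U23₂ (pow3 2)
  rw [e1, e2, det_icoFrame, one_pow, C_1, one_mul] at h
  rw [U23₃_eq, map_sub, map_sub, map_mul, map_mul, map_mul, map_mul, map_pow, map_pow, subst_C,
    subst_C, subst_C, e1, e2, ← h]

lemma subst_diagRefl_even : subst (diagRefl 0 (zeta 2)) (pow3 2) = pow3 2 ∧
    subst (diagRefl 0 (zeta 2)) U23₂ = U23₂ ∧ subst (diagRefl 0 (zeta 2)) U23₃ = U23₃ := by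
  refine ⟨?_, ?_, ?_⟩ <;>
  · apply MvPolynomial.funext
    intro p
    rw [eval_subst_diagRefl_three, zeta_two]
    simp [U23₂, U23₃, pow3, sym3, delta23]
    try ring

lemma subst_diagRefl_swap_even :
    subst (diagRefl 0 (zeta 2)) (subst swap01 (pow3 2)) = subst swap01 (pow3 2) ∧
    subst (diagRefl 0 (zeta 2)) (subst swap01 U23₂) = subst swap01 U23₂ ∧
    subst (diagRefl 0 (zeta 2)) (subst swap01 U23₃) = subst swap01 U23₃ := by
  refine ⟨?_, ?_, ?_⟩ <;>
  · apply MvPolynomial.funext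
    intro p
    rw [eval_subst_diagRefl_three, zeta_two, eval_subst_three, eval_subst_three]
    simp [swap01, U23₂, U23₃, pow3, sym3, delta23]
    try ring

lemma normalForm_G23 : ∀ l, NormalForm 2 (![pow3 2, U23₂ - 2 * pow3 2 ^ 3,
      U23₃ + C (33 / 7) * pow3 2 ^ 2 * U23₂ - C (2091 / 175) * pow3 2 ^ 5] l)
    (![X 1 ^ 2 + X 2 ^ 2, C (21 * r5) * (X 1 ^ 4 * X 2 ^ 2 - X 1 ^ 2 * X 2 ^ 4) -
        21 * (X 1 ^ 4 * X 2 ^ 2 + X 1 ^ 2 * X 2 ^ 4),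
      C (187 / 25) * (X 1 ^ 10 + X 2 ^ 10) - C (1683 / 5) * (X 1 ^ 8 * X 2 ^ 2 + X 1 ^ 2 * X 2 ^ 8) +
        C (561 * r5) * (X 1 ^ 6 * X 2 ^ 4 - X 1 ^ 4 * X 2 ^ 6) -
        C (561 / 5) * (X 1 ^ 6 * X 2 ^ 4 + X 1 ^ 4 * X 2 ^ 6)] l)
    (![1, C (21 * r5) * (X 2 ^ 4 - X 1 ^ 4) - 21 * (X 1 ^ 4 + X 2 ^ 4) + 168 * X 1 ^ 2 * X 2 ^ 2,
      C (26928 / 5) * (X 1 ^ 6 * X 2 ^ 2 - X 1 ^ 4 * X 2 ^ 4 + X 1 ^ 2 * X 2 ^ 6) -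
        C (1683 / 5) * (X 1 ^ 8 + X 2 ^ 8)] l) := by
  refine forall_fin_three ⟨?_, 0, ?_⟩ ⟨?_, C (21 * r5) * (X 0 * X 1 ^ 2 - X 0 * X 2 ^ 2) -
      21 * (X 0 * X 1 ^ 2 + X 0 * X 2 ^ 2), ?_⟩
    ⟨?_, C (187 / 25) * X 0 ^ 7 - C (1683 / 5) * X 0 ^ 5 * (X 1 ^ 2 + X 2 ^ 2) +
      C (561 * r5) * X 0 ^ 3 * (X 1 ^ 4 - X 2 ^ 4) - C (561 / 5) * X 0 ^ 3 * (X 1 ^ 4 + X 2 ^ 4) +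
      C (26928 / 5) * (X 0 ^ 3 * X 1 ^ 2 * X 2 ^ 2 - X 0 * X 1 ^ 4 * X 2 ^ 2 - X 0 * X 1 ^ 2 * X 2 ^ 4) -
      C (561 * r5) * X 0 * (X 1 ^ 6 - X 2 ^ 6) - C (561 / 5) * X 0 * (X 1 ^ 6 + X 2 ^ 6), ?_⟩
  · simp [Derivation.leibniz_pow]
  · simp [pow3]
    ring
  · simp [Derivation.leibniz, Derivation.leibniz_pow]
  · apply MvPolynomial.funext
    intro p
    simp [U23₂, pow3, sym3, delta23]
    ring
  · simp [Derivation.leibniz, Derivation.leibniz_pow]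
  · apply MvPolynomial.funext
    intro p
    simp [U23₂, U23₃, pow3, sym3, delta23]
    ring

lemma isHomogeneous_pow3_two : (pow3 2).IsHomogeneous 2 := isHomogeneous_of_eval fun t p => by
  simp [pow3]
  ring

lemma isHomogeneous_U23₂ : U23₂.IsHomogeneous 6 := isHomogeneous_of_eval fun t p => by
  simp [U23₂, pow3, sym3, delta23]
  ring

lemma isHomogeneous_U23₃ : U23₃.IsHomogeneous 10 := isHomogeneous_of_eval fun t p => by
  simp [U23₃, pow3, sym3, delta23]
  ring

lemma basic_G23 : (dataThree 1 [(![1, 0, 0], 2), (![0, 1, 0], 2), (![-2, r5 - 1, r5 + 1], 2)]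
    ![2, 6, 10] ![pow3 2, U23₂ - 2 * pow3 2 ^ 3,
      U23₃ + C (33 / 7) * pow3 2 ^ 2 * U23₂ - C (2091 / 175) * pow3 2 ^ 5] 10 [(2, 15)]).Basic := by
  apply basic_three isMetric_one
  · simp only [List.forall_mem_cons]
    have key : ∀ s : Matrix (Fin 3) (Fin 3) ℂ, subst s (pow3 2) = pow3 2 → subst s U23₂ = U23₂ →
        subst s U23₃ = U23₃ → ∀ l, subst s (![pow3 2, U23₂ - 2 * pow3 2 ^ 3,
          U23₃ + C (33 / 7) * pow3 2 ^ 2 * U23₂ - C (2091 / 175) * pow3 2 ^ 5] l) =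
          ![pow3 2, U23₂ - 2 * pow3 2 ^ 3,
            U23₃ + C (33 / 7) * pow3 2 ^ 2 * U23₂ - C (2091 / 175) * pow3 2 ^ 5] l := by
      intro s e1 e2 e3
      exact forall_fin_three e1 (by simp [e1, e2, map_ofNat]) (by simp [e1, e2, e3])
    obtain ⟨d1, d2, d3⟩ := subst_diagRefl_even
    obtain ⟨s1, s2, s3⟩ := subst_diagRefl_swap_even
    obtain ⟨g1, g2, g3⟩ := subst_icoFrame
    have h0 : (![1, 0, 0] : Fin 3 → ℂ) ≠ 0 := vec_ne_zero_three one_ne_zero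
    have h1 : (![0, 1, 0] : Fin 3 → ℂ) ≠ 0 := fun h => by simpa using congrFun h 1
    have h2 : ![-2, r5 - 1, r5 + 1] ≠ 0 := vec_ne_zero_three (by norm_num)
    have a0 : ∀ f : MvPolynomial (Fin 3) ℂ, subst (diagRefl 0 (zeta 2)) f = f →
        subst (reflection 1 ![1, 0, 0] 2) f = f := fun f hf =>
      adapted_one_zero_zero.subst_reflection_of_semi isMetric_one h0 (χ := 1)
        (by rw [subst_one, C_1, one_mul]) hf
    have a1 : ∀ f : MvPolynomial (Fin 3) ℂ,
        subst (diagRefl 0 (zeta 2)) (subst swap01 f) = subst swap01 f →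
        subst (reflection 1 ![0, 1, 0] 2) f = f := fun f hf =>
      adapted_swap01.subst_reflection_of_semi isMetric_one h1 (χ := 1) (by rw [C_1, one_mul]) hf
    have a2 : ∀ f : MvPolynomial (Fin 3) ℂ, subst icoFrame f = f →
        subst (diagRefl 0 (zeta 2)) f = f →
        subst (reflection 1 ![-2, r5 - 1, r5 + 1] 2) f = f := fun f hg hf =>
      adapted_icoFrame.subst_reflection_of_semi isMetric_one h2 (χ := 1)
        (by rw [hg, C_1, one_mul]) hf
    exact ⟨⟨h0, by norm_num, key _ (a0 _ d1) (a0 _ d2) (a0 _ d3)⟩,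
      ⟨h1, by norm_num, key _ (a1 _ s1) (a1 _ s2) (a1 _ s3)⟩,
      ⟨h2, by norm_num, key _ (a2 _ g1 d1) (a2 _ g2 d2) (a2 _ g3 d3)⟩, by simp⟩
  · have e1 := (isHomogeneous_pow3_two.pow 3).C_mul 2
    rw [map_ofNat] at e1
    have e2 := ((isHomogeneous_pow3_two.pow 2).C_mul (33 / 7)).mul isHomogeneous_U23₂
    exact forall_fin_three isHomogeneous_pow3_two (isHomogeneous_U23₂.sub e1)
      ((isHomogeneous_U23₃.add e2).sub ((isHomogeneous_pow3_two.pow 5).C_mul _))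
  · decide
  · refine det_jacOf_ne_zero_three normalForm_G23 ![0, 1, 1] rfl ?_
    have h : (-314160 : ℂ) * r5 ≠ 0 := mul_ne_zero (by norm_num) r5_ne_zero
    convert h using 1
    simp [cofactor, Fin.sum_univ_three, Derivation.leibniz, Derivation.leibniz_pow]
    ring

lemma goodAt_G23 : (dataThree 1 [(![1, 0, 0], 2), (![0, 1, 0], 2), (![-2, r5 - 1, r5 + 1], 2)]
    ![2, 6, 10] ![pow3 2, U23₂ - 2 * pow3 2 ^ 3,
      U23₃ + C (33 / 7) * pow3 2 ^ 2 * U23₂ - C (2091 / 175) * pow3 2 ^ 5] 10 [(2, 15)]).GoodAt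
      ![1, 0, 0] 1 ((2 : ℕ) / (10 : ℕ)) := by
  refine adapted_one_zero_zero.goodAt (localGood_three basic_G23.two_le
    (fun l => isHomogeneous_subst _ (basic_G23.hom l)) (fun l => (normalForm_G23 l).subst_one) ?_ ?_)
  all_goals
    apply MvPolynomial.funext
    intro p
    simp [cofactor, Fin.sum_univ_three, Derivation.leibniz, Derivation.leibniz_pow]
    ring_nf
    try simp only [r5_sq]
    try ring

lemma conclusion_G23 : (STGroup.data .G23).Conclusion := by
  have : Fact (Nat.Prime 11) := ⟨by norm_num⟩
  refine conclusion_three basic_G23 11 [(0, 0), (1, 2), (1, 0), (1, 1), (1, 0), (1, 2), (1, 0), (1, 1),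
    (1, 0), (2, 2), (4, 2), (1, 0), (1, 1), (1, 0), (2, 2)] ?_ 0 0 (by decide) goodAt_G23 goodAt_G23
  intro k _ _ φ
  have hg : ∀ x : ℤ, Red φ r5 x → GroupData.GenRed φ 11 1 (![-2, r5 - 1, r5 + 1], 2)
      ([residue 11 (-2), residue 11 (x - 1), residue 11 (x + 1)],
        [residue 11 (-2), residue 11 (x - 1), residue 11 (x + 1)], 9) := fun x hx =>
    genRed_three 1 1 ((Red.ofNat 2).neg.of_eq (by simp)) ((hx.sub Red.one).of_eq (by simp))
      ((hx.add Red.one).of_eq (by simp)) ((Red.ofNat 2).neg.of_eq (by simp [sharp_one]))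
      ((hx.sub Red.one).of_eq (by simp [sharp_one])) ((hx.add Red.one).of_eq (by simp [sharp_one])) 9
      (by decide) one_ne_zero one_ne_zero
  rcases Red.of_sq (φ := φ) (p := 11) r5_sq (a := 4) (Red.ofNat 5) (by decide) with hr | hr <;>
  exact ⟨_, .cons (genRed_int ![1, 0, 0] (forall_fin_three (by simp) (by simp) (by simp)) 9 (by decide))
    (.cons (genRed_int ![0, 1, 0] (forall_fin_three (by simp) (by simp) (by simp)) 9 (by decide))
    (.cons (hg _ hr) .nil)), by decide +kernel⟩

end Icosahedral

end RankThree

/-! ### Transport of adapted frames, scaling of the local conditions, and reductions of roots of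
unity. -/

section RankThree

/-- Transport of an adapted frame by a unitary transformation. -/
lemma Adapted.mul_left {h : Matrix (Fin 3) (Fin 3) ℂ} (hh : IsMetric h) {β : Fin 3 → ℂ}
    {g x y : Matrix (Fin 3) (Fin 3) ℂ} (hx : x.conjTranspose * h * x = h) (hxy : x * y = 1)
    (hg : Adapted h β g) : Adapted h (Matrix.vecMul β y) (x * g) := by
  obtain ⟨h0, ⟨s, hs⟩, t, ht⟩ := hg
  refine ⟨?_, ⟨s, ?_⟩, t, fun i => ?_⟩
  · rw [Matrix.det_mul]
    refine mul_ne_zero (fun e => one_ne_zero (α := ℂ) ?_) h0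
    rw [← Matrix.det_one (n := Fin 3), ← hxy, Matrix.det_mul, e, zero_mul]
  · rw [Matrix.vecMul_vecMul, ← Matrix.mul_assoc, mul_eq_one_comm.mp hxy, Matrix.one_mul, hs]
  · have e := GroupData.sharp_vecMul (D := dataThree h [] 0 0 0 []) hh hx hxy β
    have e' : sharp h (Matrix.vecMul β y) i = x.mulVec (sharp h β) i := congrFun e i
    rw [e', Matrix.mul_apply, Matrix.mulVec, dotProduct, Finset.mul_sum]
    exact Finset.sum_congr rfl fun j _ => by rw [ht]; ring

lemma Adapted.subst_reflection_mul_left {h : Matrix (Fin 3) (Fin 3) ℂ} (hh : IsMetric h)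
    {β : Fin 3 → ℂ} {g x y : Matrix (Fin 3) (Fin 3) ℂ} (hx : x.conjTranspose * h * x = h)
    (hxy : x * y = 1) (hg : Adapted h β g) (hβ : Matrix.vecMul β y ≠ 0)
    {f : MvPolynomial (Fin 3) ℂ} (hf : subst x f = f)
    (hd : subst (diagRefl 0 (zeta 2)) (subst g f) = subst g f) :
    subst (reflection h (Matrix.vecMul β y) 2) f = f := by
  refine (hg.mul_left hh hx hxy).subst_reflection_of_semi hh hβ (χ := 1) (f' := subst g f) ?_ hd
  rw [← subst_subst, hf, C_1, one_mul]

/-- The determinant -1 of a reflection of order two enters the transformation law squared. -/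
lemma det_hessian_invariant {h : Matrix (Fin 3) (Fin 3) ℂ} (hh : IsMetric h) {β : Fin 3 → ℂ}
    (hβ : β ≠ 0) {f : MvPolynomial (Fin 3) ℂ} (hf : subst (reflection h β 2) f = f) :
    subst (reflection h β 2) (hessian f).det = (hessian f).det := by
  have hd : (reflection h β 2).det = -1 := (hh.det_unitaryRefl hβ _).trans zeta_two
  have e := det_hessian_subst (reflection h β 2) f
  rw [hf, hd] at e
  rw [neg_one_sq, C_1, one_mul] at e
  exact e.symm

lemma bord_invariant {h : Matrix (Fin 3) (Fin 3) ℂ} (hh : IsMetric h) {β : Fin 3 → ℂ}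
    (hβ : β ≠ 0) {f k : MvPolynomial (Fin 3) ℂ} (hf : subst (reflection h β 2) f = f)
    (hk : subst (reflection h β 2) k = k) :
    subst (reflection h β 2) (bord f k) = bord f k := by
  have hd : (reflection h β 2).det = -1 := (hh.det_unitaryRefl hβ _).trans zeta_two
  have e := bord_subst (reflection h β 2) f k
  rw [hf, hk, hd] at e
  rw [neg_one_sq, C_1, one_mul] at e
  exact e.symm

lemma sum_smul_cofactor (s : Fin 3 → ℂ) (A b : Fin 3 → MvPolynomial (Fin 3) ℂ) :
    ∑ l, C (s l) * b l * cofactor (fun l => C (s l) * A l) l =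
      C (s 0 * s 1 * s 2) * ∑ l, b l * cofactor A l := by
  simp [cofactor, Fin.sum_univ_three]
  ring

/-- The local conditions do not depend on the normalization of the polynomials. -/
lemma localGood_three_of_smul {m : ℕ} {v w A c : Fin 3 → MvPolynomial (Fin 3) ℂ} {d : Fin 3 → ℕ}
    (hd : ∀ l, 2 ≤ d l) (hv : ∀ l, (v l).IsHomogeneous (d l)) (s : Fin 3 → ℂ)
    (hs : ∀ l, v l = C (s l) * w l) (h : ∀ l, NormalForm (m + 1) (w l) (A l) (c l)) {r : ℂ}
    (h1 : ∑ l, C ((m : ℂ) / ((d l : ℂ) - 1) - r) * (c l * cofactor A l) = 0)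
    (h2 : ∑ l, C (1 / ((d l : ℂ) - 1)) * (pderiv 1 (pderiv 1 (A l)) * cofactor A l) = 0) :
    LocalGood d v 0 m r := by
  refine localGood_three hd hv (A := fun l => C (s l) * A l) (c := fun l => C (s l) * c l)
    (fun l => hs l ▸ (h l).C_mul (s l)) ?_ ?_
  · have e := sum_smul_cofactor s A fun l => C ((m : ℂ) / ((d l : ℂ) - 1) - r) * c l
    simp only [mul_assoc] at e
    rw [h1, mul_zero] at e
    rw [← e]
    exact Finset.sum_congr rfl fun l _ => by ring
  · have e := sum_smul_cofactor s A fun l => C (1 / ((d l : ℂ) - 1)) * pderiv 1 (pderiv 1 (A l))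
    simp only [mul_assoc] at e
    rw [h2, mul_zero] at e
    rw [← e]
    exact Finset.sum_congr rfl fun l _ => by rw [pderiv_C_mul, pderiv_C_mul]; ring

lemma det_jacOf_ne_zero_three_of_smul {m : ℕ} {v w A c : Fin 3 → MvPolynomial (Fin 3) ℂ}
    (s : Fin 3 → ℂ) (hs0 : ∀ l, s l ≠ 0) (hs : ∀ l, v l = C (s l) * w l)
    (h : ∀ l, NormalForm (m + 1) (w l) (A l) (c l)) (p : Fin 3 → ℂ)
    (hp : p 0 = 0) (hne : eval p (∑ l, c l * cofactor A l) ≠ 0) : (jacOf v).det ≠ 0 := by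
  refine det_jacOf_ne_zero_three (A := fun l => C (s l) * A l) (c := fun l => C (s l) * c l)
    (fun l => hs l ▸ (h l).C_mul (s l)) p hp ?_
  rw [sum_smul_cofactor, map_mul, eval_C]
  exact mul_ne_zero (mul_ne_zero (mul_ne_zero (hs0 0) (hs0 1)) (hs0 2)) hne

lemma star_zeta (m : ℕ) : star (zeta m) = (zeta m)⁻¹ := by
  rw [zeta, ← Complex.exp_neg, Complex.star_def, ← Complex.exp_conj]
  congr 1
  simp [map_ofNat]
  ring

/-- As `m` is prime, `a` reduces to a primitive root and generates the roots of unity of order `m`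
in `k`. The exponent depends on the unknown reduction map, so the applications run through all its
values. -/
lemma exists_red_primitiveRoot {k : Type} [Field k] {p : ℕ} {φ : integralClosure ℤ ℂ →+* k}
    [CharP k p] [NeZero p] {m : ℕ} [Fact m.Prime] (hmp : ¬ p ∣ m) {ζ : ℂ} (hζ : IsPrimitiveRoot ζ m)
    {a : ℤ} (ha : (p : ℤ) ∣ a ^ m - 1) (ha1 : ¬ (p : ℤ) ∣ a - 1) :
    ∃ j : ℕ, j < m ∧ j ≠ 0 ∧ Red φ ζ (a ^ j) := by
  have hm : m.Prime := Fact.out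
  obtain ⟨iz, h⟩ := isPrimitiveRoot_red (φ := φ) hm.pos hmp hζ
  have ha' : (a : k) ^ m = 1 := by
    rw [← sub_eq_zero, ← Int.cast_pow, ← Int.cast_one, ← Int.cast_sub, CharP.intCast_eq_zero_iff k p]
    exact ha
  have ha1' : (a : k) ≠ 1 := by
    rw [← sub_ne_zero, ← Int.cast_one, ← Int.cast_sub, Ne, CharP.intCast_eq_zero_iff k p]
    exact ha1
  have hprim : IsPrimitiveRoot (a : k) m := by
    rw [← orderOf_eq_prime ha' ha1']
    exact IsPrimitiveRoot.orderOf _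
  have : NeZero m := ⟨hm.ne_zero⟩
  obtain ⟨j, hj, e⟩ := hprim.eq_pow_of_pow_eq_one h.pow_eq_one
  refine ⟨j, hj, ?_, iz, ?_⟩
  · rintro rfl
    exact h.ne_one hm.one_lt (by rw [← e, pow_zero])
  · rw [← e, Int.cast_pow]

/-! ### The Klein group -/

section Klein

/-- Klein's quartic in a frame of three orthogonal mirrors. -/
def klein4 (a : ℂ) : MvPolynomial (Fin 3) ℂ :=
  pow3 4 + C (3 * a) * (X 0 ^ 2 * X 1 ^ 2 + X 0 ^ 2 * X 2 ^ 2 + X 1 ^ 2 * X 2 ^ 2)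

/-- Klein's sextic in a frame of three orthogonal mirrors. -/
def klein6 (a : ℂ) : MvPolynomial (Fin 3) ℂ :=
  pow3 6 - C (5 / 2 * a) * sym3 4 2 + C (10 * (a - 1)) * (X 0 ^ 2 * X 1 ^ 2 * X 2 ^ 2)

/-- The flat coordinate of degree 14 in a frame of three orthogonal mirrors. -/
def klein14 (a : ℂ) : MvPolynomial (Fin 3) ℂ :=
  C ((1 - a) / 4608) * bord (klein4 a) (klein6 a) - C (17 / 32) * klein4 a ^ 2 * klein6 a

lemma hessian_klein4 (a : ℂ) :
    pderiv 0 (pderiv 0 (klein4 a)) = 12 * X 0 ^ 2 + C (6 * a) * (X 1 ^ 2 + X 2 ^ 2) ∧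
    pderiv 1 (pderiv 1 (klein4 a)) = 12 * X 1 ^ 2 + C (6 * a) * (X 0 ^ 2 + X 2 ^ 2) ∧
    pderiv 2 (pderiv 2 (klein4 a)) = 12 * X 2 ^ 2 + C (6 * a) * (X 0 ^ 2 + X 1 ^ 2) ∧
    pderiv 0 (pderiv 1 (klein4 a)) = C (12 * a) * (X 0 * X 1) ∧
    pderiv 0 (pderiv 2 (klein4 a)) = C (12 * a) * (X 0 * X 2) ∧
    pderiv 1 (pderiv 2 (klein4 a)) = C (12 * a) * (X 1 * X 2) := by
  refine ⟨?_, ?_, ?_, ?_, ?_, ?_⟩ <;>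
  · apply MvPolynomial.funext
    intro p
    simp [klein4, pow3, Derivation.leibniz, Derivation.leibniz_pow]
    ring

lemma pderiv_klein6 (a : ℂ) :
    pderiv 0 (klein6 a) = X 0 * (6 * X 0 ^ 4 - C (5 * a) * (2 * X 0 ^ 2 * (X 1 ^ 2 + X 2 ^ 2) +
      (X 1 ^ 4 + X 2 ^ 4)) + C (20 * (a - 1)) * (X 1 ^ 2 * X 2 ^ 2)) ∧
    pderiv 1 (klein6 a) = X 1 * (6 * X 1 ^ 4 - C (5 * a) * (2 * X 1 ^ 2 * (X 0 ^ 2 + X 2 ^ 2) +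
      (X 0 ^ 4 + X 2 ^ 4)) + C (20 * (a - 1)) * (X 0 ^ 2 * X 2 ^ 2)) ∧
    pderiv 2 (klein6 a) = X 2 * (6 * X 2 ^ 4 - C (5 * a) * (2 * X 2 ^ 2 * (X 0 ^ 2 + X 1 ^ 2) +
      (X 0 ^ 4 + X 1 ^ 4)) + C (20 * (a - 1)) * (X 0 ^ 2 * X 1 ^ 2)) := by
  refine ⟨?_, ?_, ?_⟩ <;>
  · apply MvPolynomial.funext
    intro p
    simp [klein6, pow3, sym3, Derivation.leibniz, Derivation.leibniz_pow]
    ring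

variable {a : ℂ} (ha : a ^ 2 = -a - 2)
include ha

lemma det_hessian_klein4 :
    (hessian (klein4 a)).det = C (-432 * (2 + a)) * klein6 a := by
  have h3 : a ^ 3 = -a + 2 := by linear_combination (a - 1) * ha
  apply MvPolynomial.funext
  intro p
  obtain ⟨k00, k11, k22, k01, k02, k12⟩ := hessian_klein4 a
  rw [det_hessian, k00, k11, k22, k01, k02, k12]
  simp [klein6, pow3, sym3]
  ring_nf
  simp only [ha, h3]
  ring

set_option maxHeartbeats 1000000 in
set_option maxRecDepth 100000 in
lemma normalForm_klein : ∀ l, NormalForm 2 (![klein4 a, klein6 a, klein14 a] l)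
    (![X 1 ^ 4 + X 2 ^ 4 + C (3 * a) * (X 1 ^ 2 * X 2 ^ 2),
      X 1 ^ 6 + X 2 ^ 6 - C (5 / 2 * a) * (X 1 ^ 4 * X 2 ^ 2 + X 1 ^ 2 * X 2 ^ 4),
      C (-91 / 64 * a) * (X 1 ^ 12 * X 2 ^ 2 + X 1 ^ 2 * X 2 ^ 12) +
        C (19 / 32) * (X 1 ^ 14 + X 2 ^ 14) +
        C (819 / 64 * a - 91 / 8) * (X 1 ^ 10 * X 2 ^ 4 + X 1 ^ 4 * X 2 ^ 10) +
        C (1001 / 64 * a + 91 / 8) * (X 1 ^ 8 * X 2 ^ 6 + X 1 ^ 6 * X 2 ^ 8)] l)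
    (![C (3 * a) * (X 1 ^ 2 + X 2 ^ 2),
      C (-5 / 2 * a) * (X 1 ^ 4 + X 2 ^ 4) + C (10 * a - 10) * (X 1 ^ 2 * X 2 ^ 2),
      C (-1365 / 16 * a + 819 / 16) * (X 1 ^ 10 * X 2 ^ 2 + X 1 ^ 2 * X 2 ^ 10) +
        C (-91 / 64 * a) * (X 1 ^ 12 + X 2 ^ 12) +
        C (-1911 / 32 * a - 3003 / 32) * (X 1 ^ 8 * X 2 ^ 4 + X 1 ^ 4 * X 2 ^ 8) +
        C (455 / 2 * a + 1183 / 8) * (X 1 ^ 6 * X 2 ^ 6)] l) := by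
  have h3 : a ^ 3 = -a + 2 := by linear_combination (a - 1) * ha
  have h4 : a ^ 4 = 3 * a + 2 := by linear_combination (a ^ 2 - a - 1) * ha
  have h5 : a ^ 5 = -a - 6 := by linear_combination (a ^ 3 - a ^ 2 - a + 3) * ha
  refine forall_fin_three ⟨?_, X 0, ?_⟩
    ⟨?_, X 0 ^ 3 - C (5 / 2 * a) * (X 0 * X 1 ^ 2 + X 0 * X 2 ^ 2), ?_⟩
    ⟨?_, C (-1365 / 16 * a + 819 / 16) * (X 0 ^ 7 * X 1 ^ 2 * X 2 ^ 2) +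
      C (819 / 64 * a - 91 / 8) * (X 0 ^ 7 * X 1 ^ 4 + X 0 ^ 7 * X 2 ^ 4 + X 0 * X 1 ^ 10 +
        X 0 * X 2 ^ 10) + C (-91 / 64 * a) * (X 0 ^ 9 * X 1 ^ 2 + X 0 ^ 9 * X 2 ^ 2) +
      C (19 / 32) * (X 0 ^ 11) +
      C (-1911 / 32 * a - 3003 / 32) * (X 0 ^ 5 * X 1 ^ 4 * X 2 ^ 2 + X 0 ^ 5 * X 1 ^ 2 * X 2 ^ 4 +
        X 0 * X 1 ^ 8 * X 2 ^ 2 + X 0 * X 1 ^ 2 * X 2 ^ 8) +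
      C (1001 / 64 * a + 91 / 8) * (X 0 ^ 5 * X 1 ^ 6 + X 0 ^ 5 * X 2 ^ 6 + X 0 ^ 3 * X 1 ^ 8 +
        X 0 ^ 3 * X 2 ^ 8) +
      C (455 / 2 * a + 1183 / 8) * (X 0 ^ 3 * X 1 ^ 6 * X 2 ^ 2 + X 0 ^ 3 * X 1 ^ 2 * X 2 ^ 6) +
      C (-3731 / 16 * a - 2639 / 16) * (X 0 ^ 3 * X 1 ^ 4 * X 2 ^ 4 + X 0 * X 1 ^ 6 * X 2 ^ 4 +
        X 0 * X 1 ^ 4 * X 2 ^ 6), ?_⟩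
  · simp [Derivation.leibniz, Derivation.leibniz_pow]
  · apply MvPolynomial.funext
    intro p
    simp [klein4, pow3]
    ring
  · simp [Derivation.leibniz, Derivation.leibniz_pow]
  · apply MvPolynomial.funext
    intro p
    simp [klein6, pow3, sym3]
    ring
  · simp [Derivation.leibniz, Derivation.leibniz_pow]
  · apply MvPolynomial.funext
    intro p
    simp only [Matrix.cons_val, klein14]
    obtain ⟨k00, k11, k22, k01, k02, k12⟩ := hessian_klein4 a
    obtain ⟨s0, s1, s2⟩ := pderiv_klein6 a
    rw [bord_eq, k00, k11, k22, k01, k02, k12, s0, s1, s2]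
    simp [klein4, klein6, pow3, sym3]
    ring_nf
    simp only [ha, h3, h4, h5]
    ring

/-- Multiplication by minus the expression with the conjugate root -1 - a gives a non-zero integer.
The number is the leading coefficient of the Jacobian determinant of the normalized forms at the
point (0, 1, 2). -/
lemma klein_lin_ne_zero : 1248827328 * a + 2352442176 ≠ 0 := fun h => by
  have : (1248827328 * a + 2352442176) * (1248827328 * a - 1103614848) = 0 := by rw [h, zero_mul]
  have e : (-5715329504814268416 : ℂ) = 0 := by linear_combination this - 1248827328 ^ 2 * ha
  norm_num at e

end Klein

end RankThree

/-! ### The group G24. -/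

section RankThree

section Klein

lemma zeta_seven_six : zeta 7 ^ 6 = -1 - zeta 7 - zeta 7 ^ 2 - zeta 7 ^ 3 - zeta 7 ^ 4 - zeta 7 ^ 5 := by
  have h := (isPrimitiveRoot_zeta (m := 7) (by norm_num)).geom_sum_eq_zero (by norm_num)
  simp [Finset.sum_range_succ] at h
  linear_combination h

lemma zeta_seven_pows :
    zeta 7 ^ 7 = 1 ∧ zeta 7 ^ 8 = zeta 7 ∧ zeta 7 ^ 9 = zeta 7 ^ 2 ∧ zeta 7 ^ 10 = zeta 7 ^ 3 ∧ zeta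
    7 ^ 11 = zeta 7 ^ 4 ∧ zeta 7 ^ 12 = zeta 7 ^ 5 ∧ zeta 7 ^ 13 = zeta 7 ^ 6 ∧ zeta 7 ^ 14 = 1 ∧
    zeta 7 ^ 15 = zeta 7 ∧ zeta 7 ^ 16 = zeta 7 ^ 2 ∧ zeta 7 ^ 17 = zeta 7 ^ 3 ∧ zeta 7 ^ 18 = zeta
    7 ^ 4 ∧ zeta 7 ^ 19 = zeta 7 ^ 5 ∧ zeta 7 ^ 20 = zeta 7 ^ 6 ∧ zeta 7 ^ 21 = 1 ∧ zeta 7 ^ 22 =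
    zeta 7 ∧ zeta 7 ^ 23 = zeta 7 ^ 2 ∧ zeta 7 ^ 24 = zeta 7 ^ 3 := by
  have e : ∀ q r : ℕ, zeta 7 ^ (7 * q + r) = zeta 7 ^ r := fun q r => by
    rw [pow_add, pow_mul, zeta_pow (by norm_num), one_pow, one_mul]
  exact ⟨(e 1 0).trans (pow_zero _), (e 1 1).trans (pow_one _), e 1 2, e 1 3, e 1 4, e 1 5, e 1 6, (e 2
    0).trans (pow_zero _), (e 2 1).trans (pow_one _), e 2 2, e 2 3, e 2 4, e 2 5, e 2 6, (e 3
    0).trans (pow_zero _), (e 3 1).trans (pow_one _), e 3 2, e 3 3⟩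

lemma star_zeta_seven : star (zeta 7) = zeta 7 ^ 6 := by
  rw [star_zeta]
  exact inv_eq_of_mul_eq_one_right (by rw [← pow_succ', zeta_pow (by norm_num)])

lemma cos7_eq : cos7 = zeta 7 + zeta 7 ^ 6 := by
  rw [← star_zeta_seven, star_zeta, zeta, cos7, ← Complex.exp_neg]
  push_cast
  rw [Complex.cos]
  ring_nf

lemma star_cos7 : star cos7 = cos7 := Complex.conj_ofReal _

lemma star_neg_one_sub_cos7 : star (-1 - cos7) = -1 - cos7 := by
  rw [star_sub, star_cos7, star_neg, star_one]

/-- A frame of three orthogonal mirrors, adapted to the mirror of the first generator. -/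
def kleinFrame : Matrix (Fin 3) (Fin 3) ℂ :=
  !![1, zeta 7 ^ 4 + zeta 7 ^ 6, -(zeta 7 ^ 3 + zeta 7 ^ 4 + zeta 7 ^ 5);
    zeta 7 + zeta 7 ^ 6, -(1 + zeta 7 ^ 5 + zeta 7 ^ 6), zeta 7 ^ 2;
    -(1 + zeta 7 + zeta 7 ^ 6), zeta 7 ^ 3, 1 + zeta 7 ^ 2]

/-- The root of `a² + a + 2` in the seventh cyclotomic field. -/
def klein7 : ℂ := zeta 7 ^ 3 + zeta 7 ^ 5 + zeta 7 ^ 6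

/-- The square of the length of the covectors of the mirrors. -/
def kleinNorm : ℂ := 4 - 2 * zeta 7 ^ 3 - 2 * zeta 7 ^ 4

lemma klein7_sq : klein7 ^ 2 = -klein7 - 2 := by
  have h6 := zeta_seven_six
  rw [klein7]
  ring_nf
  simp only [zeta_seven_pows]
  linear_combination 2 * h6

lemma kleinNorm_ne_zero : kleinNorm ≠ 0 := fun h => by
  have h6 := zeta_seven_six
  have e : kleinNorm * (5 - zeta 7 ^ 2 + 2 * zeta 7 ^ 3 + 2 * zeta 7 ^ 4 - zeta 7 ^ 5) = 14 := by
    rw [kleinNorm]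
    ring_nf
    simp only [zeta_seven_pows]
    linear_combination -2 * h6
  rw [h, zero_mul] at e
  norm_num at e

/-- The Hessian covariants see the determinant of the frame only through its square, and this square
cancels against the constants in the normal forms. -/
lemma det_kleinFrame_sq : kleinFrame.det ^ 2 = kleinNorm ^ 3 * (2 + klein7) / 2 := by
  have h6 := zeta_seven_six
  have hd : kleinFrame.det = -6 + 2 * zeta 7 + 4 * zeta 7 ^ 2 + 8 * zeta 7 ^ 3 + 8 * zeta 7 ^ 4 -
      2 * zeta 7 ^ 5 := by
    rw [kleinFrame, Matrix.det_fin_three]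
    simp
    ring_nf
    simp only [zeta_seven_pows]
    simp only [h6]
    ring
  rw [hd, kleinNorm, klein7]
  ring_nf
  simp only [zeta_seven_pows]
  simp only [h6]
  ring

set_option maxRecDepth 100000 in
lemma kleinFrame_subst₁ : subst kleinFrame U24₁ = C (-kleinNorm ^ 2 / 4) * klein4 klein7 := by
  have h6 := zeta_seven_six
  apply MvPolynomial.funext
  intro p
  rw [eval_subst_three]
  simp [kleinFrame, U24₁, klein4, klein7, kleinNorm, pow3]
  ring_nf
  simp only [zeta_seven_pows]
  simp only [h6]
  ring

lemma det_hessian_C_mul (c : ℂ) (f : MvPolynomial (Fin 3) ℂ) :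
    (hessian (C c * f)).det = C (c ^ 3) * (hessian f).det := by
  simp only [det_hessian, pderiv_C_mul, C_pow]
  ring

lemma bord_C_mul (c c' : ℂ) (f k : MvPolynomial (Fin 3) ℂ) :
    bord (C c * f) (C c' * k) = C (c ^ 2 * c' ^ 2) * bord f k := by
  simp only [bord_eq, pderiv_C_mul, C_mul, C_pow]
  ring

/-- The sextic is the Hessian of Klein's quartic and, by the next lemma, the form of degree fourteen
is a bordered Hessian. Only the quartic has to be substituted into the frame. -/
lemma U24₂_eq : U24₂ = C (-1 / 54) * (hessian U24₁).det := by
  apply MvPolynomial.funext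
  intro p
  rw [det_hessian]
  simp [U24₁, U24₂, Derivation.leibniz, Derivation.leibniz_pow]
  ring

lemma U24₃_eq : U24₃ = C (1 / 9) * bord U24₁ U24₂ := by
  apply MvPolynomial.funext
  intro p
  rw [bord_eq]
  simp [U24₁, U24₂, U24₃, Derivation.leibniz, Derivation.leibniz_pow]
  ring

lemma det_kleinFrame_ne_zero : kleinFrame.det ≠ 0 := fun h => by
  have e := det_kleinFrame_sq
  rw [h] at e
  have h2 : 2 + klein7 ≠ 0 := fun h' => by
    have : (4 : ℂ) = 0 := by linear_combination (1 - klein7) * h' + klein7_sq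
    norm_num at this
  exact div_ne_zero (mul_ne_zero (pow_ne_zero 3 kleinNorm_ne_zero) h2) two_ne_zero
    (by rw [← e]; norm_num)

lemma kleinFrame_subst₂ : subst kleinFrame U24₂ = C (-kleinNorm ^ 3 / 4) * klein6 klein7 := by
  have e := det_hessian_subst kleinFrame U24₁
  rw [kleinFrame_subst₁, det_hessian_C_mul, det_hessian_klein4 klein7_sq] at e
  have h0 : (C (kleinFrame.det ^ 2) : MvPolynomial (Fin 3) ℂ) ≠ 0 :=
    C_ne_zero.mpr (pow_ne_zero 2 det_kleinFrame_ne_zero)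
  apply mul_left_cancel₀ h0
  rw [U24₂_eq, map_mul, subst_C, mul_left_comm, ← e, det_kleinFrame_sq, ← mul_assoc, ← mul_assoc,
    ← mul_assoc, ← C_mul, ← C_mul, ← C_mul]
  refine congrArg (fun c => C c * klein6 klein7) ?_
  ring

lemma kleinFrame_subst₃ : subst kleinFrame (U24₃ + 34 * U24₁ ^ 2 * U24₂) =
    C (kleinNorm ^ 7) * klein14 klein7 := by
  have e := bord_subst kleinFrame U24₁ U24₂
  rw [kleinFrame_subst₁, kleinFrame_subst₂, bord_C_mul] at e
  have h0 : (C (kleinFrame.det ^ 2) : MvPolynomial (Fin 3) ℂ) ≠ 0 :=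
    C_ne_zero.mpr (pow_ne_zero 2 det_kleinFrame_ne_zero)
  have e3 : subst kleinFrame U24₃ =
      C (kleinNorm ^ 7 * ((1 - klein7) / 4608)) * bord (klein4 klein7) (klein6 klein7) := by
    apply mul_left_cancel₀ h0
    rw [U24₃_eq, map_mul, subst_C, mul_left_comm, ← e, det_kleinFrame_sq, ← mul_assoc, ← mul_assoc,
      ← C_mul, ← C_mul]
    refine congrArg (fun c => C c * bord (klein4 klein7) (klein6 klein7)) ?_
    linear_combination (kleinNorm ^ 10 / 9216) * klein7_sq
  have e34 : (34 : MvPolynomial (Fin 3) ℂ) = C 34 := (map_ofNat C 34).symm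
  have e4 : (C (kleinNorm ^ 7) * C (17 / 32) : MvPolynomial (Fin 3) ℂ) =
      -(C 34 * C (-kleinNorm ^ 2 / 4) ^ 2 * C (-kleinNorm ^ 3 / 4)) := by
    rw [← C_pow, ← C_mul, ← C_mul, ← C_mul, ← C_neg]
    congr 1
    ring
  rw [map_add, map_mul, map_mul, map_pow, map_ofNat, e3, kleinFrame_subst₁, kleinFrame_subst₂, klein14,
    e34, C_mul]
  linear_combination (klein4 klein7 ^ 2 * klein6 klein7) * e4

lemma adapted_kleinFrame : Adapted 1 ![1, cos7, -1 - cos7] kleinFrame := by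
  have h6 := zeta_seven_six
  refine ⟨det_kleinFrame_ne_zero, ⟨kleinNorm, ?_⟩, 1, fun i => ?_⟩
  · rw [cos7_eq]
    ext i
    fin_cases i <;>
    · simp [kleinFrame, kleinNorm, Matrix.vecMul, dotProduct, Fin.sum_univ_three]
      ring_nf
      try simp only [zeta_seven_pows]
      simp only [h6]
      ring
  · rw [one_mul, sharp_one]
    fin_cases i
    · simp [kleinFrame]
    · refine Eq.trans ?_ star_cos7.symm
      rw [cos7_eq]
      simp [kleinFrame]
    · refine Eq.trans ?_ star_neg_one_sub_cos7.symm
      rw [cos7_eq]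
      simp [kleinFrame]
      ring

lemma subst_diagRefl_klein4 (a : ℂ) : subst (diagRefl 0 (zeta 2)) (klein4 a) = klein4 a := by
  apply MvPolynomial.funext
  intro p
  rw [eval_subst_diagRefl_three, zeta_two]
  simp [klein4, pow3]
  ring

/-- Invariance of the flat coordinates of `G24`, from that of Klein's quartic. -/
lemma subst_reflection_U24 {β : Fin 3 → ℂ} (hβ : β ≠ 0)
    (h : subst (reflection 1 β 2) U24₁ = U24₁) : ∀ l, subst (reflection 1 β 2)
      (![U24₁, U24₂, U24₃ + 34 * U24₁ ^ 2 * U24₂] l) = ![U24₁, U24₂, U24₃ + 34 * U24₁ ^ 2 * U24₂] l := by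
  have h2 : subst (reflection 1 β 2) U24₂ = U24₂ := by
    rw [U24₂_eq, map_mul, subst_C, det_hessian_invariant isMetric_one hβ h]
  have h3 : subst (reflection 1 β 2) U24₃ = U24₃ := by
    rw [U24₃_eq, map_mul, subst_C, bord_invariant isMetric_one hβ h h2]
  exact forall_fin_three h h2 (by simp [h, h2, h3, map_ofNat])

lemma isHomogeneous_U24₁ : U24₁.IsHomogeneous 4 := isHomogeneous_of_eval fun t p => by
  simp [U24₁]
  ring

lemma isHomogeneous_U24₂ : U24₂.IsHomogeneous 6 := isHomogeneous_of_eval fun t p => by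
  simp [U24₂]
  ring

lemma isHomogeneous_U24₃ : U24₃.IsHomogeneous 14 := isHomogeneous_of_eval fun t p => by
  simp [U24₃]
  ring

lemma kleinFrame_subst : ∀ l, subst kleinFrame (![U24₁, U24₂, U24₃ + 34 * U24₁ ^ 2 * U24₂] l) =
    C (![-kleinNorm ^ 2 / 4, -kleinNorm ^ 3 / 4, kleinNorm ^ 7] l) *
      ![klein4 klein7, klein6 klein7, klein14 klein7] l :=
  forall_fin_three kleinFrame_subst₁ kleinFrame_subst₂ kleinFrame_subst₃

lemma basic_G24 : (dataThree 1 [(![1, cos7, -1 - cos7], 2),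
    (![zeta 7, zeta 7 ^ 4 * cos7, zeta 7 ^ 2 * (-1 - cos7)], 2), (![cos7, -1 - cos7, 1], 2)]
    ![4, 6, 14] ![U24₁, U24₂, U24₃ + 34 * U24₁ ^ 2 * U24₂] 14 [(2, 21)]).Basic := by
  apply basic_three isMetric_one
  · simp only [List.forall_mem_cons]
    have h0 : ![1, cos7, -1 - cos7] ≠ 0 := vec_ne_zero_three one_ne_zero
    have h1 : ![zeta 7, zeta 7 ^ 4 * cos7, zeta 7 ^ 2 * (-1 - cos7)] ≠ 0 :=
      vec_ne_zero_three (zeta_ne_zero 7)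
    have h2 : ![cos7, -1 - cos7, 1] ≠ 0 := fun h => by simpa using congrFun h 2
    have hd : subst (diagRefl 0 (zeta 2)) (subst kleinFrame U24₁) = subst kleinFrame U24₁ := by
      rw [kleinFrame_subst₁, map_mul, subst_C, subst_diagRefl_klein4]
    refine ⟨⟨h0, by norm_num, subst_reflection_U24 h0 ?_⟩, ⟨h1, by norm_num, subst_reflection_U24 h1 ?_⟩,
      ⟨h2, by norm_num, subst_reflection_U24 h2 ?_⟩, by simp⟩
    · exact adapted_kleinFrame.subst_reflection_of_semi isMetric_one h0 (χ := 1)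
        (by rw [C_1, one_mul]) hd
    -- The second generator is the transport of the first by a diagonal symmetry of order seven of
    -- the quartic.
    · have e : Matrix.vecMul ![1, cos7, -1 - cos7]
          (Matrix.diagonal ![zeta 7, zeta 7 ^ 4, zeta 7 ^ 2]) =
          ![zeta 7, zeta 7 ^ 4 * cos7, zeta 7 ^ 2 * (-1 - cos7)] := by
        ext i
        fin_cases i <;> simp [Matrix.vecMul_diagonal] <;> ring
      rw [← e]
      rw [← e] at h1
      refine adapted_kleinFrame.subst_reflection_mul_left isMetric_one
        (x := Matrix.diagonal ![zeta 7 ^ 6, zeta 7 ^ 3, zeta 7 ^ 5]) ?_ ?_ h1 ?_ hd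
      · rw [Matrix.mul_one, Matrix.diagonal_conjTranspose, Matrix.diagonal_mul_diagonal,
          ← Matrix.diagonal_one]
        congr 1
        ext i
        have hu : ∀ j : ℕ, star (zeta 7 ^ j) * zeta 7 ^ j = 1 := fun j => by
          rw [star_pow, ← mul_pow, star_zeta, inv_mul_cancel₀ (zeta_ne_zero 7), one_pow]
        fin_cases i
        · exact hu 6
        · exact hu 3
        · exact hu 5
      · rw [Matrix.diagonal_mul_diagonal, ← Matrix.diagonal_one]
        congr 1
        ext i
        fin_cases i <;> simp [← pow_succ, ← pow_add, zeta_seven_pows]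
      · apply MvPolynomial.funext
        intro p
        rw [eval_subst_three]
        simp [U24₁, Matrix.diagonal]
        ring_nf
        simp only [zeta_seven_pows]
        ring
    -- The third generator is the transport of the first by the cyclic permutation of the
    -- coordinates.
    · have e : Matrix.vecMul ![1, cos7, -1 - cos7] !![0, 0, 1; 1, 0, 0; 0, 1, 0] =
          ![cos7, -1 - cos7, 1] := by
        ext i
        fin_cases i <;> simp [Matrix.vecMul, dotProduct, Fin.sum_univ_three]
      rw [← e]
      rw [← e] at h2
      refine adapted_kleinFrame.subst_reflection_mul_left isMetric_one
        (x := !![0, 1, 0; 0, 0, 1; 1, 0, 0]) ?_ ?_ h2 ?_ hd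
      · ext i j
        fin_cases i <;> fin_cases j <;> simp [Matrix.mul_apply, Fin.sum_univ_three]
      · ext i j
        fin_cases i <;> fin_cases j <;> simp [Matrix.mul_apply, Fin.sum_univ_three]
      · apply MvPolynomial.funext
        intro p
        rw [eval_subst_three]
        simp [U24₁]
        ring
  · have e := (((isHomogeneous_U24₁.pow 2).C_mul 34).mul isHomogeneous_U24₂)
    rw [map_ofNat] at e
    exact forall_fin_three isHomogeneous_U24₁ isHomogeneous_U24₂ (isHomogeneous_U24₃.add e)
  · decide
  · apply det_jacOf_ne_zero_of_subst (g := kleinFrame)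
    have hn := kleinNorm_ne_zero
    refine det_jacOf_ne_zero_three_of_smul _ (forall_fin_three ?_ ?_ ?_) kleinFrame_subst
      (normalForm_klein klein7_sq) ![0, 1, 2] rfl ?_
    · exact div_ne_zero (neg_ne_zero.mpr (pow_ne_zero 2 hn)) (by norm_num)
    · exact div_ne_zero (neg_ne_zero.mpr (pow_ne_zero 3 hn)) (by norm_num)
    · exact pow_ne_zero 7 hn
    · have h := klein_lin_ne_zero klein7_sq
      have h2 := klein7_sq
      have h3 : klein7 ^ 3 = -klein7 + 2 := by linear_combination (klein7 - 1) * h2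
      convert h using 1
      simp [cofactor, Fin.sum_univ_three, Derivation.leibniz, Derivation.leibniz_pow]
      ring_nf
      simp only [h2, h3]
      ring

section Reduction

variable {k : Type} [Field k] {p : ℕ} {φ : integralClosure ℤ ℂ →+* k} [CharP k p]

lemma red_cos7 {x : ℤ} (h : Red φ (zeta 7) x) : Red φ cos7 (x + x ^ 6) :=
  (h.add (h.pow 6)).of_eq cos7_eq

lemma genRed_klein₀ {x : ℤ} (h : Red φ (zeta 7) x) (z : ℕ)
    (hz : p ≠ 0 ∧ ¬ p ∣ 2 ∧ (p : ℤ) ∣ ((z : ℤ) + 1) ^ 2 - 1) :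
    GroupData.GenRed φ p 1 (![1, cos7, -1 - cos7], 2)
      ([residue p 1, residue p (x + x ^ 6), residue p (-1 - (x + x ^ 6))],
        [residue p 1, residue p (x + x ^ 6), residue p (-1 - (x + x ^ 6))], z) := by
  have hc := red_cos7 h
  have h0 := Red.one.neg.sub hc
  exact genRed_three 1 1 (Red.one.of_eq (by simp)) (hc.of_eq (by simp)) (h0.of_eq (by simp))
    (Red.one.of_eq (by simp [sharp_one]))
    (hc.of_eq (by rw [one_mul, sharp_one]; exact star_cos7))
    (h0.of_eq (by rw [one_mul, sharp_one]; exact star_neg_one_sub_cos7)) z hz one_ne_zero one_ne_zero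

lemma genRed_klein₁ {x : ℤ} (h : Red φ (zeta 7) x) (z : ℕ)
    (hz : p ≠ 0 ∧ ¬ p ∣ 2 ∧ (p : ℤ) ∣ ((z : ℤ) + 1) ^ 2 - 1) :
    GroupData.GenRed φ p 1 (![zeta 7, zeta 7 ^ 4 * cos7, zeta 7 ^ 2 * (-1 - cos7)], 2)
      ([residue p x, residue p (x ^ 4 * (x + x ^ 6)), residue p (x ^ 2 * (-1 - (x + x ^ 6)))],
        [residue p (x ^ 6), residue p ((x ^ 6) ^ 4 * (x + x ^ 6)),
          residue p ((x ^ 6) ^ 2 * (-1 - (x + x ^ 6)))], z) := by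
  have hc := red_cos7 h
  have h0 := Red.one.neg.sub hc
  refine genRed_three 1 1 (h.of_eq (by simp)) (((h.pow 4).mul hc).of_eq (by simp))
    (((h.pow 2).mul h0).of_eq (by simp)) ((h.pow 6).of_eq ?_) ((((h.pow 6).pow 4).mul hc).of_eq ?_)
    ((((h.pow 6).pow 2).mul h0).of_eq ?_) z hz one_ne_zero one_ne_zero
  · rw [one_mul, sharp_one]
    exact star_zeta_seven
  · rw [one_mul, sharp_one, ← star_zeta_seven, ← star_pow]
    exact (star_mul' _ _).trans (congrArg _ star_cos7)
  · rw [one_mul, sharp_one, ← star_zeta_seven, ← star_pow]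
    exact (star_mul' _ _).trans (congrArg _ star_neg_one_sub_cos7)

lemma genRed_klein₂ {x : ℤ} (h : Red φ (zeta 7) x) (z : ℕ)
    (hz : p ≠ 0 ∧ ¬ p ∣ 2 ∧ (p : ℤ) ∣ ((z : ℤ) + 1) ^ 2 - 1) :
    GroupData.GenRed φ p 1 (![cos7, -1 - cos7, 1], 2)
      ([residue p (x + x ^ 6), residue p (-1 - (x + x ^ 6)), residue p 1],
        [residue p (x + x ^ 6), residue p (-1 - (x + x ^ 6)), residue p 1], z) := by
  have hc := red_cos7 h
  have h0 := Red.one.neg.sub hc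
  exact genRed_three 1 1 (hc.of_eq (by simp)) (h0.of_eq (by simp)) (Red.one.of_eq (by simp))
    (hc.of_eq (by rw [one_mul, sharp_one]; exact star_cos7))
    (h0.of_eq (by rw [one_mul, sharp_one]; exact star_neg_one_sub_cos7))
    (Red.one.of_eq (by simp [sharp_one])) z hz one_ne_zero one_ne_zero

end Reduction

lemma goodAt_G24 : (dataThree 1 [(![1, cos7, -1 - cos7], 2),
    (![zeta 7, zeta 7 ^ 4 * cos7, zeta 7 ^ 2 * (-1 - cos7)], 2), (![cos7, -1 - cos7, 1], 2)]
    ![4, 6, 14] ![U24₁, U24₂, U24₃ + 34 * U24₁ ^ 2 * U24₂] 14 [(2, 21)]).GoodAt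
      ![1, cos7, -1 - cos7] 1 ((2 : ℕ) / (14 : ℕ)) := by
  have h2 := klein7_sq
  have h3 : klein7 ^ 3 = -klein7 + 2 := by linear_combination (klein7 - 1) * h2
  refine adapted_kleinFrame.goodAt (localGood_three_of_smul basic_G24.two_le
    (fun l => isHomogeneous_subst _ (basic_G24.hom l)) _ kleinFrame_subst
    (normalForm_klein h2) ?_ ?_)
  all_goals
    apply MvPolynomial.funext
    intro p
    simp [cofactor, Fin.sum_univ_three, Derivation.leibniz, Derivation.leibniz_pow]
    ring_nf
    simp only [h2, h3]
    ring

lemma conclusion_G24 : (STGroup.data .G24).Conclusion := by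
  have : Fact (Nat.Prime 29) := ⟨by norm_num⟩
  have : Fact (Nat.Prime 7) := ⟨by norm_num⟩
  refine conclusion_three basic_G24 29 [(0, 0), (1, 1), (1, 2), (1, 0), (1, 1), (1, 2), (1, 0), (1, 1),
    (1, 0), (1, 2), (1, 0), (1, 1), (1, 0), (1, 1), (1, 0), (1, 1), (1, 0), (2, 2), (5, 2), (9, 2),
    (1, 0)] ?_ 0 0 (by decide +kernel) goodAt_G24 goodAt_G24
  intro k _ _ φ
  -- Since 29 is 1 modulo 7, seventh roots of unity exist modulo 29, and 7 is a primitive one; √-7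
  -- and the cosine reduce along with it.
  obtain ⟨j, hj, hj0, h⟩ := exists_red_primitiveRoot (φ := φ) (p := 29) (m := 7) (by decide +kernel)
    (isPrimitiveRoot_zeta (by norm_num)) (a := 7) (by decide +kernel) (by decide +kernel)
  interval_cases j
  · exact absurd rfl hj0
  all_goals
    exact ⟨_, .cons (genRed_klein₀ h 27 (by decide +kernel)) (.cons (genRed_klein₁ h 27 (by decide +kernel))
      (.cons (genRed_klein₂ h 27 (by decide +kernel)) .nil)), by decide +kernel⟩

end Klein

end RankThree

section RankThree

/-! ### Hessian covariants along a mirror of a reflection of order two -/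

/-- `f = x c + …`, where `x` is the first variable. -/
def OddForm (f c : MvPolynomial (Fin 3) ℂ) : Prop := ∃ e, f = X 0 * (c + X 0 * e)

section CovariantForms

variable {f k A B b c q : MvPolynomial (Fin 3) ℂ}

lemma OddForm.mul {f' c' : MvPolynomial (Fin 3) ℂ} (h : OddForm f c) (h' : OddForm f' c') :
    NormalForm 2 (f * f') 0 (c * c') := by
  obtain ⟨e, rfl⟩ := h
  obtain ⟨e', rfl⟩ := h'
  exact ⟨map_zero _, c * e' + e * c' + X 0 * e * e', by ring⟩

lemma NormalForm.pderiv {κ : ℕ} (h : NormalForm κ f A c) {j : Fin 3} (hj : j ≠ 0) :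
    NormalForm κ (pderiv j f) (pderiv j A) (pderiv j c) := by
  obtain ⟨hA, e, rfl⟩ := h
  refine ⟨by rw [pderiv_comm', hA, map_zero], MvPolynomial.pderiv j e, ?_⟩
  have hX : MvPolynomial.pderiv j (X 0 : MvPolynomial (Fin 3) ℂ) = 0 := pderiv_X_of_ne hj.symm
  rw [map_add, Derivation.leibniz, Derivation.leibniz_pow, map_add, Derivation.leibniz, hX]
  simp only [smul_eq_mul, smul_zero, mul_zero, add_zero]

lemma NormalForm.pderiv_zero (h : NormalForm 2 f A c) :
    OddForm (MvPolynomial.pderiv 0 f) (2 * c) := by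
  obtain ⟨hA, e, rfl⟩ := h
  refine ⟨MvPolynomial.pderiv 0 c + 3 * e + X 0 * MvPolynomial.pderiv 0 e, ?_⟩
  rw [map_add, hA, Derivation.leibniz, Derivation.leibniz_pow, map_add, Derivation.leibniz,
    pderiv_X_self]
  simp only [smul_eq_mul, nsmul_eq_mul]
  push_cast
  ring

/-- Two normal derivatives consume two orders, so the fourth order term of `f` is supplied
separately as `q`. The mixed derivatives are odd to lowest order and occur only in pairs, which is
why no more of the expansion is needed. -/
lemma normalForm_det_hessian (h : NormalForm 2 f A c) (hq : NormalForm 2 (pderiv 0 (pderiv 0 f)) (2 * c) q) :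
    NormalForm 2 (hessian f).det
      (2 * c * (pderiv 1 (pderiv 1 A) * pderiv 2 (pderiv 2 A) - pderiv 1 (pderiv 2 A) ^ 2))
      (q * (pderiv 1 (pderiv 1 A) * pderiv 2 (pderiv 2 A) - pderiv 1 (pderiv 2 A) ^ 2) +
        2 * c * (pderiv 1 (pderiv 1 A) * pderiv 2 (pderiv 2 c) +
          pderiv 1 (pderiv 1 c) * pderiv 2 (pderiv 2 A) -
          2 * pderiv 1 (pderiv 2 A) * pderiv 1 (pderiv 2 c)) +
        8 * pderiv 1 c * pderiv 2 c * pderiv 1 (pderiv 2 A) -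
        4 * pderiv 1 (pderiv 1 A) * pderiv 2 c ^ 2 - 4 * pderiv 2 (pderiv 2 A) * pderiv 1 c ^ 2) := by
  have d1 : (1 : Fin 3) ≠ 0 := by decide
  have d2 : (2 : Fin 3) ≠ 0 := by decide
  have h1 := h.pderiv d1
  have h2 := h.pderiv d2
  have h11 := h1.pderiv d1
  have h12 := h2.pderiv d1
  have h22 := h2.pderiv d2
  have o1 := h1.pderiv_zero
  have o2 := h2.pderiv_zero
  have t : (2 : ℕ) ≠ 0 := two_ne_zero
  refine (((((hq.mul t (h11.mul t h22)).add (((o1.mul o2).mul t h12).C_mul 2)).sub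
    (hq.mul t (h12.mul t h12))).sub (h11.mul t (o2.mul o2))).sub (h22.mul t (o1.mul o1))).congr ?_ ?_ ?_
  · rw [det_hessian, map_ofNat]
    ring
  · ring
  · rw [map_ofNat]
    ring

lemma normalForm_bord (h : NormalForm 2 f A c) (hq : NormalForm 2 (pderiv 0 (pderiv 0 f)) (2 * c) q)
    (hk : NormalForm 2 k B b) : NormalForm 2 (bord f k)
      (-(2 * c * (pderiv 1 B ^ 2 * pderiv 2 (pderiv 2 A) + pderiv 2 B ^ 2 * pderiv 1 (pderiv 1 A) -
        2 * pderiv 1 B * pderiv 2 B * pderiv 1 (pderiv 2 A))))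
      (-(4 * b ^ 2 * (pderiv 1 (pderiv 1 A) * pderiv 2 (pderiv 2 A) - pderiv 1 (pderiv 2 A) ^ 2) +
        4 * c * pderiv 1 B * pderiv 1 b * pderiv 2 (pderiv 2 A) +
        pderiv 1 B ^ 2 * (q * pderiv 2 (pderiv 2 A) + 2 * c * pderiv 2 (pderiv 2 c) -
          4 * pderiv 2 c ^ 2) +
        4 * c * pderiv 2 B * pderiv 2 b * pderiv 1 (pderiv 1 A) +
        pderiv 2 B ^ 2 * (q * pderiv 1 (pderiv 1 A) + 2 * c * pderiv 1 (pderiv 1 c) -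
          4 * pderiv 1 c ^ 2) +
        8 * b * pderiv 1 B * (pderiv 2 c * pderiv 1 (pderiv 2 A) - pderiv 1 c * pderiv 2 (pderiv 2 A)) +
        8 * b * pderiv 2 B * (pderiv 1 c * pderiv 1 (pderiv 2 A) - pderiv 2 c * pderiv 1 (pderiv 1 A)) -
        4 * c * (pderiv 1 B * pderiv 2 b + pderiv 1 b * pderiv 2 B) * pderiv 1 (pderiv 2 A) +
        2 * pderiv 1 B * pderiv 2 B * (4 * pderiv 1 c * pderiv 2 c - q * pderiv 1 (pderiv 2 A) -
          2 * c * pderiv 1 (pderiv 2 c)))) := by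
  have d1 : (1 : Fin 3) ≠ 0 := by decide
  have d2 : (2 : Fin 3) ≠ 0 := by decide
  have h1 := h.pderiv d1
  have h2 := h.pderiv d2
  have h11 := h1.pderiv d1
  have h12 := h2.pderiv d1
  have h22 := h2.pderiv d2
  have o1 := h1.pderiv_zero
  have o2 := h2.pderiv_zero
  have k0 := hk.pderiv_zero
  have k1 := hk.pderiv d1
  have k2 := hk.pderiv d2
  have t : (2 : ℕ) ≠ 0 := two_ne_zero
  have m0 := (h11.mul t h22).sub (h12.mul t h12)
  have m1 := (hq.mul t h22).sub (o2.mul o2)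
  have m2 := (hq.mul t h11).sub (o1.mul o1)
  have m12 := (o1.mul o2).sub (hq.mul t h12)
  have m01 := ((k0.mul o2).mul t h12).sub ((k0.mul o1).mul t h22)
  have m02 := ((k0.mul o1).mul t h12).sub ((k0.mul o2).mul t h11)
  refine ((((k0.mul k0).mul t m0).add ((k1.mul t k1).mul t m1)).add ((k2.mul t k2).mul t m2)
    |>.add ((k1.mul t m01).C_mul 2) |>.add ((k2.mul t m02).C_mul 2)
    |>.add (((k1.mul t k2).mul t m12).C_mul 2)).neg.congr ?_ ?_ ?_
  · rw [bord_eq, map_ofNat]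
    ring
  · rw [map_ofNat]
    ring
  · rw [map_ofNat]
    ring

end CovariantForms

lemma isHomogeneous_det_hessian {f : MvPolynomial (Fin 3) ℂ} (hf : f.IsHomogeneous 6) :
    (hessian f).det.IsHomogeneous 12 := by
  have h : ∀ i j, (pderiv i (pderiv j f)).IsHomogeneous 4 := fun i j => hf.pderiv.pderiv
  have two : (2 : MvPolynomial (Fin 3) ℂ).IsHomogeneous 0 := by
    rw [← map_ofNat C 2]
    exact isHomogeneous_C _ _
  rw [det_hessian]
  exact ((((((h 0 0).mul (h 1 1)).mul (h 2 2)).add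
    (((two.mul (h 0 1)).mul (h 0 2)).mul (h 1 2))).sub ((h 0 0).mul ((h 1 2).pow 2))).sub
    ((h 1 1).mul ((h 0 2).pow 2))).sub ((h 2 2).mul ((h 0 1).pow 2))

lemma isHomogeneous_bord {f k : MvPolynomial (Fin 3) ℂ} (hf : f.IsHomogeneous 6)
    (hk : k.IsHomogeneous 12) : (bord f k).IsHomogeneous 30 := by
  have h : ∀ i j, (pderiv i (pderiv j f)).IsHomogeneous 4 := fun i j => hf.pderiv.pderiv
  have hm : ∀ a b c d e e', (pderiv a (pderiv b f) * pderiv c (pderiv d f) -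
      pderiv e (pderiv e' f) ^ 2).IsHomogeneous 8 := fun a b c d e e' =>
    ((h a b).mul (h c d)).sub ((h e e').pow 2)
  have hm' : ∀ a b c d e e' i i', (pderiv a (pderiv b f) * pderiv c (pderiv d f) -
      pderiv e (pderiv e' f) * pderiv i (pderiv i' f)).IsHomogeneous 8 := fun a b c d e e' i i' =>
    ((h a b).mul (h c d)).sub ((h e e').mul (h i i'))
  have hk' : ∀ i, (pderiv i k).IsHomogeneous 11 := fun i => hk.pderiv
  have two : (2 : MvPolynomial (Fin 3) ℂ).IsHomogeneous 0 := by
    rw [← map_ofNat C 2]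
    exact isHomogeneous_C _ _
  rw [bord_eq]
  exact ((((((((hk' 0).pow 2).mul (hm 1 1 2 2 1 2)).add (((hk' 1).pow 2).mul (hm 0 0 2 2 0 2))).add
    (((hk' 2).pow 2).mul (hm 0 0 1 1 0 1))).add
    (((two.mul (hk' 0)).mul (hk' 1)).mul (hm' 0 2 1 2 0 1 2 2))).add
    (((two.mul (hk' 0)).mul (hk' 2)).mul (hm' 0 1 1 2 0 2 1 1))).add
    (((two.mul (hk' 1)).mul (hk' 2)).mul (hm' 0 1 0 2 0 0 1 2))).neg

end RankThree

section RankThree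

/-! ### Binary forms in the last two variables -/

section BinaryForms

/-- The binary form `∑ aᵢ yⁿ⁻ⁱ zⁱ` in the last two variables with coefficients `[a₀, …, aₙ]`. -/
def binForm : List ℂ → MvPolynomial (Fin 3) ℂ
  | [] => 0
  | a :: l => C a * X 1 ^ l.length + X 2 * binForm l

/-- The value of a binary form. -/
def binEval (y z : ℂ) : List ℂ → ℂ
  | [] => 0
  | a :: l => a * y ^ l.length + z * binEval y z l

/-- The coefficients of the derivative with respect to the first variable of a binary form. -/
def binDeriv₁ : List ℂ → List ℂ
  | [] => []
  | [_] => []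
  | a :: b :: l => ((b :: l).length * a) :: binDeriv₁ (b :: l)

/-- The coefficients multiplied by `k, k + 1, …`. -/
def binScale : ℂ → List ℂ → List ℂ
  | _, [] => []
  | k, a :: l => (k * a) :: binScale (k + 1) l

/-- The coefficients of the derivative with respect to the second variable of a binary form. -/
def binDeriv₂ (l : List ℂ) : List ℂ := binScale 1 l.tail

lemma eval_binForm (p : Fin 3 → ℂ) (l : List ℂ) : eval p (binForm l) = binEval (p 1) (p 2) l := by
  induction l with
  | nil => simp [binForm, binEval]
  | cons a l ih => simp [binForm, binEval, ih]

lemma pderiv_zero_binForm (l : List ℂ) : pderiv 0 (binForm l) = 0 := by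
  induction l with
  | nil => simp [binForm]
  | cons a l ih => simp [binForm, Derivation.leibniz_pow, Derivation.leibniz, ih]

lemma length_binDeriv₁ (a : ℂ) (l : List ℂ) : (binDeriv₁ (a :: l)).length = l.length := by
  induction l generalizing a with
  | nil => rfl
  | cons b l ih => rw [binDeriv₁, List.length_cons, ih, List.length_cons]

lemma pderiv_one_binForm (l : List ℂ) : pderiv 1 (binForm l) = binForm (binDeriv₁ l) := by
  induction l with
  | nil => simp [binForm, binDeriv₁]
  | cons a l ih =>
    cases l with
    | nil => simp [binForm, binDeriv₁]
    | cons b l =>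
      have e : binForm (((b :: l).length * a) :: binDeriv₁ (b :: l)) = C ((b :: l).length * a) *
        X 1 ^ (binDeriv₁ (b :: l)).length + X 2 * binForm (binDeriv₁ (b :: l)) := rfl
      rw [binDeriv₁, e, length_binDeriv₁, ← ih, binForm]
      simp [Derivation.leibniz_pow, Derivation.leibniz]
      ring

lemma length_binScale (k : ℂ) (l : List ℂ) : (binScale k l).length = l.length := by
  induction l generalizing k with
  | nil => rfl
  | cons a l ih => rw [binScale, List.length_cons, ih, List.length_cons]

/-- The operator k + z∂_z multiplies zⁱ by k + i. With k = 1 it gives the derivative of z times the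
form, as required for the tail of a list. -/
lemma binForm_binScale (k : ℂ) (l : List ℂ) :
    C k * binForm l + X 2 * pderiv 2 (binForm l) = binForm (binScale k l) := by
  induction l generalizing k with
  | nil => simp [binForm, binScale]
  | cons a l ih =>
    rw [binScale, binForm, binForm, ← ih, length_binScale]
    simp [Derivation.leibniz_pow, Derivation.leibniz]
    ring

lemma pderiv_two_binForm (l : List ℂ) : pderiv 2 (binForm l) = binForm (binDeriv₂ l) := by
  cases l with
  | nil => simp [binForm, binDeriv₂, binScale]
  | cons a l =>
    rw [binDeriv₂, List.tail_cons, ← binForm_binScale, binForm]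
    simp [Derivation.leibniz_pow, Derivation.leibniz]
    ring

end BinaryForms

/-! ### The Valentiner group -/

section Valentiner

lemma sharp_diagonal (d : Fin 3 → ℂ) (α : Fin 3 → ℂ) (hd : ∀ i, d i ≠ 0) (i : Fin 3) :
    sharp (Matrix.diagonal d) α i = (d i)⁻¹ * star (α i) := by
  have h : (Matrix.diagonal d)⁻¹ = Matrix.diagonal fun i => (d i)⁻¹ := by
    apply Matrix.inv_eq_right_inv
    rw [Matrix.diagonal_mul_diagonal, ← Matrix.diagonal_one]
    congr 1
    ext i
    exact mul_inv_cancel₀ (hd i)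
  simp [sharp, h, Matrix.diagonal_apply]

lemma isMetric_valentiner : IsMetric (Matrix.diagonal ![1, 1, (3 : ℂ)]) := by
  refine ⟨![1, 1, 3], forall_fin_three (by simp) (by simp) (by simp), ?_⟩
  congr 1
  ext i
  fin_cases i <;> simp

lemma sharp_valentiner (α : Fin 3 → ℂ) : sharp (Matrix.diagonal ![1, 1, (3 : ℂ)]) α 0 = star (α 0) ∧
    sharp (Matrix.diagonal ![1, 1, (3 : ℂ)]) α 1 = star (α 1) ∧
    sharp (Matrix.diagonal ![1, 1, (3 : ℂ)]) α 2 = star (α 2) / 3 := by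
  have h := sharp_diagonal ![1, 1, (3 : ℂ)] α (forall_fin_three (by simp) (by simp) (by simp))
  refine ⟨by simp [h], by simp [h], ?_⟩
  rw [h]
  simp only [Matrix.cons_val]
  ring

/-- The frame adapted to the mirror of the first generator. -/
def wimanFrame : Matrix (Fin 3) (Fin 3) ℂ :=
  !![zeta 5 ^ 3, zeta 5 ^ 3, 0; -zeta 5 ^ 2, zeta 5 ^ 2, 0; 0, 0, 1]

/-- Wiman's sextic in the frame adapted to the mirror of the first generator. -/
def wiman6 : MvPolynomial (Fin 3) ℂ :=
  10 * (X 1 ^ 2 - X 0 ^ 2) ^ 3 + 18 * X 2 * (X 1 ^ 5 + 10 * X 0 ^ 2 * X 1 ^ 3 + 5 * X 0 ^ 4 * X 1) -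
    45 * (X 1 ^ 2 - X 0 ^ 2) ^ 2 * X 2 ^ 2 - 135 * (X 1 ^ 2 - X 0 ^ 2) * X 2 ^ 4 + 27 * X 2 ^ 6

/-- The second invariant in the frame adapted to the mirror of the first generator. -/
def wiman12 : MvPolynomial (Fin 3) ℂ := C (1 / 81000) * (hessian wiman6).det

/-- The third invariant in the frame adapted to the mirror of the first generator. -/
def wiman30 : MvPolynomial (Fin 3) ℂ := C (1 / 97200) * bord wiman6 wiman12

lemma star_zeta_five : star (zeta 5) = zeta 5 ^ 4 := by
  rw [star_zeta]
  exact inv_eq_of_mul_eq_one_right (by rw [← pow_succ', zeta_pow (by norm_num)])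

lemma det_wimanFrame : wimanFrame.det = 2 := by
  rw [wimanFrame, Matrix.det_fin_three]
  simp
  linear_combination 2 * zeta_pow (m := 5) (by norm_num)

lemma adapted_wimanFrame :
    Adapted (Matrix.diagonal ![1, 1, 3]) ![1, -zeta 5, 0] wimanFrame := by
  have h5 := zeta_pow (m := 5) (by norm_num)
  refine ⟨by rw [det_wimanFrame]; norm_num, ⟨2 * zeta 5 ^ 3, ?_⟩, zeta 5 ^ 3, ?_⟩
  · ext i
    fin_cases i <;> simp [wimanFrame, Matrix.vecMul, dotProduct, Fin.sum_univ_three] <;> ring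
  · obtain ⟨e0, e1, e2⟩ := sharp_valentiner ![1, -zeta 5, 0]
    refine forall_fin_three ?_ ?_ ?_
    · rw [e0]
      simp [wimanFrame]
    · rw [e1, Matrix.cons_val_one, Matrix.cons_val_zero, star_neg, star_zeta_five]
      simp [wimanFrame]
      linear_combination -zeta 5 ^ 2 * h5
    · rw [e2]
      simp [wimanFrame]

lemma wimanFrame_subst₁ : subst wimanFrame U27₁ = wiman6 := by
  have h5 := zeta_pow (m := 5) (by norm_num)
  have h10 : zeta 5 ^ 10 = 1 := by linear_combination (zeta 5 ^ 5 + 1) * h5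
  have h15 : zeta 5 ^ 15 = 1 := by linear_combination (zeta 5 ^ 10 + zeta 5 ^ 5 + 1) * h5
  apply MvPolynomial.funext
  intro p
  rw [eval_subst_three]
  simp [wimanFrame, U27₁, wiman6]
  ring_nf
  simp only [h5, h10, h15]
  ring

/-- The frame has determinant 2, so covariants acquire a factor 4; this turns the constants 20250
and 24300 into 81000 and 97200. -/
lemma C_four_mul_cancel {f k : MvPolynomial (Fin 3) ℂ} {a : ℂ} (h : k = C ((2 : ℂ) ^ 2) * f) :
    C a * f = C (a / 4) * k := by
  rw [h, ← mul_assoc, ← C_mul]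
  refine congrArg (fun c => C c * f) ?_
  ring

lemma wimanFrame_subst₂ : subst wimanFrame U27₂ = wiman12 := by
  have e := det_hessian_subst wimanFrame U27₁
  rw [wimanFrame_subst₁, det_wimanFrame] at e
  rw [U27₂, map_mul, subst_C, C_four_mul_cancel e, wiman12]
  norm_num

lemma wimanFrame_subst₃ : subst wimanFrame U27₃ = wiman30 := by
  have e := bord_subst wimanFrame U27₁ U27₂
  rw [wimanFrame_subst₁, wimanFrame_subst₂, det_wimanFrame] at e
  rw [U27₃, map_mul, subst_C, C_four_mul_cancel e, wiman30]
  norm_num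

/-- The coefficients of the restriction of the invariant of degree 6 to the mirror. -/
def wimanA6 : List ℂ :=
  [10, 18, -45, 0, -135, 0, 27]

/-- The coefficients of the second order term of the invariant of degree 6 along the mirror. -/
def wimanC6 : List ℂ :=
  [-30, 180, 90, 0, 135]

/-- The coefficients of the restriction of the invariant of degree 12 to the mirror. -/
def wimanA12 : List ℂ :=
  [26, -180, 486, -2160, -3375, 648, 1080, -5832, -1215, 0, -4374, 0, -729]

/-- The coefficients of the second order term of the invariant of degree 12 along the mirror. -/
def wimanC12 : List ℂ :=
  [-756, -1260, -1530, -17280, 13500, 5832, -3240, -58320, 2430, 0, 4374]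

/-- The coefficients of the restriction of the invariant of degree 30 to the mirror. -/
def wimanA30 : List ℂ :=
  [6832, -128208, 1366440, -6618240, 6233040, 70112952, -372736620, 98742240, -146882160,
    -1586090160, 2286873000, 1696120560, -5321947860, -5375820960, -6357565260, -6262868160,
    -15582899880, -22649621760, -7198466760, -14516606160, -21905998020, -1806899400, -7702351560,
    -8162933760, 1296716040, -2844272232, 121168548, 0, 95659380, 0, 57395628]

/-- The coefficients of the second order term of the invariant of degree 30 along the mirror. -/
def wimanC30 : List ℂ :=
  [1943920, -3453984, 44091840, 107436240, 810559980, 48891600, 2150758440, 3373248240,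
    19182943260, -3762184320, 10743759000, -19139224320, 135672046740, -92978817840,
    -316527046920, 6411409200, 298270014660, -135897730560, -94649248440, -101616243120,
    255469593600, -14455195200, 30809406240, -73466403840, -3890148120, -28442722320, -242337096,
    0, -95659380]

/-- The coefficients of the restriction of the flat coordinate of degree 12 to the mirror. -/
def flatA12 : List ℂ :=
  [134 / 9, -220, 550, -1980, -3300, 1188, -330, -5940, -2970, 0, -3564, 0, -810]

/-- The coefficients of the second order term of the flat coordinate of degree 12 along the mirror. -/
def flatC12 : List ℂ :=
  [-2068 / 3, -1540, -2750, -15840, 13200, 10692, 990, -59400, 5940, 0, 3564]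

/-- The coefficients of the restriction of the flat coordinate of degree 30 to the mirror. -/
def flatA30 : List ℂ :=
  [4744756 / 243, -4683500 / 27, 7950350 / 27, -12992000 / 3, -23091250 / 9, 20685700,
    -1947744400 / 9, 20102800, -343747150, -868738500, 783770820, 1936985400, -4939629450,
    -4033467900, 39933000, 1092566880, -13734955350, -16959310200, 4849862850, -2811753000,
    -8527010940, -4071756600, -1420675200, -6393038400, 443961000, -3228484392, 399564900, 0,
    171242100, 0, 27162540]

/-- The coefficients of the second order term of the flat coordinate of degree 30 along the mirror. -/
def flatC30 : List ℂ :=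
  [113702620 / 81, -225533000 / 27, 875275100 / 27, 195692000 / 3, 7493998750 / 9, -383670000,
    4557187600 / 3, 3966422800, 21181436150, 1551123000, 13571077800, -26746183800, 117463585050,
    -64969581600, -355488264000, 24743426400, 139430884950, -101755861200, -11340737100,
    -19682271000, 156511051200, -32574052800, 5682700800, -57537345600, -1331883000, -32284843920,
    -799129800, 0, -171242100]

lemma normalForm_wiman6 : NormalForm 2 wiman6 (binForm wimanA6) (binForm wimanC6) := by
  refine ⟨pderiv_zero_binForm _,
    X 0 * (30 * X 1 ^ 2 + 90 * X 1 * X 2 - 45 * X 2 ^ 2) - 10 * X 0 ^ 3, ?_⟩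
  apply MvPolynomial.funext
  intro p
  simp [wiman6, eval_binForm, binEval, wimanA6, wimanC6]
  ring

/-- The list is 12 times the coefficient 30 y² + 90 yz - 45 z² of the fourth power of the normal
coordinate. -/
lemma normalForm_pderiv_wiman6 : NormalForm 2 (pderiv 0 (pderiv 0 wiman6)) (2 * binForm wimanC6)
    (binForm [360, 1080, -540]) := by
  refine ⟨?_, -300 * X 0, ?_⟩
  · rw [← map_ofNat C 2, pderiv_C_mul, pderiv_zero_binForm, mul_zero]
  apply MvPolynomial.funext
  intro p
  simp [wiman6, Derivation.leibniz, Derivation.leibniz_pow, eval_binForm, binEval, wimanC6]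
  ring

lemma normalForm_wiman12 : NormalForm 2 wiman12 (binForm wimanA12) (binForm wimanC12) := by
  refine ((normalForm_det_hessian normalForm_wiman6 normalForm_pderiv_wiman6).C_mul
    (1 / 81000)).congr rfl ?_ ?_ <;>
  · apply MvPolynomial.funext
    intro p
    simp [pderiv_one_binForm, pderiv_two_binForm, eval_binForm, binEval, binDeriv₁, binDeriv₂,
      binScale, wimanA6, wimanC6, wimanA12, wimanC12]
    ring

lemma normalForm_wiman30 : NormalForm 2 wiman30 (binForm wimanA30) (binForm wimanC30) := by
  refine ((normalForm_bord normalForm_wiman6 normalForm_pderiv_wiman6 normalForm_wiman12).C_mul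
    (1 / 97200)).congr rfl ?_ ?_ <;>
  · apply MvPolynomial.funext
    intro p
    simp [pderiv_one_binForm, pderiv_two_binForm, eval_binForm, binEval, binDeriv₁, binDeriv₂,
      binScale, wimanA6, wimanC6, wimanA12, wimanC12, wimanA30, wimanC30]
    ring

lemma normalForm_G27 : ∀ l, NormalForm 2 (![wiman6, wiman12 - C (1 / 9) * wiman6 ^ 2,
      wiman30 - C (17 / 18) * wiman12 ^ 2 * wiman6 + C (29 / 27) * wiman12 * wiman6 ^ 3 -
        C (43 / 486) * wiman6 ^ 5] l)
    (![binForm wimanA6, binForm flatA12, binForm flatA30] l)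
    (![binForm wimanC6, binForm flatC12, binForm flatC30] l) := by
  have t : (2 : ℕ) ≠ 0 := two_ne_zero
  have h1 := normalForm_wiman6
  have h2 := normalForm_wiman12
  refine forall_fin_three h1 ?_ ?_
  · refine (h2.sub ((h1.mul t h1).C_mul (1 / 9))).congr ?_ ?_ ?_
    · simp only [Matrix.cons_val]
      ring
    all_goals
      apply MvPolynomial.funext
      intro p
      simp [eval_binForm, binEval, wimanA6, wimanC6, wimanA12, wimanC12, flatA12, flatC12]
      ring
  · refine (((normalForm_wiman30.sub (((h2.mul t h2).mul t h1).C_mul (17 / 18))).add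
      ((h2.mul t (h1.mul t (h1.mul t h1))).C_mul (29 / 27))).sub
      (((h1.mul t h1).mul t (h1.mul t (h1.mul t h1))).C_mul (43 / 486))).congr ?_ ?_ ?_
    · simp only [Matrix.cons_val]
      ring
    all_goals
      apply MvPolynomial.funext
      intro p
      simp [eval_binForm, binEval, wimanA6, wimanC6, wimanA12, wimanC12, wimanA30, wimanC30,
        flatA30, flatC30]
      ring

end Valentiner

end RankThree

/-! ### The group G27. -/

section RankThree

section Valentiner

lemma wimanFrame_subst : ∀ l, subst wimanFrame (![U27₁, U27₂ - C (1 / 9) * U27₁ ^ 2,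
      U27₃ - C (17 / 18) * U27₂ ^ 2 * U27₁ + C (29 / 27) * U27₂ * U27₁ ^ 3 - C (43 / 486) * U27₁ ^ 5] l) =
    ![wiman6, wiman12 - C (1 / 9) * wiman6 ^ 2,
      wiman30 - C (17 / 18) * wiman12 ^ 2 * wiman6 + C (29 / 27) * wiman12 * wiman6 ^ 3 -
        C (43 / 486) * wiman6 ^ 5] l :=
  forall_fin_three wimanFrame_subst₁ (by simp [wimanFrame_subst₁, wimanFrame_subst₂])
    (by simp [wimanFrame_subst₁, wimanFrame_subst₂, wimanFrame_subst₃])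

/-- A frame adapted to the mirror `[1, 1, (√5 - 1) v]`, where `v² = 3 (v - 1) / 2`. -/
def valentinerFrame (v : ℂ) : Matrix (Fin 3) (Fin 3) ℂ :=
  !![3 * ((r5 + 1) / 4), 1, v; 3 * ((r5 + 1) / 4), -1, v; 3 / 2 - v, 0, -2 * ((r5 + 1) / 4)]

/-- The sextic is even in the normal coordinate, as appears once all powers of s = (√5 + 1)/4 and of
`v` are reduced by their quadratic equations. Both conjugate roots `v` are covered, hence both
remaining generators. -/
lemma subst_diagRefl_valentinerFrame {v : ℂ} (hv : v ^ 2 = 3 / 2 * v - 3 / 2) :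
    subst (diagRefl 0 (zeta 2)) (subst (valentinerFrame v) U27₁) = subst (valentinerFrame v) U27₁ := by
  have hs : ((r5 + 1) / 4) ^ 2 = (r5 + 1) / 4 / 2 + 1 / 4 := by
    linear_combination (1 / 16) * r5_sq
  apply MvPolynomial.funext
  intro p
  rw [eval_subst_diagRefl_three, zeta_two, eval_subst_three, eval_subst_three]
  simp only [valentinerFrame, U27₁, map_add, map_sub, map_mul, map_pow, eval_X, map_ofNat,
    Matrix.of_apply, Matrix.cons_val]
  generalize (r5 + 1) / 4 = s at hs ⊢
  have s3 : s ^ 3 = s / 2 + 1 / 8 := by linear_combination (s + 1 / 2) * hs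
  have s4 : s ^ 4 = 3 / 8 * s + 1 / 8 := by linear_combination s * s3 + (1 / 2) * hs
  have s5 : s ^ 5 = 5 / 16 * s + 3 / 32 := by linear_combination s * s4 + (3 / 8) * hs
  have s6 : s ^ 6 = s / 4 + 5 / 64 := by linear_combination s * s5 + (5 / 16) * hs
  have v3 : v ^ 3 = 3 / 4 * v - 9 / 4 := by linear_combination (v + 3 / 2) * hv
  have v4 : v ^ 4 = -9 / 8 * v - 9 / 8 := by linear_combination v * v3 + (3 / 4) * hv
  have v5 : v ^ 5 = -45 / 16 * v + 27 / 16 := by linear_combination v * v4 - (9 / 8) * hv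
  have v6 : v ^ 6 = -81 / 32 * v + 135 / 32 := by linear_combination v * v5 - (45 / 16) * hv
  ring_nf
  simp only [hs, s3, s4, s5, s6, hv, v3, v4, v5, v6]
  ring

lemma adapted_valentinerFrame {v : ℂ} (hv : v ^ 2 = 3 / 2 * v - 3 / 2) (hs : star v = 3 / 2 - v) :
    Adapted (Matrix.diagonal ![1, 1, 3]) ![1, 1, (r5 - 1) * v] (valentinerFrame v) := by
  have h5 := r5_sq
  refine ⟨fun h => ?_, ⟨3 / 2 * (r5 + 1) + (r5 - 1) * (3 / 2), ?_⟩, 3 * ((r5 + 1) / 4), ?_⟩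
  · rw [valentinerFrame, Matrix.det_fin_three] at h
    simp at h
    have e : r5 + 5 = 0 := by linear_combination (2 / 3) * h + (4 / 3) * hv - (1 / 2) * h5
    have : (20 : ℂ) = 0 := by linear_combination -(r5 - 5) * e + h5
    norm_num at this
  · ext i
    fin_cases i
    · simp [valentinerFrame, Matrix.vecMul, dotProduct, Fin.sum_univ_three]
      linear_combination -(r5 - 1) * hv
    · simp [valentinerFrame, Matrix.vecMul, dotProduct, Fin.sum_univ_three]
    · simp [valentinerFrame, Matrix.vecMul, dotProduct, Fin.sum_univ_three]
      linear_combination (-v / 2) * h5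
  · obtain ⟨e0, e1, e2⟩ := sharp_valentiner ![1, 1, (r5 - 1) * v]
    refine forall_fin_three ?_ ?_ ?_
    · rw [e0]
      simp [valentinerFrame]
    · rw [e1]
      simp [valentinerFrame]
    · have e : star (![1, 1, (r5 - 1) * v] 2) = (r5 - 1) * (3 / 2 - v) := by
        rw [← hs]
        simp
      rw [e2, e]
      simp [valentinerFrame]
      linear_combination (-(3 / 2 - v) / 4) * h5

lemma w27_eq : w27 = (r5 - 1) * ((3 + Complex.I * r15) / 4) ∧
    star w27 = (r5 - 1) * ((3 - Complex.I * r15) / 4) := by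
  constructor
  · rw [w27]
    ring
  · have h15 : star r15 = r15 := Complex.conj_ofReal _
    rw [w27]
    simp only [star_div₀, star_mul', star_add, star_sub, star_r5, h15, star_one, star_ofNat,
      Complex.star_def, Complex.conj_I]
    ring

lemma r15_sq : r15 ^ 2 = 15 := by simpa [r15] using ofReal_sqrt_sq (x := 15) (by norm_num)

lemma subst_reflection_U27 {β : Fin 3 → ℂ} (hβ : β ≠ 0)
    (h : subst (reflection (Matrix.diagonal ![1, 1, 3]) β 2) U27₁ = U27₁) :
    ∀ l, subst (reflection (Matrix.diagonal ![1, 1, 3]) β 2) (![U27₁, U27₂ - C (1 / 9) * U27₁ ^ 2,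
      U27₃ - C (17 / 18) * U27₂ ^ 2 * U27₁ + C (29 / 27) * U27₂ * U27₁ ^ 3 - C (43 / 486) * U27₁ ^ 5] l) =
      ![U27₁, U27₂ - C (1 / 9) * U27₁ ^ 2, U27₃ - C (17 / 18) * U27₂ ^ 2 * U27₁ +
        C (29 / 27) * U27₂ * U27₁ ^ 3 - C (43 / 486) * U27₁ ^ 5] l := by
  have h2 : subst (reflection (Matrix.diagonal ![1, 1, 3]) β 2) U27₂ = U27₂ := by
    rw [U27₂, map_mul, subst_C, det_hessian_invariant isMetric_valentiner hβ h]
  have h3 : subst (reflection (Matrix.diagonal ![1, 1, 3]) β 2) U27₃ = U27₃ := by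
    rw [U27₃, map_mul, subst_C, bord_invariant isMetric_valentiner hβ h h2]
  exact forall_fin_three h (by simp [h, h2]) (by simp [h, h2, h3])

lemma isHomogeneous_U27₁ : U27₁.IsHomogeneous 6 := isHomogeneous_of_eval fun t p => by
  simp [U27₁]
  ring

lemma isHomogeneous_U27₂ : U27₂.IsHomogeneous 12 :=
  (isHomogeneous_det_hessian isHomogeneous_U27₁).C_mul _

lemma isHomogeneous_U27₃ : U27₃.IsHomogeneous 30 :=
  (isHomogeneous_bord isHomogeneous_U27₁ isHomogeneous_U27₂).C_mul _

lemma basic_G27 : (dataThree (Matrix.diagonal ![1, 1, 3]) [(![1, -zeta 5, 0], 2), (![1, 1, w27], 2),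
    (![1, 1, star w27], 2)] ![6, 12, 30] ![U27₁, U27₂ - C (1 / 9) * U27₁ ^ 2,
      U27₃ - C (17 / 18) * U27₂ ^ 2 * U27₁ + C (29 / 27) * U27₂ * U27₁ ^ 3 - C (43 / 486) * U27₁ ^ 5]
    30 [(2, 45)]).Basic := by
  apply basic_three isMetric_valentiner
  · simp only [List.forall_mem_cons]
    have h0 : ∀ a b : ℂ, ![1, a, b] ≠ 0 := fun a b => vec_ne_zero_three one_ne_zero
    have key : ∀ v : ℂ, v ^ 2 = 3 / 2 * v - 3 / 2 → star v = 3 / 2 - v →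
        subst (reflection (Matrix.diagonal ![1, 1, 3]) ![1, 1, (r5 - 1) * v] 2) U27₁ = U27₁ :=
      fun v hv hs => (adapted_valentinerFrame hv hs).subst_reflection_of_semi isMetric_valentiner
        (h0 _ _) (χ := 1) (by rw [C_1, one_mul]) (subst_diagRefl_valentinerFrame hv)
    have h15 : star r15 = r15 := Complex.conj_ofReal _
    refine ⟨⟨h0 _ _, by norm_num, subst_reflection_U27 (h0 _ _) ?_⟩,
      ⟨h0 _ _, by norm_num, subst_reflection_U27 (h0 _ _) ?_⟩,
      ⟨h0 _ _, by norm_num, subst_reflection_U27 (h0 _ _) ?_⟩, by simp⟩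
    · refine adapted_wimanFrame.subst_reflection_of_semi isMetric_valentiner (h0 _ _) (χ := 1)
        (f' := wiman6) (by rw [wimanFrame_subst₁, C_1, one_mul]) ?_
      apply MvPolynomial.funext
      intro p
      rw [eval_subst_diagRefl_three, zeta_two]
      simp only [wiman6, map_add, map_sub, map_mul, map_pow, eval_X, map_ofNat, Matrix.cons_val]
      ring
    · rw [w27_eq.1]
      refine key _ ?_ ?_
      · linear_combination (r15 ^ 2 / 16) * Complex.I_sq - (1 / 16) * r15_sq
      · simp only [star_div₀, star_mul', star_add, h15, star_ofNat, Complex.star_def, Complex.conj_I]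
        ring
    · rw [w27_eq.2]
      refine key _ ?_ ?_
      · linear_combination (r15 ^ 2 / 16) * Complex.I_sq - (1 / 16) * r15_sq
      · simp only [star_div₀, star_mul', star_sub, h15, star_ofNat, Complex.star_def, Complex.conj_I]
        ring
  · have h1 := isHomogeneous_U27₁
    have h2 := isHomogeneous_U27₂
    exact forall_fin_three h1 (h2.sub ((h1.pow 2).C_mul _))
      (((isHomogeneous_U27₃.sub (((h2.pow 2).C_mul _).mul h1)).add
        ((h2.C_mul _).mul (h1.pow 3))).sub ((h1.pow 5).C_mul _))
  · decide
  · apply det_jacOf_ne_zero_of_subst (g := wimanFrame)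
    refine det_jacOf_ne_zero_three (fun l => (normalForm_G27 l).congr (wimanFrame_subst l) rfl rfl)
      ![0, 1, 0] rfl ?_
    simp [cofactor, Fin.sum_univ_three, pderiv_one_binForm, pderiv_two_binForm, eval_binForm, binEval,
      binDeriv₁, binDeriv₂, binScale, wimanA6, wimanC6, flatA12, flatC12, flatA30, flatC30]
    norm_num

/-- Ties √5 to the fifth root of unity, so that the reduction of the latter determines that of the
former. -/
lemma r5_eq_zeta_five : r5 = 1 + 2 * (zeta 5 + zeta 5 ^ 4) := by
  have h1 : zeta 5 + zeta 5 ^ 4 = ((2 * Real.cos (2 * (Real.pi / 5)) : ℝ) : ℂ) := by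
    rw [← star_zeta_five, star_zeta, zeta, ← Complex.exp_neg]
    push_cast
    rw [Complex.cos]
    ring_nf
  have h2 : (2 * Real.cos (2 * (Real.pi / 5)) : ℝ) = (Real.sqrt 5 - 1) / 2 := by
    rw [Real.cos_two_mul, Real.cos_pi_div_five]
    linear_combination (1 / 4) * Real.sq_sqrt (show (0 : ℝ) ≤ 5 by norm_num)
  rw [h1, h2, r5]
  push_cast
  ring

section Reduction

variable {k : Type} [Field k] {p : ℕ} {φ : integralClosure ℤ ℂ →+* k} [CharP k p]

/-- `w27` and its conjugate have sum and product in ℤ[ζ₅], so they reduce to the two roots of one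
quadratic equation modulo `p`, in either order. This avoids the denominator 4 and a separate
reduction of i√15. -/
lemma red_w27 {x : ℤ} (h : Red φ (zeta 5) x) (a b : ℤ)
    (hab : (p : ℤ) ∣ 3 * (x + x ^ 4) - (a + b) ∧ (p : ℤ) ∣ 6 - 6 * (x + x ^ 4) - a * b) :
    (Red φ w27 a ∧ Red φ (star w27) b) ∨ (Red φ w27 b ∧ Red φ (star w27) a) := by
  have h5 := r5_eq_zeta_five
  have hsum : w27 + star w27 = 3 * (zeta 5 + zeta 5 ^ 4) := by
    rw [w27_eq.2, w27_eq.1]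
    linear_combination (3 / 2) * h5
  have hprod : w27 * star w27 = 6 - 6 * (zeta 5 + zeta 5 ^ 4) := by
    rw [w27_eq.2, w27_eq.1]
    linear_combination (3 / 2) * r5_sq - 3 * h5 - (r5 - 1) ^ 2 * r15 ^ 2 / 16 * Complex.I_sq +
      (r5 - 1) ^ 2 / 16 * r15_sq
  have ht := h.add (h.pow 4)
  have hs := ((Red.ofNat 3).mul ht).congr hab.1
  have hp := ((Red.ofNat 6).sub ((Red.ofNat 6).mul ht)).congr hab.2
  have hq := Red.of_quadratic (φ := φ) (z := w27) (s := 3 * (zeta 5 + zeta 5 ^ 4))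
    (t := 6 - 6 * (zeta 5 + zeta 5 ^ 4)) (by rw [← hsum, ← hprod]; ring) hs hp
  refine hq.imp (fun e => ⟨e, ?_⟩) fun e => ⟨e, ?_⟩
  · have := (hs.sub e).of_eq (w := star w27) (by rw [← hsum]; ring)
    rwa [add_sub_cancel_left] at this
  · have := (hs.sub e).of_eq (w := star w27) (by rw [← hsum]; ring)
    rwa [add_sub_cancel_right] at this

lemma genRed_valentiner₀ {x : ℤ} (h : Red φ (zeta 5) x) (z : ℕ)
    (hz : p ≠ 0 ∧ ¬ p ∣ 2 ∧ (p : ℤ) ∣ ((z : ℤ) + 1) ^ 2 - 1) :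
    GroupData.GenRed φ p (Matrix.diagonal ![1, 1, 3]) (![1, -zeta 5, 0], 2)
      ([residue p 1, residue p (-x), residue p 0],
        [residue p 1, residue p (-x ^ 4), residue p 0], z) := by
  obtain ⟨e0, e1, e2⟩ := sharp_valentiner ![1, -zeta 5, 0]
  refine genRed_three 1 1 (Red.one.of_eq (by simp)) (h.neg.of_eq (by simp)) (Red.zero.of_eq (by simp))
    (Red.one.of_eq (by rw [e0]; simp)) ((h.pow 4).neg.of_eq ?_) (Red.zero.of_eq (by rw [e2]; simp)) z hz
    one_ne_zero one_ne_zero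
  rw [e1, one_mul, ← star_zeta_five]
  exact star_neg _

lemma genRed_valentiner {w : ℂ} {a b : ℤ} (ha : Red φ w a) (hb : Red φ (star w) b) (z : ℕ)
    (hz : p ≠ 0 ∧ ¬ p ∣ 2 ∧ (p : ℤ) ∣ ((z : ℤ) + 1) ^ 2 - 1) :
    GroupData.GenRed φ p (Matrix.diagonal ![1, 1, 3]) (![1, 1, w], 2)
      ([residue p 1, residue p 1, residue p a], [residue p 3, residue p 3, residue p b], z) := by
  obtain ⟨e0, e1, e2⟩ := sharp_valentiner ![1, 1, w]
  refine genRed_three 1 3 (Red.one.of_eq (by simp)) (Red.one.of_eq (by simp)) (ha.of_eq (by simp))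
    ((Red.ofNat 3).of_eq (by rw [e0]; simp)) ((Red.ofNat 3).of_eq (by rw [e1]; simp)) (hb.of_eq ?_) z hz
    one_ne_zero three_ne_zero
  rw [e2]
  exact mul_div_cancel₀ _ three_ne_zero

end Reduction

/-- A path through the 45 mirrors of the Valentiner group. -/
def valentinerMoves : List (ℕ × ℕ) :=
  [(0, 0), (1, 1), (1, 0), (1, 2), (1, 0), (1, 1), (1, 2), (1, 0),
    (1, 1), (1, 0), (1, 1), (1, 0), (1, 2), (1, 0), (1, 1), (1, 0), (1, 1), (1, 0), (1, 2), (1, 0),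
    (1, 1), (1, 0), (1, 1), (1, 0), (4, 2), (1, 0), (1, 1), (1, 0), (1, 1), (1, 0), (1, 2), (1, 0),
    (2, 1), (1, 2), (1, 0), (1, 1), (1, 0), (1, 1), (1, 0), (13, 2), (1, 1), (1, 0), (2, 2), (1, 1),
    (1, 0)]

lemma goodAt_G27 : (dataThree (Matrix.diagonal ![1, 1, 3]) [(![1, -zeta 5, 0], 2), (![1, 1, w27], 2),
    (![1, 1, star w27], 2)] ![6, 12, 30] ![U27₁, U27₂ - C (1 / 9) * U27₁ ^ 2,
      U27₃ - C (17 / 18) * U27₂ ^ 2 * U27₁ + C (29 / 27) * U27₂ * U27₁ ^ 3 - C (43 / 486) * U27₁ ^ 5]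
    30 [(2, 45)]).GoodAt ![1, -zeta 5, 0] 1 ((2 : ℕ) / (30 : ℕ)) := by
  refine adapted_wimanFrame.goodAt (localGood_three basic_G27.two_le
    (fun l => isHomogeneous_subst _ (basic_G27.hom l))
    (fun l => (normalForm_G27 l).congr (wimanFrame_subst l) rfl rfl) ?_ ?_)
  all_goals
    apply MvPolynomial.funext
    intro p
    simp [cofactor, Fin.sum_univ_three, pderiv_one_binForm, pderiv_two_binForm, eval_binForm, binEval,
      binDeriv₁, binDeriv₂, binScale, wimanA6, wimanC6, flatA12, flatC12, flatA30, flatC30]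
    ring

lemma conclusion_G27 : (STGroup.data .G27).Conclusion := by
  have : Fact (Nat.Prime 31) := ⟨by norm_num⟩
  have : Fact (Nat.Prime 5) := ⟨by norm_num⟩
  refine conclusion_three basic_G27 31 valentinerMoves ?_ 0 0 (by decide +kernel) goodAt_G27 goodAt_G27
  intro k _ _ φ
  -- Modulo 31 the number 2 is a primitive fifth root of unity. The value of ζ + ζ⁴ depends only on
  -- the pair {j, 5 - j}, so two quadratic equations occur.
  obtain ⟨j, hj, hj0, h⟩ := exists_red_primitiveRoot (φ := φ) (p := 31) (m := 5) (by decide +kernel)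
    (isPrimitiveRoot_zeta (by norm_num)) (a := 2) (by decide +kernel) (by decide +kernel)
  have hw : ∀ x a b : ℤ, Red φ (zeta 5) x → Red φ w27 a → Red φ (star w27) b →
      checkMoves 31 3 [([residue 31 1, residue 31 (-x), residue 31 0],
          [residue 31 1, residue 31 (-x ^ 4), residue 31 0], 29),
        ([residue 31 1, residue 31 1, residue 31 a], [residue 31 3, residue 31 3, residue 31 b], 29),
        ([residue 31 1, residue 31 1, residue 31 b], [residue 31 3, residue 31 3, residue 31 a], 29)]
        valentinerMoves [] = true →
      ∃ S, List.Forall₂ (GroupData.GenRed φ 31 (Matrix.diagonal ![1, 1, 3])) [(![1, -zeta 5, 0], 2),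
        (![1, 1, w27], 2), (![1, 1, star w27], 2)] S ∧ checkMoves 31 3 S valentinerMoves [] = true :=
    fun x a b hx ha hb hc => ⟨_, .cons (genRed_valentiner₀ hx 29 (by decide +kernel))
      (.cons (genRed_valentiner ha hb 29 (by decide +kernel)) (.cons (genRed_valentiner hb
        (by rwa [star_star]) 29 (by decide +kernel)) .nil)), hc⟩
  interval_cases j
  · exact absurd rfl hj0
  · rcases red_w27 (p := 31) h 1 22 (by decide +kernel) with ⟨h1, h2⟩ | ⟨h1, h2⟩ <;>
    exact hw _ _ _ h h1 h2 (by decide +kernel)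
  · rcases red_w27 (p := 31) h 11 25 (by decide +kernel) with ⟨h1, h2⟩ | ⟨h1, h2⟩ <;>
    exact hw _ _ _ h h1 h2 (by decide +kernel)
  · rcases red_w27 (p := 31) h 11 25 (by decide +kernel) with ⟨h1, h2⟩ | ⟨h1, h2⟩ <;>
    exact hw _ _ _ h h1 h2 (by decide +kernel)
  · rcases red_w27 (p := 31) h 1 22 (by decide +kernel) with ⟨h1, h2⟩ | ⟨h1, h2⟩ <;>
    exact hw _ _ _ h h1 h2 (by decide +kernel)

end Valentiner

end RankThree

end ReflectionDuality

end

theorem mainTheorem1 (g : ReflectionDuality.STGroup) :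
    -- the u^l are homogeneous invariants of the group, of degrees d_l
    (∀ l, (g.data.u l).IsHomogeneous (g.data.deg l)) ∧
    (∀ x ∈ g.data.group, ∀ l, ∀ p : Fin g.data.n → ℂ,
      MvPolynomial.eval ((x : Matrix (Fin g.data.n) (Fin g.data.n) ℂ).mulVec p) (g.data.u l)
        = MvPolynomial.eval p (g.data.u l)) ∧
    -- the number of mirrors and the orders of the reflections
    g.data.mirrors.Finite ∧
    g.data.mirrors.ncard = (g.data.table.map Prod.snd).sum ∧
    (∀ a ∈ g.data.table, {H | H ∈ g.data.mirrors ∧ g.data.kappa H = a.1}.ncard = a.2) ∧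
    (∀ H ∈ g.data.mirrors, ∃ x ∈ g.data.group,
      ReflectionDuality.GroupData.fixedSpace x = H ∧ orderOf x = g.data.kappa H) ∧
    -- for every choice of linear forms defining the mirrors
    ∀ α : Submodule ℂ (Fin g.data.n → ℂ) → Fin g.data.n → ℂ, g.data.IsMirrorForms α →
      -- the Jacobian determinant factorizes into the forms defining the mirrors
      (∃ a : ℂ, a ≠ 0 ∧ g.data.jac.det = MvPolynomial.C a *
        ∏ᶠ H ∈ g.data.mirrors,
          (∑ i, MvPolynomial.C (α H i) * MvPolynomial.X i) ^ (g.data.kappa H - 1)) ∧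
      -- the normalization, and the formula for the dual product and the dual connection
      (∀ p ∈ g.data.regularSet, IsUnit (g.data.jacAt p).det ∧
        (∀ i j, ∑ k, g.data.dunklKohno α p i j k * p k = if i = j then 1 else 0) ∧
        ∀ i j k, g.data.dualProduct p i j k = g.data.dunklKohno α p i j k ∧
          g.data.dualConnection p i j k = - g.data.dunklKohno α p i j k) ∧
      -- the same for the dual product and connection of any standard bi-flat structure
      (∀ (Ω : Set (Fin g.data.n → ℂ)) (Γ₁ Γ₂ c cs : ReflectionDuality.Field12 g.data.n)
        (e : ReflectionDuality.VField g.data.n), g.data.IsStandard Ω Γ₁ Γ₂ c cs e →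
        ∀ p ∈ Ω, ∀ i j k, cs p i j k = g.data.dunklKohno α p i j k ∧
          Γ₂ p i j k = - g.data.dunklKohno α p i j k) := by
  -- For each group the statement is `Conclusion` of its data, unfolded.
  cases g
  · exact ReflectionDuality.conclusion_G4
  · exact ReflectionDuality.conclusion_G5
  · exact ReflectionDuality.conclusion_G6
  · exact ReflectionDuality.conclusion_G8
  · exact ReflectionDuality.conclusion_G9
  · exact ReflectionDuality.conclusion_G10
  · exact ReflectionDuality.conclusion_G14
  · exact ReflectionDuality.conclusion_G16
  · exact ReflectionDuality.conclusion_G17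
  · exact ReflectionDuality.conclusion_G18
  · exact ReflectionDuality.conclusion_G20
  · exact ReflectionDuality.conclusion_G21
  · exact ReflectionDuality.conclusion_G23
  · exact ReflectionDuality.conclusion_G24
  · exact ReflectionDuality.conclusion_G25
  · exact ReflectionDuality.conclusion_G26
  · exact ReflectionDuality.conclusion_G27
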